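/- Let $n\ge 2$ and let $\Pi_1\ne\Pi_2$ be two parallel hyperplanes in $\mathbb R^{n+1}$. Let $\Omega\subset\mathbb R^{n+1}$ be a connected, open and bounded set contained in the slab determined by $\Pi_1$ and $\Pi_2$, such that $\partial\Omega = M\cup D_1\cup D_2$, where $D_i=\overline\Omega\cap\Pi_i\neq\emptyset$ and $M$ is a compact embedded hypersurface with boundary $\partial M=\partial D_1\cup\partial D_2$ (here $\partial D_i$ is the boundary of $D_i$ relative to $\Pi_i$), of class $C^2$ in its interior. Suppose that the mean curvature of $M$ at its interior points, taken with respect to the normal pointing into $\Omega$, is a function $H(u)$ of the distance $u$ to $\Pi_1$ alone, where $H$ is of class $C^1$ on $[0,\operatorname{dist}(\Pi_1,\Pi_2)]$. (a) Let $\alpha$ be a hyperplane orthogonal to $\Pi_1$ and $\Pi_2$, and let $M$ be of class $C^2$, up to its boundary, in the portion not touching $\alpha$. Suppose that for $i=1,2$ the set $D_i$ is symmetric about $\alpha$ and $\partial D_i=\partial D_i^+\cup\partial D_i^-$, where $\partial D_i^+$ is the graph over $\Pi_i\cap\alpha$ (in the direction normal to $\alpha$) of a continuous function $f_i:\overline{U_i}\to[0,\infty)$,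 with $U_i$ a relatively open subset of $\Pi_i\cap\alpha$, such that $f_i$ is $C^2$ and positive on $U_i$ and zero on $\overline{U_i}\setminus U_i$, and where $\partial D_i^-$ is the reflection of $\partial D_i^+$ in $\alpha$. Then $\Omega$ is symmetric about $\alpha$. (b) Suppose that $M$ is of class $C^2$ up to its boundary and that $\partial D_1$ and $\partial D_2$ are round $(n-1)$-spheres in $\Pi_1$ and $\Pi_2$ (circles if $n=2$), possibly of different radii, whose centres lie on a common line $\ell$ orthogonal to $\Pi_1$ and $\Pi_2$. Then $M$ is rotationally symmetric about $\ell$: every isometry of $\mathbb R^{n+1}$ that fixes $\ell$ pointwise maps $M$ onto itself. -/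

import Mathlib

open scoped RealInnerProductSpace

/-- The ambient space `ℝ^(n+1)`. -/
abbrev Amb (n : ℕ) : Type := EuclideanSpace ℝ (Fin (n + 1))

/-- The affine hyperplane with normal vector `v` at level `s`. -/
def hyperplane {n : ℕ} (v : Amb n) (s : ℝ) : Set (Amb n) := {x | ⟪v, x⟫ = s}

/-- The orthogonal reflection in `hyperplane v s`, for a unit vector `v`. -/
noncomputable def reflectIn {n : ℕ} (v : Amb n) (s : ℝ) (x : Amb n) : Amb n :=
  x - (2 * (⟪v, x⟫ - s)) • v

/-- The boundary of a subset `D` of `P`, relative to `P`. -/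
def relBoundary {n : ℕ} (P D : Set (Amb n)) : Set (Amb n) := closure D ∩ closure (P \ D)

/-- `D = closure Ω ∩ P`. -/
def face {n : ℕ} (Ω P : Set (Amb n)) : Set (Amb n) := closure Ω ∩ P

/-- On the open set `V`, the set `M` is the zero set of the `C²` function `φ`, which has no
critical point in `V`. -/
structure IsC2DefiningFunction {n : ℕ} (M V : Set (Amb n)) (φ : Amb n → ℝ) : Prop where
  isOpen : IsOpen V
  contDiffOn : ContDiffOn ℝ 2 φ V
  gradient_ne_zero : ∀ x ∈ V, gradient φ x ≠ 0
  inter_eq : M ∩ V = {x ∈ V | φ x = 0}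

/-- Near `p`, the set `M` is an embedded hypersurface of class `C²` without boundary. -/
def IsC2InteriorPoint {n : ℕ} (M : Set (Amb n)) (p : Amb n) : Prop :=
  p ∈ M ∧ ∃ (V : Set (Amb n)) (φ : Amb n → ℝ), p ∈ V ∧ IsC2DefiningFunction M V φ

/-- Near `p`, the set `M` is an embedded hypersurface with boundary, of class `C²` up to the
boundary, and `p` is one of its boundary points. -/
def IsC2BoundaryPoint {n : ℕ} (M : Set (Amb n)) (p : Amb n) : Prop :=
  ∃ (V : Set (Amb n)) (φ ψ : Amb n → ℝ), IsOpen V ∧ p ∈ V ∧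
    ContDiffOn ℝ 2 φ V ∧ ContDiffOn ℝ 2 ψ V ∧
    (∀ x ∈ V, LinearIndependent ℝ ![gradient φ x, gradient ψ x]) ∧
    φ p = 0 ∧ ψ p = 0 ∧ M ∩ V = {x ∈ V | φ x = 0 ∧ 0 ≤ ψ x}

/-- Near `p`, the set `M` is an `n`-dimensional topological manifold with boundary, and `p` is one
of its boundary points. -/
def IsTopBoundaryPoint {n : ℕ} (M : Set (Amb n)) (p : Amb n) : Prop :=
  ∃ (hp : p ∈ M)
    (χ : OpenPartialHomeomorph M (EuclideanSpace ℝ (Fin (n - 1)) × Set.Ici (0 : ℝ))),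
    (⟨p, hp⟩ : M) ∈ χ.source ∧ ((χ ⟨p, hp⟩).2 : ℝ) = 0

/-- `M` is a compact embedded hypersurface with boundary `Γ`; it is of class `C²` in its interior
and, up to the boundary, away from the set `A`. -/
structure IsCompactHypersurface {n : ℕ} (M Γ A : Set (Amb n)) : Prop where
  isCompact : IsCompact M
  boundary_subset : Γ ⊆ M
  interior_point : ∀ p ∈ M \ Γ, IsC2InteriorPoint M p
  boundary_point : ∀ p ∈ Γ \ A, IsC2BoundaryPoint M p
  top_boundary_point : ∀ p ∈ Γ ∩ A, IsTopBoundaryPoint M p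

/-- The divergence of a vector field at `p`. -/
noncomputable def divergence {n : ℕ} (F : Amb n → Amb n) (p : Amb n) : ℝ :=
  ∑ i, fderiv ℝ F p (EuclideanSpace.single i 1) i

/-- The mean curvature (average of the principal curvatures) at `p` of the level set of `φ`
through `p`, with respect to the unit normal `∇φ / |∇φ|`. For `φ (x, z) = z - u x` it is
`(1 / n) div (∇u / √(1 + |∇u|²))`. -/
noncomputable def levelSetMeanCurvature {n : ℕ} (φ : Amb n → ℝ) (p : Amb n) : ℝ :=
  -(1 / (n : ℝ)) * divergence (fun x => ‖gradient φ x‖⁻¹ • gradient φ x) p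

/-- With respect to the normal that points into `Ω`, the mean curvature of `M` at each point `p`
outside the boundary `Γ` equals `H p`. -/
def HasInwardMeanCurvature {n : ℕ} (Ω M Γ : Set (Amb n)) (H : Amb n → ℝ) : Prop :=
  ∀ p ∈ M \ Γ, ∀ (V : Set (Amb n)) (φ : Amb n → ℝ), p ∈ V → IsC2DefiningFunction M V φ →
    {x ∈ V | 0 < φ x} ⊆ Ω → levelSetMeanCurvature φ p = H p

/-- `Ω` is a bounded domain in the slab between the hyperplanes `⟪e, x⟫ = c₁` and `⟪e, x⟫ = c₂`;
it reaches both of them, and its boundary is made of `M` and of its two faces. -/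
structure IsSlabDomain {n : ℕ} (e : Amb n) (c₁ c₂ : ℝ) (Ω M : Set (Amb n)) : Prop where
  isOpen : IsOpen Ω
  isConnected : IsConnected Ω
  isBounded : Bornology.IsBounded Ω
  subset_slab : Ω ⊆ {x | c₁ ≤ ⟪e, x⟫ ∧ ⟪e, x⟫ ≤ c₂}
  face_nonempty₁ : (face Ω (hyperplane e c₁)).Nonempty
  face_nonempty₂ : (face Ω (hyperplane e c₂)).Nonempty
  frontier_eq : frontier Ω = M ∪ face Ω (hyperplane e c₁) ∪ face Ω (hyperplane e c₂)

/-- `∂D₁ ∪ ∂D₂`, where each `∂Dᵢ` is taken relative to the hyperplane of `Dᵢ`. -/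
def faceBoundaries {n : ℕ} (e : Amb n) (c₁ c₂ : ℝ) (Ω : Set (Amb n)) : Set (Amb n) :=
  relBoundary (hyperplane e c₁) (face Ω (hyperplane e c₁)) ∪
    relBoundary (hyperplane e c₂) (face Ω (hyperplane e c₂))

/-- `Γ`, a subset of the hyperplane `P`, is the union of a graph over the closure of a relatively
open subset `U` of `P ∩ α`, with `α = hyperplane v s`, and of its reflection in `α`. The graph is
that of a continuous function which is `C²` and positive on `U` and zero on the border of `U`. -/
def IsDoubleC2Graph {n : ℕ} (P : Set (Amb n)) (v : Amb n) (s : ℝ) (Γ : Set (Amb n)) : Prop :=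
  ∃ (U : Set (Amb n)) (f : Amb n → ℝ),
    (∃ O, IsOpen O ∧ U = O ∩ (P ∩ hyperplane v s)) ∧
    ContDiffOn ℝ 2 f U ∧ ContinuousOn f (closure U) ∧
    (∀ x ∈ U, 0 < f x) ∧ (∀ x ∈ closure U \ U, f x = 0) ∧
    Γ = (fun x => x + f x • v) '' closure U ∪
      reflectIn v s '' ((fun x => x + f x • v) '' closure U)

open scoped RealInnerProductSpace

/-! The proof is Alexandrov's method of moving planes. Fix a unit vector `v` orthogonal to `e` and
let the planes `⟪v, x⟫ = t` come in from infinity down to the level `s`. The claim `ReflectsInto v s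
Ω` is that the part of `Ω` right of each plane with `t ≥ s` is reflected into `Ω`; for `v` and `-v`
together it gives the symmetry of `Ω`. These reflections preserve the height over the lower plane,
hence the prescribed curvature, so `M` and its mirror image solve the same elliptic equation. As `H`
is Lipschitz, the difference `w` of two such graphs satisfies `L (D²w) ≤ C (|Dw| + |w|)`. The strong
maximum principle and the Hopf lemma then need no sign on the zero-order term, because they are
applied to `w ≥ 0` at a zero of `w`.

If the claim fails, let `T > s` be the supremum of the failing levels. Compactness yields a point
`x` near which planes just left of level `T` reflect points of `Ω` out of `Ω` (`IsBadPoint`). Inside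
the slab there are three cases. If `x` lies right of the plane, then `M` touches its mirror image at
`x`. If `x` lies on the plane and `v` is tangent to `M`, the Hopf lemma makes `M` agree with its
mirror image on a piece near `x`. If `v` is transversal to `M`, lines in the direction `v` meet `M`
at most once near `x`, which rules out a bad point. The first two cases give a nonempty
`contactSet`. Contact is an open and closed condition on the part of `M` right of the plane and
inside the slab. Following rays in the direction `v` from points of the connected set `Ω` to their
first exit turns this into: a nonempty contact set forces the reflection to map `Ω` into itself. The
chords of the faces (`face_cap`) forbid this for `T > s`.

The remaining work is on the faces; only the lower one is treated, since replacing `e` by `-e`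
exchanges them. In the relative interior of the face, either `Ω` fills a half ball or `Ω` is
squeezed between the face and a graph tangent to it (`half_ball_or_isLowerGraph`). A bad point's
mirror image must be of the second kind when the bad point is right of the plane, and the Hopf lemma
again gives contact points. At a boundary point of `M` on the plane of reflection, the border of the
face is transversal to `v`. If `M` is also tangent to the face there, it is flat when `H` vanishes
and strictly convex in the direction `v` when it does not; both rule out bad points.

For (b), a sphere is a double graph over each hyperplane through its centre, so `Ω` is symmetric
about every hyperplane containing the axis. An isometry fixing the axis moves each single point as
one of these reflections does, so it preserves `Ω`. The frontier of `Ω` determines `M` only inside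
the slab; the points of `M` in the relative interior of a face are shown to be limits of points of
`M` inside the slab. Otherwise `H` would vanish at that height, unique continuation would put the
whole disc into `M`, and `M` would leave the disc tangentially, which is impossible. -/

section Preliminaries

open Set Filter Topology Metric

/-! ### The Hopf lemma and the strong maximum principle for elliptic differential inequalities -/

section MaximumPrinciple

variable {E : Type*} [NormedAddCommGroup E] [InnerProductSpace ℝ E]

/-- The second derivative, as a bilinear form. -/
noncomputable def hess (w : E → ℝ) (x : E) : E →L[ℝ] E →L[ℝ] ℝ := fderiv ℝ (fderiv ℝ w) x

theorem nonneg_of_hasDerivAt_of_eventually_nonneg {k : ℝ → ℝ} {k' : ℝ} (hk : HasDerivAt k k' 0)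
    (h0 : k 0 = 0) (h : ∀ᶠ t in 𝓝[>] (0 : ℝ), 0 ≤ k t) : 0 ≤ k' := by
  have h1 := (hasDerivAt_iff_tendsto_slope.1 hk).mono_left
    (nhdsWithin_mono 0 (fun t (ht : t ∈ Ioi (0 : ℝ)) => ne_of_gt ht))
  refine ge_of_tendsto h1 ?_
  filter_upwards [h, self_mem_nhdsWithin] with t ht ht0
  rw [slope_def_field, h0, sub_zero, sub_zero]
  exact div_nonneg ht (le_of_lt ht0)

theorem hasDerivAt_comp_line {w : E → ℝ} {x ξ : E} {t : ℝ}
    (hw : DifferentiableAt ℝ w (x + t • ξ)) :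
    HasDerivAt (fun t : ℝ => w (x + t • ξ)) (fderiv ℝ w (x + t • ξ) ξ) t := by
  have h1 : HasDerivAt (fun t : ℝ => x + t • ξ) ξ t := by
    simpa using ((hasDerivAt_id t).smul_const ξ).const_add x
  exact hw.hasFDerivAt.comp_hasDerivAt t h1

theorem hasDerivAt_fderiv_comp_line {w : E → ℝ} {x ξ η : E} {t : ℝ}
    (hw : ContDiffAt ℝ 2 w (x + t • ξ)) :
    HasDerivAt (fun t : ℝ => fderiv ℝ w (x + t • ξ) η) (hess w (x + t • ξ) ξ η) t := by
  have h1 : HasDerivAt (fun t : ℝ => x + t • ξ) ξ t := by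
    simpa using ((hasDerivAt_id t).smul_const ξ).const_add x
  have h2 : DifferentiableAt ℝ (fderiv ℝ w) (x + t • ξ) :=
    (hw.fderiv_right (m := 1) (by norm_num)).differentiableAt (by norm_num)
  have h3 := h2.hasFDerivAt.comp_hasDerivAt t h1
  exact ((ContinuousLinearMap.apply ℝ ℝ η).hasFDerivAt.comp_hasDerivAt t h3)

/-- A negative second derivative along a line would make the point a local maximum of the
restriction as well; the restriction would then be locally constant, with zero second derivative. -/
theorem hess_nonneg_of_isLocalMin {w : E → ℝ} {x : E} (hw : ContDiffAt ℝ 2 w x)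
    (h : IsLocalMin w x) (ξ : E) : 0 ≤ hess w x ξ ξ := by
  by_contra! hneg
  set k : ℝ → ℝ := fun t => w (x + t • ξ) with hk
  have hx0 : x + (0 : ℝ) • ξ = x := by simp
  have hcont : Tendsto (fun t : ℝ => x + t • ξ) (𝓝 0) (𝓝 x) := by
    have : Continuous (fun t : ℝ => x + t • ξ) := by fun_prop
    simpa using this.tendsto 0
  have hev : ∀ᶠ t in 𝓝 (0 : ℝ), ContDiffAt ℝ 2 w (x + t • ξ) :=
    hcont.eventually (hw.eventually (by norm_num))
  have hd : deriv k =ᶠ[𝓝 0] fun t => fderiv ℝ w (x + t • ξ) ξ := by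
    filter_upwards [hev] with t ht
    exact (hasDerivAt_comp_line (ht.differentiableAt (by norm_num))).deriv
  have hdd : deriv (deriv k) 0 = hess w x ξ ξ := by
    rw [hd.deriv_eq]
    have := (hasDerivAt_fderiv_comp_line (w := w) (x := x) (ξ := ξ) (η := ξ) (t := 0)
      (by rwa [hx0])).deriv
    rwa [hx0] at this
  have hmin : IsLocalMin k 0 := by
    have := hcont.eventually h
    simpa [IsLocalMin, IsMinFilter, hk] using this
  have hmax : IsLocalMax k 0 := by
    apply isLocalMax_of_deriv_deriv_neg (by rw [hdd]; exact hneg) hmin.deriv_eq_zero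
    exact (hasDerivAt_comp_line (by
      rw [hx0]; exact hw.differentiableAt (by norm_num))).continuousAt
  have hconst : k =ᶠ[𝓝 0] fun _ => k 0 := by
    filter_upwards [hmin, hmax] with t h1 h2
    exact le_antisymm h2 h1
  have : deriv k =ᶠ[𝓝 0] fun _ => 0 := by
    simpa using hconst.deriv
  have h3 := this.deriv_eq
  rw [hdd] at h3
  simp at h3
  linarith

/-- The bilinear form `(ξ, η) ↦ ⟪u, ξ⟫ * ⟪u, η⟫`. -/
noncomputable def sqForm (u : E) : E →L[ℝ] E →L[ℝ] ℝ := (innerSL ℝ u).smulRight (innerSL ℝ u)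

@[simp] theorem sqForm_apply (u ξ η : E) : sqForm u ξ η = ⟪u, ξ⟫ * ⟪u, η⟫ := by
  simp [sqForm]

/-- The inner product, as a bilinear form. -/
noncomputable def innerForm : E →L[ℝ] E →L[ℝ] ℝ := innerSL ℝ

@[simp] theorem innerForm_apply (ξ η : E) : innerForm ξ η = ⟪ξ, η⟫ := rfl

/-- On `S`, the function `w` satisfies `L (D²w) ≤ C (|Dw| + |w|)` for a uniformly elliptic
second-order operator `L`. -/
def EllIneq (w : E → ℝ) (S : Set E) : Prop :=
  ∃ (L : E → (E →L[ℝ] E →L[ℝ] ℝ) →ₗ[ℝ] ℝ) (a b C : ℝ), 0 < a ∧ 0 ≤ C ∧ ∀ x ∈ S,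
    (∀ B : E →L[ℝ] E →L[ℝ] ℝ, (∀ ξ, 0 ≤ B ξ ξ) → 0 ≤ L x B) ∧
    (∀ u, a * ‖u‖ ^ 2 ≤ L x (sqForm u)) ∧ L x innerForm ≤ b ∧
    L x (hess w x) ≤ C * (‖fderiv ℝ w x‖ + |w x|)

theorem EllIneq.mono {w : E → ℝ} {S S' : Set E} (h : EllIneq w S) (hS : S' ⊆ S) :
    EllIneq w S' := by
  obtain ⟨L, a, b, C, ha, hC, h⟩ := h
  exact ⟨L, a, b, C, ha, hC, fun x hx => h x (hS hx)⟩

/-- The barrier function of the Hopf lemma. -/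
noncomputable def barrier (α : ℝ) (c x : E) : ℝ := Real.exp (-α * ‖x - c‖ ^ 2)

theorem barrier_hasFDerivAt (α : ℝ) (c x : E) :
    HasFDerivAt (barrier α c) ((-2 * α * barrier α c x) • innerSL ℝ (x - c)) x := by
  have h1 : HasFDerivAt (fun x : E => ‖x - c‖ ^ 2) (2 • innerSL ℝ (x - c)) x := by
    have := (hasStrictFDerivAt_norm_sq (x - c)).hasFDerivAt.comp x ((hasFDerivAt_id x).sub_const c)
    exact this
  have h2 := (h1.const_mul (-α)).exp
  refine h2.congr_fderiv ?_
  ext ξ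
  simp [barrier]
  ring

theorem barrier_contDiff (α : ℝ) (c : E) : ContDiff ℝ 2 (barrier α c) := by
  unfold barrier
  exact ((contDiff_const.mul ((contDiff_id.sub contDiff_const).norm_sq ℝ))).exp

theorem barrier_hess (α : ℝ) (c x : E) :
    hess (barrier α c) x = barrier α c x • ((4 * α ^ 2) • sqForm (x - c) - (2 * α) • innerForm) := by
  have h0 : fderiv ℝ (barrier α c) = fun x => (-2 * α * barrier α c x) • innerSL ℝ (x - c) :=
    funext fun x => (barrier_hasFDerivAt α c x).fderiv
  have h1 : HasFDerivAt (fun x : E => innerForm (x - c)) innerForm x := by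
    have := (innerForm (E := E)).hasFDerivAt.comp x ((hasFDerivAt_id x).sub_const c)
    exact this
  have h2 := ((barrier_hasFDerivAt α c x).const_mul (-2 * α)).smul h1
  rw [hess, h0]
  refine HasFDerivAt.fderiv (h2.congr_fderiv ?_)
  ext ξ η
  simp only [sqForm_apply, innerForm_apply, innerSL_apply_apply, add_apply, sub_apply, smul_apply,
    ContinuousLinearMap.smulRight_apply, smul_eq_mul]
  ring

theorem hess_sub {f g : E → ℝ} {x : E} (hf : ContDiffAt ℝ 2 f x) (hg : ContDiffAt ℝ 2 g x) :
    hess (fun y => f y - g y) x = hess f x - hess g x := by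
  have h : fderiv ℝ (fun y => f y - g y) =ᶠ[𝓝 x] fun y => fderiv ℝ f y - fderiv ℝ g y := by
    filter_upwards [hf.eventually (by norm_num), hg.eventually (by norm_num)] with y h1 h2
    exact fderiv_fun_sub (h1.differentiableAt (by norm_num)) (h2.differentiableAt (by norm_num))
  rw [hess, h.fderiv_eq]
  exact fderiv_fun_sub ((hf.fderiv_right (m := 1) (by norm_num)).differentiableAt (by norm_num))
    ((hg.fderiv_right (m := 1) (by norm_num)).differentiableAt (by norm_num))

theorem hess_const_mul {f : E → ℝ} {x : E} (a : ℝ) (hf : ContDiffAt ℝ 2 f x) :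
    hess (fun y => a * f y) x = a • hess f x := by
  have h : fderiv ℝ (fun y => a * f y) =ᶠ[𝓝 x] fun y => a • fderiv ℝ f y := by
    filter_upwards [hf.eventually (by norm_num)] with y h1
    exact fderiv_const_mul (h1.differentiableAt (by norm_num)) a
  rw [hess, h.fderiv_eq]
  exact fderiv_fun_const_smul
    ((hf.fderiv_right (m := 1) (by norm_num)).differentiableAt (by norm_num)) a

theorem hess_sub_const (f : E → ℝ) (x : E) (a : ℝ) :
    hess (fun y => f y - a) x = hess f x := by
  have : fderiv ℝ (fun y => f y - a) = fderiv ℝ f := funext fun y => fderiv_sub_const a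
  rw [hess, this, hess]

theorem map_sub_smul_smul (L : (E →L[ℝ] E →L[ℝ] ℝ) →ₗ[ℝ] ℝ) (A B D : E →L[ℝ] E →L[ℝ] ℝ)
    (a b c d : ℝ) :
    L (A - a • b • (c • B - d • D)) = L A - a * (b * (c * L B - d * L D)) := by
  have h1 : L (A - a • b • (c • B - d • D)) = L A - L (a • b • (c • B - d • D)) := L.map_sub A (a • b • (c • B - d • D))
  have h2 : L (a • b • (c • B - d • D)) = a • L (b • (c • B - d • D)) := L.map_smul _ _
  have h3 : L (b • (c • B - d • D)) = b • L (c • B - d • D) := L.map_smul _ _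
  have h4 : L (c • B - d • D) = L (c • B) - L (d • D) := L.map_sub (c • B) (d • D)
  have h5 : L (c • B) = c • L B := L.map_smul _ _
  have h6 : L (d • D) = d • L D := L.map_smul _ _
  rw [h1, h2, h3, h4, h5, h6]
  rfl

/-- On the annulus between the radii `r / 2` and `r`, `w` is at least a small multiple `ε` of the
barrier `h`, which vanishes on the outer sphere and has a nonzero inward slope there. A vanishing
derivative of `w` at `x₀` would make `w - ε h` negative just inside. -/
theorem hopf [FiniteDimensional ℝ E] {w : E → ℝ} {c x₀ : E} {r : ℝ} (hr : 0 < r)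
    (hw : ∀ x ∈ closedBall c r, ContDiffAt ℝ 2 w x) (hell : EllIneq w (ball c r))
    (hpos : ∀ x ∈ ball c r, 0 < w x) (hx₀ : x₀ ∈ sphere c r) (hw₀ : w x₀ = 0) :
    fderiv ℝ w x₀ ≠ 0 := by
  intro hD
  obtain ⟨L, a, b, C, ha, hC, hL⟩ := hell
  have hcw : ContinuousOn w (closedBall c r) := fun x hx => (hw x hx).continuousAt.continuousWithinAt
  have hnn : ∀ x ∈ closedBall c r, 0 ≤ w x := by
    intro x hx
    have h1 := (hcw x hx).mono ball_subset_closedBall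
    rw [← closure_ball c hr.ne'] at hx
    simpa using h1.mem_closure hx (t := Ici (0 : ℝ)) (fun y hy => (hpos y hy).le)
  have hx₀' : ‖x₀ - c‖ = r := by simpa [dist_eq_norm] using hx₀
  -- choice of the exponent
  obtain ⟨α, hα0, hα⟩ : ∃ α : ℝ, 0 < α ∧
      C * (2 * α * r + 1) < α ^ 2 * a * r ^ 2 - 2 * α * b := by
    have h1 : 0 < a * r ^ 2 := by positivity
    -- The quotient makes `α² a r²` beat every term linear in `α`; the added `1` gives `1 ≤ α`,
    -- which absorbs the constant term through `C ≤ α C`.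
    refine ⟨(2 * |b| + 2 * C * r + C + 1) / (a * r ^ 2) + 1, by positivity, ?_⟩
    set α := (2 * |b| + 2 * C * r + C + 1) / (a * r ^ 2) + 1 with hα
    have h2 : 1 ≤ α := by
      have : 0 ≤ (2 * |b| + 2 * C * r + C + 1) / (a * r ^ 2) := by positivity
      linarith
    have h3 : α * (a * r ^ 2) = (2 * |b| + 2 * C * r + C + 1) + a * r ^ 2 := by
      rw [hα]; field_simp
    have h4 : α ^ 2 * a * r ^ 2 = α * (2 * |b| + 2 * C * r + C + 1 + a * r ^ 2) := by
      rw [← h3]; ring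
    have h5 : α * b ≤ α * |b| := mul_le_mul_of_nonneg_left (le_abs_self b) (by linarith)
    have h6 : C ≤ α * C := le_mul_of_one_le_left hC h2
    have h7 : 0 < α * (1 + a * r ^ 2) := by positivity
    nlinarith
  set E₀ : ℝ := Real.exp (-α * r ^ 2) with hE₀
  set h : E → ℝ := fun x => barrier α c x - E₀ with hh
  have hhC : ContDiff ℝ 2 h := (barrier_contDiff α c).sub contDiff_const
  -- the compact annulus
  have hKc : IsCompact (closedBall c r \ ball c (r / 2)) := (isCompact_closedBall c r).diff isOpen_ball
  have hx₀K : x₀ ∈ closedBall c r \ ball c (r / 2) := by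
    refine ⟨sphere_subset_closedBall hx₀, ?_⟩
    simp only [mem_ball, dist_eq_norm, hx₀']
    linarith
  have hbar1 : ∀ x, barrier α c x ≤ 1 := by
    intro x
    rw [barrier, Real.exp_le_one_iff]
    nlinarith [sq_nonneg ‖x - c‖]
  -- lower bound on the inner sphere
  obtain ⟨m, hm0, hm⟩ : ∃ m : ℝ, 0 < m ∧ ∀ x ∈ sphere c (r / 2), m ≤ w x := by
    have hsub : sphere c (r / 2) ⊆ ball c r := fun x hx => by
      simp only [mem_sphere, mem_ball] at hx ⊢; linarith
    rcases (sphere c (r / 2)).eq_empty_or_nonempty with hemp | hne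
    · exact ⟨1, one_pos, by simp [hemp]⟩
    · obtain ⟨z, hz, hzm⟩ := (isCompact_sphere c (r / 2)).exists_isMinOn hne
        (hcw.mono (hsub.trans ball_subset_closedBall))
      exact ⟨w z, hpos z (hsub hz), fun x hx => hzm hx⟩
  -- As `h ≤ 1`, this keeps `w - ε h` positive on the inner sphere.
  set ε : ℝ := m / 2 with hε
  have hε0 : 0 < ε := by positivity
  set f : E → ℝ := fun x => w x - ε * h x with hf
  have hfnn : ∀ x ∈ closedBall c r \ ball c (r / 2), 0 ≤ f x := by
    obtain ⟨x₁, hx₁, hmin⟩ := hKc.exists_isMinOn ⟨x₀, hx₀K⟩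
      (f := f) ((hcw.mono sdiff_subset).sub (hhC.continuous.continuousOn.const_smul ε))
    suffices h0 : 0 ≤ f x₁ from fun x hx => h0.trans (hmin hx)
    by_contra! hneg
    have hd1 : ‖x₁ - c‖ ≤ r := by simpa [dist_eq_norm] using hx₁.1
    have hd2 : r / 2 ≤ ‖x₁ - c‖ := by simpa [dist_eq_norm] using hx₁.2
    have hw1 : 0 ≤ w x₁ := hnn _ hx₁.1
    have hh1 : 0 < h x₁ := by
      by_contra! hh1
      have : ε * h x₁ ≤ 0 := mul_nonpos_of_nonneg_of_nonpos hε0.le hh1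
      simp only [hf] at hneg; linarith
    have hd3 : ‖x₁ - c‖ < r := by
      refine lt_of_le_of_ne hd1 fun heq => ?_
      simp [hh, barrier, heq, hE₀] at hh1
    have hd4 : r / 2 < ‖x₁ - c‖ := by
      refine lt_of_le_of_ne hd2 fun heq => ?_
      have h1 := hm x₁ (by simp [← heq])
      have h2 : h x₁ ≤ 1 := by
        have := hbar1 x₁
        have : 0 < E₀ := Real.exp_pos _
        simp only [hh]; linarith
      have h3 : ε * h x₁ ≤ ε := by nlinarith
      simp only [hf] at hneg; linarith
    have hx₁b : x₁ ∈ ball c r := by simpa [dist_eq_norm] using hd3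
    have hloc : IsLocalMin f x₁ := by
      apply hmin.isLocalMin
      have : ball c r \ closedBall c (r / 2) ∈ 𝓝 x₁ :=
        (isOpen_ball.sdiff isClosed_closedBall).mem_nhds ⟨hx₁b, by simpa [dist_eq_norm] using hd4⟩
      exact mem_of_superset this (sdiff_subset_sdiff ball_subset_closedBall ball_subset_closedBall)
    have hwx := hw x₁ hx₁.1
    have hhx : ContDiffAt ℝ 2 (fun x => ε * h x) x₁ := (contDiff_const.mul hhC).contDiffAt
    have hD1 : fderiv ℝ w x₁ = ε • fderiv ℝ h x₁ := by
      have h1 := hloc.fderiv_eq_zero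
      rw [hf, fderiv_fun_sub (hwx.differentiableAt (by norm_num)) (hhx.differentiableAt (by norm_num)),
        fderiv_const_mul (hhC.contDiffAt.differentiableAt (by norm_num)), sub_eq_zero] at h1
      exact h1
    have hfx : ContDiffAt ℝ 2 f x₁ := hwx.sub hhx
    -- At a negative interior minimum, `Dw = ε Dh` and `0 ≤ w < ε h`, so the inequality bounds `L
    -- (D²w)` above by `ε e₁ C (2 α r + 1)`. Ellipticity and `D²(w - ε h) ≥ 0` bound it below by `ε
    -- e₁ (α² a r² - 2 α b)`, which is larger by the choice of `α`.
    obtain ⟨hL1, hL2, hL3, hL4⟩ := hL x₁ hx₁b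
    have hpsd := hL1 _ (hess_nonneg_of_isLocalMin hfx hloc)
    rw [hf, hess_sub hwx hhx, hess_const_mul ε hhC.contDiffAt, hh, hess_sub_const, barrier_hess,
      map_sub_smul_smul] at hpsd
    set e₁ := barrier α c x₁ with he₁
    have he₁0 : 0 < e₁ := Real.exp_pos _
    have hDh : fderiv ℝ h x₁ = (-2 * α * e₁) • innerSL ℝ (x₁ - c) := by
      rw [hh, fderiv_sub_const]; exact (barrier_hasFDerivAt α c x₁).fderiv
    have hDn : ‖fderiv ℝ w x₁‖ ≤ ε * (2 * α * e₁ * r) := by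
      rw [hD1, hDh, norm_smul, norm_smul, innerSL_apply_norm, Real.norm_eq_abs, Real.norm_eq_abs,
        abs_of_pos hε0]
      have : |(-2 * α * e₁)| = 2 * α * e₁ := by
        rw [abs_of_neg (by have : 0 < α * e₁ := by positivity
                           linarith)]; ring
      rw [this]
      gcongr
    have hwle : |w x₁| ≤ ε * e₁ := by
      rw [abs_of_nonneg hw1]
      have : 0 < E₀ := Real.exp_pos _
      have h2 : h x₁ ≤ e₁ := by simp only [hh, he₁]; linarith
      have h3 : ε * h x₁ ≤ ε * e₁ := by gcongr
      simp only [hf] at hneg; linarith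
    have hup : L x₁ (hess w x₁) ≤ ε * e₁ * (C * (2 * α * r + 1)) := by
      refine hL4.trans ?_
      calc C * (‖fderiv ℝ w x₁‖ + |w x₁|) ≤ C * (ε * (2 * α * e₁ * r) + ε * e₁) := by gcongr
        _ = _ := by ring
    have hsq : a * (r / 2) ^ 2 ≤ L x₁ (sqForm (x₁ - c)) := by
      refine le_trans ?_ (hL2 (x₁ - c))
      gcongr
    have hlow : ε * e₁ * (α ^ 2 * a * r ^ 2 - 2 * α * b) ≤
        ε * (e₁ * (4 * α ^ 2 * L x₁ (sqForm (x₁ - c)) - 2 * α * L x₁ innerForm)) := by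
      rw [mul_assoc]
      refine mul_le_mul_of_nonneg_left (mul_le_mul_of_nonneg_left ?_ he₁0.le) hε0.le
      have h1 : 4 * α ^ 2 * (a * (r / 2) ^ 2) ≤ 4 * α ^ 2 * L x₁ (sqForm (x₁ - c)) := by gcongr
      have h2 : 2 * α * L x₁ innerForm ≤ 2 * α * b := by gcongr
      nlinarith
    have : ε * e₁ * (C * (2 * α * r + 1)) < ε * e₁ * (α ^ 2 * a * r ^ 2 - 2 * α * b) := by
      gcongr
    linarith
  -- derivative at the boundary point
  have hu : HasDerivAt (fun t : ℝ => f (x₀ + t • (c - x₀))) (fderiv ℝ f x₀ (c - x₀)) 0 := by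
    have hd : DifferentiableAt ℝ f (x₀ + (0 : ℝ) • (c - x₀)) := by
      rw [zero_smul, add_zero]
      exact ((hw x₀ hx₀K.1).sub (contDiff_const.mul hhC).contDiffAt).differentiableAt (by norm_num)
    simpa using hasDerivAt_comp_line hd
  have hf0 : f (x₀ + (0 : ℝ) • (c - x₀)) = 0 := by
    simp [hf, hw₀, hh, barrier, hx₀', hE₀]
  have hge := nonneg_of_hasDerivAt_of_eventually_nonneg hu hf0 (by
    filter_upwards [Ioo_mem_nhdsGT (show (0 : ℝ) < 1 / 2 by norm_num)] with t ht
    apply hfnn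
    have hn : ‖x₀ + t • (c - x₀) - c‖ = (1 - t) * r := by
      rw [show x₀ + t • (c - x₀) - c = (1 - t) • (x₀ - c) by module, norm_smul, hx₀',
        Real.norm_eq_abs, abs_of_pos (by linarith [ht.2])]
    simp only [Set.mem_sdiff, mem_closedBall, mem_ball, dist_eq_norm, hn, not_lt]
    constructor <;> nlinarith [ht.1, ht.2])
  have hDf : fderiv ℝ f x₀ (c - x₀) = -(ε * (2 * α * E₀ * r ^ 2)) := by
    rw [hf, fderiv_fun_sub ((hw x₀ hx₀K.1).differentiableAt (by norm_num))
      ((contDiff_const.mul hhC).contDiffAt.differentiableAt (by norm_num)),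
      fderiv_const_mul (hhC.contDiffAt.differentiableAt (by norm_num)), hD, hh, fderiv_sub_const,
      (barrier_hasFDerivAt α c x₀).fderiv]
    have h1 : ⟪x₀ - c, c - x₀⟫ = -r ^ 2 := by
      rw [← neg_sub x₀ c, inner_neg_right, real_inner_self_eq_norm_sq, hx₀']
    simp only [sub_apply, smul_apply, innerSL_apply_apply, h1,
      smul_eq_mul, barrier, hx₀', zero_apply]
    ring
  rw [hDf] at hge
  have : 0 < ε * (2 * α * E₀ * r ^ 2) := by
    have : 0 < E₀ := Real.exp_pos _
    positivity
  linarith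

/-- The strong maximum principle, local form. -/
theorem eq_zero_of_nonneg_of_ellIneq_half [FiniteDimensional ℝ E] {w : E → ℝ} {p : E} {r : ℝ}
    (hw : ∀ x ∈ ball p r, ContDiffAt ℝ 2 w x) (hell : EllIneq w (ball p r))
    (hnn : ∀ x ∈ ball p r, 0 ≤ w x) (hp : w p = 0) : ∀ x ∈ ball p (r / 2), w x = 0 := by
  intro x hx
  by_contra hne
  have hxr : dist x p < r / 2 := hx
  have hr : 0 < r := by linarith [dist_nonneg (x := x) (y := p)]
  have hxr' : x ∈ ball p r := ball_subset_ball (by linarith) hx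
  set d := dist x p with hd
  have hsub : closedBall x d ⊆ ball p r := by
    intro y hy
    have := dist_triangle y x p
    simp only [mem_closedBall, mem_ball] at hy ⊢
    linarith
  -- the zeros in the closed ball of radius `dist x p` form a compact set
  have hcont : ContinuousOn w (closedBall x d) := fun y hy =>
    (hw y (hsub hy)).continuousAt.continuousWithinAt
  have hZ : IsCompact (closedBall x d ∩ w ⁻¹' {0}) :=
    (isCompact_closedBall x d).of_isClosed_subset
      (hcont.preimage_isClosed_of_isClosed isClosed_closedBall isClosed_singleton) inter_subset_left
  -- `z` is a zero nearest to `x`: `w` is positive on the open ball about `x` that reaches `z`, yet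
  -- `Dw` vanishes at `z`, an interior minimum. This contradicts the Hopf lemma. The radius `r / 2`
  -- keeps that ball inside the domain.
  obtain ⟨z, hz, hzmin⟩ := hZ.exists_isMinOn ⟨p, by simp [hd, dist_comm], hp⟩
    (f := fun y => dist y x) (by fun_prop)
  have hz0 : w z = 0 := hz.2
  have hzx : 0 < dist z x := dist_pos.2 fun h => hne (h ▸ hz0)
  have hzd : dist z x ≤ d := hz.1
  have hpos : ∀ y ∈ ball x (dist z x), 0 < w y := by
    intro y hy
    have hy1 : y ∈ closedBall x d := by
      simp only [mem_ball, mem_closedBall] at hy ⊢; linarith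
    refine lt_of_le_of_ne (hnn y (hsub hy1)) fun h0 => ?_
    have := hzmin ⟨hy1, h0.symm⟩
    simp only [mem_ofPred_eq, mem_ball] at this hy
    linarith
  have hzb : z ∈ ball p r := hsub hz.1
  refine hopf hzx (fun y hy => hw y (hsub ?_)) (hell.mono ?_) hpos (x₀ := z) rfl hz0 ?_
  · simp only [mem_closedBall] at hy ⊢; linarith
  · intro y hy
    apply hsub
    simp only [mem_closedBall, mem_ball] at hy ⊢; linarith
  · apply IsLocalMin.fderiv_eq_zero
    filter_upwards [isOpen_ball.mem_nhds hzb] with y hy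
    rw [hz0]; exact hnn y hy

/-- The strong maximum principle. -/
theorem eq_zero_of_nonneg_of_ellIneq [FiniteDimensional ℝ E] {w : E → ℝ} {O : Set E}
    (hO : IsOpen O) (hOc : IsPreconnected O)
    (hw : ∀ x ∈ O, ContDiffAt ℝ 2 w x) (hell : EllIneq w O)
    (hnn : ∀ x ∈ O, 0 ≤ w x) {p : E} (hpO : p ∈ O) (hp : w p = 0) : ∀ x ∈ O, w x = 0 := by
  have hcont : ContinuousOn w O := fun y hy => (hw y hy).continuousAt.continuousWithinAt
  have h1 : IsOpen {x ∈ O | w x = 0} := by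
    rw [isOpen_iff_mem_nhds]
    rintro x ⟨hxO, hx0⟩
    obtain ⟨r, hr, hball⟩ := Metric.isOpen_iff.1 hO x hxO
    have := eq_zero_of_nonneg_of_ellIneq_half (fun y hy => hw y (hball hy)) (hell.mono hball)
      (fun y hy => hnn y (hball hy)) hx0
    refine mem_of_superset (ball_mem_nhds x (half_pos hr)) fun y hy => ⟨hball ?_, this y hy⟩
    exact ball_subset_ball (by linarith) hy
  have h2 : IsOpen {x ∈ O | w x ≠ 0} := hcont.isOpen_inter_preimage hO isOpen_ne
  intro x hx
  by_contra hne
  obtain ⟨y, -, hy1, hy2⟩ := hOc _ _ h1 h2 (fun y hy => by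
    by_cases h : w y = 0
    · exact Or.inl ⟨hy, h⟩
    · exact Or.inr ⟨hy, h⟩) ⟨p, hpO, hpO, hp⟩ ⟨x, hx, hx, hne⟩
  exact hy2.2 hy1.2

/-- The strong maximum principle together with the Hopf lemma. -/
theorem eq_zero_on_ball_of_ellIneq [FiniteDimensional ℝ E] {w : E → ℝ} {c x₀ : E} {r : ℝ}
    (hr : 0 < r) (hw : ∀ x ∈ closedBall c r, ContDiffAt ℝ 2 w x) (hell : EllIneq w (ball c r))
    (hnn : ∀ x ∈ ball c r, 0 ≤ w x) (hx₀ : x₀ ∈ sphere c r) (hw₀ : w x₀ = 0)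
    (hD : fderiv ℝ w x₀ = 0) : ∀ x ∈ ball c r, w x = 0 := by
  by_cases h : ∃ p ∈ ball c r, w p = 0
  · obtain ⟨p, hp, hp0⟩ := h
    exact eq_zero_of_nonneg_of_ellIneq isOpen_ball (convex_ball c r).isPreconnected
      (fun x hx => hw x (ball_subset_closedBall hx)) hell hnn hp hp0
  · push Not at h
    exact absurd hD (hopf hr hw hell
      (fun x hx => lt_of_le_of_ne (hnn x hx) (Ne.symm (h x hx))) hx₀ hw₀)

end MaximumPrinciple

/-! ### The mean curvature of level sets and its invariance under reflections -/

section MeanCurvature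

variable {n : ℕ}

theorem inner_gradient (φ : Amb n → ℝ) (x ξ : Amb n) : ⟪gradient φ x, ξ⟫ = fderiv ℝ φ x ξ := by
  rw [gradient, InnerProductSpace.toDual_symm_apply]

theorem gradient_ne_zero_iff {φ : Amb n → ℝ} {x : Amb n} :
    gradient φ x ≠ 0 ↔ fderiv ℝ φ x ≠ 0 := by
  simp [gradient]

theorem norm_gradient (φ : Amb n → ℝ) (x : Amb n) : ‖gradient φ x‖ = ‖fderiv ℝ φ x‖ := by
  simp [gradient]

/-- The trace of a bilinear form. -/
noncomputable def trForm (B : Amb n →L[ℝ] Amb n →L[ℝ] ℝ) : ℝ :=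
  ∑ i, B (EuclideanSpace.single i 1) (EuclideanSpace.single i 1)

/-- The quadratic expression `|p|² tr B - B (p, p)`. -/
noncomputable def mcForm (p : Amb n) (B : Amb n →L[ℝ] Amb n →L[ℝ] ℝ) : ℝ :=
  ‖p‖ ^ 2 * trForm B - B p p

theorem sum_coord_smul_single (p : Amb n) :
    ∑ i, p i • EuclideanSpace.single i (1 : ℝ) = p := by
  ext j
  simp [Finset.sum_apply, Pi.single_apply]

theorem bilin_eq_sum (B : Amb n →L[ℝ] Amb n →L[ℝ] ℝ) (p q : Amb n) :
    B p q = ∑ i, ∑ j, p i * q j * B (EuclideanSpace.single i 1) (EuclideanSpace.single j 1) := by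
  conv_lhs => rw [← sum_coord_smul_single p, ← sum_coord_smul_single q]
  simp only [map_sum, map_smul, sum_apply, smul_apply, smul_eq_mul, Finset.mul_sum]
  rw [Finset.sum_comm]
  exact Finset.sum_congr rfl fun i _ => Finset.sum_congr rfl fun j _ => by ring

theorem sum_coord_mul_left (B : Amb n →L[ℝ] Amb n →L[ℝ] ℝ) (p q : Amb n) :
    ∑ i, p i * B (EuclideanSpace.single i 1) q = B p q := by
  have h : B p q = B (∑ i, p i • EuclideanSpace.single i (1 : ℝ)) q := by
    rw [sum_coord_smul_single]
  rw [h]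
  simp only [map_sum, map_smul, sum_apply, smul_apply, smul_eq_mul]

theorem sum_coord_mul (l : Amb n →L[ℝ] ℝ) (p : Amb n) :
    ∑ i, p i * l (EuclideanSpace.single i 1) = l p := by
  have h : l p = l (∑ i, p i • EuclideanSpace.single i (1 : ℝ)) := by
    rw [sum_coord_smul_single]
  rw [h]
  simp only [map_sum, map_smul, smul_eq_mul]

theorem single_inner (p : Amb n) (i : Fin (n + 1)) :
    ⟪p, EuclideanSpace.single i (1 : ℝ)⟫ = p i := by
  simp [EuclideanSpace.inner_single_right]

theorem trForm_sqForm (u : Amb n) : trForm (sqForm u) = ‖u‖ ^ 2 := by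
  simp only [trForm, sqForm_apply, single_inner, EuclideanSpace.norm_sq_eq, Real.norm_eq_abs, sq_abs]
  exact Finset.sum_congr rfl fun i _ => by ring

theorem trForm_innerForm : trForm (innerForm : Amb n →L[ℝ] Amb n →L[ℝ] ℝ) = n + 1 := by
  simp [trForm]

/-- Twice the expression is the sum over `i` and `j` of `B ξ ξ` with `ξ = p j • eᵢ - p i • eⱼ`. -/
theorem mcForm_nonneg (p : Amb n) {B : Amb n →L[ℝ] Amb n →L[ℝ] ℝ} (hB : ∀ ξ, 0 ≤ B ξ ξ) :
    0 ≤ mcForm p B := by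
  set b : Fin (n + 1) → Fin (n + 1) → ℝ := fun i j =>
    B (EuclideanSpace.single i 1) (EuclideanSpace.single j 1) with hb
  have h1 : ∀ i j, 0 ≤ p j ^ 2 * b i i + p i ^ 2 * b j j - p i * p j * (b i j + b j i) := by
    intro i j
    have := hB (p j • EuclideanSpace.single i 1 - p i • EuclideanSpace.single j 1)
    simp only [map_sub, map_smul, sub_apply, smul_apply, smul_eq_mul] at this
    simp only [hb]
    linarith
  have h2 : 0 ≤ ∑ i, ∑ j, (p j ^ 2 * b i i + p i ^ 2 * b j j - p i * p j * (b i j + b j i)) :=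
    Finset.sum_nonneg fun i _ => Finset.sum_nonneg fun j _ => h1 i j
  have h3 : ∑ i, ∑ j, p j ^ 2 * b i i = ‖p‖ ^ 2 * trForm B := by
    simp only [trForm, EuclideanSpace.norm_sq_eq, Real.norm_eq_abs, sq_abs, Finset.sum_mul_sum]
    rw [Finset.sum_comm]
  have h4 : ∑ i, ∑ j, p i ^ 2 * b j j = ‖p‖ ^ 2 * trForm B := by
    rw [Finset.sum_comm]; exact h3
  have h5 : ∑ i, ∑ j, p i * p j * b i j = B p p := (bilin_eq_sum B p p).symm
  have h6 : ∑ i, ∑ j, p i * p j * b j i = B p p := by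
    rw [Finset.sum_comm, bilin_eq_sum B p p]
    exact Finset.sum_congr rfl fun i _ => Finset.sum_congr rfl fun j _ => by ring
  simp only [mul_add, Finset.sum_add_distrib, Finset.sum_sub_distrib] at h2
  rw [h3, h4, h5, h6] at h2
  rw [mcForm]
  linarith

theorem gradient_eq_sum (φ : Amb n → ℝ) (x : Amb n) :
    gradient φ x =
      ∑ i, fderiv ℝ φ x (EuclideanSpace.single i 1) • EuclideanSpace.single i (1 : ℝ) := by
  conv_lhs => rw [← sum_coord_smul_single (gradient φ x)]
  exact Finset.sum_congr rfl fun i _ => by rw [← inner_gradient, single_inner]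

theorem hasFDerivAt_gradient {φ : Amb n → ℝ} {x : Amb n} (hφ : ContDiffAt ℝ 2 φ x) :
    HasFDerivAt (gradient φ) (∑ i, ((hess φ x).flip (EuclideanSpace.single i 1)).smulRight
      (EuclideanSpace.single i (1 : ℝ))) x := by
  have h1 : HasFDerivAt (fderiv ℝ φ) (hess φ x) x :=
    ((hφ.fderiv_right (m := 1) (by norm_num)).differentiableAt (by norm_num)).hasFDerivAt
  have h2 : gradient φ = fun y =>
      ∑ i, fderiv ℝ φ y (EuclideanSpace.single i 1) • EuclideanSpace.single i (1 : ℝ) :=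
    funext (gradient_eq_sum φ)
  rw [h2]
  refine HasFDerivAt.fun_sum fun i _ => ?_
  exact ((ContinuousLinearMap.apply ℝ ℝ
    (EuclideanSpace.single i (1 : ℝ) : Amb n)).hasFDerivAt.comp x h1).smul_const _

/-- Expanding the divergence of the normalized gradient shows the curvature as a quasilinear
operator: the gradient supplies the coefficients, and the Hessian enters linearly through `mcForm`.
-/
theorem levelSetMeanCurvature_eq {φ : Amb n → ℝ} {x : Amb n} (hφ : ContDiffAt ℝ 2 φ x)
    (h0 : gradient φ x ≠ 0) :
    levelSetMeanCurvature φ x =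
      -(1 / (n : ℝ)) * (mcForm (gradient φ x) (hess φ x) / ‖gradient φ x‖ ^ 3) := by
  have hA := hasFDerivAt_gradient hφ
  set A : Amb n →L[ℝ] Amb n := ∑ i, ((hess φ x).flip (EuclideanSpace.single i 1)).smulRight
      (EuclideanSpace.single i (1 : ℝ)) with hAdef
  have hAi : ∀ ξ η, ⟪A ξ, η⟫ = hess φ x ξ η := fun ξ η => by
    rw [← sum_coord_mul (hess φ x ξ) η, hAdef]
    rw [sum_apply, sum_inner]
    refine Finset.sum_congr rfl fun i _ => ?_
    rw [ContinuousLinearMap.smulRight_apply, ContinuousLinearMap.flip_apply, real_inner_smul_left,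
      real_inner_comm, single_inner, mul_comm]
  set p := gradient φ x with hp
  have hp0 : 0 < ‖p‖ := norm_pos_iff.2 h0
  have h1 := hA.norm_sq
  have h2 := h1.sqrt (by positivity)
  have h3 := (hasDerivAt_inv (x := √(‖gradient φ x‖ ^ 2)) (by rw [Real.sqrt_sq (norm_nonneg _)]
                                                              exact hp0.ne')).comp_hasFDerivAt x h2
  have h4 := h3.congr_of_eventuallyEq (f₁ := fun y => ‖gradient φ y‖⁻¹)
    (Eventually.of_forall fun y => by simp [Real.sqrt_sq (norm_nonneg _)])
  have h5 := (h4.smul hA).fderiv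
  rw [levelSetMeanCurvature, divergence]
  congr 1
  have h6 : ∀ i, fderiv ℝ (fun x => ‖gradient φ x‖⁻¹ • gradient φ x) x (EuclideanSpace.single i 1) i
      = ‖p‖⁻¹ * hess φ x (EuclideanSpace.single i 1) (EuclideanSpace.single i 1)
        - (‖p‖ ^ 3)⁻¹ * (p i * hess φ x (EuclideanSpace.single i 1) p) := by
    intro i
    have h5' : fderiv ℝ (fun x => ‖gradient φ x‖⁻¹ • gradient φ x) x = _ := h5
    rw [h5', ← single_inner]
    simp only [← hp, Real.sqrt_sq (norm_nonneg _), add_apply, smul_apply,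
      ContinuousLinearMap.smulRight_apply, inner_add_left, inner_smul_left, hAi, single_inner,
      ContinuousLinearMap.comp_apply, innerSL_apply_apply, smul_eq_mul, nsmul_eq_mul]
    simp
    rw [real_inner_comm, hAi]
    field_simp
    ring
  simp only [h6, Finset.sum_sub_distrib, ← Finset.mul_sum]
  rw [sum_coord_mul_left, mcForm, trForm]
  field_simp

/-- The linear part of `reflectIn v s`. -/
noncomputable def reflectLin (v : Amb n) : Amb n →L[ℝ] Amb n :=
  ContinuousLinearMap.id ℝ _ - (2 : ℝ) • (innerSL ℝ v).smulRight v

@[simp] theorem reflectLin_apply (v ξ : Amb n) : reflectLin v ξ = ξ - (2 * ⟪v, ξ⟫) • v := by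
  simp [reflectLin, smul_smul]

theorem reflectIn_eq (v : Amb n) (s : ℝ) (x : Amb n) :
    reflectIn v s x = reflectLin v x + (2 * s) • v := by
  rw [reflectIn, reflectLin_apply]; module

theorem reflectIn_add (v : Amb n) (s : ℝ) (x ξ : Amb n) :
    reflectIn v s (x + ξ) = reflectIn v s x + reflectLin v ξ := by
  rw [reflectIn_eq, reflectIn_eq, map_add]; abel

theorem inner_reflectLin {v : Amb n} (hv : ‖v‖ = 1) (ξ η : Amb n) :
    ⟪reflectLin v ξ, reflectLin v η⟫ = ⟪ξ, η⟫ := by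
  have : ⟪v, v⟫ = 1 := by rw [real_inner_self_eq_norm_sq, hv]; norm_num
  simp only [reflectLin_apply, inner_sub_left, inner_sub_right, inner_smul_left, inner_smul_right,
    this, real_inner_comm v]
  simp
  ring

theorem reflectLin_reflectLin {v : Amb n} (hv : ‖v‖ = 1) (ξ : Amb n) :
    reflectLin v (reflectLin v ξ) = ξ := by
  have : ⟪v, v⟫ = 1 := by rw [real_inner_self_eq_norm_sq, hv]; norm_num
  simp only [reflectLin_apply, inner_sub_right, inner_smul_right, this]
  module

theorem reflectIn_reflectIn {v : Amb n} (hv : ‖v‖ = 1) (s : ℝ) (x : Amb n) :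
    reflectIn v s (reflectIn v s x) = x := by
  have : ⟪v, v⟫ = 1 := by rw [real_inner_self_eq_norm_sq, hv]; norm_num
  simp only [reflectIn, inner_sub_right, inner_smul_right, this]
  module

theorem inner_reflectIn_self {v : Amb n} (hv : ‖v‖ = 1) (s : ℝ) (x : Amb n) :
    ⟪v, reflectIn v s x⟫ = 2 * s - ⟪v, x⟫ := by
  have : ⟪v, v⟫ = 1 := by rw [real_inner_self_eq_norm_sq, hv]; norm_num
  simp only [reflectIn, inner_sub_right, inner_smul_right, this]
  ring

theorem inner_reflectIn_of_orthogonal {v e : Amb n} (hev : ⟪e, v⟫ = 0) (s : ℝ) (x : Amb n) :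
    ⟪e, reflectIn v s x⟫ = ⟪e, x⟫ := by
  simp [reflectIn, inner_sub_right, inner_smul_right, hev]

theorem continuous_reflectIn (v : Amb n) (s : ℝ) : Continuous (reflectIn v s) := by
  unfold reflectIn; fun_prop

theorem dist_reflectIn {v : Amb n} (hv : ‖v‖ = 1) (s : ℝ) (x y : Amb n) :
    dist (reflectIn v s x) (reflectIn v s y) = dist x y := by
  rw [dist_eq_norm, dist_eq_norm, reflectIn_eq, reflectIn_eq, add_sub_add_right_eq_sub, ← map_sub,
    ← sq_eq_sq₀ (norm_nonneg _) (norm_nonneg _), ← real_inner_self_eq_norm_sq, inner_reflectLin hv,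
    real_inner_self_eq_norm_sq]

theorem hasFDerivAt_reflectIn (v : Amb n) (s : ℝ) (x : Amb n) :
    HasFDerivAt (reflectIn v s) (reflectLin v) x := by
  have : reflectIn v s = fun x => reflectLin v x + (2 * s) • v := funext (reflectIn_eq v s)
  rw [this]
  exact (reflectLin v).hasFDerivAt.add_const _

theorem contDiff_reflectIn (v : Amb n) (s : ℝ) : ContDiff ℝ 2 (reflectIn v s) := by
  have : reflectIn v s = fun x => reflectLin v x + (2 * s) • v := funext (reflectIn_eq v s)
  rw [this]
  exact (reflectLin v).contDiff.add contDiff_const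

theorem trForm_reflectLin {v : Amb n} (hv : ‖v‖ = 1) {B B' : Amb n →L[ℝ] Amb n →L[ℝ] ℝ}
    (h : ∀ ξ η, B' ξ η = B (reflectLin v ξ) (reflectLin v η)) : trForm B' = trForm B := by
  have hvv : ∑ i, v i * v i = 1 := by
    have := EuclideanSpace.norm_sq_eq v
    rw [hv] at this
    simp only [Real.norm_eq_abs, sq_abs] at this
    simp only [← sq]
    linarith
  have h1 := sum_coord_mul_left B v v
  have h2 := sum_coord_mul (B v) v
  have h3 : ∀ i, B' (EuclideanSpace.single i 1) (EuclideanSpace.single i 1) =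
      B (EuclideanSpace.single i 1) (EuclideanSpace.single i 1)
      - 2 * (v i * B (EuclideanSpace.single i 1) v) - 2 * (v i * B v (EuclideanSpace.single i 1))
      + 4 * (v i * v i) * B v v := by
    intro i
    rw [h]
    simp only [reflectLin_apply, single_inner, map_sub, map_smul, sub_apply, smul_apply, smul_eq_mul]
    ring
  simp only [trForm, h3, Finset.sum_add_distrib, Finset.sum_sub_distrib, ← Finset.mul_sum, h1, h2,
    ← Finset.sum_mul, hvv]
  ring

theorem gradient_comp_reflectIn {v : Amb n} {s : ℝ} {φ : Amb n → ℝ} {x : Amb n}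
    (hφ : DifferentiableAt ℝ φ (reflectIn v s x)) :
    gradient (fun y => φ (reflectIn v s y)) x = reflectLin v (gradient φ (reflectIn v s x)) := by
  refine ext_inner_right ℝ fun ξ => ?_
  have h := (hφ.hasFDerivAt.comp x (hasFDerivAt_reflectIn v s x)).fderiv
  have h' : fderiv ℝ (fun y => φ (reflectIn v s y)) x = _ := h
  rw [inner_gradient, h']
  simp only [ContinuousLinearMap.comp_apply, ← inner_gradient, reflectLin_apply, inner_sub_left,
    inner_sub_right, inner_smul_left, inner_smul_right, real_inner_comm v]
  simp
  ring

theorem hess_comp_reflectIn {v : Amb n} {s : ℝ} {φ : Amb n → ℝ} {x : Amb n}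
    (hφ : ContDiffAt ℝ 2 φ (reflectIn v s x)) (ξ η : Amb n) :
    hess (fun y => φ (reflectIn v s y)) x ξ η =
      hess φ (reflectIn v s x) (reflectLin v ξ) (reflectLin v η) := by
  have h1 : fderiv ℝ (fun y => φ (reflectIn v s y)) =ᶠ[𝓝 x]
      fun y => (fderiv ℝ φ (reflectIn v s y)).comp (reflectLin v) := by
    filter_upwards [(continuous_reflectIn v s).continuousAt.eventually
      (hφ.eventually (by norm_num))] with y hy
    exact ((hy.differentiableAt (by norm_num)).hasFDerivAt.comp y (hasFDerivAt_reflectIn v s y)).fderiv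
  have h2 : HasFDerivAt (fderiv ℝ φ) (hess φ (reflectIn v s x)) (reflectIn v s x) :=
    ((hφ.fderiv_right (m := 1) (by norm_num)).differentiableAt (by norm_num)).hasFDerivAt
  have h3 := h2.comp x (hasFDerivAt_reflectIn v s x)
  have h4 := (((ContinuousLinearMap.compL ℝ (Amb n) (Amb n) ℝ).flip
    (reflectLin v)).hasFDerivAt.comp x h3).fderiv
  rw [hess, h1.fderiv_eq]
  exact congrArg (fun F => F ξ η) h4

theorem norm_reflectLin {v : Amb n} (hv : ‖v‖ = 1) (ξ : Amb n) : ‖reflectLin v ξ‖ = ‖ξ‖ := by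
  rw [← sq_eq_sq₀ (norm_nonneg _) (norm_nonneg _), ← real_inner_self_eq_norm_sq,
    inner_reflectLin hv, real_inner_self_eq_norm_sq]

theorem mcForm_comp_reflectIn {v : Amb n} (hv : ‖v‖ = 1) {s : ℝ} {φ : Amb n → ℝ} {x : Amb n}
    (hφ : ContDiffAt ℝ 2 φ (reflectIn v s x)) :
    mcForm (gradient (fun y => φ (reflectIn v s y)) x) (hess (fun y => φ (reflectIn v s y)) x) =
      mcForm (gradient φ (reflectIn v s x)) (hess φ (reflectIn v s x)) := by
  rw [gradient_comp_reflectIn (hφ.differentiableAt (by norm_num)), mcForm, mcForm,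
    norm_reflectLin hv, trForm_reflectLin hv (hess_comp_reflectIn hφ), hess_comp_reflectIn hφ,
    reflectLin_reflectLin hv]

end MeanCurvature

/-! ### Level sets as graphs over a hyperplane -/

section Graph

variable {E : Type*} [NormedAddCommGroup E] [InnerProductSpace ℝ E]

/-- The point above `x`, in the direction `N`, whose height over `Nᗮ` is `G x`. -/
noncomputable def graphPt (N : E) (G : E → ℝ) (x : E) : E := x + (G x - ⟪N, x⟫) • N

/-- The function `G` does not depend on the coordinate in the direction `N`. -/
def InvariantAlong (N : E) (G : E → ℝ) : Prop := ∀ x (t : ℝ), G (x + t • N) = G x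

theorem inner_graphPt {N : E} (hN : ‖N‖ = 1) (G : E → ℝ) (x : E) : ⟪N, graphPt N G x⟫ = G x := by
  rw [graphPt, inner_add_right, inner_smul_right, real_inner_self_eq_norm_sq, hN]; ring

theorem InvariantAlong.graphPt {N : E} {G : E → ℝ} (hG : InvariantAlong N G) (x : E) :
    G (graphPt N G x) = G x := hG _ _

/-- The map `Φ` replaces the coordinate `⟪N, x - p⟫` by `φ x`. Its derivative at `p` is the identity
plus a rank one map and has an explicit inverse because `Dφ N > 0`. The graph is the image under
`Φ⁻¹` of the hyperplane through `p`; composing with the projection `q` makes `G` a function on the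
whole space that is invariant along `N`, so no coordinates on the hyperplane are needed. -/
theorem exists_graph [CompleteSpace E] {N p : E} (hN : ‖N‖ = 1) {φ : E → ℝ}
    (hφ : ContDiffAt ℝ 2 φ p) (h0 : φ p = 0) (hd : 0 < fderiv ℝ φ p N) :
    ∃ G : E → ℝ, InvariantAlong N G ∧ ContDiffAt ℝ 2 G p ∧ G p = ⟪N, p⟫ ∧
      ∀ᶠ x in 𝓝 p, φ (graphPt N G x) = 0 ∧ (0 < φ x ↔ G x < ⟪N, x⟫) ∧ (φ x = 0 ↔ ⟪N, x⟫ = G x) := by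
  have hNN : ⟪N, N⟫ = 1 := by rw [real_inner_self_eq_norm_sq, hN]; norm_num
  set a := fderiv ℝ φ p N with ha
  set Φ : E → E := fun x => x + (φ x - ⟪N, x - p⟫) • N with hΦ
  set g : E →L[ℝ] ℝ := fderiv ℝ φ p - innerSL ℝ N with hg
  have hgN : g N = a - 1 := by
    rw [hg, sub_apply, innerSL_apply_apply, hNN]
  have hinv1 : Function.LeftInverse (ContinuousLinearMap.id ℝ E - (a⁻¹ • g).smulRight N)
      (ContinuousLinearMap.id ℝ E + g.smulRight N : E →L[ℝ] E) := fun ξ => by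
    simp only [hgN, sub_apply, add_apply, ContinuousLinearMap.smulRight_apply, smul_apply,
      ContinuousLinearMap.id_apply, map_add, map_smul, smul_eq_mul]
    match_scalars <;> field_simp <;> ring
  have hinv2 : Function.RightInverse (ContinuousLinearMap.id ℝ E - (a⁻¹ • g).smulRight N)
      (ContinuousLinearMap.id ℝ E + g.smulRight N : E →L[ℝ] E) := fun ξ => by
    simp only [hgN, sub_apply, add_apply, ContinuousLinearMap.smulRight_apply, smul_apply,
      ContinuousLinearMap.id_apply, map_sub, map_smul, smul_eq_mul]
    match_scalars <;> field_simp <;> ring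
  set Φ' : E ≃L[ℝ] E := ContinuousLinearEquiv.equivOfInverse _ _ hinv1 hinv2 with hΦ'
  have hΦd : HasFDerivAt Φ (Φ' : E →L[ℝ] E) p := by
    have h1 := (hφ.differentiableAt (by norm_num)).hasFDerivAt
    have h2 : HasFDerivAt (fun x : E => ⟪N, x - p⟫) (innerSL ℝ N) p :=
      (innerSL ℝ N).hasFDerivAt.comp p ((hasFDerivAt_id p).sub_const p)
    exact (hasFDerivAt_id p).add ((h1.sub h2).smul_const N)
  have hΦC : ContDiffAt ℝ 2 Φ p := by
    refine contDiffAt_id.add (ContDiffAt.smul (hφ.sub ?_) contDiffAt_const)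
    exact contDiffAt_const.inner ℝ (contDiffAt_id.sub contDiffAt_const)
  have hΦp : Φ p = p := by simp [hΦ, h0]
  set e := hΦC.toOpenPartialHomeomorph Φ hΦd (by norm_num) with he
  have hpe : p ∈ e.source := hΦC.mem_toOpenPartialHomeomorph_source hΦd (by norm_num)
  have hec : ∀ x, e x = Φ x := fun x => rfl
  have hpt : p ∈ e.target := by
    have := e.map_source hpe; rwa [hec, hΦp] at this
  have hsp : e.symm p = p := by
    have := e.left_inv hpe; rwa [hec, hΦp] at this
  have hsC : ContDiffAt ℝ 2 e.symm p := e.contDiffAt_symm hpt (by rw [hsp]; exact hΦd)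
    (by rw [hsp]; exact hΦC)
  -- the projection to the hyperplane through `p`
  set q : E → E := fun x => x - ⟪N, x - p⟫ • N with hq
  have hqC : ContDiff ℝ 2 q := contDiff_id.sub ((contDiff_const.inner ℝ
    (contDiff_id.sub contDiff_const)).smul contDiff_const)
  have hqp : q p = p := by simp [hq]
  set G : E → ℝ := fun x => ⟪N, e.symm (q x)⟫ with hG
  have hGC : ContDiffAt ℝ 2 G p :=
    contDiffAt_const.inner ℝ (ContDiffAt.comp p (by rw [hqp]; exact hsC) hqC.contDiffAt)
  have hGp : G p = ⟪N, p⟫ := by simp [hG, hqp, hsp]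
  have hGpt : ContinuousAt (graphPt N G) p := by
    unfold graphPt
    exact continuousAt_id.add (ContinuousAt.smul (hGC.continuousAt.sub
      (continuousAt_const.inner continuousAt_id)) continuousAt_const)
  have hgp : graphPt N G p = p := by simp [graphPt, hGp]
  -- a convex neighbourhood on which `φ` increases in the direction `N`
  have hφ' : ∀ᶠ x in 𝓝 p, DifferentiableAt ℝ φ x ∧ 0 < fderiv ℝ φ x N := by
    have h1 : ContinuousAt (fun x => fderiv ℝ φ x N) p :=
      ((hφ.fderiv_right (m := 1) (by norm_num)).continuousAt).clm_apply continuousAt_const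
    filter_upwards [hφ.eventually (by norm_num), h1.eventually (lt_mem_nhds hd)] with x hx1 hx2
    exact ⟨hx1.differentiableAt (by norm_num), hx2⟩
  obtain ⟨r, hr, hball⟩ := Metric.eventually_nhds_iff_ball.1 hφ'
  have hmono : ∀ x ∈ ball p r, ∀ t : ℝ, 0 < t → x + t • N ∈ ball p r → φ x < φ (x + t • N) := by
    intro x hx t ht hxt
    have hseg : ∀ u ∈ Icc 0 t, x + u • N ∈ ball p r := by
      intro u hu
      have h1 : x + u • N = (1 - u / t) • x + (u / t) • (x + t • N) := by
        match_scalars <;> field_simp; ring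
      rw [h1]
      exact (convex_ball p r) hx hxt (by
        rw [sub_nonneg, div_le_one ht]; exact hu.2) (div_nonneg hu.1 ht.le) (by ring)
    have := strictMonoOn_of_deriv_pos (convex_Icc 0 t) (f := fun u : ℝ => φ (x + u • N))
      (fun u hu => (hasDerivAt_comp_line (hball _ (hseg u hu)).1).continuousAt.continuousWithinAt)
      (fun u hu => by
        rw [interior_Icc] at hu
        have hu' := hball _ (hseg u ⟨hu.1.le, hu.2.le⟩)
        rw [(hasDerivAt_comp_line hu'.1).deriv]; exact hu'.2)
      (left_mem_Icc.2 ht.le) (right_mem_Icc.2 ht.le) ht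
    simpa using this
  refine ⟨G, fun x t => ?_, hGC, hGp, ?_⟩
  · have : q (x + t • N) = q x := by
      simp only [hq, inner_sub_right, inner_add_right, inner_smul_right, hNN]; module
    simp only [hG, this]
  have h1 : ∀ᶠ x in 𝓝 p, q x ∈ e.target :=
    hqC.continuous.continuousAt.eventually (by rw [hqp]; exact e.open_target.mem_nhds hpt)
  have h2 : ∀ᶠ x in 𝓝 p, graphPt N G x ∈ ball p r :=
    hGpt.eventually (by rw [hgp]; exact ball_mem_nhds p hr)
  filter_upwards [h1, h2, ball_mem_nhds p hr] with x hx1 hx2 hx3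
  have hkey : graphPt N G x = e.symm (q x) ∧ φ (graphPt N G x) = 0 := by
    have h3 : Φ (e.symm (q x)) = q x := by rw [← hec]; exact e.right_inv hx1
    set m := e.symm (q x) with hm
    have h4 : ⟪N, Φ m - p⟫ = φ m := by
      simp only [hΦ, inner_sub_right, inner_add_right, inner_smul_right, hNN]; ring
    have h5 : φ m = 0 := by
      rw [← h4, h3]
      simp only [hq, inner_sub_right, inner_smul_right, hNN]; ring
    have h6 : graphPt N G x = m := by
      have h7 : m + (φ m - ⟪N, m - p⟫) • N = q x := h3
      rw [h5] at h7
      have h8 : m = q x + ⟪N, m - p⟫ • N := by rw [← h7]; module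
      have h9 : G x = ⟪N, m⟫ := rfl
      rw [graphPt, h9]
      conv_rhs => rw [h8]
      simp only [hq, inner_sub_right]
      module
    exact ⟨h6, h6 ▸ h5⟩
  have hxg : x = graphPt N G x + (⟪N, x⟫ - G x) • N := by
    rw [graphPt]; module
  have hgx : graphPt N G x = x + (G x - ⟪N, x⟫) • N := rfl
  have hlt : G x < ⟪N, x⟫ → 0 < φ x := fun h => by
    have := hmono _ hx2 (⟪N, x⟫ - G x) (by linarith) (by rw [← hxg]; exact hx3)
    rwa [← hxg, hkey.2] at this
  have hgt : ⟪N, x⟫ < G x → φ x < 0 := fun h => by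
    have := hmono _ hx3 (G x - ⟪N, x⟫) (by linarith) (by rw [← hgx]; exact hx2)
    rwa [← hgx, hkey.2] at this
  have heq : ⟪N, x⟫ = G x → φ x = 0 := fun h => by
    have := hkey.2
    rwa [graphPt, h, sub_self, zero_smul, add_zero] at this
  refine ⟨hkey.2, ⟨fun h => ?_, hlt⟩, ⟨fun h => ?_, heq⟩⟩
  · rcases lt_trichotomy (G x) ⟪N, x⟫ with h' | h' | h'
    · exact h'
    · exact absurd (heq h'.symm) h.ne'
    · exact absurd (hgt h') (by linarith)
  · rcases lt_trichotomy (G x) ⟪N, x⟫ with h' | h' | h'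
    · exact absurd h (hlt h').ne'
    · exact h'.symm
    · exact absurd h (hgt h').ne

end Graph

/-! ### The elliptic inequality for the difference of two graphs -/

section Comparison

variable {n : ℕ}

/-- The function that vanishes on the graph of `G` in the direction `N`. -/
noncomputable def graphFn (N : Amb n) (G : Amb n → ℝ) (x : Amb n) : ℝ := ⟪N, x⟫ - G x

theorem ContDiffAt.graphFn {N : Amb n} {G : Amb n → ℝ} {x : Amb n} (hG : ContDiffAt ℝ 2 G x) :
    ContDiffAt ℝ 2 (graphFn N G) x :=
  (contDiffAt_const.inner ℝ contDiffAt_id).sub hG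

theorem fderiv_graphFn {N : Amb n} {G : Amb n → ℝ} {x : Amb n} (hG : DifferentiableAt ℝ G x) :
    fderiv ℝ (graphFn N G) x = innerSL ℝ N - fderiv ℝ G x :=
  ((innerSL ℝ N).hasFDerivAt.sub hG.hasFDerivAt).fderiv

theorem ContDiffAt.continuousAt_hess {φ : Amb n → ℝ} {x : Amb n} (hφ : ContDiffAt ℝ 2 φ x) :
    ContinuousAt (hess φ) x :=
  ((hφ.fderiv_right (m := 1) (by norm_num)).fderiv_right (m := 0) (by norm_num)).continuousAt

theorem ContDiffAt.continuousAt_norm_hess {φ : Amb n → ℝ} {x : Amb n} (hφ : ContDiffAt ℝ 2 φ x) :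
    ContinuousAt (fun y => ‖hess φ y‖) x :=
  ((hφ.fderiv_right (m := 1) (by norm_num)).fderiv_right (m := 0) (by norm_num)).continuousAt.norm

theorem ContDiffAt.continuousAt_gradient {φ : Amb n → ℝ} {x : Amb n} (hφ : ContDiffAt ℝ 2 φ x) :
    ContinuousAt (gradient φ) x := (hasFDerivAt_gradient hφ).continuousAt

theorem continuous_trForm : Continuous (trForm (n := n)) := by
  unfold trForm
  fun_prop

theorem ContDiffAt.continuousAt_mcForm {φ : Amb n → ℝ} {x : Amb n} (hφ : ContDiffAt ℝ 2 φ x) :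
    ContinuousAt (fun y => mcForm (gradient φ y) (hess φ y)) x := by
  have h1 := hφ.continuousAt_hess
  have h2 := hφ.continuousAt_gradient
  unfold mcForm
  exact ((h2.norm.pow 2).mul (continuous_trForm.continuousAt.comp h1)).sub
    ((h1.clm_apply h2).clm_apply h2)

theorem continuousAt_levelSetMeanCurvature {φ : Amb n → ℝ} {x : Amb n} (hφ : ContDiffAt ℝ 2 φ x)
    (h0 : gradient φ x ≠ 0) : ContinuousAt (levelSetMeanCurvature φ) x := by
  have h2 := hφ.continuousAt_gradient
  have h3 : (fun y => -(1 / (n : ℝ)) * (mcForm (gradient φ y) (hess φ y) / ‖gradient φ y‖ ^ 3))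
      =ᶠ[𝓝 x] levelSetMeanCurvature φ := by
    filter_upwards [hφ.eventually (by norm_num), h2.eventually_ne h0] with y hy1 hy2
    exact (levelSetMeanCurvature_eq hy1 hy2).symm
  refine ContinuousAt.congr ?_ h3
  exact continuousAt_const.mul (hφ.continuousAt_mcForm.div (h2.norm.pow 3)
    (pow_ne_zero _ (norm_ne_zero_iff.2 h0)))

theorem mcForm_of_levelSetMeanCurvature (hn : n ≠ 0) {φ : Amb n → ℝ} {x : Amb n}
    (hφ : ContDiffAt ℝ 2 φ x) (h0 : gradient φ x ≠ 0) :
    mcForm (gradient φ x) (hess φ x) =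
      -(n * ‖gradient φ x‖ ^ 3 * levelSetMeanCurvature φ x) := by
  rw [levelSetMeanCurvature_eq hφ h0]
  have : (n : ℝ) ≠ 0 := Nat.cast_ne_zero.2 hn
  have h1 : ‖gradient φ x‖ ≠ 0 := norm_ne_zero_iff.2 h0
  field_simp

theorem abs_trForm_le (B : Amb n →L[ℝ] Amb n →L[ℝ] ℝ) : |trForm B| ≤ (n + 1) * ‖B‖ := by
  refine (Finset.abs_sum_le_sum_abs _ _).trans ?_
  refine (Finset.sum_le_sum (g := fun _ => ‖B‖) fun i _ => ?_).trans (by simp)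
  have := B.le_opNorm₂ (EuclideanSpace.single i (1 : ℝ)) (EuclideanSpace.single i 1)
  simpa using this

theorem levelSetMeanCurvature_add_const (φ : Amb n → ℝ) (c : ℝ) (x : Amb n) :
    levelSetMeanCurvature (fun y => φ y + c) x = levelSetMeanCurvature φ x := by
  have : gradient (fun y => φ y + c) = gradient φ := by
    funext y; simp [gradient, fderiv_add_const]
  simp only [levelSetMeanCurvature, this]

theorem levelSetMeanCurvature_comp_add (φ : Amb n → ℝ) (a x : Amb n) :
    levelSetMeanCurvature (fun y => φ (y + a)) x = levelSetMeanCurvature φ (x + a) := by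
  have : ∀ y, gradient (fun y => φ (y + a)) y = gradient φ (y + a) := by
    intro y; simp only [gradient, fderiv_comp_add_right]
  simp only [levelSetMeanCurvature, this, divergence]
  congr 1
  refine Finset.sum_congr rfl fun i _ => ?_
  rw [fderiv_comp_add_right (f := fun x => ‖gradient φ x‖⁻¹ • gradient φ x) (x := x) a]

theorem levelSetMeanCurvature_neg (φ : Amb n → ℝ) (x : Amb n) :
    levelSetMeanCurvature (fun y => -φ y) x = -levelSetMeanCurvature φ x := by
  have : ∀ y, gradient (fun y => -φ y) y = -gradient φ y := by
    intro y; simp only [gradient, fderiv_fun_neg, map_neg]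
  simp only [levelSetMeanCurvature, this, divergence, norm_neg, smul_neg, fderiv_fun_neg, neg_apply,
    PiLp.neg_apply, Finset.sum_neg_distrib, mul_neg]

/-- Translation along `N` changes `graphFn N G` only by a constant, so the curvature equation may be
read off the graph, at any height. -/
theorem levelSetMeanCurvature_graphPt {N : Amb n} (hN : ‖N‖ = 1) {G : Amb n → ℝ}
    (hG : InvariantAlong N G) (x : Amb n) :
    levelSetMeanCurvature (graphFn N G) (graphPt N G x) =
      levelSetMeanCurvature (graphFn N G) x := by
  have h : (fun y => graphFn N G (y + (G x - ⟪N, x⟫) • N)) =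
      fun y => graphFn N G y + (G x - ⟪N, x⟫) := by
    funext y
    rw [graphFn, graphFn, hG, inner_add_right, inner_smul_right, real_inner_self_eq_norm_sq, hN]
    ring
  rw [graphPt, ← levelSetMeanCurvature_comp_add, h, levelSetMeanCurvature_add_const]

theorem levelSetMeanCurvature_comp_reflectIn {v : Amb n} (hv : ‖v‖ = 1) {s : ℝ} {φ : Amb n → ℝ}
    {x : Amb n} (hφ : ContDiffAt ℝ 2 φ (reflectIn v s x)) (h0 : gradient φ (reflectIn v s x) ≠ 0) :
    levelSetMeanCurvature (fun y => φ (reflectIn v s y)) x =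
      levelSetMeanCurvature φ (reflectIn v s x) := by
  have hg := gradient_comp_reflectIn (v := v) (s := s) (hφ.differentiableAt (by norm_num))
  have hg' : ‖gradient (fun y => φ (reflectIn v s y)) x‖ = ‖gradient φ (reflectIn v s x)‖ := by
    rw [hg, norm_reflectLin hv]
  have hφ' : ContDiffAt ℝ 2 (fun y => φ (reflectIn v s y)) x :=
    hφ.comp x (contDiff_reflectIn v s).contDiffAt
  rw [levelSetMeanCurvature_eq hφ h0, levelSetMeanCurvature_eq hφ'
    (by rw [← norm_ne_zero_iff, hg']; exact norm_ne_zero_iff.2 h0), mcForm_comp_reflectIn hv hφ, hg']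

/-- The elliptic operator `B ↦ mcForm p B + 2 B (N, N)`. -/
noncomputable def mcOperator (N p : Amb n) : (Amb n →L[ℝ] Amb n →L[ℝ] ℝ) →ₗ[ℝ] ℝ where
  toFun B := mcForm p B + 2 * B N N
  map_add' A B := by
    simp only [mcForm, trForm, add_apply, Finset.sum_add_distrib]; ring
  map_smul' a B := by
    simp only [mcForm, trForm, smul_apply, smul_eq_mul, ← Finset.mul_sum, RingHom.id_apply]; ring

theorem mcOperator_apply (N p : Amb n) (B : Amb n →L[ℝ] Amb n →L[ℝ] ℝ) :
    mcOperator N p B = mcForm p B + 2 * B N N := rfl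

/-- This makes the extra term `2 * B N N` of `mcOperator` vanish on the functions to which the
operator is applied. -/
theorem hess_apply_self_of_invariantAlong {N : Amb n} {G : Amb n → ℝ} (hG : InvariantAlong N G)
    {x : Amb n} (hx : ContDiffAt ℝ 2 G x) : hess G x N N = 0 := by
  have h0 : ∀ᶠ y in 𝓝 x, fderiv ℝ G y N = 0 := by
    filter_upwards [hx.eventually (by norm_num)] with y hy
    have h1 := hasDerivAt_comp_line (x := y) (ξ := N) (t := 0) (w := G)
      (by simpa using hy.differentiableAt (by norm_num))
    have h2 : (fun t : ℝ => G (y + t • N)) = fun _ => G y := funext fun t => hG y t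
    rw [h2] at h1
    simpa using h1.unique (hasDerivAt_const 0 (G y))
  have h3 := hasDerivAt_fderiv_comp_line (x := x) (ξ := N) (η := N) (t := 0) (w := G)
      (by simpa using hx)
  have h4 : (fun t : ℝ => fderiv ℝ G (x + t • N) N) =ᶠ[𝓝 0] fun _ => 0 := by
    have : Tendsto (fun t : ℝ => x + t • N) (𝓝 0) (𝓝 x) := by
      have : Continuous (fun t : ℝ => x + t • N) := by fun_prop
      simpa using this.tendsto 0
    exact this.eventually h0
  simpa using (h3.congr_of_eventuallyEq h4.symm).unique (hasDerivAt_const 0 (0 : ℝ))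

theorem abs_bilin_sub_le (B : Amb n →L[ℝ] Amb n →L[ℝ] ℝ) (p q : Amb n) :
    |B p p - B q q| ≤ ‖B‖ * (‖p‖ + ‖q‖) * ‖p - q‖ := by
  have h1 : B p p - B q q = B p (p - q) + B (p - q) q := by
    simp only [map_sub, sub_apply]; ring
  rw [h1]
  refine (abs_add_le _ _).trans ?_
  have h2 := B.le_opNorm₂ p (p - q)
  have h3 := B.le_opNorm₂ (p - q) q
  rw [Real.norm_eq_abs] at h2 h3
  linarith

theorem mcForm_sub (p : Amb n) (A B : Amb n →L[ℝ] Amb n →L[ℝ] ℝ) :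
    mcForm p (A - B) = mcForm p A - mcForm p B := by
  simp only [mcForm, trForm, sub_apply, Finset.sum_sub_distrib]; ring

theorem mcForm_sub_le {p q : Amb n} {B : Amb n →L[ℝ] Amb n →L[ℝ] ℝ} {K : ℝ}
    (hp : ‖p‖ ≤ 2) (hq : ‖q‖ ≤ 2) (hB : ‖B‖ ≤ K) :
    mcForm p B - mcForm q B ≤ (4 * (n + 1) * K + 4 * K) * ‖p - q‖ := by
  have t1 : mcForm p B - mcForm q B = (‖p‖ ^ 2 - ‖q‖ ^ 2) * trForm B - (B p p - B q q) := by
    simp only [mcForm]; ring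
  have hdn : |‖p‖ - ‖q‖| ≤ ‖p - q‖ := abs_norm_sub_norm_le _ _
  have hK : 0 ≤ K := (norm_nonneg B).trans hB
  have q1 : (‖p‖ ^ 2 - ‖q‖ ^ 2) * trForm B ≤ 4 * ‖p - q‖ * ((n + 1) * K) := by
    refine (le_abs_self _).trans ?_
    rw [abs_mul, show ‖p‖ ^ 2 - ‖q‖ ^ 2 = (‖p‖ + ‖q‖) * (‖p‖ - ‖q‖) by ring, abs_mul,
      abs_of_nonneg (by positivity)]
    have := abs_trForm_le B
    gcongr
    · linarith
    · exact this.trans (by gcongr)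
  have q2 : -(B p p - B q q) ≤ K * 4 * ‖p - q‖ := by
    refine (neg_le_abs _).trans ((abs_bilin_sub_le _ _ _).trans ?_)
    gcongr
    linarith
  rw [t1]
  linarith

theorem cube_mul_sub_le {p q d κ₁ κ₂ K δ : ℝ} (hp : 0 ≤ p) (hp2 : p ≤ 2) (hq : 0 ≤ q) (hq2 : q ≤ 2)
    (hd : |p - q| ≤ d) (hκ : |κ₁ - κ₂| ≤ δ) (hK : |κ₂| ≤ K) :
    p ^ 3 * κ₁ - q ^ 3 * κ₂ ≤ 8 * δ + 12 * K * d := by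
  have h1 : p ^ 3 * (κ₁ - κ₂) ≤ 8 * δ := by
    have s1 : p ^ 3 ≤ 8 := by
      calc p ^ 3 ≤ 2 ^ 3 := by gcongr
        _ = 8 := by norm_num
    calc p ^ 3 * (κ₁ - κ₂) ≤ p ^ 3 * |κ₁ - κ₂| := by gcongr; exact le_abs_self _
      _ ≤ 8 * δ := by gcongr
  have h2 : (p ^ 3 - q ^ 3) * κ₂ ≤ 12 * d * K := by
    refine (le_abs_self _).trans ?_
    rw [abs_mul, show p ^ 3 - q ^ 3 = (p ^ 2 + p * q + q ^ 2) * (p - q) by ring, abs_mul,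
      abs_of_nonneg (by positivity)]
    have s1 : p ^ 2 + p * q + q ^ 2 ≤ 12 := by nlinarith
    have : 0 ≤ d := (abs_nonneg _).trans hd
    gcongr
  linarith

set_option maxHeartbeats 1000000 in
/-- The difference of two graph functions, whose mean curvatures differ by a Lipschitz function of
the height, satisfies an elliptic inequality. -/
theorem exists_ellIneq_sub (hn : n ≠ 0) {N p : Amb n} (hN : ‖N‖ = 1) {G₁ G₂ : Amb n → ℝ}
    (hi₁ : InvariantAlong N G₁) (hi₂ : InvariantAlong N G₂) (h₁ : ContDiffAt ℝ 2 G₁ p)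
    (h₂ : ContDiffAt ℝ 2 G₂ p) (hd₁ : fderiv ℝ G₁ p = 0) (hd₂ : fderiv ℝ G₂ p = 0) (L : ℝ)
    (hL : 0 ≤ L) :
    ∃ ρ > 0, ∀ S ⊆ ball p ρ, (∀ x ∈ S,
      |levelSetMeanCurvature (graphFn N G₁) x - levelSetMeanCurvature (graphFn N G₂) x| ≤
        L * |G₁ x - G₂ x|) → EllIneq (fun x => G₁ x - G₂ x) S := by
  set φ₁ := graphFn N G₁ with hφ₁
  set φ₂ := graphFn N G₂ with hφ₂
  have hC₁ : ContDiffAt ℝ 2 φ₁ p := h₁.graphFn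
  have hC₂ : ContDiffAt ℝ 2 φ₂ p := h₂.graphFn
  have hgp : ∀ {G : Amb n → ℝ}, ContDiffAt ℝ 2 G p → fderiv ℝ G p = 0 →
      gradient (graphFn N G) p = N := fun {G} hG hd => by
    refine ext_inner_right ℝ fun ξ => ?_
    rw [inner_gradient, fderiv_graphFn (hG.differentiableAt (by norm_num)), hd, sub_zero,
      innerSL_apply_apply]
  have hg₁ : gradient φ₁ p = N := hgp h₁ hd₁
  have hg₂ : gradient φ₂ p = N := hgp h₂ hd₂
  have hN0 : N ≠ 0 := fun h => by simp [h] at hN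
  have e₁ : ∀ᶠ x in 𝓝 p, ‖gradient φ₁ x - N‖ < 1 / 4 := by
    have := (hC₁.continuousAt_gradient.sub (continuousAt_const (y := N))).norm
    exact this.eventually (gt_mem_nhds (by simp [hg₁]))
  have e₂ : ∀ᶠ x in 𝓝 p, ‖gradient φ₂ x - N‖ < 1 / 4 := by
    have := (hC₂.continuousAt_gradient.sub (continuousAt_const (y := N))).norm
    exact this.eventually (gt_mem_nhds (by simp [hg₂]))
  have e₃ : ∀ᶠ x in 𝓝 p, ‖hess φ₂ x‖ < ‖hess φ₂ p‖ + 1 := by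
    exact hC₂.continuousAt_norm_hess.eventually (gt_mem_nhds (lt_add_one ‖hess φ₂ p‖))
  have e₄ : ∀ᶠ x in 𝓝 p, |levelSetMeanCurvature φ₂ x| < |levelSetMeanCurvature φ₂ p| + 1 :=
    (continuousAt_levelSetMeanCurvature hC₂ (by rw [hg₂]; exact hN0)).abs.eventually
      (gt_mem_nhds (lt_add_one |levelSetMeanCurvature φ₂ p|))
  obtain ⟨ρ, hρ, hball⟩ := Metric.eventually_nhds_iff_ball.1
    ((h₁.eventually (by norm_num)).and ((h₂.eventually (by norm_num)).and
      (e₁.and (e₂.and (e₃.and e₄)))))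
  refine ⟨ρ, hρ, fun S hS hκ => ?_⟩
  set K := ‖hess φ₂ p‖ + 1 with hK
  set K' := |levelSetMeanCurvature φ₂ p| + 1 with hK'
  have hK0 : 0 < K := by positivity
  have hK'0 : 0 < K' := by positivity
  -- The curvature form degenerates in the direction of the gradient, which is close to `N`. The
  -- term `2 B (N, N)` restores ellipticity on the full space and costs nothing, since the Hessian
  -- of `G₁ - G₂` vanishes on `(N, N)`.
  refine ⟨fun x => mcOperator N (gradient φ₁ x), 7 / 16, 4 * (n + 1) + 2,
    8 * n * L + 12 * n * K' + 4 * (n + 1) * K + 4 * K, by norm_num, by positivity, fun x hx => ?_⟩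
  obtain ⟨b1, b2, b3, b4, b5, b6⟩ := hball x (hS hx)
  have c1 : ContDiffAt ℝ 2 φ₁ x := b1.graphFn
  have c2 : ContDiffAt ℝ 2 φ₂ x := b2.graphFn
  have hκx := hκ x hx
  have hsum := mcForm_of_levelSetMeanCurvature hn c1
  have hsum2 := mcForm_of_levelSetMeanCurvature hn c2
  set p₁ := gradient φ₁ x with hp₁
  set p₂ := gradient φ₂ x with hp₂
  set κ₁ := levelSetMeanCurvature φ₁ x
  set κ₂ := levelSetMeanCurvature φ₂ x
  have n1 : 3 / 4 ≤ ‖p₁‖ ∧ ‖p₁‖ ≤ 2 := by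
    have t1 := norm_sub_norm_le N p₁
    have t2 := norm_sub_norm_le p₁ N
    rw [norm_sub_rev, hN] at t1; rw [hN] at t2
    constructor <;> linarith
  have n2 : 3 / 4 ≤ ‖p₂‖ ∧ ‖p₂‖ ≤ 2 := by
    have t1 := norm_sub_norm_le N p₂
    have t2 := norm_sub_norm_le p₂ N
    rw [norm_sub_rev, hN] at t1; rw [hN] at t2
    constructor <;> linarith
  have np1 : p₁ ≠ 0 := fun h => by rw [h, norm_zero] at n1; linarith
  have np2 : p₂ ≠ 0 := fun h => by rw [h, norm_zero] at n2; linarith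
  have hw : (fun y => G₁ y - G₂ y) = fun y => φ₂ y - φ₁ y := by
    funext y; simp only [hφ₁, hφ₂, graphFn]; ring
  have hwh : hess (fun y => G₁ y - G₂ y) x = hess φ₂ x - hess φ₁ x := by rw [hw, hess_sub c2 c1]
  have hwNN : hess (fun y => G₁ y - G₂ y) x N N = 0 := by
    rw [hess_sub b1 b2, sub_apply, sub_apply, hess_apply_self_of_invariantAlong hi₁ b1,
      hess_apply_self_of_invariantAlong hi₂ b2, sub_zero]
  have hwd : ‖fderiv ℝ (fun y => G₁ y - G₂ y) x‖ = ‖p₁ - p₂‖ := by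
    rw [← norm_gradient, norm_sub_rev]
    congr 1
    refine ext_inner_right ℝ fun ξ => ?_
    rw [inner_gradient, inner_sub_left, hp₁, hp₂, inner_gradient, inner_gradient, hw,
      fderiv_fun_sub (c2.differentiableAt (by norm_num)) (c1.differentiableAt (by norm_num)), sub_apply]
  refine ⟨fun B hB => ?_, fun u => ?_, ?_, ?_⟩
  · rw [mcOperator_apply]
    have := mcForm_nonneg p₁ hB
    have := hB N
    linarith
  -- From `⟪u, p₁⟫² ≤ 2 ⟪u, N⟫² + 2 (‖u‖ / 4)²` and `‖p₁‖ ≥ 3 / 4` there remains `9 / 16 - 2 / 16`.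
  · rw [mcOperator_apply, mcForm, trForm_sqForm, sqForm_apply, sqForm_apply]
    have t1 : ⟪u, p₁⟫ = ⟪u, N⟫ + ⟪u, p₁ - N⟫ := by rw [inner_sub_right]; ring
    have t2 : |⟪u, p₁ - N⟫| ≤ ‖u‖ * (1 / 4) :=
      (abs_real_inner_le_norm _ _).trans (by gcongr)
    have t3 : ⟪u, p₁ - N⟫ ^ 2 ≤ (‖u‖ * (1 / 4)) ^ 2 := by
      rw [← sq_abs ⟪u, p₁ - N⟫]; gcongr
    have t4 : (3 / 4) ^ 2 * ‖u‖ ^ 2 ≤ ‖p₁‖ ^ 2 * ‖u‖ ^ 2 := by gcongr; exact n1.1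
    rw [t1]
    nlinarith [sq_nonneg (⟪u, N⟫ - ⟪u, p₁ - N⟫)]
  · rw [mcOperator_apply, mcForm, trForm_innerForm, innerForm_apply, innerForm_apply,
      real_inner_self_eq_norm_sq, real_inner_self_eq_norm_sq, hN]
    have t4 : ‖p₁‖ ^ 2 ≤ 4 := by nlinarith [norm_nonneg p₁]
    have : ‖p₁‖ ^ 2 * (n + 1) ≤ 4 * (n + 1) := by gcongr
    nlinarith [sq_nonneg ‖p₁‖]
  -- Inserting `mcForm p₂ (hess φ₂ x)` splits the left side into a change of coefficients,
  -- controlled by `‖p₁ - p₂‖`, and a difference of the two curvature equations, controlled by `‖p₁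
  -- - p₂‖` and `L * |G₁ x - G₂ x|`.
  · rw [mcOperator_apply, hwNN, mul_zero, add_zero, hwd, hwh, mcForm_sub, hsum np1]
    have t1 := mcForm_sub_le n1.2 n2.2 b5.le (p := p₁) (q := p₂)
    have t2 := cube_mul_sub_le (norm_nonneg p₁) n1.2 (norm_nonneg p₂) n2.2
      (abs_norm_sub_norm_le p₁ p₂) hκx b6.le
    have t3 := mul_le_mul_of_nonneg_left t2 (Nat.cast_nonneg (α := ℝ) n)
    rw [hsum2 np2] at t1
    have q5 : 0 ≤ 8 * n * L * ‖p₁ - p₂‖ := by positivity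
    have q6 : 0 ≤ (12 * n * K' + 4 * (n + 1) * K + 4 * K) * |G₁ x - G₂ x| := by positivity
    linarith

end Comparison

/-! ### The two sides of a graph and Lagrange multipliers -/

section Local

variable {E : Type*} [NormedAddCommGroup E] [InnerProductSpace ℝ E]

theorem tendsto_add_smul (x ξ : E) : Tendsto (fun t : ℝ => x + t • ξ) (𝓝 0) (𝓝 x) := by
  have : Continuous (fun t : ℝ => x + t • ξ) := by fun_prop
  simpa using this.tendsto 0

theorem tendsto_graphPt {N p : E} {G : E → ℝ} (hG : ContinuousAt G p) (hp : G p = ⟪N, p⟫) :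
    Tendsto (graphPt N G) (𝓝 p) (𝓝 p) := by
  have h : ContinuousAt (graphPt N G) p := by
    unfold graphPt
    exact continuousAt_id.add (ContinuousAt.smul (hG.sub
      (continuousAt_const.inner continuousAt_id)) continuousAt_const)
  have h2 := h.tendsto
  rwa [show graphPt N G p = p by simp [graphPt, hp]] at h2

/-- Points near `p` that lie above the graph of `G` form arbitrarily small preconnected sets. -/
theorem exists_nhds_isPreconnected_above {N p : E} (hN : ‖N‖ = 1) {G : E → ℝ}
    (hi : InvariantAlong N G) (hG : ∀ᶠ x in 𝓝 p, ContinuousAt G x) (hp : G p = ⟪N, p⟫)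
    {U : Set E} (hU : U ∈ 𝓝 p) :
    ∃ W ∈ 𝓝 p, IsOpen W ∧ W ⊆ U ∧ IsPreconnected {x ∈ W | G x < ⟪N, x⟫} := by
  have hNN : ⟪N, N⟫ = 1 := by rw [real_inner_self_eq_norm_sq, hN]; norm_num
  obtain ⟨ρ, hρ, hball⟩ := Metric.mem_nhds_iff.1 hU
  set c := ⟪N, p⟫ with hc
  set ε := ρ / 2 with hε
  have hε0 : 0 < ε := by positivity
  have h1 : ∀ᶠ x in 𝓝 p, c - ε < G x ∧ G x < c + ε := by
    have h := hG.self_of_nhds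
    filter_upwards [h.eventually (lt_mem_nhds (show c - ε < G p by rw [hp]; linarith)),
      h.eventually (gt_mem_nhds (show G p < c + ε by rw [hp]; linarith))] with x hx1 hx2
    exact ⟨hx1, hx2⟩
  obtain ⟨r₀, hr₀, hr₀'⟩ := Metric.eventually_nhds_iff_ball.1 (hG.and h1)
  set r := min r₀ (ρ / 2) with hr
  have hr0 : 0 < r := lt_min hr₀ (by positivity)
  set q : E → E := fun x => x - ⟪N, x - p⟫ • N with hq
  have hqc : Continuous q := by fun_prop
  have hqp : q p = p := by simp [hq]
  have hGq : ∀ x, G (q x) = G x := fun x => by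
    have := hi x (-⟪N, x - p⟫)
    rwa [neg_smul, ← sub_eq_add_neg] at this
  have hNq : ∀ x, ⟪N, q x⟫ = c := fun x => by
    simp only [hq, inner_sub_right, inner_smul_right, hNN]; ring
  have hqq : ∀ x (t : ℝ), q (x + t • N) = q x := fun x t => by
    simp only [hq, inner_sub_right, inner_add_right, inner_smul_right, hNN]; module
  have hqq' : ∀ x, q (q x) = q x := fun x => by
    have := hqq x (-⟪N, x - p⟫)
    rwa [neg_smul, ← sub_eq_add_neg] at this
  have hqle : ∀ x, ‖q x - p‖ ≤ ‖x - p‖ := fun x => by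
    rw [← sq_le_sq₀ (norm_nonneg _) (norm_nonneg _), ← real_inner_self_eq_norm_sq,
      ← real_inner_self_eq_norm_sq]
    have : q x - p = (x - p) - ⟪N, x - p⟫ • N := by simp only [hq]; abel
    rw [this]
    simp only [inner_sub_left (x - p), inner_sub_right, inner_smul_left, inner_smul_right, hNN,
      real_inner_comm N]
    simp
    nlinarith [sq_nonneg (⟪N, x⟫ - ⟪N, p⟫)]
  have hopen : IsOpen {x | ‖q x - p‖ < r ∧ |⟪N, x⟫ - c| < ε} := by
    apply IsOpen.inter
    · exact isOpen_lt (hqc.sub continuous_const).norm continuous_const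
    · have h2 : Continuous fun x : E => |⟪N, x⟫ - c| := by fun_prop
      exact isOpen_lt h2 continuous_const
  refine ⟨{x | ‖q x - p‖ < r ∧ |⟪N, x⟫ - c| < ε}, hopen.mem_nhds ?_, hopen, ?_, ?_⟩
  · simp [hqp, hr0, hε0, hc]
  · rintro x ⟨hx1, hx2⟩
    apply hball
    rw [mem_ball, dist_eq_norm]
    have : x - p = (q x - p) + (⟪N, x⟫ - c) • N := by
      simp only [hq, hc, inner_sub_right]; module
    rw [this]
    refine (norm_add_le _ _).trans_lt ?_
    rw [norm_smul, hN, mul_one, Real.norm_eq_abs]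
    have := min_le_right r₀ (ρ / 2)
    linarith
  -- Over each `y` in the ball, `F` runs through the heights from `G y` up to the top `c + ε` of the
  -- cylinder, so the region above the graph is a continuous image of a ball times an interval.
  · set F : E × ℝ → E := fun z =>
      q z.1 + ((1 - z.2) * G z.1 + z.2 * (c + ε) - c) • N with hF
    have hFc : ContinuousOn F (ball p r ×ˢ Ioo (0 : ℝ) 1) := by
      have hGc : ContinuousOn (fun z : E × ℝ => G z.1) (ball p r ×ˢ Ioo (0 : ℝ) 1) := by
        intro z hz
        have : ContinuousAt G z.1 := (hr₀' z.1 (ball_subset_ball (min_le_left _ _) hz.1)).1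
        exact (this.comp continuousAt_fst).continuousWithinAt
      have hq1 : Continuous fun z : E × ℝ => q z.1 := hqc.comp continuous_fst
      have h2 : Continuous fun z : E × ℝ => z.2 := continuous_snd
      exact hq1.continuousOn.add ((((continuousOn_const.sub h2.continuousOn).mul hGc).add
        (h2.continuousOn.mul continuousOn_const)).sub continuousOn_const |>.smul continuousOn_const)
    have himg : {x ∈ {x | ‖q x - p‖ < r ∧ |⟪N, x⟫ - c| < ε} | G x < ⟪N, x⟫} =
        F '' (ball p r ×ˢ Ioo (0 : ℝ) 1) := by
      ext x
      constructor
      · rintro ⟨⟨hx1, hx2⟩, hx3⟩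
        have hx4 : q x ∈ ball p r := by rwa [mem_ball, dist_eq_norm]
        have hx5 := (hr₀' (q x) (ball_subset_ball (min_le_left _ _) hx4)).2
        rw [hGq] at hx5
        have hx6 := abs_lt.1 hx2
        have hden : 0 < c + ε - G x := by linarith
        refine ⟨(q x, (⟪N, x⟫ - G x) / (c + ε - G x)), ⟨hx4, div_pos (by linarith) hden, ?_⟩, ?_⟩
        · rw [div_lt_one hden]; linarith
        · simp only [hF, hqq', hGq]
          have : (1 - (⟪N, x⟫ - G x) / (c + ε - G x)) * G x +
              (⟪N, x⟫ - G x) / (c + ε - G x) * (c + ε) - c = ⟪N, x - p⟫ := by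
            rw [inner_sub_right, ← hc]; field_simp; ring
          rw [this]; simp [hq]
      · rintro ⟨⟨y, θ⟩, ⟨hy, hθ0, hθ1⟩, rfl⟩
        have hy' := (hr₀' y (ball_subset_ball (min_le_left _ _) hy)).2
        have hNF : ⟪N, F (y, θ)⟫ = (1 - θ) * G y + θ * (c + ε) := by
          simp only [hF, inner_add_right, inner_smul_right, hNq, hNN]; ring
        have hqF : q (F (y, θ)) = q y := by simp only [hF, hqq, hqq']
        have hGF : G (F (y, θ)) = G y := by rw [← hGq, hqF, hGq]
        simp only at hθ0 hθ1 hy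
        refine ⟨⟨?_, ?_⟩, ?_⟩
        · rw [hqF]; exact (hqle y).trans_lt (by rwa [mem_ball, dist_eq_norm] at hy)
        · rw [hNF, abs_lt]; constructor <;> nlinarith
        · rw [hGF, hNF]; nlinarith
    rw [himg]
    exact (((convex_ball p r).isPreconnected).prod isPreconnected_Ioo).image F hFc

/-- Away from the frontier, the space is the disjoint union of two open sets: the interior of `Ω`
and that of its complement. -/
theorem subset_or_disjoint_of_frontier {X : Type*} [TopologicalSpace X] {A Ω : Set X}
    (hA : IsPreconnected A) (h : A ∩ frontier Ω = ∅) : A ⊆ Ω ∨ A ⊆ Ωᶜ := by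
  have hcov : A ⊆ interior Ω ∪ interior Ωᶜ := by
    intro x hx
    by_contra! hcon
    have h1 : x ∈ frontier Ω := by
      simp only [mem_union, not_or, interior_compl, mem_compl_iff, not_not] at hcon
      exact ⟨hcon.2, hcon.1⟩
    exact (h ▸ (⟨hx, h1⟩ : x ∈ A ∩ frontier Ω) : x ∈ (∅ : Set X)).elim
  rcases hA.subset_or_subset isOpen_interior isOpen_interior
    ((disjoint_compl_right (a := Ω)).mono interior_subset interior_subset) hcov with h1 | h1
  · exact Or.inl (h1.trans interior_subset)
  · exact Or.inr (h1.trans interior_subset)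

theorem eventually_mem_or_notMem_of_above {N p : E} (hN : ‖N‖ = 1) {G : E → ℝ}
    (hi : InvariantAlong N G) (hG : ∀ᶠ x in 𝓝 p, ContinuousAt G x) (hp : G p = ⟪N, p⟫)
    {Ω : Set E} (h : ∀ᶠ x in 𝓝 p, G x < ⟪N, x⟫ → x ∉ frontier Ω) :
    (∀ᶠ x in 𝓝 p, G x < ⟪N, x⟫ → x ∈ Ω) ∨ (∀ᶠ x in 𝓝 p, G x < ⟪N, x⟫ → x ∉ Ω) := by
  obtain ⟨W, hW, -, hWU, hWc⟩ := exists_nhds_isPreconnected_above hN hi hG hp h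
  rcases subset_or_disjoint_of_frontier hWc (Ω := Ω)
    (eq_empty_of_forall_notMem fun x hx => hWU hx.1.1 hx.1.2 hx.2) with h1 | h1
  · exact Or.inl (mem_of_superset hW fun x hx hx' => h1 ⟨hx, hx'⟩)
  · exact Or.inr (mem_of_superset hW fun x hx hx' => h1 ⟨hx, hx'⟩)

/-- The point `p` is a constrained minimum of `φ`. The multiplier of `φ'` cannot vanish because `χ'`
is nonzero. This is the source of all tangency statements. -/
theorem exists_smul_eq_of_nonneg_on_zeroSet [CompleteSpace E] {φ χ : E → ℝ} {p : E}
    {φ' χ' : E →L[ℝ] ℝ} (hφ : HasStrictFDerivAt φ φ' p) (hχ : HasStrictFDerivAt χ χ' p)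
    (hχ0 : χ p = 0) (hφ0 : φ p = 0) (h : ∀ᶠ x in 𝓝 p, χ x = 0 → 0 ≤ φ x) (hχ' : χ' ≠ 0) :
    ∃ c : ℝ, φ' = c • χ' := by
  have hext : IsLocalExtrOn φ {x | χ x = χ p} p := by
    left
    filter_upwards [nhdsWithin_le_nhds h, self_mem_nhdsWithin] with x hx hx'
    rw [hφ0]; exact hx (hx'.trans hχ0)
  obtain ⟨a, b, hab, h0⟩ := hext.exists_multipliers_of_hasStrictFDerivAt_1d hχ hφ
  have hb : b ≠ 0 := by
    rintro rfl
    rw [zero_smul, add_zero] at h0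
    rcases smul_eq_zero.1 h0 with h1 | h1
    · exact hab (by rw [h1]; rfl)
    · exact hχ' h1
  refine ⟨-(b⁻¹ * a), ?_⟩
  have h1 : b • φ' = -(a • χ') := by rw [eq_neg_iff_add_eq_zero, add_comm]; exact h0
  have h2 : φ' = b⁻¹ • (b • φ') := by rw [smul_smul, inv_mul_cancel₀ hb, one_smul]
  rw [h2, h1]; module

theorem exists_add_smul_eq_of_nonneg_on_zeroSet [CompleteSpace E] {φ χ ψ : E → ℝ} {p : E}
    {φ' χ' ψ' : E →L[ℝ] ℝ} (hφ : HasStrictFDerivAt φ φ' p) (hχ : HasStrictFDerivAt χ χ' p)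
    (hψ : HasStrictFDerivAt ψ ψ' p) (hχ0 : χ p = 0) (hψ0 : ψ p = 0)
    (hφ0 : φ p = 0) (h : ∀ᶠ x in 𝓝 p, χ x = 0 → ψ x = 0 → 0 ≤ φ x)
    (hli : LinearIndependent ℝ ![χ', ψ']) :
    ∃ a b : ℝ, φ' = a • χ' + b • ψ' := by
  have hext : IsLocalExtrOn φ {x | ∀ i : Fin 2, ![χ, ψ] i x = ![χ, ψ] i p} p := by
    left
    filter_upwards [nhdsWithin_le_nhds h, self_mem_nhdsWithin] with x hx hx'
    rw [hφ0]
    exact hx ((hx' 0).trans hχ0) ((hx' 1).trans hψ0)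
  obtain ⟨Λ, b, hab, h0⟩ := hext.exists_multipliers_of_hasStrictFDerivAt (f' := ![χ', ψ'])
    (fun i => by fin_cases i; exacts [hχ, hψ]) hφ
  rw [Fin.sum_univ_two] at h0
  simp only [Matrix.cons_val_zero, Matrix.cons_val_one] at h0
  have hb : b ≠ 0 := by
    rintro rfl
    rw [zero_smul, add_zero] at h0
    have := LinearIndependent.pair_iff.1 hli _ _ h0
    apply hab
    rw [Prod.mk_eq_zero]
    refine ⟨funext fun i => ?_, rfl⟩
    fin_cases i
    exacts [this.1, this.2]
  refine ⟨-(b⁻¹ * Λ 0), -(b⁻¹ * Λ 1), ?_⟩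
  have h1 : b • φ' = -(Λ 0 • χ' + Λ 1 • ψ') := by rw [eq_neg_iff_add_eq_zero, add_comm]; exact h0
  have h2 : φ' = b⁻¹ • (b • φ') := by rw [smul_smul, inv_mul_cancel₀ hb, one_smul]
  rw [h2, h1]; module

end Local

/-! ### The curvature equation for a graph with `Ω` on one side -/

section LocalMeanCurvature

variable {n : ℕ}

theorem gradient_graphFn_ne_zero {N : Amb n} (hN : ‖N‖ = 1) {G : Amb n → ℝ} {x : Amb n}
    (hi : InvariantAlong N G) (hG : DifferentiableAt ℝ G x) : gradient (graphFn N G) x ≠ 0 := by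
  rw [gradient_ne_zero_iff, fderiv_graphFn hG]
  intro h
  have h1 := hasDerivAt_comp_line (x := x) (ξ := N) (t := 0) (w := G) (by simpa using hG)
  have h2 : (fun t : ℝ => G (x + t • N)) = fun _ => G x := funext fun t => hi x t
  rw [h2] at h1
  have h3 : fderiv ℝ G x N = 0 := by simpa using h1.unique (hasDerivAt_const 0 (G x))
  have h4 := congrArg (fun l : Amb n →L[ℝ] ℝ => l N) h
  simp [h3, hN] at h4

variable {Ω M Γ : Set (Amb n)} {Hf : Amb n → ℝ}

/-- `graphFn N G` is itself an admissible defining function of `M`, positive only on the side that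
lies in `Ω`. -/
theorem HasInwardMeanCurvature.eq_of_above (hM : HasInwardMeanCurvature Ω M Γ Hf) {N p : Amb n}
    (hN : ‖N‖ = 1) {G : Amb n → ℝ} (hi : InvariantAlong N G) (hG : ContDiffAt ℝ 2 G p)
    (hp : G p = ⟪N, p⟫) (hMG : ∀ᶠ x in 𝓝 p, x ∈ M ↔ ⟪N, x⟫ = G x) (hΓ : p ∉ Γ)
    (hup : ∀ᶠ x in 𝓝 p, G x < ⟪N, x⟫ → x ∈ Ω) :
    levelSetMeanCurvature (graphFn N G) p = Hf p := by
  have hpM : p ∈ M := hMG.self_of_nhds.2 hp.symm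
  obtain ⟨V, hV, hVo, hpV⟩ := _root_.eventually_nhds_iff.1
    ((hG.eventually (by norm_num)).and (hMG.and hup))
  refine hM p ⟨hpM, hΓ⟩ V _ hpV ⟨hVo, ?_, ?_, ?_⟩ ?_
  · exact fun x hx => (hV x hx).1.graphFn.contDiffWithinAt
  · exact fun x hx => gradient_graphFn_ne_zero hN hi ((hV x hx).1.differentiableAt (by norm_num))
  · ext x
    simp only [mem_inter_iff, mem_ofPred_eq, graphFn, sub_eq_zero]
    exact ⟨fun h => ⟨h.2, (hV x h.2).2.1.1 h.1⟩, fun h => ⟨(hV x h.1).2.1.2 h.2, h.1⟩⟩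
  · rintro x ⟨hx, hx'⟩
    exact (hV x hx).2.2 (by rw [graphFn] at hx'; linarith)

theorem HasInwardMeanCurvature.eventually_eq_of_above (hM : HasInwardMeanCurvature Ω M Γ Hf)
    {N p : Amb n} (hN : ‖N‖ = 1) {G : Amb n → ℝ} (hi : InvariantAlong N G)
    (hG : ContDiffAt ℝ 2 G p) (hp : G p = ⟪N, p⟫) (hMG : ∀ᶠ x in 𝓝 p, x ∈ M ↔ ⟪N, x⟫ = G x)
    (hΓ : ∀ᶠ x in 𝓝 p, x ∈ M → x ∉ Γ) (hup : ∀ᶠ x in 𝓝 p, G x < ⟪N, x⟫ → x ∈ Ω) :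
    ∀ᶠ x in 𝓝 p, levelSetMeanCurvature (graphFn N G) x = Hf (graphPt N G x) := by
  have h := (tendsto_graphPt hG.continuousAt hp).eventually
    ((hG.eventually (by norm_num)).eventually_nhds.and
      (hMG.eventually_nhds.and (hΓ.and hup.eventually_nhds)))
  filter_upwards [h] with x ⟨h1, h2, h3, h4⟩
  rw [← levelSetMeanCurvature_graphPt hN hi]
  have h5 : G (graphPt N G x) = ⟪N, graphPt N G x⟫ := by rw [hi.graphPt, inner_graphPt hN]
  exact hM.eq_of_above hN hi h1.self_of_nhds h5 h2 (h3 (h2.self_of_nhds.2 h5.symm)) h4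

theorem graphFn_neg (N : Amb n) (G : Amb n → ℝ) :
    graphFn (-N) (fun x => -G x) = fun x => -graphFn N G x := by
  funext x; simp only [graphFn, inner_neg_left]; ring

theorem InvariantAlong.neg {N : Amb n} {G : Amb n → ℝ} (hi : InvariantAlong N G) :
    InvariantAlong (-N) (fun x => -G x) := fun x t => by
  have := hi x (-t)
  simp only [smul_neg, ← neg_smul, this]

/-- Turning `N` and `G` around puts `Ω` above the graph and changes the sign of the curvature. -/
theorem HasInwardMeanCurvature.eq_of_below (hM : HasInwardMeanCurvature Ω M Γ Hf) {N p : Amb n}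
    (hN : ‖N‖ = 1) {G : Amb n → ℝ} (hi : InvariantAlong N G) (hG : ContDiffAt ℝ 2 G p)
    (hp : G p = ⟪N, p⟫) (hMG : ∀ᶠ x in 𝓝 p, x ∈ M ↔ ⟪N, x⟫ = G x) (hΓ : p ∉ Γ)
    (hlow : ∀ᶠ x in 𝓝 p, ⟪N, x⟫ < G x → x ∈ Ω) :
    levelSetMeanCurvature (graphFn N G) p = -Hf p := by
  have := hM.eq_of_above (N := -N) (by rwa [norm_neg]) hi.neg hG.neg
    (by rw [inner_neg_left, hp]) (hMG.mono fun x hx => by rw [inner_neg_left, neg_inj]; exact hx) hΓ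
    (hlow.mono fun x hx hx' => hx (by rw [inner_neg_left] at hx'; linarith))
  rw [graphFn_neg, levelSetMeanCurvature_neg] at this
  linarith

theorem eventually_mem_or_notMem_of_below {N p : Amb n} (hN : ‖N‖ = 1) {G : Amb n → ℝ}
    (hi : InvariantAlong N G) (hG : ∀ᶠ x in 𝓝 p, ContinuousAt G x) (hp : G p = ⟪N, p⟫)
    (h : ∀ᶠ x in 𝓝 p, ⟪N, x⟫ < G x → x ∉ frontier Ω) :
    (∀ᶠ x in 𝓝 p, ⟪N, x⟫ < G x → x ∈ Ω) ∨ (∀ᶠ x in 𝓝 p, ⟪N, x⟫ < G x → x ∉ Ω) := by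
  have key := eventually_mem_or_notMem_of_above (N := -N) (p := p) (by rwa [norm_neg]) hi.neg
    (hG.mono fun x hx => hx.neg) (by rw [inner_neg_left, hp]) (Ω := Ω)
    (h.mono fun x hx hx' => hx (by rw [inner_neg_left] at hx'; linarith))
  refine key.imp (fun h => ?_) (fun h => ?_) <;>
  exact h.mono fun x hx hx' => hx (by rw [inner_neg_left]; linarith)

end LocalMeanCurvature

/-! ### Graphs over tangent planes and the touching principle -/

section TangentGraphs

variable {n : ℕ}

/-- Near `p`, the set `M` is the graph of the `C²` function `G` over its tangent hyperplane at `p`,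
whose unit normal is `N`. -/
structure IsTangentGraph (M : Set (Amb n)) (p N : Amb n) (G : Amb n → ℝ) : Prop where
  norm_eq : ‖N‖ = 1
  inv : InvariantAlong N G
  contDiffAt : ContDiffAt ℝ 2 G p
  apply_eq : G p = ⟪N, p⟫
  fderiv_eq : fderiv ℝ G p = 0
  mem_iff : ∀ᶠ x in 𝓝 p, x ∈ M ↔ ⟪N, x⟫ = G x

variable {M Ω Γ : Set (Amb n)} {p N : Amb n} {G : Amb n → ℝ} {Hf : Amb n → ℝ}

theorem ContDiffAt.eventually_continuousAt (h : ContDiffAt ℝ 2 G p) :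
    ∀ᶠ x in 𝓝 p, ContinuousAt G x :=
  (h.eventually (by norm_num)).mono fun _ hx => hx.continuousAt

theorem IsTangentGraph.neg (h : IsTangentGraph M p N G) :
    IsTangentGraph M p (-N) (fun x => -G x) where
  norm_eq := by rw [norm_neg, h.norm_eq]
  inv := h.inv.neg
  contDiffAt := h.contDiffAt.neg
  apply_eq := by rw [inner_neg_left, h.apply_eq]
  fderiv_eq := by rw [fderiv_fun_neg, h.fderiv_eq, neg_zero]
  mem_iff := h.mem_iff.mono fun x hx => by rw [hx, inner_neg_left, neg_inj]

/-- Differentiating `φ (graphPt N G x) = 0` at `p` leaves `a • DG = 0`. A negative `a` is reduced to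
a positive one by changing the sign of `φ`. -/
theorem exists_tangent_graph {φ : Amb n → ℝ} (hφ : ContDiffAt ℝ 2 φ p) (h0 : φ p = 0)
    (hN : ‖N‖ = 1) {a : ℝ} (ha : a ≠ 0) (hd : fderiv ℝ φ p = a • innerSL ℝ N) :
    ∃ G : Amb n → ℝ, IsTangentGraph {x | φ x = 0} p N G := by
  wlog hpos : 0 < a generalizing φ a with H
  · have hneg : 0 < -a := neg_pos.2 (lt_of_le_of_ne (not_lt.1 hpos) ha)
    obtain ⟨G, hG⟩ := H (φ := fun x => -φ x) hφ.neg (by simp [h0]) hneg.ne'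
      (by rw [fderiv_fun_neg, hd, neg_smul]) hneg
    exact ⟨G, { hG with mem_iff := by simpa using hG.mem_iff }⟩
  have hNN : ⟪N, N⟫ = 1 := by rw [real_inner_self_eq_norm_sq, hN]; norm_num
  obtain ⟨G, hi, hG, hGp, hev⟩ := exists_graph hN hφ h0 (by
    rw [hd, smul_apply, innerSL_apply_apply, hNN]; simpa using hpos)
  refine ⟨G, hN, hi, hG, hGp, ?_, hev.mono fun x hx => hx.2.2⟩
  have hGd := (hG.differentiableAt (by norm_num)).hasFDerivAt
  have h1 : HasFDerivAt (graphPt N G)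
      (ContinuousLinearMap.id ℝ _ + (fderiv ℝ G p - innerSL ℝ N).smulRight N) p := by
    unfold graphPt
    exact (hasFDerivAt_id p).add ((hGd.sub (innerSL ℝ N).hasFDerivAt).smul_const N)
  have hgp : graphPt N G p = p := by simp [graphPt, hGp]
  have h2 : HasFDerivAt φ (a • innerSL ℝ N) (graphPt N G p) := by
    rw [hgp, ← hd]; exact (hφ.differentiableAt (by norm_num)).hasFDerivAt
  have h3 := h2.comp p h1
  have h4 : HasFDerivAt (φ ∘ graphPt N G) (0 : Amb n →L[ℝ] ℝ) p :=
    (hasFDerivAt_const (0 : ℝ) p).congr_of_eventuallyEq (hev.mono fun x hx => hx.1)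
  have h5 := h3.unique h4
  ext ξ
  have h6 := congrArg (fun l : Amb n →L[ℝ] ℝ => l ξ) h5
  simp only [ContinuousLinearMap.comp_apply, add_apply, smul_apply, innerSL_apply_apply,
    ContinuousLinearMap.id_apply, ContinuousLinearMap.smulRight_apply, sub_apply, inner_add_right,
    inner_smul_right, hNN, zero_apply, smul_eq_mul] at h6
  rw [zero_apply]
  have h7 : a * fderiv ℝ G p ξ = 0 := by linarith
  exact (mul_eq_zero.1 h7).resolve_left ha

theorem exists_unit_normal {φ : Amb n → ℝ} (h : gradient φ p ≠ 0) :
    ∃ (N : Amb n) (a : ℝ), ‖N‖ = 1 ∧ a ≠ 0 ∧ fderiv ℝ φ p = a • innerSL ℝ N := by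
  have h0 : ‖gradient φ p‖ ≠ 0 := norm_ne_zero_iff.2 h
  refine ⟨‖gradient φ p‖⁻¹ • gradient φ p, ‖gradient φ p‖, ?_, h0, ?_⟩
  · rw [norm_smul, norm_inv, norm_norm, inv_mul_cancel₀ h0]
  · ext ξ
    rw [smul_apply, innerSL_apply_apply, real_inner_smul_left, inner_gradient, smul_eq_mul,
      mul_inv_cancel_left₀ h0]

theorem IsC2DefiningFunction.contDiffAt {V : Set (Amb n)} {φ : Amb n → ℝ}
    (h : IsC2DefiningFunction M V φ) (hp : p ∈ V) : ContDiffAt ℝ 2 φ p :=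
  h.contDiffOn.contDiffAt (h.isOpen.mem_nhds hp)

theorem IsC2DefiningFunction.eventually_mem_iff {V : Set (Amb n)} {φ : Amb n → ℝ}
    (h : IsC2DefiningFunction M V φ) (hp : p ∈ V) : ∀ᶠ x in 𝓝 p, x ∈ M ↔ φ x = 0 := by
  filter_upwards [h.isOpen.mem_nhds hp] with x hx
  have := congrArg (x ∈ ·) h.inter_eq
  simpa [hx] using this

theorem IsTangentGraph.congr_set {M' : Set (Amb n)} (h : IsTangentGraph M' p N G)
    (hM : ∀ᶠ x in 𝓝 p, x ∈ M ↔ x ∈ M') : IsTangentGraph M p N G :=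
  { h with mem_iff := by filter_upwards [hM, h.mem_iff] with x h1 h2; rw [h1, h2] }

theorem IsC2InteriorPoint.exists_isTangentGraph (h : IsC2InteriorPoint M p) :
    ∃ N G, IsTangentGraph M p N G := by
  obtain ⟨hpM, V, φ, hpV, hφ⟩ := h
  have hev := hφ.eventually_mem_iff hpV
  obtain ⟨N, a, hN, ha, hd⟩ := exists_unit_normal (hφ.gradient_ne_zero p hpV)
  obtain ⟨G, hG⟩ := exists_tangent_graph (hφ.contDiffAt hpV) (hev.self_of_nhds.1 hpM) hN ha hd
  exact ⟨N, G, hG.congr_set hev⟩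

theorem IsTangentGraph.tendsto_graphPt (h : IsTangentGraph M p N G) :
    Tendsto (graphPt N G) (𝓝 p) (𝓝 p) :=
  _root_.tendsto_graphPt h.contDiffAt.continuousAt h.apply_eq

theorem IsTangentGraph.eventually_graphPt_mem (h : IsTangentGraph M p N G) :
    ∀ᶠ x in 𝓝 p, graphPt N G x ∈ M := by
  filter_upwards [h.tendsto_graphPt.eventually h.mem_iff] with x hx
  rw [hx, inner_graphPt h.norm_eq, h.inv.graphPt]

theorem IsTangentGraph.eventually_above (h : IsTangentGraph M p N G) :
    ∀ᶠ t in 𝓝[>] (0 : ℝ), G (p + t • N) < ⟪N, p + t • N⟫ := by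
  filter_upwards [self_mem_nhdsWithin] with t ht
  rw [h.inv, inner_add_right, inner_smul_right, real_inner_self_eq_norm_sq, h.norm_eq, h.apply_eq]
  simpa using ht

/-- Each side of the graph misses the frontier, so it lies locally in `Ω` or outside it. Both sides
cannot lie outside, since `p` is in the closure of `Ω`. Both may lie in `Ω`. -/
theorem IsTangentGraph.exists_above (hg : IsTangentGraph M p N G) (hΩ : IsOpen Ω)
    (hfr : ∀ᶠ x in 𝓝 p, x ∈ frontier Ω ↔ x ∈ M) (hp : p ∈ M) :
    (∀ᶠ x in 𝓝 p, G x < ⟪N, x⟫ → x ∈ Ω) ∨ (∀ᶠ x in 𝓝 p, ⟪N, x⟫ < G x → x ∈ Ω) := by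
  have hc := hg.contDiffAt.eventually_continuousAt
  have h1 := eventually_mem_or_notMem_of_above hg.norm_eq hg.inv hc hg.apply_eq (Ω := Ω) (by
    filter_upwards [hfr, hg.mem_iff] with x h1 h2 h3
    rw [h1, h2]; exact h3.ne')
  have h2 := eventually_mem_or_notMem_of_below hg.norm_eq hg.inv hc hg.apply_eq (Ω := Ω) (by
    filter_upwards [hfr, hg.mem_iff] with x h1 h2 h3
    rw [h1, h2]; exact h3.ne)
  rcases h1 with h1 | h1
  · exact Or.inl h1
  rcases h2 with h2 | h2
  · exact Or.inr h2
  exfalso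
  have hpf : p ∈ closure Ω := frontier_subset_closure (hfr.self_of_nhds.2 hp)
  obtain ⟨x, hx, hx1, hx2, hx3, hx4⟩ := ((mem_closure_iff_frequently.1 hpf).and_eventually
    (h1.and (h2.and (hg.mem_iff.and hfr)))).exists
  rcases lt_trichotomy (G x) ⟪N, x⟫ with h | h | h
  · exact hx1 h hx
  · have := hx4.2 (hx3.2 h.symm)
    rw [hΩ.frontier_eq] at this
    exact this.2 hx
  · exact hx2 h hx

theorem graphPt_sub_graphPt (N : Amb n) (G₁ G₂ : Amb n → ℝ) (x : Amb n) :
    graphPt N G₁ x - graphPt N G₂ x = (G₁ x - G₂ x) • N := by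
  simp only [graphPt]; module

/-- The strong maximum principle for `G₁ - G₂`, which is nonnegative and vanishes at the interior
point `p`. -/
theorem eventually_eq_of_touching (hn : n ≠ 0) {G₁ G₂ : Amb n → ℝ} (hN : ‖N‖ = 1)
    (hi₁ : InvariantAlong N G₁) (hi₂ : InvariantAlong N G₂) (h₁ : ContDiffAt ℝ 2 G₁ p)
    (h₂ : ContDiffAt ℝ 2 G₂ p) (hd₁ : fderiv ℝ G₁ p = 0) (hd₂ : fderiv ℝ G₂ p = 0)
    (hp : G₁ p = G₂ p) {L : ℝ} (hL : 0 ≤ L)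
    (h : ∀ᶠ x in 𝓝 p, G₂ x ≤ G₁ x ∧
      |levelSetMeanCurvature (graphFn N G₁) x - levelSetMeanCurvature (graphFn N G₂) x| ≤
        L * |G₁ x - G₂ x|) : ∀ᶠ x in 𝓝 p, G₁ x = G₂ x := by
  obtain ⟨ρ, hρ, hell⟩ := exists_ellIneq_sub hn hN hi₁ hi₂ h₁ h₂ hd₁ hd₂ L hL
  obtain ⟨r, hr, hball⟩ := Metric.eventually_nhds_iff_ball.1
    (h.and ((h₁.eventually (by norm_num)).and (h₂.eventually (by norm_num))))
  have hr' : 0 < min r ρ := lt_min hr hρ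
  have key := eq_zero_of_nonneg_of_ellIneq_half (w := fun x => G₁ x - G₂ x) (p := p)
    (r := min r ρ) (fun x hx => ?_)
    (hell _ (ball_subset_ball (min_le_right _ _)) fun x hx => ?_) (fun x hx => ?_) (by simp [hp])
  · filter_upwards [ball_mem_nhds p (half_pos hr')] with x hx
    have := key x hx
    linarith
  · have := hball x (ball_subset_ball (min_le_left _ _) hx)
    exact this.2.1.sub this.2.2
  · exact (hball x (ball_subset_ball (min_le_left _ _) hx)).1.2
  · have := (hball x (ball_subset_ball (min_le_left _ _) hx)).1.1
    linarith

/-- The version for a point `p` on the border of the set `S` where the graphs are ordered. Both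
graphs are horizontal at `p`, so the Hopf lemma on a ball of `S` that touches `p` forces equality
there. -/
theorem exists_ball_eq_of_touching (hn : n ≠ 0) {G₁ G₂ : Amb n → ℝ} (hN : ‖N‖ = 1)
    (hi₁ : InvariantAlong N G₁) (hi₂ : InvariantAlong N G₂) (h₁ : ContDiffAt ℝ 2 G₁ p)
    (h₂ : ContDiffAt ℝ 2 G₂ p) (hd₁ : fderiv ℝ G₁ p = 0) (hd₂ : fderiv ℝ G₂ p = 0)
    (hp : G₁ p = G₂ p) {L : ℝ} (hL : 0 ≤ L) {S : Set (Amb n)}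
    (h : ∀ᶠ x in 𝓝 p, x ∈ S → G₂ x ≤ G₁ x ∧
      |levelSetMeanCurvature (graphFn N G₁) x - levelSetMeanCurvature (graphFn N G₂) x| ≤
        L * |G₁ x - G₂ x|) {ν : Amb n} (hν : ‖ν‖ = 1)
    (hS : ∀ᶠ r in 𝓝[>] (0 : ℝ), ball (p + r • ν) r ⊆ S) :
    ∀ᶠ r in 𝓝[>] (0 : ℝ), ∀ x ∈ ball (p + r • ν) r, G₁ x = G₂ x := by
  obtain ⟨ρ, hρ, hell⟩ := exists_ellIneq_sub hn hN hi₁ hi₂ h₁ h₂ hd₁ hd₂ L hL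
  obtain ⟨r₀, hr₀, hball⟩ := Metric.eventually_nhds_iff_ball.1
    (h.and ((h₁.eventually (by norm_num)).and (h₂.eventually (by norm_num))))
  have hr' : 0 < min r₀ ρ / 3 := div_pos (lt_min hr₀ hρ) (by norm_num)
  filter_upwards [hS, Ioo_mem_nhdsGT hr'] with r hrS hr x hx
  have hsub : closedBall (p + r • ν) r ⊆ ball p (min r₀ ρ) := by
    intro y hy
    rw [mem_closedBall] at hy
    have h1 : dist (p + r • ν) p = r := by
      rw [dist_eq_norm, add_sub_cancel_left, norm_smul, hν, mul_one, Real.norm_eq_abs,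
        abs_of_pos hr.1]
    have := dist_triangle y (p + r • ν) p
    rw [mem_ball]
    linarith [hr.2]
  have hsub₀ : closedBall (p + r • ν) r ⊆ ball p r₀ :=
    hsub.trans (ball_subset_ball (min_le_left _ _))
  have key := eq_zero_on_ball_of_ellIneq (w := fun x => G₁ x - G₂ x) (c := p + r • ν) (x₀ := p)
    hr.1 (fun y hy => ?_) (hell _ ?_ fun y hy => ?_) (fun y hy => ?_) ?_ (by simp [hp]) ?_ x hx
  · linarith
  · have := hball y (hsub₀ hy)
    exact this.2.1.sub this.2.2
  · exact (ball_subset_closedBall.trans hsub).trans (ball_subset_ball (min_le_right _ _))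
  · exact ((hball y (hsub₀ (ball_subset_closedBall hy))).1 (hrS hy)).2
  · have := ((hball y (hsub₀ (ball_subset_closedBall hy))).1 (hrS hy)).1
    linarith
  · rw [mem_sphere, dist_eq_norm, sub_add_cancel_left, norm_neg, norm_smul, hν, mul_one,
      Real.norm_eq_abs, abs_of_pos hr.1]
  · rw [fderiv_fun_sub (h₁.differentiableAt (by norm_num)) (h₂.differentiableAt (by norm_num)),
      hd₁, hd₂, sub_zero]

theorem isTangentGraph_hasStrictFDerivAt_graphFn (hg : IsTangentGraph M p N G) :
    HasStrictFDerivAt (graphFn N G) (innerSL ℝ N) p := by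
  have h := hg.contDiffAt.hasStrictFDerivAt (by norm_num)
  rw [hg.fderiv_eq] at h
  have := (innerSL ℝ N).hasStrictFDerivAt (x := p).sub h
  rwa [sub_zero] at this

/-- If the region above the graph of `G₁` avoids `M₂`, then the two hypersurfaces are tangent, and
`M₂` is a graph in the same direction, below that of `G₁`. -/
theorem IsTangentGraph.exists_of_disjoint {M₁ M₂ : Set (Amb n)} {G₁ : Amb n → ℝ}
    (h₁ : IsTangentGraph M₁ p N G₁) (h₂ : IsC2InteriorPoint M₂ p)
    (hdis : ∀ᶠ x in 𝓝 p, G₁ x < ⟪N, x⟫ → x ∉ M₂) :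
    ∃ G₂, IsTangentGraph M₂ p N G₂ ∧ ∀ᶠ x in 𝓝 p, G₂ x ≤ G₁ x := by
  obtain ⟨N₂, G₂, hg₂⟩ := h₂.exists_isTangentGraph
  -- choose the orientation of the second graph
  obtain ⟨N₂, G₂, hg₂, W, hW, hpos⟩ : ∃ N₂ G₂, IsTangentGraph M₂ p N₂ G₂ ∧ ∃ W ∈ 𝓝 p,
      ∀ x ∈ W, G₁ x < ⟪N, x⟫ → 0 < graphFn N₂ G₂ x := by
    obtain ⟨W, hW, -, hWU, hWc⟩ := exists_nhds_isPreconnected_above h₁.norm_eq h₁.inv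
      h₁.contDiffAt.eventually_continuousAt h₁.apply_eq
      (hdis.and (hg₂.mem_iff.and hg₂.contDiffAt.eventually_continuousAt))
    have hcont : ContinuousOn (graphFn N₂ G₂) {x ∈ W | G₁ x < ⟪N, x⟫} := fun x hx =>
      ((continuousAt_const.inner continuousAt_id).sub (hWU hx.1).2.2).continuousWithinAt
    have hne : ∀ x ∈ {x ∈ W | G₁ x < ⟪N, x⟫}, graphFn N₂ G₂ x ≠ 0 := by
      intro x hx h0
      exact (hWU hx.1).1 hx.2 ((hWU hx.1).2.1.2 (sub_eq_zero.1 h0))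
    by_cases hs : ∃ x ∈ {x ∈ W | G₁ x < ⟪N, x⟫}, 0 < graphFn N₂ G₂ x
    · obtain ⟨x, hx, hx0⟩ := hs
      refine ⟨N₂, G₂, hg₂, W, hW, fun y hy hy' => ?_⟩
      by_contra! hy0
      obtain ⟨z, hz, hz0⟩ := hWc.intermediate_value₂ ⟨hy, hy'⟩ hx hcont continuousOn_const hy0 hx0.le
      exact hne z hz hz0
    · push Not at hs
      refine ⟨-N₂, _, hg₂.neg, W, hW, fun y hy hy' => ?_⟩
      have h1 := hs y ⟨hy, hy'⟩
      have h2 := hne y ⟨hy, hy'⟩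
      rw [graphFn_neg]
      exact neg_pos.2 (lt_of_le_of_ne h1 h2)
  have hNN : ⟪N, N⟫ = 1 := by rw [real_inner_self_eq_norm_sq, h₁.norm_eq]; norm_num
  have hN0 : (innerSL ℝ N : Amb n →L[ℝ] ℝ) ≠ 0 := fun h => by
    have := congrArg (fun l : Amb n →L[ℝ] ℝ => l N) h
    simp [h₁.norm_eq] at this
  -- the two hypersurfaces are tangent
  have hc₂ := hg₂.contDiffAt.eventually_continuousAt
  have hnn : ∀ᶠ x in 𝓝 p, graphFn N G₁ x = 0 → 0 ≤ graphFn N₂ G₂ x := by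
    filter_upwards [eventually_mem_nhds_iff.2 hW, hc₂] with x hxW hxc hx0
    have h1 : Tendsto (fun t : ℝ => graphFn N₂ G₂ (x + t • N)) (𝓝[>] 0) (𝓝 (graphFn N₂ G₂ x)) := by
      have : ContinuousAt (graphFn N₂ G₂) x :=
        (continuousAt_const.inner continuousAt_id).sub hxc
      exact this.tendsto.comp ((tendsto_add_smul x N).mono_left nhdsWithin_le_nhds)
    refine ge_of_tendsto h1 ?_
    filter_upwards [self_mem_nhdsWithin,
      ((tendsto_add_smul x N).mono_left nhdsWithin_le_nhds).eventually hxW] with t ht htW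
    refine (hpos _ htW ?_).le
    rw [h₁.inv, inner_add_right, inner_smul_right, hNN]
    have : ⟪N, x⟫ = G₁ x := sub_eq_zero.1 hx0
    have : 0 < t := ht
    linarith
  -- The second defining function is nonnegative on the first graph, as a limit from above, and
  -- vanishes at `p`; so the normals are parallel. Moving from `p` upwards fixes the sign.
  obtain ⟨c, hc⟩ := exists_smul_eq_of_nonneg_on_zeroSet
    (isTangentGraph_hasStrictFDerivAt_graphFn hg₂) (isTangentGraph_hasStrictFDerivAt_graphFn h₁)
    (by rw [graphFn, h₁.apply_eq, sub_self]) (by rw [graphFn, hg₂.apply_eq, sub_self]) hnn hN0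
  have hcN : N₂ = c • N := by
    refine ext_inner_right ℝ fun ξ => ?_
    have := congrArg (fun l : Amb n →L[ℝ] ℝ => l ξ) hc
    simpa [inner_smul_left] using this
  have hc1 : |c| = 1 := by
    have := hg₂.norm_eq
    rwa [hcN, norm_smul, h₁.norm_eq, mul_one, Real.norm_eq_abs] at this
  have hcpos : 0 ≤ c := by
    have h1 : HasDerivAt (fun t : ℝ => graphFn N₂ G₂ (p + t • N)) c 0 := by
      have h2 := (isTangentGraph_hasStrictFDerivAt_graphFn hg₂).hasFDerivAt
      have h3 := hasDerivAt_comp_line (x := p) (ξ := N) (t := 0) (w := graphFn N₂ G₂)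
        (by simpa using h2.differentiableAt)
      have h4 : fderiv ℝ (graphFn N₂ G₂) (p + (0 : ℝ) • N) N = c := by
        rw [zero_smul, add_zero, h2.fderiv, innerSL_apply_apply, hcN, real_inner_smul_left, hNN,
          mul_one]
      rwa [h4] at h3
    refine nonneg_of_hasDerivAt_of_eventually_nonneg h1
      (by simp [graphFn, hg₂.apply_eq]) ?_
    filter_upwards [h₁.eventually_above,
      ((tendsto_add_smul p N).mono_left nhdsWithin_le_nhds).eventually hW] with t ht htW
    exact (hpos _ htW ht).le
  have hNe : N₂ = N := by
    rw [abs_of_nonneg hcpos] at hc1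
    rw [hcN, hc1, one_smul]
  subst hNe
  refine ⟨G₂, hg₂, ?_⟩
  filter_upwards [hg₂.tendsto_graphPt.eventually hW] with x hxW
  by_contra! hlt
  have := hpos _ hxW (by rw [inner_graphPt hg₂.norm_eq, graphPt, h₁.inv]; exact hlt)
  rw [graphFn, inner_graphPt hg₂.norm_eq, hg₂.inv.graphPt, sub_self] at this
  exact lt_irrefl _ this

/-- Two hypersurfaces whose mean curvatures are the same Lipschitz function and which touch from
one side at `p` agree near `p`. -/
theorem eventually_mem_iff_of_touching (hn : n ≠ 0) {Ω₁ M₁ Γ₁ Ω₂ M₂ Γ₂ : Set (Amb n)}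
    {H₁ H₂ : Amb n → ℝ} (hM₁ : HasInwardMeanCurvature Ω₁ M₁ Γ₁ H₁)
    (hM₂ : HasInwardMeanCurvature Ω₂ M₂ Γ₂ H₂) (ho₁ : IsOpen Ω₁) (ho₂ : IsOpen Ω₂)
    (h₁ : IsC2InteriorPoint M₁ p) (h₂ : IsC2InteriorPoint M₂ p)
    (hΓ₁ : ∀ᶠ x in 𝓝 p, x ∈ M₁ → x ∉ Γ₁) (hΓ₂ : ∀ᶠ x in 𝓝 p, x ∈ M₂ → x ∉ Γ₂)
    (hf₁ : ∀ᶠ x in 𝓝 p, x ∈ frontier Ω₁ ↔ x ∈ M₁) (hf₂ : ∀ᶠ x in 𝓝 p, x ∈ frontier Ω₂ ↔ x ∈ M₂)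
    (hsub : ∀ᶠ x in 𝓝 p, x ∈ Ω₁ → x ∈ Ω₂) {L : ℝ} (hL : 0 ≤ L) {U : Set (Amb n)} (hU : U ∈ 𝓝 p)
    (hH : ∀ x ∈ U ∩ M₁, ∀ y ∈ U ∩ M₂, |H₁ x - H₂ y| ≤ L * ‖x - y‖) :
    ∀ᶠ x in 𝓝 p, x ∈ M₁ ↔ x ∈ M₂ := by
  obtain ⟨N, G₁, hg₁, hup₁⟩ : ∃ N G₁, IsTangentGraph M₁ p N G₁ ∧
      ∀ᶠ x in 𝓝 p, G₁ x < ⟪N, x⟫ → x ∈ Ω₁ := by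
    obtain ⟨N, G, hg⟩ := h₁.exists_isTangentGraph
    rcases hg.exists_above ho₁ hf₁ h₁.1 with h | h
    · exact ⟨N, G, hg, h⟩
    · exact ⟨-N, _, hg.neg, h.mono fun x hx hx' => hx (by rw [inner_neg_left] at hx'; linarith)⟩
  have hup₂ : ∀ᶠ x in 𝓝 p, G₁ x < ⟪N, x⟫ → x ∈ Ω₂ := by
    filter_upwards [hup₁, hsub] with x h1 h2 h3 using h2 (h1 h3)
  have hdisj : ∀ᶠ x in 𝓝 p, x ∈ Ω₂ → x ∉ M₂ := by
    filter_upwards [hf₂] with x hx hxΩ hxM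
    have := hx.2 hxM
    rw [ho₂.frontier_eq] at this
    exact this.2 hxΩ
  obtain ⟨G₂, hg₂, hle⟩ := hg₁.exists_of_disjoint h₂ (by
    filter_upwards [hup₂, hdisj] with x h1 h2 h3 using h2 (h1 h3))
  -- Both inner normals thus point to the same side, so the two curvature equations carry the same
  -- sign and can be subtracted.
  have hup₂' : ∀ᶠ x in 𝓝 p, G₂ x < ⟪N, x⟫ → x ∈ Ω₂ := by
    refine (eventually_mem_or_notMem_of_above hg₂.norm_eq hg₂.inv
      hg₂.contDiffAt.eventually_continuousAt hg₂.apply_eq (Ω := Ω₂) ?_).resolve_right fun h => ?_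
    · filter_upwards [hf₂, hg₂.mem_iff] with x h1 h2 h3
      rw [h1, h2]; exact h3.ne'
    · have ht := (tendsto_add_smul p N).mono_left (nhdsWithin_le_nhds (s := Ioi (0 : ℝ)))
      obtain ⟨t, h1, h2, h3, h4⟩ := (hg₁.eventually_above.and (hg₂.eventually_above.and
        ((ht.eventually hup₂).and (ht.eventually h)))).exists
      exact h4 h2 (h3 h1)
  have pde₁ := hM₁.eventually_eq_of_above hg₁.norm_eq hg₁.inv hg₁.contDiffAt hg₁.apply_eq
    hg₁.mem_iff hΓ₁ hup₁
  have pde₂ := hM₂.eventually_eq_of_above hg₂.norm_eq hg₂.inv hg₂.contDiffAt hg₂.apply_eq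
    hg₂.mem_iff hΓ₂ hup₂'
  have heq := eventually_eq_of_touching hn hg₁.norm_eq hg₁.inv hg₂.inv hg₁.contDiffAt
    hg₂.contDiffAt hg₁.fderiv_eq hg₂.fderiv_eq (hg₁.apply_eq.trans hg₂.apply_eq.symm) hL (by
      filter_upwards [hle, pde₁, pde₂, hg₁.eventually_graphPt_mem, hg₂.eventually_graphPt_mem,
        hg₁.tendsto_graphPt.eventually hU, hg₂.tendsto_graphPt.eventually hU]
        with x k1 k2 k3 k4 k5 k6 k7
      refine ⟨k1, ?_⟩
      rw [k2, k3]
      refine (hH _ ⟨k6, k4⟩ _ ⟨k7, k5⟩).trans ?_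
      rw [graphPt_sub_graphPt, norm_smul, hg₁.norm_eq, mul_one, Real.norm_eq_abs])
  filter_upwards [heq, hg₁.mem_iff, hg₂.mem_iff] with x k1 k2 k3
  rw [k2, k3, k1]

end TangentGraphs

/-! ### Transport of hypersurfaces and their curvature by reflections -/

section Reflections

variable {n : ℕ} {v : Amb n}

/-- A reflection as a homeomorphism. -/
noncomputable def reflectHomeo (hv : ‖v‖ = 1) (s : ℝ) : Amb n ≃ₜ Amb n where
  toFun := reflectIn v s
  invFun := reflectIn v s
  left_inv := reflectIn_reflectIn hv s
  right_inv := reflectIn_reflectIn hv s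
  continuous_toFun := continuous_reflectIn v s
  continuous_invFun := continuous_reflectIn v s

theorem preimage_reflectIn_reflectIn (hv : ‖v‖ = 1) (s : ℝ) (A : Set (Amb n)) :
    reflectIn v s ⁻¹' (reflectIn v s ⁻¹' A) = A := by
  ext x; simp only [mem_preimage, reflectIn_reflectIn hv]

theorem reflectIn_of_inner_eq {s : ℝ} {x : Amb n} (h : ⟪v, x⟫ = s) : reflectIn v s x = x := by
  simp [reflectIn, h]

theorem reflectIn_add_smul {N : Amb n} (hN : ⟪N, v⟫ = 0) (s : ℝ) (x : Amb n) (t : ℝ) :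
    reflectIn v s (x + t • N) = reflectIn v s x + t • N := by
  rw [reflectIn_add, map_smul, reflectLin_apply, real_inner_comm, hN]; simp

theorem IsC2DefiningFunction.preimage_reflectIn {M V : Set (Amb n)} {φ : Amb n → ℝ}
    (h : IsC2DefiningFunction M V φ) (hv : ‖v‖ = 1) (s : ℝ) :
    IsC2DefiningFunction (reflectIn v s ⁻¹' M) (reflectIn v s ⁻¹' V)
      (fun x => φ (reflectIn v s x)) where
  isOpen := h.isOpen.preimage (continuous_reflectIn v s)
  contDiffOn := h.contDiffOn.comp (contDiff_reflectIn v s).contDiffOn fun x hx => hx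
  gradient_ne_zero x hx := by
    rw [gradient_comp_reflectIn ((h.contDiffAt hx).differentiableAt (by norm_num)), ← norm_ne_zero_iff,
      norm_reflectLin hv, norm_ne_zero_iff]
    exact h.gradient_ne_zero _ hx
  inter_eq := by
    rw [← preimage_inter, h.inter_eq]; rfl

theorem IsC2InteriorPoint.preimage_reflectIn {M : Set (Amb n)} (hv : ‖v‖ = 1) {s : ℝ} {p : Amb n}
    (h : IsC2InteriorPoint M (reflectIn v s p)) : IsC2InteriorPoint (reflectIn v s ⁻¹' M) p := by
  obtain ⟨hp, V, φ, hpV, hφ⟩ := h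
  exact ⟨hp, _, _, hpV, hφ.preimage_reflectIn hv s⟩

theorem HasInwardMeanCurvature.preimage_reflectIn {Ω M Γ : Set (Amb n)} {Hf : Amb n → ℝ}
    (h : HasInwardMeanCurvature Ω M Γ Hf) (hv : ‖v‖ = 1) (s : ℝ) :
    HasInwardMeanCurvature (reflectIn v s ⁻¹' Ω) (reflectIn v s ⁻¹' M) (reflectIn v s ⁻¹' Γ)
      (fun x => Hf (reflectIn v s x)) := by
  rintro p ⟨hpM, hpΓ⟩ V φ hpV hφ hsub
  have h1 := hφ.preimage_reflectIn hv s
  rw [preimage_reflectIn_reflectIn hv] at h1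
  have hRR := reflectIn_reflectIn hv s p
  have hpV' : reflectIn v s p ∈ reflectIn v s ⁻¹' V := by rwa [mem_preimage, hRR]
  have h2 := h _ ⟨hpM, hpΓ⟩ _ _ hpV' h1 (by
    rintro x ⟨hx, hx0⟩
    have := hsub ⟨hx, hx0⟩
    rwa [mem_preimage, reflectIn_reflectIn hv] at this)
  rw [levelSetMeanCurvature_comp_reflectIn hv, hRR] at h2
  · exact h2
  · rw [hRR]; exact hφ.contDiffAt hpV
  · rw [hRR]; exact hφ.gradient_ne_zero _ hpV

end Reflections

/-! ### The moving plane configuration and contact with the mirror image -/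

section MovingPlanes

variable {n : ℕ}

/-- The open slab between the levels `c₁` and `c₂`. -/
def openSlab (e : Amb n) (c₁ c₂ : ℝ) : Set (Amb n) := {x | c₁ < ⟪e, x⟫ ∧ ⟪e, x⟫ < c₂}

theorem isOpen_openSlab (e : Amb n) (c₁ c₂ : ℝ) : IsOpen (openSlab e c₁ c₂) := by
  have h : Continuous fun x : Amb n => ⟪e, x⟫ := by fun_prop
  exact (isOpen_lt continuous_const h).inter (isOpen_lt h continuous_const)

theorem isClosed_hyperplane (e : Amb n) (c : ℝ) : IsClosed (hyperplane e c) := by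
  have h : Continuous fun x : Amb n => ⟪e, x⟫ := by fun_prop
  exact isClosed_eq h continuous_const

theorem isClosed_face (Ω : Set (Amb n)) (e : Amb n) (c : ℝ) : IsClosed (face Ω (hyperplane e c)) :=
  isClosed_closure.inter (isClosed_hyperplane e c)

theorem relBoundary_face_subset (Ω : Set (Amb n)) (e : Amb n) (c : ℝ) :
    relBoundary (hyperplane e c) (face Ω (hyperplane e c)) ⊆ face Ω (hyperplane e c) :=
  inter_subset_left.trans (isClosed_face Ω e c).closure_eq.subset

theorem hyperplane_neg (e : Amb n) (c : ℝ) : hyperplane (-e) (-c) = hyperplane e c := by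
  ext x; simp [hyperplane]

theorem faceBoundaries_neg (e : Amb n) (c₁ c₂ : ℝ) (Ω : Set (Amb n)) :
    faceBoundaries (-e) (-c₂) (-c₁) Ω = faceBoundaries e c₁ c₂ Ω := by
  rw [faceBoundaries, hyperplane_neg, hyperplane_neg, union_comm, faceBoundaries]

theorem openSlab_neg (e : Amb n) (c₁ c₂ : ℝ) :
    openSlab (-e) (-c₂) (-c₁) = openSlab e c₁ c₂ := by
  ext x; simp [openSlab, and_comm]

theorem IsSlabDomain.neg {e : Amb n} {c₁ c₂ : ℝ} {Ω M : Set (Amb n)}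
    (h : IsSlabDomain e c₁ c₂ Ω M) : IsSlabDomain (-e) (-c₂) (-c₁) Ω M where
  isOpen := h.isOpen
  isConnected := h.isConnected
  isBounded := h.isBounded
  subset_slab x hx := by
    have := h.subset_slab hx
    simp only [mem_ofPred_eq, inner_neg_left, neg_le_neg_iff] at this ⊢
    exact this.symm
  face_nonempty₁ := by rw [hyperplane_neg]; exact h.face_nonempty₂
  face_nonempty₂ := by rw [hyperplane_neg]; exact h.face_nonempty₁
  frontier_eq := by rw [hyperplane_neg, hyperplane_neg, h.frontier_eq, union_right_comm]

section SlabDomain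

variable {e : Amb n} {c₁ c₂ : ℝ} {Ω M : Set (Amb n)}

theorem IsSlabDomain.subset_openSlab (h : IsSlabDomain e c₁ c₂ Ω M) (he : ‖e‖ = 1) :
    Ω ⊆ openSlab e c₁ c₂ := by
  intro x hx
  have hee : ⟪e, e⟫ = 1 := by rw [real_inner_self_eq_norm_sq, he]; norm_num
  have h1 : ∀ᶠ t in 𝓝 (0 : ℝ), x + t • e ∈ Ω :=
    (tendsto_add_smul x e).eventually (h.isOpen.mem_nhds hx)
  obtain ⟨ε, hε, hball⟩ := Metric.eventually_nhds_iff.1 h1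
  have h2 := h.subset_slab (hball (y := -(ε / 2)) (by
    rw [dist_zero_right, Real.norm_eq_abs, abs_neg, abs_of_pos (by positivity)]; linarith))
  have h3 := h.subset_slab (hball (y := ε / 2) (by
    rw [dist_zero_right, Real.norm_eq_abs, abs_of_pos (by positivity)]; linarith))
  simp only [mem_ofPred_eq, inner_add_right, inner_smul_right, hee] at h2 h3
  constructor <;> linarith

theorem IsSlabDomain.closure_subset (h : IsSlabDomain e c₁ c₂ Ω M) :
    closure Ω ⊆ {x | c₁ ≤ ⟪e, x⟫ ∧ ⟪e, x⟫ ≤ c₂} := by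
  have hc : Continuous fun x : Amb n => ⟪e, x⟫ := by fun_prop
  exact closure_minimal h.subset_slab
    ((isClosed_le continuous_const hc).inter (isClosed_le hc continuous_const))

theorem IsSlabDomain.subset_frontier (h : IsSlabDomain e c₁ c₂ Ω M) : M ⊆ frontier Ω := by
  rw [h.frontier_eq, union_assoc]; exact subset_union_left

theorem IsSlabDomain.notMem_of_mem (h : IsSlabDomain e c₁ c₂ Ω M) {x : Amb n} (hx : x ∈ M) :
    x ∉ Ω := fun hxΩ => by
  have := h.subset_frontier hx
  rw [h.isOpen.frontier_eq] at this
  exact this.2 hxΩ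

theorem IsSlabDomain.mem_closure_of_mem (h : IsSlabDomain e c₁ c₂ Ω M) {x : Amb n} (hx : x ∈ M) :
    x ∈ closure Ω := frontier_subset_closure (h.subset_frontier hx)

theorem IsSlabDomain.mem_frontier_iff (h : IsSlabDomain e c₁ c₂ Ω M) {x : Amb n}
    (hx : x ∈ openSlab e c₁ c₂) : x ∈ frontier Ω ↔ x ∈ M := by
  refine ⟨fun hf => ?_, fun hx => h.subset_frontier hx⟩
  rw [h.frontier_eq] at hf
  rcases hf with (hf | hf) | hf
  · exact hf
  · exact absurd hf.2 hx.1.ne'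
  · exact absurd hf.2 hx.2.ne

theorem IsSlabDomain.mem_of_closure (h : IsSlabDomain e c₁ c₂ Ω M) {x : Amb n}
    (hx : x ∈ openSlab e c₁ c₂) (hc : x ∈ closure Ω) (hn : x ∉ Ω) : x ∈ M :=
  (h.mem_frontier_iff hx).1 (by rw [h.isOpen.frontier_eq]; exact ⟨hc, hn⟩)

theorem notMem_faceBoundaries {x : Amb n} (hx : x ∈ openSlab e c₁ c₂) :
    x ∉ faceBoundaries e c₁ c₂ Ω := by
  rintro (h | h)
  · exact absurd (relBoundary_face_subset _ _ _ h).2 hx.1.ne'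
  · exact absurd (relBoundary_face_subset _ _ _ h).2 hx.2.ne

end SlabDomain

/-- The hypotheses for moving planes in the direction `v`, from outside down to level `s`. -/
structure SlabConfig (e v : Amb n) (c₁ c₂ s : ℝ) (Ω M : Set (Amb n)) (Hf : Amb n → ℝ) (L : ℝ) :
    Prop where
  hn : n ≠ 0
  norm_e : ‖e‖ = 1
  norm_v : ‖v‖ = 1
  inner_eq : ⟪e, v⟫ = 0
  lt : c₁ < c₂
  dom : IsSlabDomain e c₁ c₂ Ω M
  nonneg : 0 ≤ L
  lip : ∀ x ∈ closure Ω, ∀ y ∈ closure Ω, |Hf x - Hf y| ≤ L * |⟪e, x⟫ - ⟪e, y⟫|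
  eq_of_inner_eq : ∀ x y, ⟪e, x⟫ = ⟪e, y⟫ → Hf x = Hf y
  isCompact : IsCompact M
  boundary_subset : faceBoundaries e c₁ c₂ Ω ⊆ M
  interior_point : ∀ p ∈ M \ faceBoundaries e c₁ c₂ Ω, IsC2InteriorPoint M p
  boundary_point : ∀ p ∈ faceBoundaries e c₁ c₂ Ω, s < ⟪v, p⟫ → IsC2BoundaryPoint M p
  mc : HasInwardMeanCurvature Ω M (faceBoundaries e c₁ c₂ Ω) Hf
  -- The open chord from a face point to its mirror image in the plane at level `s` avoids the
  -- relative boundary. In particular, planes at levels strictly between `s` and that of the point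
  -- reflect it into the relative interior of the face.
  face_cap : ∀ c, c = c₁ ∨ c = c₂ → ∀ x ∈ face Ω (hyperplane e c), ∀ τ : ℝ, 0 < τ →
    τ < 2 * (⟪v, x⟫ - s) → x - τ • v ∈ face Ω (hyperplane e c) \
      relBoundary (hyperplane e c) (face Ω (hyperplane e c))
  -- The border of the faces is transversal to `v`; this is what excludes tangency of `v` to the
  -- border at a point of the reflecting plane.
  border : ∀ q ∈ faceBoundaries e c₁ c₂ Ω, s < ⟪v, q⟫ →
    ∃ (F : Amb n → ℝ) (F' : Amb n →L[ℝ] ℝ), HasStrictFDerivAt F F' q ∧ F q = 0 ∧ F' v ≠ 0 ∧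
      ∀ᶠ x in 𝓝 q, x ∈ faceBoundaries e c₁ c₂ Ω → F x = 0

/-- Near `p`, the set `M` is a graph over its tangent plane, with `Ω` above it; the mean curvature
equation holds on the whole graph, although `p` may lie on the border of the slab. -/
structure IsGoodGraph (e : Amb n) (c₁ c₂ : ℝ) (Ω M : Set (Amb n)) (Hf : Amb n → ℝ) (p N : Amb n)
    (G : Amb n → ℝ) : Prop extends IsTangentGraph M p N G where
  above : ∀ᶠ x in 𝓝 p, G x < ⟪N, x⟫ → x ∈ openSlab e c₁ c₂ → x ∈ Ω
  pde : ∀ᶠ x in 𝓝 p, levelSetMeanCurvature (graphFn N G) x = Hf (graphPt N G x)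
  dense : ∀ᶠ x in 𝓝 p, x ∈ closure {y | graphPt N G y ∈ openSlab e c₁ c₂}

/-- The points of `M` right of the plane at level `T` whose reflection belongs to `M`. -/
def contactSet (e v : Amb n) (c₁ c₂ T : ℝ) (M : Set (Amb n)) : Set (Amb n) :=
  {x | x ∈ M ∧ x ∈ openSlab e c₁ c₂ ∧ T < ⟪v, x⟫ ∧ reflectIn v T x ∈ M}

/-- All the planes at levels `t ≥ T` reflect the part of `Ω` on their right into `Ω`. -/
def ReflectsInto (v : Amb n) (T : ℝ) (Ω : Set (Amb n)) : Prop :=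
  ∀ t, T ≤ t → ∀ x ∈ Ω, t < ⟪v, x⟫ → reflectIn v t x ∈ Ω

variable {e v : Amb n} {c₁ c₂ s L T : ℝ} {Ω M : Set (Amb n)} {Hf : Amb n → ℝ} {p N : Amb n}
  {G : Amb n → ℝ}

namespace SlabConfig

theorem neg (h : SlabConfig e v c₁ c₂ s Ω M Hf L) :
    SlabConfig (-e) v (-c₂) (-c₁) s Ω M Hf L where
  hn := h.hn
  norm_e := by rw [norm_neg, h.norm_e]
  norm_v := h.norm_v
  inner_eq := by rw [inner_neg_left, h.inner_eq, neg_zero]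
  lt := neg_lt_neg h.lt
  dom := h.dom.neg
  nonneg := h.nonneg
  lip x hx y hy := by
    rw [inner_neg_left, inner_neg_left, neg_sub_neg, abs_sub_comm ⟪e, y⟫]; exact h.lip x hx y hy
  eq_of_inner_eq x y hxy := h.eq_of_inner_eq x y (by simpa [inner_neg_left] using hxy)
  isCompact := h.isCompact
  boundary_subset := by rw [faceBoundaries_neg]; exact h.boundary_subset
  interior_point := by rw [faceBoundaries_neg]; exact h.interior_point
  boundary_point := by rw [faceBoundaries_neg]; exact h.boundary_point
  mc := by rw [faceBoundaries_neg]; exact h.mc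
  face_cap c hc := by
    have := h.face_cap (-c) (by rcases hc with rfl | rfl <;> simp)
    rwa [← hyperplane_neg e (-c), neg_neg] at this
  border := by rw [faceBoundaries_neg]; exact h.border

theorem eventually_interior (h : SlabConfig e v c₁ c₂ s Ω M Hf L) (hp : p ∈ openSlab e c₁ c₂) :
    (∀ᶠ x in 𝓝 p, x ∈ frontier Ω ↔ x ∈ M) ∧
      ∀ᶠ x in 𝓝 p, x ∈ M → x ∉ faceBoundaries e c₁ c₂ Ω := by
  have := (isOpen_openSlab e c₁ c₂).mem_nhds hp
  exact ⟨by filter_upwards [this] with x hx using h.dom.mem_frontier_iff hx,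
    by filter_upwards [this] with x hx _ using notMem_faceBoundaries hx⟩

theorem isC2InteriorPoint (h : SlabConfig e v c₁ c₂ s Ω M Hf L) (hp : p ∈ openSlab e c₁ c₂)
    (hpM : p ∈ M) : IsC2InteriorPoint M p :=
  h.interior_point p ⟨hpM, notMem_faceBoundaries hp⟩

theorem exists_isGoodGraph (h : SlabConfig e v c₁ c₂ s Ω M Hf L) (hp : p ∈ openSlab e c₁ c₂)
    (hpM : p ∈ M) : ∃ N G, IsGoodGraph e c₁ c₂ Ω M Hf p N G := by
  have hS := (isOpen_openSlab e c₁ c₂).mem_nhds hp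
  obtain ⟨N, G, hg, hup⟩ : ∃ N G, IsTangentGraph M p N G ∧
      ∀ᶠ x in 𝓝 p, G x < ⟪N, x⟫ → x ∈ Ω := by
    obtain ⟨N, G, hg⟩ := (h.isC2InteriorPoint hp hpM).exists_isTangentGraph
    rcases hg.exists_above h.dom.isOpen (h.eventually_interior hp).1 hpM with h | h
    · exact ⟨N, G, hg, h⟩
    · exact ⟨-N, _, hg.neg, h.mono fun x hx hx' => hx (by rw [inner_neg_left] at hx'; linarith)⟩
  exact ⟨N, G, { hg with
    above := hup.mono fun x hx h1 _ => hx h1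
    pde := h.mc.eventually_eq_of_above hg.norm_eq hg.inv hg.contDiffAt hg.apply_eq hg.mem_iff
      (h.eventually_interior hp).2 hup
    dense := (hg.tendsto_graphPt.eventually hS).mono fun x hx => subset_closure hx }⟩

theorem reflectIn_mem_openSlab (h : SlabConfig e v c₁ c₂ s Ω M Hf L) (T : ℝ) {x : Amb n} :
    reflectIn v T x ∈ openSlab e c₁ c₂ ↔ x ∈ openSlab e c₁ c₂ := by
  simp only [openSlab, mem_ofPred_eq, inner_reflectIn_of_orthogonal h.inner_eq]

/-- Contact with the reflection is an open condition on `M`. -/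
theorem eventually_reflectIn_mem (h : SlabConfig e v c₁ c₂ s Ω M Hf L) (hT : ReflectsInto v T Ω)
    {x : Amb n} (hx : x ∈ contactSet e v c₁ c₂ T M) :
    ∀ᶠ m in 𝓝 x, m ∈ M → reflectIn v T m ∈ M := by
  obtain ⟨hxM, hxS, hxT, hRM⟩ := hx
  have hv := h.norm_v
  set R := reflectIn v T with hR
  have hRR : ∀ y, R (R y) = y := reflectIn_reflectIn hv T
  have hRc : Continuous R := continuous_reflectIn v T
  have hRS : R x ∈ openSlab e c₁ c₂ := (h.reflectIn_mem_openSlab T).2 hxS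
  have ht : Tendsto R (𝓝 (R x)) (𝓝 x) := by
    have := hRc.tendsto (R x); rwa [hRR] at this
  have hfr : ∀ A : Set (Amb n), frontier (R ⁻¹' A) = R ⁻¹' frontier A := fun A =>
    ((reflectHomeo hv T).preimage_frontier A).symm
  have key := eventually_mem_iff_of_touching (p := R x) h.hn
    (h.mc.preimage_reflectIn hv T) h.mc (h.dom.isOpen.preimage hRc) h.dom.isOpen
    (IsC2InteriorPoint.preimage_reflectIn hv (by
      rw [reflectIn_reflectIn hv]; exact h.isC2InteriorPoint hxS hxM))
    (h.isC2InteriorPoint hRS hRM)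
    (ht.eventually (h.eventually_interior hxS).2) (h.eventually_interior hRS).2
    (by
      rw [hfr]
      exact ht.eventually (h.eventually_interior hxS).1)
    (h.eventually_interior hRS).1
    (by
      have hc : Continuous fun y : Amb n => ⟪v, y⟫ := by fun_prop
      have : ∀ᶠ y in 𝓝 (R x), T < ⟪v, R y⟫ :=
        ht.eventually ((isOpen_lt continuous_const hc).mem_nhds hxT)
      filter_upwards [this] with y hy hyΩ
      have := hT T le_rfl (R y) hyΩ hy
      rwa [← hR, hRR] at this)
    h.nonneg (U := univ) univ_mem (by
      rintro y ⟨-, hy⟩ z ⟨-, hz⟩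
      rw [h.eq_of_inner_eq (reflectIn v T y) y (inner_reflectIn_of_orthogonal h.inner_eq _ _)]
      have hy' : Hf y = Hf (R y) := h.eq_of_inner_eq _ _
        (inner_reflectIn_of_orthogonal h.inner_eq _ _).symm
      rw [hy']
      refine (h.lip _ (h.dom.mem_closure_of_mem hy) _ (h.dom.mem_closure_of_mem hz)).trans
        (mul_le_mul_of_nonneg_left ?_ h.nonneg)
      rw [inner_reflectIn_of_orthogonal h.inner_eq, ← inner_sub_right]
      exact (abs_real_inner_le_norm _ _).trans (by rw [h.norm_e, one_mul]))
  have ht' : Tendsto R (𝓝 x) (𝓝 (R x)) := hRc.tendsto x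
  filter_upwards [ht'.eventually key] with m hm hmM
  exact hm.1 (by rw [mem_preimage, ← hR, hRR]; exact hmM)

/-- The plane halfway between `x` and `x + τ • v` has level at least `T` and would reflect the
second point to the first. Hence right of level `T` a ray in the direction `v` never returns to `Ω`.
-/
theorem notMem_of_right (h : SlabConfig e v c₁ c₂ s Ω M Hf L) (hT : ReflectsInto v T Ω)
    {x : Amb n} (hx : x ∉ Ω) (hxT : T ≤ ⟪v, x⟫) {τ : ℝ} (hτ : 0 ≤ τ) : x + τ • v ∉ Ω := by
  have hvv : ⟪v, v⟫ = 1 := by rw [real_inner_self_eq_norm_sq, h.norm_v]; norm_num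
  intro hcon
  rcases hτ.eq_or_lt with rfl | hτ
  · exact hx (by simpa using hcon)
  have h1 := hT (⟪v, x⟫ + τ / 2) (by linarith) _ hcon (by
    rw [inner_add_right, inner_smul_right, hvv]; linarith)
  apply hx
  convert h1 using 1
  rw [reflectIn, inner_add_right, inner_smul_right, hvv]
  module

/-- A graph that is vertical over the plane of symmetry produces contact points. -/
theorem contactSet_nonempty_of_isGoodGraph (h : SlabConfig e v c₁ c₂ s Ω M Hf L)
    (hT : ReflectsInto v T Ω) (hg : IsGoodGraph e c₁ c₂ Ω M Hf p N G) (hp : ⟪v, p⟫ = T)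
    (hNv : ⟪N, v⟫ = 0) : (contactSet e v c₁ c₂ T M).Nonempty := by
  have hv := h.norm_v
  set R := reflectIn v T with hR
  have hRR : ∀ y, R (R y) = y := reflectIn_reflectIn hv T
  have hRc : Continuous R := continuous_reflectIn v T
  have hRp : R p = p := reflectIn_of_inner_eq hp
  have hRt : Tendsto R (𝓝 p) (𝓝 p) := by
    have := hRc.tendsto p; rwa [hRp] at this
  have hRN : ∀ x, ⟪N, R x⟫ = ⟪N, x⟫ := inner_reflectIn_of_orthogonal hNv T
  have hvN : ⟪v, N⟫ = 0 := by rw [real_inner_comm]; exact hNv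
  have hvg : ∀ x, ⟪v, graphPt N G x⟫ = ⟪v, x⟫ := fun x => by
    rw [graphPt, inner_add_right, inner_smul_right, hvN, mul_zero, add_zero]
  have hiR : InvariantAlong N (fun x => G (R x)) := fun x t => by
    simp only [hR, reflectIn_add_smul hNv, hg.inv _ t]
  have hGR : ∀ x, G (R (graphPt N G x)) = G (R x) := fun x => hiR x _
  have hcR : ContDiffAt ℝ 2 (fun x => G (R x)) p := by
    have : ContDiffAt ℝ 2 G (R p) := by rw [hRp]; exact hg.contDiffAt
    exact this.comp p (contDiff_reflectIn v T).contDiffAt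
  have hdR : fderiv ℝ (fun x => G (R x)) p = 0 := by
    have h1 : HasFDerivAt G (0 : Amb n →L[ℝ] ℝ) (R p) := by
      rw [hRp, ← hg.fderiv_eq]
      exact (hg.contDiffAt.differentiableAt (by norm_num)).hasFDerivAt
    have h2 := (h1.comp p (hasFDerivAt_reflectIn v T p)).fderiv
    have h3 : fderiv ℝ (fun x => G (R x)) p = _ := h2
    rw [h3, ContinuousLinearMap.zero_comp]
  have hvc : Continuous fun y : Amb n => ⟪v, y⟫ := by fun_prop
  -- the comparison left of the plane
  have hle₀ : ∀ᶠ x in 𝓝 p, graphPt N G x ∈ openSlab e c₁ c₂ → ⟪v, x⟫ < T → G x ≤ G (R x) := by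
    filter_upwards [hg.eventually_graphPt_mem,
      (hRt.comp hg.tendsto_graphPt).eventually hg.above] with x hxM hxa hxS hxT
    by_contra! hlt
    have h1 := hxa (by simp only [Function.comp_apply, hGR, hRN, inner_graphPt hg.norm_eq, hlt])
      ((h.reflectIn_mem_openSlab T).2 hxS)
    have h2 := hT T le_rfl _ h1 (by
      simp only [Function.comp_apply, hR, inner_reflectIn_self hv, hvg]; linarith)
    simp only [Function.comp_apply, ← hR, hRR] at h2
    exact h.dom.notMem_of_mem hxM h2
  -- The order is known so far only where the graph lies in the open slab; these points are dense,
  -- and continuity gives the rest.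
  have hle : ∀ᶠ x in 𝓝 p, x ∈ {x | ⟪v, x⟫ < T} → G x ≤ G (R x) := by
    filter_upwards [hle₀.eventually_nhds, hg.dense, hg.contDiffAt.eventually_continuousAt,
      hcR.eventually_continuousAt] with x h1 h2 h3 h4 h5
    by_contra! hlt
    have h6 : ∀ᶠ y in 𝓝 x, G (R y) < G y := h4.eventually_lt h3 hlt
    obtain ⟨y, hy, h7, h8, h9⟩ := ((mem_closure_iff_frequently.1 h2).and_eventually
      (h1.and (h6.and ((isOpen_lt hvc continuous_const).mem_nhds h5)))).exists
    exact (h7 hy h9).not_gt h8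
  have hclG : ∀ᶠ x in 𝓝 p, graphPt N G x ∈ closure Ω :=
    hg.eventually_graphPt_mem.mono fun x hx => h.dom.mem_closure_of_mem hx
  have hcmp := exists_ball_eq_of_touching (S := {x | ⟪v, x⟫ < T}) h.hn hg.norm_eq hiR hg.inv hcR
    hg.contDiffAt hdR hg.fderiv_eq (by simp only [hRp]) h.nonneg (by
      filter_upwards [hle, hg.pde, hRt.eventually hg.pde, hclG, hRt.eventually hclG,
        hRt.eventually (hg.contDiffAt.eventually (by norm_num))] with x h1 h2 h3 h4 h5 h6 hx
      refine ⟨h1 hx, ?_⟩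
      have h7 : graphFn N (fun x => G (R x)) = fun x => graphFn N G (R x) := by
        funext y; simp only [graphFn, hRN]
      rw [h7, levelSetMeanCurvature_comp_reflectIn hv (ContDiffAt.graphFn h6)
        (gradient_graphFn_ne_zero hg.norm_eq hg.inv (h6.differentiableAt (by norm_num))), h3, h2]
      refine (h.lip _ h5 _ h4).trans (mul_le_mul_of_nonneg_left ?_ h.nonneg)
      have h8 : ⟪e, graphPt N G (R x)⟫ - ⟪e, graphPt N G x⟫ = (G (R x) - G x) * ⟪e, N⟫ := by
        have h9 : ⟪e, R x⟫ = ⟪e, x⟫ := inner_reflectIn_of_orthogonal h.inner_eq T x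
        simp only [graphPt, inner_add_right, inner_smul_right, hRN, h9]; ring
      rw [h8, abs_mul]
      have : |⟪e, N⟫| ≤ 1 :=
        (abs_real_inner_le_norm e N).trans (by rw [h.norm_e, hg.norm_eq, one_mul])
      exact mul_le_of_le_one_right (abs_nonneg _) this)
    (ν := -v) (by rw [norm_neg, hv]) (by
      filter_upwards with r x hx
      have h1 : ⟪v, x - (p + r • -v)⟫ = ⟪v, x⟫ - T + r := by
        have hvv : ⟪v, v⟫ = 1 := by rw [real_inner_self_eq_norm_sq, hv]; norm_num
        simp only [inner_sub_right, inner_add_right, inner_smul_right, inner_neg_right, hvv, hp]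
        ring
      have h2 := real_inner_le_norm v (x - (p + r • -v))
      rw [h1, hv, one_mul, ← dist_eq_norm] at h2
      have h3 : dist x (p + r • -v) < r := hx
      change ⟪v, x⟫ < T
      linarith)
  have hgR : ∀ᶠ x in 𝓝 p, graphPt N G x ∈ M ∧ graphPt N G (R x) ∈ M :=
    hg.eventually_graphPt_mem.and (hRt.eventually hg.eventually_graphPt_mem)
  have ht := (tendsto_add_smul p (-v)).mono_left (nhdsWithin_le_nhds (s := Ioi (0 : ℝ)))
  have hpos : ∀ᶠ r in 𝓝[>] (0 : ℝ), 0 < r := self_mem_nhdsWithin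
  -- The graphs agree on a ball left of the plane. Near its centre there are points over which the
  -- graph lies in the open slab, and the mirror images of these graph points are contact points.
  obtain ⟨r, hr, hr0, hr1, hr2⟩ := (hcmp.and (hpos.and
    ((ht.eventually hgR.eventually_nhds).and (ht.eventually hg.dense)))).exists
  have hball : ∀ᶠ y in 𝓝 (p + r • -v), y ∈ ball (p + r • -v) r := ball_mem_nhds _ hr0
  obtain ⟨y, hyS, hyb, hy1, hy2⟩ := ((mem_closure_iff_frequently.1 hr2).and_eventually (hball.and hr1)).exists
  have hyeq := hr y hyb
  have hyT : ⟪v, y⟫ < T := by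
    have h1 : ⟪v, y - (p + r • -v)⟫ = ⟪v, y⟫ - T + r := by
      have hvv : ⟪v, v⟫ = 1 := by rw [real_inner_self_eq_norm_sq, hv]; norm_num
      simp only [inner_sub_right, inner_add_right, inner_smul_right, inner_neg_right, hvv, hp]
      ring
    have h2 := real_inner_le_norm v (y - (p + r • -v))
    rw [h1, hv, one_mul, ← dist_eq_norm] at h2
    have h3 : dist y (p + r • -v) < r := hyb
    linarith
  have hRg : R (graphPt N G y) = graphPt N G (R y) := by
    rw [graphPt, hR, reflectIn_add_smul hNv, graphPt, ← hR, hRN, hyeq]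
  refine ⟨R (graphPt N G y), by rw [hRg]; exact hy2, (h.reflectIn_mem_openSlab T).2 hyS, ?_, ?_⟩
  · rw [hR, inner_reflectIn_self hv, hvg]; linarith
  · rw [← hR, hRR]; exact hy1

end SlabConfig

end MovingPlanes

/-! ### First exits of rays from `Ω` -/

section Exits

variable {n : ℕ} {v : Amb n} {Ω : Set (Amb n)}

/-- The ray from `x` in the direction `v` leaves `Ω` for the first time at `x + τ • v`. -/
def IsExit (v : Amb n) (Ω : Set (Amb n)) (x : Amb n) (τ : ℝ) : Prop :=
  0 < τ ∧ (∀ σ : ℝ, 0 ≤ σ → σ < τ → x + σ • v ∈ Ω) ∧ x + τ • v ∉ Ω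

theorem IsExit.unique {x : Amb n} {τ τ' : ℝ} (h : IsExit v Ω x τ) (h' : IsExit v Ω x τ') :
    τ = τ' := by
  rcases lt_trichotomy τ τ' with hlt | heq | hlt
  · exact absurd (h'.2.1 τ h.1.le hlt) h.2.2
  · exact heq
  · exact absurd (h.2.1 τ' h'.1.le hlt) h'.2.2

theorem IsExit.mem_closure {x : Amb n} {τ : ℝ} (h : IsExit v Ω x τ) {σ : ℝ} (h0 : 0 ≤ σ)
    (hσ : σ ≤ τ) : x + σ • v ∈ closure Ω := by
  rcases hσ.lt_or_eq with hσ | rfl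
  · exact subset_closure (h.2.1 σ h0 hσ)
  have hc : Continuous fun t : ℝ => x + t • v := by fun_prop
  refine mem_closure_of_tendsto ((hc.tendsto σ).mono_left (nhdsWithin_le_nhds (s := Iio σ))) ?_
  filter_upwards [Ioo_mem_nhdsLT h.1] with t ht using h.2.1 t ht.1.le ht.2

/-- The bound is uniform in `x`, so that sequences of exit times have convergent subsequences. -/
theorem exists_isExit_le (hv : ‖v‖ = 1) (ho : IsOpen Ω) (hb : Bornology.IsBounded Ω) :
    ∃ B : ℝ, ∀ x ∈ Ω, ∃ τ ≤ B, IsExit v Ω x τ := by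
  obtain ⟨B, hB⟩ := Metric.isBounded_iff.1 hb
  refine ⟨B + 1, fun x hx => ?_⟩
  have hout : ∀ τ : ℝ, B < τ → x + τ • v ∉ Ω := by
    intro τ hτ hcon
    have h1 := hB hcon hx
    rw [dist_eq_norm, add_sub_cancel_left, norm_smul, hv, mul_one, Real.norm_eq_abs] at h1
    linarith [le_abs_self τ]
  have hB0 : 0 ≤ B := by simpa using hB hx hx
  set A : Set ℝ := {τ | 0 ≤ τ ∧ x + τ • v ∉ Ω} with hA
  have hc : Continuous fun t : ℝ => x + t • v := by fun_prop
  have hAc : IsClosed A := isClosed_Ici.inter (ho.isClosed_compl.preimage hc)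
  have hAB : B + 1 ∈ A := ⟨by linarith, hout _ (by linarith)⟩
  have hbdd : BddBelow A := ⟨0, fun t ht => ht.1⟩
  have hmem := hAc.csInf_mem ⟨_, hAB⟩ hbdd
  refine ⟨sInf A, csInf_le hbdd hAB, ?_, fun σ h0 hσ => ?_, hmem.2⟩
  · refine lt_of_le_of_ne hmem.1 fun h0 => hmem.2 ?_
    rw [← h0]; simpa using hx
  · by_contra hcon
    exact (csInf_le hbdd (show σ ∈ A from ⟨h0, hcon⟩)).not_gt hσ

end Exits

/-! ### A contact point forces symmetry; bad points inside the slab -/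

section MovingPlanes

variable {n : ℕ} {e v : Amb n} {c₁ c₂ s L T : ℝ} {Ω M : Set (Amb n)} {Hf : Amb n → ℝ}

/-- The ray from `x` in the direction `v` leaves `Ω` at a contact point. -/
def ExitsAtContact (e v : Amb n) (c₁ c₂ T : ℝ) (Ω M : Set (Amb n)) (x : Amb n) : Prop :=
  ∃ τ, IsExit v Ω x τ ∧ x + τ • v ∈ contactSet e v c₁ c₂ T M

namespace SlabConfig

theorem inner_self_v (h : SlabConfig e v c₁ c₂ s Ω M Hf L) : ⟪v, v⟫ = 1 := by
  rw [real_inner_self_eq_norm_sq, h.norm_v]; norm_num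

theorem inner_v_add (h : SlabConfig e v c₁ c₂ s Ω M Hf L) (x : Amb n) (t : ℝ) :
    ⟪v, x + t • v⟫ = ⟪v, x⟫ + t := by
  rw [inner_add_right, inner_smul_right, h.inner_self_v, mul_one]

theorem add_smul_mem_openSlab (h : SlabConfig e v c₁ c₂ s Ω M Hf L) {x : Amb n} (t : ℝ) :
    x + t • v ∈ openSlab e c₁ c₂ ↔ x ∈ openSlab e c₁ c₂ := by
  simp only [openSlab, mem_ofPred_eq, inner_add_right, inner_smul_right, h.inner_eq, mul_zero,
    add_zero]

/-- Contact is open by the touching principle, and its failure is open because `M` is closed. -/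
theorem eventually_mem_contactSet_iff (h : SlabConfig e v c₁ c₂ s Ω M Hf L)
    (hT : ReflectsInto v T Ω) {y : Amb n} (hyM : y ∈ M) (hyS : y ∈ openSlab e c₁ c₂)
    (hyT : T < ⟪v, y⟫) :
    ∀ᶠ m in 𝓝 y, m ∈ M → (m ∈ contactSet e v c₁ c₂ T M ↔ y ∈ contactSet e v c₁ c₂ T M) := by
  have hc : Continuous fun y : Amb n => ⟪v, y⟫ := by fun_prop
  by_cases hy : y ∈ contactSet e v c₁ c₂ T M
  · filter_upwards [h.eventually_reflectIn_mem hT hy,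
      (isOpen_openSlab e c₁ c₂).mem_nhds hyS, (isOpen_lt continuous_const hc).mem_nhds hyT]
      with m h1 h2 h3 hm
    exact iff_of_true ⟨hm, h2, h3, h1 hm⟩ hy
  · have h1 : reflectIn v T y ∉ M := fun h1 => hy ⟨hyM, hyS, hyT, h1⟩
    have h2 := (continuous_reflectIn v T).continuousAt.eventually
      (h.isCompact.isClosed.isOpen_compl.mem_nhds h1)
    filter_upwards [h2] with m hm _
    exact iff_of_false (fun h3 => hm h3.2.2.2) hy

theorem mem_contactSet_iff_of_segment (h : SlabConfig e v c₁ c₂ s Ω M Hf L)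
    (hT : ReflectsInto v T Ω) {x : Amb n} (hxS : x ∈ openSlab e c₁ c₂) {α β : ℝ} (hαβ : α ≤ β)
    (hα : T < ⟪v, x⟫ + α) (hM : ∀ σ ∈ Icc α β, x + σ • v ∈ M) :
    x + α • v ∈ contactSet e v c₁ c₂ T M ↔ x + β • v ∈ contactSet e v c₁ c₂ T M := by
  have hc : Continuous fun t : ℝ => x + t • v := by fun_prop
  refine isPreconnected_Icc.induction₂ (s := Icc α β)
    (P := fun a b => x + a • v ∈ contactSet e v c₁ c₂ T M ↔ x + b • v ∈ contactSet e v c₁ c₂ T M)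
    (fun σ hσ => ?_) (fun _ _ _ _ _ _ h1 h2 => h1.trans h2) (fun _ _ _ _ h1 => h1.symm)
    (left_mem_Icc.2 hαβ) (right_mem_Icc.2 hαβ)
  have h1 := h.eventually_mem_contactSet_iff hT (hM σ hσ) ((h.add_smul_mem_openSlab σ).2 hxS)
    (by rw [h.inner_v_add]; linarith [hσ.1])
  filter_upwards [nhdsWithin_le_nhds ((hc.tendsto σ).eventually h1), self_mem_nhdsWithin]
    with t ht ht'
  exact (ht (hM t ht')).symm

/-- The exit time need not be continuous: in the limit it can jump from `σ₀` to `τ'`. All points of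
the ray in between are limits of points of the closure of `Ω` and lie outside `Ω` by
`notMem_of_right`, so they form a segment of `M`. Along it the contact condition does not change. -/
theorem eventually_exit_mem_contactSet_iff (h : SlabConfig e v c₁ c₂ s Ω M Hf L)
    (hT : ReflectsInto v T Ω) {x : Amb n} (hxS : x ∈ openSlab e c₁ c₂) {σ₀ τ' : ℝ} (h0 : 0 ≤ σ₀)
    (hσ₀ : T < ⟪v, x⟫ + σ₀) (hout : x + σ₀ • v ∉ Ω) (hle : σ₀ ≤ τ') {u : ℕ → Amb n} {τ : ℕ → ℝ}
    (hu : Tendsto u atTop (𝓝 x)) (hτ : Tendsto τ atTop (𝓝 τ')) (huΩ : ∀ k, u k ∈ Ω)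
    (hexit : ∀ k, IsExit v Ω (u k) (τ k)) :
    ∀ᶠ k in atTop, u k + τ k • v ∈ contactSet e v c₁ c₂ T M ↔
      x + σ₀ • v ∈ contactSet e v c₁ c₂ T M := by
  have hseg : ∀ σ ∈ Icc σ₀ τ', x + σ • v ∈ M := by
    intro σ hσ
    refine h.dom.mem_of_closure ((h.add_smul_mem_openSlab σ).2 hxS) ?_ ?_
    · have h1 : Tendsto (fun k => u k + min σ (τ k) • v) atTop (𝓝 (x + min σ τ' • v)) :=
        hu.add ((tendsto_const_nhds.min hτ).smul_const v)
      rw [min_eq_left hσ.2] at h1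
      refine isClosed_closure.mem_of_tendsto h1 (Eventually.of_forall fun k => ?_)
      exact (hexit k).mem_closure (le_min (h0.trans hσ.1) (hexit k).1.le) (min_le_right _ _)
    · have := h.notMem_of_right hT hout (by rw [h.inner_v_add]; exact hσ₀.le)
        (sub_nonneg.2 hσ.1)
      rwa [add_assoc, ← add_smul, add_sub_cancel] at this
  have h1 := h.eventually_mem_contactSet_iff hT (hseg τ' (right_mem_Icc.2 hle))
    ((h.add_smul_mem_openSlab τ').2 hxS) (by rw [h.inner_v_add]; linarith)
  have h2 : Tendsto (fun k => u k + τ k • v) atTop (𝓝 (x + τ' • v)) := hu.add (hτ.smul_const v)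
  filter_upwards [h2.eventually h1] with k hk
  rw [h.mem_contactSet_iff_of_segment hT hxS hle hσ₀ hseg]
  refine hk (h.dom.mem_of_closure ((h.add_smul_mem_openSlab _).2
    (h.dom.subset_openSlab h.norm_e (huΩ k))) ((hexit k).mem_closure (hexit k).1.le le_rfl)
    (hexit k).2.2)

/-- A sequence of counterexamples would have a subsequence with convergent exit times; the limit is
at least `σ₀` because `Ω` is open. The point `x` may lie outside `Ω`, with `σ₀ = 0`; this is used at
points of `M`. -/
theorem eventually_exitsAtContact_iff (h : SlabConfig e v c₁ c₂ s Ω M Hf L)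
    (hT : ReflectsInto v T Ω) {x : Amb n} (hxS : x ∈ openSlab e c₁ c₂) {σ₀ : ℝ} (h0 : 0 ≤ σ₀)
    (hσ₀ : T < ⟪v, x⟫ + σ₀) (hin : ∀ σ : ℝ, 0 ≤ σ → σ < σ₀ → x + σ • v ∈ Ω)
    (hout : x + σ₀ • v ∉ Ω) :
    ∀ᶠ y in 𝓝 x, y ∈ Ω → (ExitsAtContact e v c₁ c₂ T Ω M y ↔
      x + σ₀ • v ∈ contactSet e v c₁ c₂ T M) := by
  by_contra hcon
  obtain ⟨u, hu, hu'⟩ := exists_seq_forall_of_frequently (not_eventually.1 hcon)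
  obtain ⟨B, hB⟩ := exists_isExit_le h.norm_v h.dom.isOpen h.dom.isBounded
  have huΩ : ∀ k, u k ∈ Ω := fun k => by_contra fun h1 => hu' k fun h2 => absurd h2 h1
  choose τ hτB hτ using fun k => hB (u k) (huΩ k)
  obtain ⟨τ', -, φ, hφ, hlim⟩ := isCompact_Icc.tendsto_subseq (x := τ) (s := Icc 0 B)
    fun k => ⟨(hτ k).1.le, hτB k⟩
  have huφ := hu.comp hφ.tendsto_atTop
  have hτ'0 : 0 ≤ τ' := ge_of_tendsto hlim (Eventually.of_forall fun k => (hτ (φ k)).1.le)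
  have hle : σ₀ ≤ τ' := by
    by_contra! hlt
    have h1 : Tendsto (fun k => u (φ k) + τ (φ k) • v) atTop (𝓝 (x + τ' • v)) :=
      huφ.add (hlim.smul_const v)
    obtain ⟨k, hk⟩ := (h1.eventually (h.dom.isOpen.mem_nhds (hin τ' hτ'0 hlt))).exists
    exact (hτ (φ k)).2.2 hk
  obtain ⟨k, hk⟩ := (h.eventually_exit_mem_contactSet_iff hT hxS h0 hσ₀ hout hle huφ hlim
    (fun k => huΩ _) (fun k => hτ _)).exists
  refine hu' (φ k) fun _ => ⟨fun ⟨t, ht, ht'⟩ => ?_, fun h1 => ⟨_, hτ _, hk.2 h1⟩⟩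
  rw [ht.unique (hτ (φ k))] at ht'
  exact hk.1 ht'

theorem eventually_exitsAtContact_iff_of_mem (h : SlabConfig e v c₁ c₂ s Ω M Hf L)
    (hT : ReflectsInto v T Ω) {x : Amb n} (hx : x ∈ Ω) (hxT : T ≤ ⟪v, x⟫) :
    ∀ᶠ y in 𝓝 x, y ∈ Ω → (ExitsAtContact e v c₁ c₂ T Ω M y ↔
      ExitsAtContact e v c₁ c₂ T Ω M x) := by
  obtain ⟨B, hB⟩ := exists_isExit_le h.norm_v h.dom.isOpen h.dom.isBounded
  obtain ⟨τ, -, hτ⟩ := hB x hx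
  have h1 := h.eventually_exitsAtContact_iff hT (h.dom.subset_openSlab h.norm_e hx) hτ.1.le
    (by linarith [hτ.1]) hτ.2.1 hτ.2.2
  filter_upwards [h1] with y hy hyΩ
  rw [hy hyΩ, h1.self_of_nhds hx]

/-- The property `Q`, that `x` or its mirror image is a point of `Ω` weakly right of the plane whose
ray exits at a contact point, is locally constant on `Ω`. It holds near a contact point, hence on
all of the connected set `Ω`, and it implies that the mirror image lies in `Ω`. Working in `Ω`
avoids any connectedness assumption on `M`. -/
theorem reflectIn_mem_of_exitsAtContact (h : SlabConfig e v c₁ c₂ s Ω M Hf L)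
    (hT : ReflectsInto v T Ω) (hne : (contactSet e v c₁ c₂ T M).Nonempty) :
    ∀ x ∈ Ω, reflectIn v T x ∈ Ω := by
  have hv := h.norm_v
  set R := reflectIn v T with hR
  have hRR : ∀ y, R (R y) = y := reflectIn_reflectIn hv T
  have hRc : Continuous R := continuous_reflectIn v T
  have hvR : ∀ y, ⟪v, R y⟫ = 2 * T - ⟪v, y⟫ := inner_reflectIn_self hv T
  have hvc : Continuous fun y : Amb n => ⟪v, y⟫ := by fun_prop
  set EC := ExitsAtContact e v c₁ c₂ T Ω M with hEC
  set Q : Amb n → Prop := fun x =>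
    (T ≤ ⟪v, x⟫ ∧ EC x) ∨ (T ≤ ⟪v, R x⟫ ∧ R x ∈ Ω ∧ EC (R x)) with hQ
  have hloc : ∀ x ∈ Ω, ∀ᶠ y in 𝓝 x, y ∈ Ω → (Q x ↔ Q y) := by
    intro x hx
    rcases lt_trichotomy ⟪v, x⟫ T with hlt | heq | hgt
    · have hRx : T < ⟪v, R x⟫ := by rw [hvR]; linarith
      have hQy : ∀ y, ⟪v, y⟫ < T → (Q y ↔ R y ∈ Ω ∧ EC (R y)) := fun y hy => by
        have h1 : T ≤ ⟪v, R y⟫ := by rw [hvR]; linarith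
        simp only [hQ, hy.not_ge, h1, false_and, true_and, false_or]
      have hlt' : ∀ᶠ y in 𝓝 x, ⟪v, y⟫ < T := (isOpen_lt hvc continuous_const).mem_nhds hlt
      by_cases hRΩ : R x ∈ Ω
      · filter_upwards [hlt', (hRc.tendsto x).eventually
          (h.eventually_exitsAtContact_iff_of_mem hT hRΩ hRx.le),
          (hRc.tendsto x).eventually (h.dom.isOpen.mem_nhds hRΩ)] with y h1 h2 h3 _
        rw [hQy y h1, hQy x hlt, hEC, h2 h3]
        exact and_congr_left' (iff_of_true hRΩ h3)
      -- If points of `Ω` near `R x` exited at contact points, then `R x` would be a contact point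
      -- itself, and its mirror image `x` would lie in `M` instead of `Ω`.
      · have hRS : R x ∈ openSlab e c₁ c₂ :=
          (h.reflectIn_mem_openSlab T).2 (h.dom.subset_openSlab h.norm_e hx)
        have h4 := h.eventually_exitsAtContact_iff hT hRS le_rfl (by linarith)
          (fun σ h1 h2 => absurd h1 h2.not_ge) (by simpa using hRΩ)
        filter_upwards [hlt', (hRc.tendsto x).eventually h4] with y h1 h2 _
        rw [hQy y h1, hQy x hlt]
        refine iff_of_false (fun h3 => hRΩ h3.1) fun h3 => ?_
        have h5 := (h2 h3.1).1 h3.2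
        rw [zero_smul, add_zero] at h5
        have h6 := h5.2.2.2
        rw [← hR, hRR] at h6
        exact h.dom.notMem_of_mem h6 hx
    · have hRx : R x = x := reflectIn_of_inner_eq heq
      have hQx : Q x ↔ EC x := by simp [hQ, hRx, heq, hx]
      have h1 := h.eventually_exitsAtContact_iff_of_mem hT hx heq.ge
      have hRt : Tendsto R (𝓝 x) (𝓝 x) := by
        have := hRc.tendsto x; rwa [hRx] at this
      filter_upwards [h1, hRt.eventually h1, hRt.eventually (h.dom.isOpen.mem_nhds hx)]
        with y h2 h3 h4 hy
      rw [hQx]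
      simp only [hQ, hEC, h2 hy, h3 h4, hvR]
      constructor
      · intro h5
        rcases le_total T ⟪v, y⟫ with h6 | h6
        · exact Or.inl ⟨h6, h5⟩
        · exact Or.inr ⟨by linarith, h4, h5⟩
      · rintro (h5 | h5)
        · exact h5.2
        · exact h5.2.2
    · have hQy : ∀ y, T < ⟪v, y⟫ → (Q y ↔ EC y) := fun y hy => by
        have h1 : ¬ T ≤ ⟪v, R y⟫ := by rw [hvR]; linarith
        simp only [hQ, hy.le, h1, false_and, true_and, or_false]
      have hgt' : ∀ᶠ y in 𝓝 x, T < ⟪v, y⟫ := (isOpen_lt continuous_const hvc).mem_nhds hgt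
      filter_upwards [hgt', h.eventually_exitsAtContact_iff_of_mem hT hx hgt.le] with y h1 h2 hy
      rw [hQy y h1, hQy x hgt, hEC, h2 hy]
  obtain ⟨z, hz⟩ := hne
  obtain ⟨y, hy, hQy⟩ : ∃ y ∈ Ω, Q y := by
    -- With `σ₀ = 0`: points of `Ω` close to the contact point `z` exit at contact points.
    have h1 := h.eventually_exitsAtContact_iff hT hz.2.1 le_rfl (by linarith [hz.2.2.1])
      (fun σ h1 h2 => absurd h1 h2.not_ge) (by simpa using h.dom.notMem_of_mem hz.1)
    obtain ⟨y, hy, h2, h3⟩ := ((mem_closure_iff_frequently.1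
      (h.dom.mem_closure_of_mem hz.1)).and_eventually (h1.and
        ((isOpen_lt continuous_const hvc).mem_nhds hz.2.2.1))).exists
    exact ⟨y, hy, Or.inl ⟨le_of_lt h3, (h2 hy).2 (by simpa using hz)⟩⟩
  intro x hx
  have hQx : Q y ↔ Q x := h.dom.isConnected.isPreconnected.induction₂
    (P := fun a b => Q a ↔ Q b)
    (fun a ha => by
      filter_upwards [nhdsWithin_le_nhds (hloc a ha), self_mem_nhdsWithin] with b h1 h2
      exact h1 h2)
    (fun _ _ _ _ _ _ h1 h2 => h1.trans h2) (fun _ _ _ _ h1 => h1.symm) hy hx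
  rcases hQx.1 hQy with h1 | h1
  · rcases h1.1.lt_or_eq with h2 | h2
    · exact hT T le_rfl x hx h2
    · rw [hR, reflectIn_of_inner_eq h2.symm]; exact hx
  · exact h1.2.1

/-- Otherwise the lower face would be mapped into itself by the reflection at level `T`. But the
chord that starts at its farthest point in the direction `v` extends beyond the mirror image of that
point, because `s < T`. -/
theorem contactSet_eq_empty (h : SlabConfig e v c₁ c₂ s Ω M Hf L) (hT : ReflectsInto v T Ω)
    (hs : s < T) : contactSet e v c₁ c₂ T M = ∅ := by
  by_contra hne
  have hRΩ := h.reflectIn_mem_of_exitsAtContact hT (nonempty_iff_ne_empty.2 hne)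
  have hRcl : ∀ x ∈ closure Ω, reflectIn v T x ∈ closure Ω := fun x hx =>
    (show MapsTo (reflectIn v T) Ω Ω from hRΩ).closure (continuous_reflectIn v T) hx
  have hRf : ∀ x ∈ face Ω (hyperplane e c₁), reflectIn v T x ∈ face Ω (hyperplane e c₁) :=
    fun x hx => ⟨hRcl x hx.1, by
      have := hx.2
      rw [hyperplane, mem_ofPred_eq] at this ⊢
      rw [inner_reflectIn_of_orthogonal h.inner_eq, this]⟩
  have hcomp : IsCompact (face Ω (hyperplane e c₁)) :=
    (h.dom.isBounded.isCompact_closure).inter_right (isClosed_hyperplane e c₁)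
  have hvc : Continuous fun y : Amb n => ⟪v, y⟫ := by fun_prop
  obtain ⟨x, hx, hmax⟩ := hcomp.exists_isMaxOn h.dom.face_nonempty₁ hvc.continuousOn
  have hmax' : ∀ y ∈ face Ω (hyperplane e c₁), ⟪v, y⟫ ≤ ⟪v, x⟫ := fun y hy => hmax hy
  have h1 := hmax' _ (hRf x hx)
  rw [inner_reflectIn_self h.norm_v] at h1
  set m := ⟪v, x⟫ with hm
  -- This chord point has level `T + s - m`, and its mirror image has level `m + (T - s)`, above the
  -- maximum `m`.
  have h2 := h.face_cap c₁ (Or.inl rfl) x hx (2 * (m - s) - (T - s)) (by linarith) (by linarith)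
  have h3 := hmax' _ (hRf _ h2.1)
  rw [inner_reflectIn_self h.norm_v, inner_sub_right, inner_smul_right, h.inner_self_v, ← hm] at h3
  linarith

theorem _root_.ReflectsInto.reflectIn_mem_closure (hT : ReflectsInto v T Ω)
    {x : Amb n} (hx : x ∈ closure Ω) (hxT : T ≤ ⟪v, x⟫) : reflectIn v T x ∈ closure Ω := by
  rcases hxT.lt_or_eq with hxT | hxT
  · have hvc : Continuous fun y : Amb n => ⟪v, y⟫ := by fun_prop
    have h1 : x ∈ closure (Ω ∩ {y | T < ⟪v, y⟫}) := by
      rw [mem_closure_iff_frequently] at hx ⊢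
      exact hx.and_eventually ((isOpen_lt continuous_const hvc).mem_nhds hxT)
    exact (show MapsTo (reflectIn v T) (Ω ∩ {y | T < ⟪v, y⟫}) Ω from
      fun y hy => hT T le_rfl y hy.1 hy.2).closure (continuous_reflectIn v T) h1
  · rw [reflectIn_of_inner_eq hxT.symm]; exact hx

end SlabConfig

/-- Near `x` there are points of `Ω` which planes just left of level `T` reflect out of `Ω`. -/
def IsBadPoint (v : Amb n) (T : ℝ) (Ω : Set (Amb n)) (x : Amb n) : Prop :=
  ∃ᶠ z : ℝ × Amb n in 𝓝[<] T ×ˢ 𝓝 x, z.2 ∈ Ω ∧ z.1 < ⟪v, z.2⟫ ∧ reflectIn v z.1 z.2 ∉ Ω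

namespace IsBadPoint

variable {x q : Amb n}

theorem mem_closure (hb : IsBadPoint v T Ω x) : x ∈ closure Ω := by
  rw [mem_closure_iff_frequently]
  exact tendsto_snd.frequently (hb.mono fun z hz => hz.1)

theorem le_inner (hb : IsBadPoint v T Ω x) : T ≤ ⟪v, x⟫ := by
  by_contra! hlt
  have h1 : Tendsto (fun z : ℝ × Amb n => ⟪v, z.2⟫ - z.1) (𝓝[<] T ×ˢ 𝓝 x) (𝓝 (⟪v, x⟫ - T)) := by
    have hvc : Continuous fun y : Amb n => ⟪v, y⟫ := by fun_prop
    exact ((hvc.tendsto x).comp tendsto_snd).sub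
      ((tendsto_id'.2 nhdsWithin_le_nhds).comp tendsto_fst)
  obtain ⟨z, hz, hz'⟩ := (hb.and_eventually
    (h1.eventually (gt_mem_nhds (show ⟪v, x⟫ - T < 0 by linarith)))).exists
  linarith [hz.2.1]

theorem tendsto_reflectIn (v x : Amb n) (T : ℝ) :
    Tendsto (fun z : ℝ × Amb n => reflectIn v z.1 z.2) (𝓝[<] T ×ˢ 𝓝 x) (𝓝 (reflectIn v T x)) := by
  have hc : Continuous (fun z : ℝ × Amb n => reflectIn v z.1 z.2) := by unfold reflectIn; fun_prop
  have := hc.tendsto (T, x)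
  rw [nhds_prod_eq] at this
  exact this.mono_left (prod_mono nhdsWithin_le_nhds le_rfl)

theorem not_eventually (h : SlabConfig e v c₁ c₂ s Ω M Hf L) (hb : IsBadPoint v T Ω x) :
    ¬ ∀ᶠ w in 𝓝 (reflectIn v T x), w ∈ openSlab e c₁ c₂ → w ∈ Ω := by
  intro hev
  obtain ⟨z, hz, hz'⟩ := (hb.and_eventually ((tendsto_reflectIn v x T).eventually hev)).exists
  exact hz.2.2 (hz' ((h.reflectIn_mem_openSlab z.1).2 (h.dom.subset_openSlab h.norm_e hz.1)))

theorem notMem (h : SlabConfig e v c₁ c₂ s Ω M Hf L) (hb : IsBadPoint v T Ω x) :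
    reflectIn v T x ∉ Ω := fun hcon => hb.not_eventually h <| by
  filter_upwards [h.dom.isOpen.mem_nhds hcon] with w hw _ using hw

/-- On the plane of reflection, bad points require lines in the direction `v` to meet `M` twice. -/
theorem false_of_line (h : SlabConfig e v c₁ c₂ s Ω M Hf L) (hT : ReflectsInto v T Ω)
    (hb : IsBadPoint v T Ω q) (hq : ⟪v, q⟫ = T) {U : Set (Amb n)} (hU : U ∈ 𝓝 q)
    (hline : ∀ m ∈ U, m ∈ M → m ∈ openSlab e c₁ c₂ → ∀ τ : ℝ, 0 < τ → m + τ • v ∈ U →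
      m + τ • v ∉ M) : False := by
  obtain ⟨r, hr, hball⟩ := Metric.mem_nhds_iff.1 hU
  have hqR : reflectIn v T q = q := reflectIn_of_inner_eq hq
  have h1 := (tendsto_reflectIn v q T).eventually (by rw [hqR]; exact ball_mem_nhds q hr)
  obtain ⟨⟨t, x⟩, ⟨hx, htx, hout⟩, hRb, hxb⟩ := (hb.and_eventually (h1.and
    (tendsto_snd.eventually (ball_mem_nhds q hr)))).exists
  simp only at hx htx hout hRb hxb
  have hxS := h.dom.subset_openSlab h.norm_e hx
  have hc : Continuous fun t : ℝ => x + t • v := by fun_prop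
  have hRx : reflectIn v t x = x + (-(2 * (⟪v, x⟫ - t))) • v := by rw [reflectIn]; module
  have hsegball : ∀ α β : ℝ, x + α • v ∈ ball q r → x + β • v ∈ ball q r → ∀ σ ∈ Icc α β,
      x + σ • v ∈ ball q r := by
    intro α β hα hβ σ hσ
    rcases (hσ.1.trans hσ.2).eq_or_lt with heq | hlt
    · rwa [le_antisymm (hσ.2.trans heq.ge) hσ.1]
    have h2 := (convex_ball q r).add_smul_sub_mem hα hβ (t := (σ - α) / (β - α))
      ⟨div_nonneg (by linarith [hσ.1]) (by linarith), by
        rw [div_le_one (by linarith)]; linarith [hσ.2]⟩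
    rwa [show x + α • v + ((σ - α) / (β - α)) • (x + β • v - (x + α • v)) = x + σ • v by
      have h3 : (σ - α) / (β - α) * (β - α) = σ - α := div_mul_cancel₀ _ (by linarith)
      rw [add_sub_add_left_eq_sub, ← sub_smul, smul_smul, h3]; module] at h2
  have hx0 : x + (0 : ℝ) • v = x := by simp
  -- a boundary point left of `x`
  obtain ⟨σ, hσ, hσf⟩ : ∃ σ ∈ Icc (-(2 * (⟪v, x⟫ - t))) 0, x + σ • v ∈ frontier Ω := by
    by_contra! hcon
    have hI : IsPreconnected ((fun t : ℝ => x + t • v) '' Icc (-(2 * (⟪v, x⟫ - t))) 0) :=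
      isPreconnected_Icc.image _ hc.continuousOn
    have h0 : (0 : ℝ) ∈ Icc (-(2 * (⟪v, x⟫ - t))) 0 := ⟨by linarith, le_rfl⟩
    rcases subset_or_disjoint_of_frontier hI (Ω := Ω) (by
      rw [eq_empty_iff_forall_notMem]
      rintro y ⟨⟨σ, hσ, rfl⟩, hy⟩
      exact hcon σ hσ hy) with h2 | h2
    · apply hout
      rw [hRx]
      exact h2 ⟨_, left_mem_Icc.2 (by linarith), rfl⟩
    · exact h2 ⟨0, h0, rfl⟩ (by simpa using hx)
  have hσb : x + σ • v ∈ ball q r :=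
    hsegball _ 0 (by rw [← hRx]; exact hRb) (by rw [hx0]; exact hxb) σ hσ
  have hσΩ : x + σ • v ∉ Ω := by
    rw [h.dom.isOpen.frontier_eq] at hσf; exact hσf.2
  have hσS := (h.add_smul_mem_openSlab σ).2 hxS
  have hσM := (h.dom.mem_frontier_iff hσS).1 hσf
  have hσ0 : σ < 0 := lt_of_le_of_ne hσ.2 fun h0 => hσΩ (by rw [h0, hx0]; exact hx)
  -- the boundary point lies left of the plane
  rcases le_or_gt (2 * T) (2 * ⟪v, x⟫ + σ) with hcase | hcase
  · refine hσΩ ?_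
    -- The plane halfway between `x` and `x + σ • v`, still at level at least `T`, reflects `x` to
    -- the frontier point.
    have h2 := hT (⟪v, x⟫ + σ / 2) (by linarith) x hx (by linarith)
    convert h2 using 1
    rw [reflectIn]; module
  -- The mirror image of the frontier point at level `T` lies on the same line, beyond `x`. The line
  -- meets `M` no second time near `q`, so this mirror image is in `Ω`; reflecting it back puts the
  -- frontier point into `Ω`.
  set ρ := 2 * T - 2 * ⟪v, x⟫ - σ with hρ
  have hRσ : reflectIn v T (x + σ • v) = x + ρ • v := by
    rw [reflectIn, h.inner_v_add, hρ]; module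
  have hρb : x + ρ • v ∈ ball q r := by
    rw [← hRσ, mem_ball, ← hqR, dist_reflectIn h.norm_v]; exact hσb
  have hρΩ : x + ρ • v ∈ Ω := by
    have hI : IsPreconnected ((fun t : ℝ => x + t • v) '' Icc 0 ρ) :=
      isPreconnected_Icc.image _ hc.continuousOn
    rcases subset_or_disjoint_of_frontier hI (Ω := Ω) (by
      rw [eq_empty_iff_forall_notMem]
      rintro y ⟨⟨τ, hτ, rfl⟩, hy⟩
      have h3 := (h.dom.mem_frontier_iff ((h.add_smul_mem_openSlab τ).2 hxS)).1 hy
      have h4 : x + τ • v = (x + σ • v) + (τ - σ) • v := by module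
      refine hline _ (hball hσb) hσM hσS (τ - σ) (by linarith [hτ.1]) ?_ ?_
      · rw [← h4]
        exact hball (hsegball 0 ρ (by rw [hx0]; exact hxb) hρb τ hτ)
      · rw [← h4]; exact h3) with h2 | h2
    · exact h2 ⟨ρ, ⟨by linarith, le_rfl⟩, rfl⟩
    · exact absurd hx (by simpa using h2 ⟨0, ⟨le_rfl, by linarith⟩, rfl⟩)
  have h5 := hT T le_rfl _ hρΩ (by rw [h.inner_v_add]; linarith)
  rw [← hRσ, reflectIn_reflectIn h.norm_v] at h5
  exact hσΩ h5

/-- Strict differentiability bounds the increment of `φ` along `v` from below by half of its linear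
part, uniformly near `q`. -/
theorem exists_nhds_line {φ : Amb n → ℝ} {φ' : Amb n →L[ℝ] ℝ} (hφ : HasStrictFDerivAt φ φ' q)
    (hv : φ' v ≠ 0) (hv1 : ‖v‖ = 1) :
    ∃ U ∈ 𝓝 q, ∀ m ∈ U, φ m = 0 → ∀ τ : ℝ, 0 < τ → m + τ • v ∈ U → φ (m + τ • v) ≠ 0 := by
  have h1 := hφ.isLittleO.def (half_pos (abs_pos.2 hv))
  rw [nhds_prod_eq] at h1
  obtain ⟨U, hU, hU'⟩ := mem_prod_self_iff.1 h1
  refine ⟨U, hU, fun m hm hm0 τ hτ hmτ h0 => ?_⟩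
  have h2 : ‖φ (m + τ • v) - φ m - φ' (m + τ • v - m)‖ ≤ |φ' v| / 2 * ‖m + τ • v - m‖ :=
    hU' (mk_mem_prod hmτ hm)
  simp only [add_sub_cancel_left, map_smul, h0, hm0, norm_smul, hv1, smul_eq_mul, Real.norm_eq_abs,
    sub_zero, zero_sub, abs_neg, abs_mul, mul_one] at h2
  have h3 := abs_pos.2 hv
  have h4 : 0 < |τ| := abs_pos.2 hτ.ne'
  nlinarith

/-- Right of the plane, such a point is a contact point. On the plane, either `v` is tangent to `M`
and the Hopf lemma produces contact points, or `v` is transversal to `M` and `false_of_line`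
applies. -/
theorem notMem_openSlab (h : SlabConfig e v c₁ c₂ s Ω M Hf L) (hT : ReflectsInto v T Ω)
    (hs : s < T) (hb : IsBadPoint v T Ω x) : x ∉ openSlab e c₁ c₂ := by
  intro hxS
  have hcontact := h.contactSet_eq_empty hT hs
  have hx : x ∉ Ω := fun hx => by
    rcases hb.le_inner.lt_or_eq with h1 | h1
    · exact hb.notMem h (hT T le_rfl x hx h1)
    · exact hb.notMem h (by rw [reflectIn_of_inner_eq h1.symm]; exact hx)
  have hxM := h.dom.mem_of_closure hxS hb.mem_closure hx
  rcases hb.le_inner.lt_or_eq with h1 | h1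
  · have h2 : x ∈ contactSet e v c₁ c₂ T M := ⟨hxM, hxS, h1, h.dom.mem_of_closure
      ((h.reflectIn_mem_openSlab T).2 hxS) (hT.reflectIn_mem_closure hb.mem_closure h1.le)
      (hb.notMem h)⟩
    rw [hcontact] at h2
    exact h2
  · obtain ⟨N, G, hg⟩ := h.exists_isGoodGraph hxS hxM
    by_cases hNv : ⟪N, v⟫ = 0
    · have := h.contactSet_nonempty_of_isGoodGraph hT hg h1.symm hNv
      rw [hcontact] at this
      exact not_nonempty_empty this
    · obtain ⟨U, hU, hline⟩ := exists_nhds_line (v := v)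
        (isTangentGraph_hasStrictFDerivAt_graphFn hg.toIsTangentGraph)
        (by simpa using hNv) h.norm_v
      refine hb.false_of_line h hT h1.symm (inter_mem hU hg.mem_iff) fun m hm hmM _ τ hτ hmτ hM => ?_
      exact hline m hm.1 (sub_eq_zero.2 (hm.2.1 hmM)) τ hτ hmτ.1 (sub_eq_zero.2 (hmτ.2.1 hM))

end IsBadPoint

end MovingPlanes

/-! ### Curvature of flat graphs and arguments by density -/

section GraphCurvature

variable {n : ℕ}

theorem levelSetMeanCurvature_congr {φ ψ : Amb n → ℝ} {x : Amb n} (h : φ =ᶠ[𝓝 x] ψ) :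
    levelSetMeanCurvature φ x = levelSetMeanCurvature ψ x := by
  have h1 : (fun y => ‖gradient φ y‖⁻¹ • gradient φ y) =ᶠ[𝓝 x]
      fun y => ‖gradient ψ y‖⁻¹ • gradient ψ y := by
    filter_upwards [h.fderiv (𝕜 := ℝ)] with y hy
    simp only [gradient, hy]
  simp only [levelSetMeanCurvature, divergence, h1.fderiv_eq]

theorem levelSetMeanCurvature_graphFn_const {N : Amb n} (hN : ‖N‖ = 1) (c : ℝ) (x : Amb n) :
    levelSetMeanCurvature (graphFn N fun _ => c) x = 0 := by
  have h1 : fderiv ℝ (graphFn N fun _ => c) = fun _ => innerSL ℝ N := by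
    funext y; rw [fderiv_graphFn (differentiableAt_const c)]; simp
  have h2 : hess (graphFn N fun _ => c) x = 0 := by
    rw [hess, h1, fderiv_const_apply]
  rw [levelSetMeanCurvature_eq (ContDiffAt.graphFn contDiffAt_const)
    (gradient_graphFn_ne_zero hN (fun _ _ => rfl) (differentiableAt_const c)), h2]
  simp [mcForm, trForm]

theorem continuousAt_levelSetMeanCurvature_graphFn {N : Amb n} (hN : ‖N‖ = 1) {G : Amb n → ℝ}
    (hi : InvariantAlong N G) {x : Amb n} (hG : ContDiffAt ℝ 2 G x) :
    ContinuousAt (levelSetMeanCurvature (graphFn N G)) x :=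
  continuousAt_levelSetMeanCurvature hG.graphFn
    (gradient_graphFn_ne_zero hN hi (hG.differentiableAt (by norm_num)))

theorem invariantAlong_const (N : Amb n) (c : ℝ) : InvariantAlong N fun _ => c := fun _ _ => rfl

theorem Filter.Eventually.exists_column {P : Amb n → Prop} {y : Amb n}
    (h : ∀ᶠ x in 𝓝 y, P x) {e : Amb n} (he : ‖e‖ = 1) :
    ∃ δ > 0, ∀ᶠ x in 𝓝 y, ∀ t : ℝ, |t| < δ → P (x + t • e) := by
  obtain ⟨r, hr, hball⟩ := Metric.eventually_nhds_iff_ball.1 h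
  refine ⟨r / 2, half_pos hr, ?_⟩
  filter_upwards [ball_mem_nhds y (half_pos hr)] with x hx t ht
  apply hball
  rw [mem_ball] at hx ⊢
  have h1 : dist (x + t • e) x = |t| := by
    rw [dist_eq_norm, add_sub_cancel_left, norm_smul, he, mul_one, Real.norm_eq_abs]
  linarith [dist_triangle (x + t • e) x y]

theorem ContinuousAt.eq_zero_of_mem_closure {f : Amb n → ℝ} {x : Amb n} {A : Set (Amb n)}
    (hf : ContinuousAt f x) (hx : x ∈ closure A) (h : ∀ᶠ y in 𝓝 x, y ∈ A → f y = 0) : f x = 0 := by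
  by_contra hne
  obtain ⟨y, hy, h1, h2⟩ := ((mem_closure_iff_frequently.1 hx).and_eventually
    (h.and (hf.eventually_ne hne))).exists
  exact h2 (h1 hy)

end GraphCurvature

/-! ### The relative interior of the lower face -/

section Floor

variable {n : ℕ} {e v : Amb n} {c₁ c₂ s L T : ℝ} {Ω M : Set (Amb n)} {Hf : Amb n → ℝ}
  {y : Amb n} {G : Amb n → ℝ}

/-- Near the point `y` of the lower plane, `Ω` is the region between that plane and the graph of
`G`, which is contained in `M`. -/
structure IsLowerGraph (e : Amb n) (c₁ : ℝ) (Ω M : Set (Amb n)) (Hf : Amb n → ℝ) (y : Amb n)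
    (G : Amb n → ℝ) : Prop extends IsTangentGraph M y e G where
  inner_eq : ⟪e, y⟫ = c₁
  mem_domain_iff : ∀ᶠ x in 𝓝 y, x ∈ Ω ↔ c₁ < ⟪e, x⟫ ∧ ⟪e, x⟫ < G x
  pde : ∀ᶠ x in 𝓝 y, levelSetMeanCurvature (graphFn e G) x = -Hf (graphPt e G x)
  dense : ∀ᶠ x in 𝓝 y, x ∈ closure {z | c₁ < G z}

theorem graphPt_neg (N : Amb n) (G : Amb n → ℝ) (x : Amb n) :
    graphPt (-N) (fun z => -G z) x = graphPt N G x := by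
  simp only [graphPt, inner_neg_left]; module

namespace SlabConfig

theorem inner_self_e (h : SlabConfig e v c₁ c₂ s Ω M Hf L) : ⟪e, e⟫ = 1 := by
  rw [real_inner_self_eq_norm_sq, h.norm_e]; norm_num

theorem inner_e_add (h : SlabConfig e v c₁ c₂ s Ω M Hf L) (x : Amb n) (t : ℝ) :
    ⟪e, x + t • e⟫ = ⟪e, x⟫ + t := by
  rw [inner_add_right, inner_smul_right, h.inner_self_e, mul_one]

theorem eventually_lt_top (h : SlabConfig e v c₁ c₂ s Ω M Hf L) (hy : ⟪e, y⟫ = c₁) :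
    ∀ᶠ x in 𝓝 y, ⟪e, x⟫ < c₂ := by
  have hc : Continuous fun x : Amb n => ⟪e, x⟫ := by fun_prop
  exact (isOpen_lt hc continuous_const).mem_nhds (by rw [mem_ofPred_eq, hy]; exact h.lt)

theorem eventually_mem_or_eq (h : SlabConfig e v c₁ c₂ s Ω M Hf L) (hy : ⟪e, y⟫ = c₁) :
    ∀ᶠ x in 𝓝 y, x ∈ frontier Ω → x ∈ M ∨ ⟪e, x⟫ = c₁ := by
  filter_upwards [h.eventually_lt_top hy] with x hx hf
  rw [h.dom.frontier_eq] at hf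
  rcases hf with (hf | hf) | hf
  · exact Or.inl hf
  · exact Or.inr hf.2
  · exact absurd hf.2 hx.ne

theorem eventually_mem_of_above_plane (h : SlabConfig e v c₁ c₂ s Ω M Hf L) (hy : ⟪e, y⟫ = c₁)
    (hcl : y ∈ closure Ω) (hfr : ∀ᶠ x in 𝓝 y, c₁ < ⟪e, x⟫ → x ∉ frontier Ω) :
    ∀ᶠ x in 𝓝 y, c₁ < ⟪e, x⟫ → x ∈ Ω := by
  refine (eventually_mem_or_notMem_of_above (G := fun _ => c₁) h.norm_e (invariantAlong_const e c₁)
    (Eventually.of_forall fun _ => continuousAt_const) hy.symm hfr).resolve_right fun h1 => ?_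
  obtain ⟨x, hx, hx'⟩ := ((mem_closure_iff_frequently.1 hcl).and_eventually h1).exists
  exact hx' (h.dom.subset_openSlab h.norm_e hx).1 hx

theorem eventually_mem_closure_of_face (hy : y ∈ face Ω (hyperplane e c₁)) (hyΓ : y ∉ faceBoundaries e c₁ c₂ Ω) :
    ∀ᶠ x in 𝓝 y, ⟪e, x⟫ = c₁ → x ∈ closure Ω := by
  have h1 : y ∉ closure (hyperplane e c₁ \ face Ω (hyperplane e c₁)) := fun h1 =>
    hyΓ (Or.inl ⟨subset_closure hy, h1⟩)
  filter_upwards [isClosed_closure.isOpen_compl.mem_nhds h1] with x hx hxc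
  by_contra hcon
  exact hx (subset_closure ⟨hxc, fun h2 => hcon h2.1⟩)

theorem continuousAt_comp_graphPt (h : SlabConfig e v c₁ c₂ s Ω M Hf L) {N x : Amb n}
    (hG : ContinuousAt G x) (hM : ∀ᶠ z in 𝓝 x, graphPt N G z ∈ M) :
    ContinuousAt (fun z => Hf (graphPt N G z)) x := by
  have h1 : ContinuousAt (graphPt N G) x := by
    unfold graphPt
    exact continuousAt_id.add (ContinuousAt.smul (hG.sub
      (continuousAt_const.inner continuousAt_id)) continuousAt_const)
  have h2 : ContinuousAt (fun z => L * |⟪e, graphPt N G z⟫ - ⟪e, graphPt N G x⟫|) x :=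
    continuousAt_const.mul ((continuousAt_const.inner h1).sub continuousAt_const).abs
  have h3 := h2.tendsto
  rw [sub_self, abs_zero, mul_zero] at h3
  refine tendsto_iff_dist_tendsto_zero.2 (squeeze_zero' (Eventually.of_forall fun _ => dist_nonneg)
    ?_ h3)
  filter_upwards [hM] with z hz
  rw [Real.dist_eq]
  exact h.lip _ (h.dom.mem_closure_of_mem hz) _ (h.dom.mem_closure_of_mem hM.self_of_nhds)

/-- At a point of `M` in the interior of the lower face, `M` is tangent to the plane. -/
theorem exists_isTangentGraph_floor (h : SlabConfig e v c₁ c₂ s Ω M Hf L) (hy : ⟪e, y⟫ = c₁)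
    (hyM : y ∈ M) (hyΓ : y ∉ faceBoundaries e c₁ c₂ Ω) : ∃ G, IsTangentGraph M y e G := by
  obtain ⟨N, G, hg⟩ := (h.interior_point y ⟨hyM, hyΓ⟩).exists_isTangentGraph
  have hN0 : (innerSL ℝ N : Amb n →L[ℝ] ℝ) ≠ 0 := fun h => by
    have := congrArg (fun l : Amb n →L[ℝ] ℝ => l N) h
    simp [hg.norm_eq] at this
  have he : HasStrictFDerivAt (fun x : Amb n => ⟪e, x⟫ - c₁) (innerSL ℝ e) y :=
    (innerSL ℝ e).hasStrictFDerivAt.sub_const c₁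
  obtain ⟨c, hc⟩ := exists_smul_eq_of_nonneg_on_zeroSet he
    (isTangentGraph_hasStrictFDerivAt_graphFn hg) (by rw [graphFn, hg.apply_eq, sub_self])
    (by rw [hy, sub_self]) (by
      filter_upwards [hg.mem_iff] with x hx hx0
      have h1 := h.dom.closure_subset (h.dom.mem_closure_of_mem (hx.2 (sub_eq_zero.1 hx0)))
      exact sub_nonneg.2 h1.1) hN0
  have hcN : e = c • N := by
    refine ext_inner_right ℝ fun ξ => ?_
    have := congrArg (fun l : Amb n →L[ℝ] ℝ => l ξ) hc
    simpa [inner_smul_left] using this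
  have hc1 : |c| = 1 := by
    have := h.norm_e
    rwa [hcN, norm_smul, hg.norm_eq, mul_one, Real.norm_eq_abs] at this
  rcases (abs_eq zero_le_one).1 hc1 with rfl | rfl
  · rw [one_smul] at hcN
    exact ⟨G, hcN ▸ hg⟩
  · rw [neg_smul, one_smul] at hcN
    exact ⟨_, hcN ▸ hg.neg⟩

/-- In the interior of the lower face, either `Ω` fills a half ball, or it lies below a graph. -/
theorem half_ball_or_isLowerGraph (h : SlabConfig e v c₁ c₂ s Ω M Hf L)
    (hy : y ∈ face Ω (hyperplane e c₁)) (hyΓ : y ∉ faceBoundaries e c₁ c₂ Ω) :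
    (∀ᶠ x in 𝓝 y, c₁ < ⟪e, x⟫ → x ∈ Ω) ∨ ∃ G, IsLowerGraph e c₁ Ω M Hf y G := by
  have hye : ⟪e, y⟫ = c₁ := hy.2
  have hfr := h.eventually_mem_or_eq hye
  by_cases hyM : y ∉ M
  · left
    refine h.eventually_mem_of_above_plane hye hy.1 ?_
    filter_upwards [hfr, h.isCompact.isClosed.isOpen_compl.mem_nhds hyM] with x hx hxM hxe hxf
    rcases hx hxf with h1 | h1
    · exact hxM h1
    · exact hxe.ne' h1
  rw [not_not] at hyM
  obtain ⟨G, hg⟩ := h.exists_isTangentGraph_floor hye hyM hyΓ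
  have he := h.norm_e
  have hcont := hg.contDiffAt.eventually_continuousAt
  have hC2 := hg.contDiffAt.eventually (by norm_num)
  have hnn : ∀ᶠ x in 𝓝 y, c₁ ≤ G x := by
    filter_upwards [hg.eventually_graphPt_mem] with x hx
    have := (h.dom.closure_subset (h.dom.mem_closure_of_mem hx)).1
    rwa [inner_graphPt he] at this
  have hGe : ∀ x (t : ℝ), G (x + t • e) = G x := hg.inv
  have hface := eventually_mem_closure_of_face hy hyΓ
  -- the foot of a point near `y`
  have hfoot : ∀ x, ⟪e, x + (c₁ - ⟪e, x⟫) • e⟫ = c₁ := fun x => by rw [h.inner_e_add]; ring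
  -- The vertical segment from `x` down to the face meets no frontier above the plane. If it were
  -- outside `Ω`, consider its foot: it is in the closure of `Ω`, and near it the frontier lies in
  -- the plane, so `Ω` fills the space just above the foot. This is a contradiction.
  have hunder : ∀ᶠ x in 𝓝 y, c₁ < ⟪e, x⟫ → ⟪e, x⟫ < G x → x ∈ Ω := by
    obtain ⟨δ, hδ, hcol⟩ := ((hg.mem_iff.and hfr).eventually_nhds.and (hface.and hcont)).exists_column
      (e := e) he
    have hc : Continuous fun x : Amb n => |⟪e, x⟫ - c₁| := by fun_prop
    filter_upwards [hcol, hc.continuousAt.eventually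
      (gt_mem_nhds (show |⟪e, y⟫ - c₁| < δ by rw [hye, sub_self, abs_zero]; exact hδ))]
      with x hx hxδ hx1 hx2
    set a := ⟪e, x⟫ - c₁ with ha
    have ha0 : 0 < a := sub_pos.2 hx1
    rw [abs_of_pos ha0] at hxδ
    have hcl : Continuous fun t : ℝ => x + t • e := by fun_prop
    have hI : IsPreconnected ((fun t : ℝ => x + t • e) '' Ioc (-a) 0) :=
      isPreconnected_Ioc.image _ hcl.continuousOn
    rcases subset_or_disjoint_of_frontier hI (Ω := Ω) (by
      rw [eq_empty_iff_forall_notMem]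
      rintro z ⟨⟨t, ht, rfl⟩, hz⟩
      have h1 := (hx t (by rw [abs_of_nonpos ht.2]; linarith [ht.1])).1.self_of_nhds
      have h2 := h.inner_e_add x t
      rcases h1.2 hz with h3 | h3
      · have h4 := h1.1.1 h3
        rw [hGe, h2] at h4
        linarith [ht.2]
      · rw [h2] at h3
        linarith [ht.1]) with h1 | h1
    · exact h1 ⟨0, ⟨by linarith, le_rfl⟩, by simp⟩
    · exfalso
      have h2 := hx (-a) (by rw [abs_neg, abs_of_pos ha0]; exact hxδ)
      have h3 : ⟪e, x + (-a) • e⟫ = c₁ := by rw [h.inner_e_add, ha]; ring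
      have h4 : ∀ᶠ z in 𝓝 (x + (-a) • e), ⟪e, z⟫ < G z := by
        have hec : ContinuousAt (fun x : Amb n => ⟪e, x⟫) (x + (-a) • e) := by fun_prop
        exact hec.eventually_lt h2.2.2 (by rw [h3, hGe]; linarith)
      have h5 := h.eventually_mem_of_above_plane h3 (h2.2.1 h3) (by
        filter_upwards [h2.1, h4] with z hz1 hz2 hz3 hz4
        rcases hz1.2 hz4 with h5 | h5
        · exact hz2.ne (hz1.1.1 h5)
        · exact hz3.ne' h5)
      have ht := (tendsto_add_smul (x + (-a) • e) e).mono_left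
        (nhdsWithin_le_nhds (s := Ioi (0 : ℝ)))
      obtain ⟨t, ht1, ht2⟩ := ((ht.eventually h5).and (Ioo_mem_nhdsGT ha0)).exists
      have h6 := ht1 (by rw [h.inner_e_add, h3]; linarith [ht2.1])
      rw [add_assoc, ← add_smul] at h6
      exact h1 ⟨-a + t, ⟨by linarith [ht2.1], by linarith [ht2.2]⟩, rfl⟩ h6
  have habove := eventually_mem_or_notMem_of_above he hg.inv hcont hg.apply_eq (Ω := Ω) (by
    filter_upwards [hfr, hg.mem_iff, hnn] with x h1 h2 h3 h4 h5
    rcases h1 h5 with h6 | h6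
    · exact h4.ne' (h2.1 h6)
    · linarith)
  have hS : ∀ᶠ x in 𝓝 y, c₁ < G x → graphPt e G x ∈ openSlab e c₁ c₂ := by
    filter_upwards [hg.tendsto_graphPt.eventually (h.eventually_lt_top hye)] with x hx hx'
    exact ⟨by rwa [inner_graphPt he], hx⟩
  -- the mean curvature where `Ω` lies below the graph
  have hbelow : ∀ᶠ x in 𝓝 y, c₁ < G x →
      levelSetMeanCurvature (graphFn e G) x = -Hf (graphPt e G x) := by
    filter_upwards [hS, hg.tendsto_graphPt.eventually (hunder.eventually_nhds.and
      (hC2.and hg.mem_iff.eventually_nhds))] with x h1 ⟨h2, h3, h4⟩ hx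
    rw [← levelSetMeanCurvature_graphPt he hg.inv]
    have h5 : G (graphPt e G x) = ⟪e, graphPt e G x⟫ := by rw [hg.inv.graphPt, inner_graphPt he]
    have hec : ContinuousAt (fun x : Amb n => ⟪e, x⟫) (graphPt e G x) := by fun_prop
    refine h.mc.eq_of_below he hg.inv h3 h5 h4 (notMem_faceBoundaries (h1 hx)) ?_
    filter_upwards [h2, hec.eventually (lt_mem_nhds (h1 hx).1)] with z h6 h7 h8 using h6 h7 h8
  rcases habove with habove | habove
  · left
    -- With `Ω` on both sides of the graph, the inward curvature is prescribed for both normals, so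
    -- it is zero. Then `G` is minimal, lies above the plane and touches it, and must be flat.
    have hzero : ∀ᶠ x in 𝓝 y, c₁ < G x → levelSetMeanCurvature (graphFn e G) x = 0 := by
      filter_upwards [hS, hbelow, hg.tendsto_graphPt.eventually (habove.eventually_nhds.and
        (hC2.and hg.mem_iff.eventually_nhds))] with x h1 h6 ⟨h2, h3, h4⟩ hx
      have h5 : G (graphPt e G x) = ⟪e, graphPt e G x⟫ := by
        rw [hg.inv.graphPt, inner_graphPt he]
      have h7 := h.mc.eq_of_above he hg.inv h3 h5 h4 (notMem_faceBoundaries (h1 hx)) h2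
      rw [levelSetMeanCurvature_graphPt he hg.inv] at h7
      linarith [h6 hx]
    have hzero' : ∀ᶠ x in 𝓝 y, levelSetMeanCurvature (graphFn e G) x = 0 := by
      filter_upwards [hzero.eventually_nhds, hnn.eventually_nhds, hC2] with x h1 h2 h3
      -- At limits of points with `c₁ < G` the curvature vanishes by continuity; elsewhere `G` is
      -- locally the constant `c₁`.
      by_cases hx : x ∈ closure {z | c₁ < G z}
      · exact (continuousAt_levelSetMeanCurvature_graphFn he hg.inv h3).eq_zero_of_mem_closure hx h1
      · have h4 : ∀ᶠ z in 𝓝 x, G z = c₁ := by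
          filter_upwards [h2, isClosed_closure.isOpen_compl.mem_nhds hx] with z hz1 hz2
          exact le_antisymm (not_lt.1 fun h5 => hz2 (subset_closure h5)) hz1
        have h5 : graphFn e G =ᶠ[𝓝 x] graphFn e fun _ => c₁ := by
          filter_upwards [h4] with z hz
          simp only [graphFn, hz]
        rw [levelSetMeanCurvature_congr h5, levelSetMeanCurvature_graphFn_const he]
    have heq := eventually_eq_of_touching h.hn he hg.inv (invariantAlong_const e c₁) hg.contDiffAt
      contDiffAt_const hg.fderiv_eq (by simp) (by rw [hg.apply_eq, hye]) le_rfl (by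
        filter_upwards [hnn, hzero'] with x h1 h2
        refine ⟨h1, ?_⟩
        rw [h2, levelSetMeanCurvature_graphFn_const he]; simp)
    filter_upwards [habove, heq] with x h1 h2 h3
    exact h1 (by rw [h2]; exact h3)
  · right
    have hdom : ∀ᶠ x in 𝓝 y, x ∈ Ω ↔ c₁ < ⟪e, x⟫ ∧ ⟪e, x⟫ < G x := by
      filter_upwards [hunder, habove, hg.mem_iff] with x h1 h2 h3
      refine ⟨fun hx => ⟨(h.dom.subset_openSlab he hx).1, ?_⟩, fun hx => h1 hx.1 hx.2⟩
      by_contra! hle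
      rcases hle.lt_or_eq with h4 | h4
      · exact h2 h4 hx
      · exact h.dom.notMem_of_mem (h3.2 h4.symm) hx
    -- Plane points near `y` are limits of points of `Ω`, over which `G` exceeds `c₁`; invariance
    -- along `e` moves this to every height.
    have hdense : ∀ᶠ x in 𝓝 y, x ∈ closure {z | c₁ < G z} := by
      have hfc : Tendsto (fun x => x + (c₁ - ⟪e, x⟫) • e) (𝓝 y) (𝓝 y) := by
        have : Continuous (fun x => x + (c₁ - ⟪e, x⟫) • e) := by fun_prop
        have := this.tendsto y
        simpa [hye] using this
      filter_upwards [hfc.eventually (hface.and hdom.eventually_nhds)] with x ⟨h1, h2⟩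
      have h3 : x + (c₁ - ⟪e, x⟫) • e ∈ closure {z | c₁ < G z} := by
        have h4 := h1 (hfoot x)
        rw [mem_closure_iff_frequently] at h4 ⊢
        refine (h4.and_eventually h2).mono fun z hz => ?_
        have := hz.2.1 hz.1
        exact this.1.trans this.2
      have h5 : MapsTo (fun z => z + (⟪e, x⟫ - c₁) • e) {z | c₁ < G z} {z | c₁ < G z} :=
        fun z hz => by rw [mem_ofPred_eq, hGe]; exact hz
      have h6 := h5.closure (by fun_prop) h3
      convert h6 using 1
      module
    refine ⟨G, { hg with
      inner_eq := hye
      mem_domain_iff := hdom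
      dense := hdense
      pde := ?_ }⟩
    filter_upwards [hbelow.eventually_nhds, hdense, hC2, hg.eventually_graphPt_mem.eventually_nhds]
      with x h1 h2 h3 h4
    have h5 := ((continuousAt_levelSetMeanCurvature_graphFn he hg.inv h3).add
      (h.continuousAt_comp_graphPt h3.continuousAt h4)).eq_zero_of_mem_closure h2 (by
        filter_upwards [h1] with z hz hz'
        simp only [Pi.add_apply, hz hz', neg_add_cancel])
    simp only [Pi.add_apply] at h5
    linarith

end SlabConfig

/-- Seen upside down, `Ω` lies above the graph of `-G`, so the Hopf argument on the plane of
reflection also applies on the face. -/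
theorem IsLowerGraph.isGoodGraph (hg : IsLowerGraph e c₁ Ω M Hf y G)
    (h : SlabConfig e v c₁ c₂ s Ω M Hf L) :
    IsGoodGraph e c₁ c₂ Ω M Hf y (-e) (fun x => -G x) :=
  { hg.toIsTangentGraph.neg with
    above := by
      filter_upwards [hg.mem_domain_iff] with x hx h1 h2
      rw [inner_neg_left, neg_lt_neg_iff] at h1
      exact hx.2 ⟨h2.1, h1⟩
    pde := by
      filter_upwards [hg.pde] with x hx
      rw [graphFn_neg, levelSetMeanCurvature_neg, hx, graphPt_neg, neg_neg]
    dense := by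
      have h1 := hg.contDiffAt.continuousAt.eventually (gt_mem_nhds (show G y < c₂ by
        rw [hg.apply_eq, hg.inner_eq]; exact h.lt))
      filter_upwards [hg.dense, h1.eventually_nhds] with x hx h2
      rw [mem_closure_iff_frequently] at hx ⊢
      refine (hx.and_eventually h2).mono fun z hz => ?_
      rw [mem_ofPred_eq, graphPt_neg, openSlab, mem_ofPred_eq, inner_graphPt hg.norm_eq]
      exact hz }

/-- A piece of `M` over the reflection of a lower graph, tangent to the plane, produces contact
points. -/
theorem IsLowerGraph.contactSet_nonempty (h : SlabConfig e v c₁ c₂ s Ω M Hf L)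
    (hT : ReflectsInto v T Ω) {x : Amb n} (hxT : T < ⟪v, x⟫)
    (hg : IsLowerGraph e c₁ Ω M Hf (reflectIn v T x) G) {g : Amb n → ℝ}
    (hi : InvariantAlong e g) (hC2 : ContDiffAt ℝ 2 g x) (hgx : g x = c₁) (hdg : fderiv ℝ g x = 0)
    {O : Set (Amb n)} (hgM : ∀ᶠ z in 𝓝 x, z ∈ O → graphPt e g z ∈ M)
    (hpde : ∀ᶠ z in 𝓝 x, z ∈ O →
      levelSetMeanCurvature (graphFn e g) z = -Hf (graphPt e g z))
    {ν : Amb n} (hν : ‖ν‖ = 1) (hball : ∀ᶠ r in 𝓝[>] (0 : ℝ), ball (x + r • ν) r ⊆ O) :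
    (contactSet e v c₁ c₂ T M).Nonempty := by
  have hv := h.norm_v
  have he := h.norm_e
  set R := reflectIn v T with hR
  have hRR : ∀ y, R (R y) = y := reflectIn_reflectIn hv T
  have hRc : Continuous R := continuous_reflectIn v T
  have hRt : Tendsto R (𝓝 x) (𝓝 (R x)) := hRc.tendsto x
  have hRe : ∀ z, ⟪e, R z⟫ = ⟪e, z⟫ := inner_reflectIn_of_orthogonal h.inner_eq T
  have hve : ⟪v, e⟫ = 0 := by rw [real_inner_comm]; exact h.inner_eq
  have hvg : ∀ z, ⟪v, graphPt e g z⟫ = ⟪v, z⟫ := fun z => by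
    rw [graphPt, inner_add_right, inner_smul_right, hve, mul_zero, add_zero]
  have hxe : ⟪e, x⟫ = c₁ := by rw [← hRe]; exact hg.inner_eq
  have hiR : InvariantAlong e (fun z => G (R z)) := fun z t => by
    simp only [hR, reflectIn_add_smul h.inner_eq, hg.inv _ t]
  have hcR : ContDiffAt ℝ 2 (fun z => G (R z)) x :=
    hg.contDiffAt.comp x (contDiff_reflectIn v T).contDiffAt
  have hdR : fderiv ℝ (fun z => G (R z)) x = 0 := by
    have h1 : HasFDerivAt G (0 : Amb n →L[ℝ] ℝ) (R x) := by
      rw [← hg.fderiv_eq]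
      exact (hg.contDiffAt.differentiableAt (by norm_num)).hasFDerivAt
    have h2 := (h1.comp x (hasFDerivAt_reflectIn v T x)).fderiv
    have h3 : fderiv ℝ (fun z => G (R z)) x = _ := h2
    rw [h3, ContinuousLinearMap.zero_comp]
  have hGRx : G (R x) = c₁ := by rw [hg.apply_eq, hg.inner_eq]
  have hvc : Continuous fun y : Amb n => ⟪v, y⟫ := by fun_prop
  have hgt : Tendsto (graphPt e g) (𝓝 x) (𝓝 x) :=
    tendsto_graphPt hC2.continuousAt (by rw [hgx, hxe])
  have hclos : ∀ᶠ w in 𝓝 (R x), w ∈ closure Ω → ⟪e, w⟫ ≤ G w := by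
    filter_upwards [hg.mem_domain_iff.eventually_nhds,
      hg.contDiffAt.eventually_continuousAt] with w h1 h2 h3
    by_contra! h4
    have hec : ContinuousAt (fun x : Amb n => ⟪e, x⟫) w := by fun_prop
    obtain ⟨z, hz, h5, h6⟩ := ((mem_closure_iff_frequently.1 h3).and_eventually
      (h1.and (h2.eventually_lt hec h4))).exists
    exact h6.not_gt (h5.1 hz).2
  -- Mirror images of points of `M` right of the plane lie in the closure of `Ω`, hence under the
  -- graph of `G`.
  have hle : ∀ᶠ z in 𝓝 x, z ∈ O → g z ≤ G (R z) := by
    filter_upwards [hgM, (hRt.comp hgt).eventually hclos,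
      (isOpen_lt continuous_const hvc).mem_nhds hxT] with z h1 h2 h3 hz
    have h4 := h2 (hT.reflectIn_mem_closure (h.dom.mem_closure_of_mem (h1 hz))
      (by rw [hvg]; exact le_of_lt h3))
    simp only [Function.comp_apply, hRe, inner_graphPt he] at h4
    rw [show G (R (graphPt e g z)) = G (R z) from hiR z _] at h4
    exact h4
  have hcmp := exists_ball_eq_of_touching (S := O) h.hn he hiR hi hcR hC2 hdR hdg
    (by simp only [hGRx, hgx]) h.nonneg (by
      filter_upwards [hle, hgM, hpde, hRt.eventually hg.pde, hRt.eventually hg.eventually_graphPt_mem,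
        hRt.eventually (hg.contDiffAt.eventually (by norm_num))] with z h1 h2 h3 h4 h5 h6 hz
      refine ⟨h1 hz, ?_⟩
      have h7 : graphFn e (fun z => G (R z)) = fun z => graphFn e G (R z) := by
        funext y; simp only [graphFn, hRe]
      rw [h7, levelSetMeanCurvature_comp_reflectIn hv (ContDiffAt.graphFn h6)
        (gradient_graphFn_ne_zero he hg.inv (h6.differentiableAt (by norm_num))), h4, h3 hz,
        neg_sub_neg, abs_sub_comm]
      refine (h.lip _ (h.dom.mem_closure_of_mem h5) _ (h.dom.mem_closure_of_mem (h2 hz))).trans ?_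
      rw [inner_graphPt he, inner_graphPt he]) hν hball
  have hdense : ∀ᶠ z in 𝓝 x, z ∈ closure {w | c₁ < G (R w)} := by
    filter_upwards [hRt.eventually hg.dense] with z hz
    have h1 : MapsTo R {w | c₁ < G w} {w | c₁ < G (R w)} := fun w hw => by
      rw [mem_ofPred_eq, hRR]; exact hw
    have h2 := h1.closure hRc hz
    rwa [hRR] at h2
  have hev : ∀ᶠ z in 𝓝 x, (z ∈ O → graphPt e g z ∈ M) ∧ graphPt e G (R z) ∈ M ∧
      ⟪e, graphPt e g z⟫ < c₂ ∧ T < ⟪v, z⟫ :=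
    hgM.and ((hRt.eventually hg.eventually_graphPt_mem).and
      ((hgt.eventually (h.eventually_lt_top hxe)).and
        ((isOpen_lt continuous_const hvc).mem_nhds hxT)))
  have ht := (tendsto_add_smul x ν).mono_left (nhdsWithin_le_nhds (s := Ioi (0 : ℝ)))
  have hpos : ∀ᶠ r in 𝓝[>] (0 : ℝ), 0 < r := self_mem_nhdsWithin
  obtain ⟨r, hr, hr0, hrO, hr1, hr2⟩ := (hcmp.and (hpos.and (hball.and
    ((ht.eventually hev.eventually_nhds).and (ht.eventually hdense))))).exists
  have hb : ∀ᶠ z in 𝓝 (x + r • ν), z ∈ ball (x + r • ν) r := ball_mem_nhds _ hr0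
  obtain ⟨z, hzG, hzb, hz1, hz2, hz3, hz4⟩ := ((mem_closure_iff_frequently.1 hr2).and_eventually
    (hb.and hr1)).exists
  have hzeq : G (R z) = g z := hr z hzb
  have hzG' : c₁ < G (R z) := hzG
  have hRg : R (graphPt e g z) = graphPt e G (R z) := by
    rw [graphPt, hR, reflectIn_add_smul h.inner_eq, graphPt, ← hR, hRe, hzeq]
  refine ⟨graphPt e g z, hz1 (hrO hzb), ⟨?_, hz3⟩, by rw [hvg]; exact hz4, ?_⟩
  · rw [inner_graphPt he, ← hzeq]; exact hzG'
  · rw [← hR, hRg]; exact hz2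

namespace IsBadPoint

variable {x : Amb n}

theorem not_half_ball (h : SlabConfig e v c₁ c₂ s Ω M Hf L) (hb : IsBadPoint v T Ω x) :
    ¬ ∀ᶠ w in 𝓝 (reflectIn v T x), c₁ < ⟪e, w⟫ → w ∈ Ω := fun h1 =>
  hb.not_eventually h (h1.mono fun _ hw hwS => hw hwS.1)

/-- A bad point in the interior of the lower face lies right of the plane of reflection. -/
theorem lt_inner_of_face (h : SlabConfig e v c₁ c₂ s Ω M Hf L) (hT : ReflectsInto v T Ω)
    (hs : s < T) (hb : IsBadPoint v T Ω x) (hx : x ∈ face Ω (hyperplane e c₁))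
    (hxΓ : x ∉ faceBoundaries e c₁ c₂ Ω) : T < ⟪v, x⟫ := by
  refine hb.le_inner.lt_of_ne fun heq => ?_
  have hRx : reflectIn v T x = x := reflectIn_of_inner_eq heq.symm
  rcases h.half_ball_or_isLowerGraph hx hxΓ with h1 | ⟨G, hG⟩
  · exact hb.not_half_ball h (by rw [hRx]; exact h1)
  · have := h.contactSet_nonempty_of_isGoodGraph hT (hG.isGoodGraph h) heq.symm
      (by rw [inner_neg_left, h.inner_eq, neg_zero])
    rw [h.contactSet_eq_empty hT hs] at this
    exact not_nonempty_empty this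

/-- The reflection of a bad point of the lower face lies on a lower graph. -/
theorem exists_isLowerGraph_reflectIn (h : SlabConfig e v c₁ c₂ s Ω M Hf L)
    (hs : s < T) (hb : IsBadPoint v T Ω x) (hx : x ∈ face Ω (hyperplane e c₁))
    (hxT : T < ⟪v, x⟫) : ∃ G, IsLowerGraph e c₁ Ω M Hf (reflectIn v T x) G := by
  have h1 := h.face_cap c₁ (Or.inl rfl) x hx (2 * (⟪v, x⟫ - T)) (by linarith) (by linarith)
  refine (h.half_ball_or_isLowerGraph (y := reflectIn v T x) h1.1 ?_).resolve_left
    (hb.not_half_ball h)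
  rintro (h2 | h2)
  · exact h1.2 h2
  · exact h.lt.ne (h1.1.2.symm.trans (relBoundary_face_subset _ _ _ h2).2)

/-- A half ball of `Ω` at `x` would be reflected to one at the mirror image, where there is a lower
graph that allows no half ball. A lower graph at `x` would touch the reflection of the one at the
mirror image and give contact points. -/
theorem mem_faceBoundaries (h : SlabConfig e v c₁ c₂ s Ω M Hf L) (hT : ReflectsInto v T Ω)
    (hs : s < T) (hb : IsBadPoint v T Ω x) (hx : x ∈ face Ω (hyperplane e c₁)) :
    x ∈ faceBoundaries e c₁ c₂ Ω := by
  by_contra hxΓ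
  have hxT := hb.lt_inner_of_face h hT hs hx hxΓ
  obtain ⟨G, hG⟩ := hb.exists_isLowerGraph_reflectIn h hs hx hxT
  have hRR : reflectIn v T (reflectIn v T x) = x := reflectIn_reflectIn h.norm_v T x
  rcases h.half_ball_or_isLowerGraph hx hxΓ with h1 | ⟨g, hg⟩
  · refine hb.not_half_ball h ?_
    have h2 : Tendsto (reflectIn v T) (𝓝 (reflectIn v T x)) (𝓝 x) := by
      have := (continuous_reflectIn v T).tendsto (reflectIn v T x)
      rwa [hRR] at this
    have hvc : Continuous fun y : Amb n => ⟪v, y⟫ := by fun_prop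
    filter_upwards [h2.eventually h1, h2.eventually ((isOpen_lt continuous_const hvc).mem_nhds hxT)]
      with w h3 h4 h5
    have h6 := hT T le_rfl _ (h3 (by rwa [inner_reflectIn_of_orthogonal h.inner_eq])) h4
    rwa [reflectIn_reflectIn h.norm_v] at h6
  · have := hG.contactSet_nonempty h hT hxT hg.inv hg.contDiffAt
      (by rw [hg.apply_eq, hg.inner_eq]) hg.fderiv_eq (O := univ)
      (hg.eventually_graphPt_mem.mono fun _ hz _ => hz) (hg.pde.mono fun _ hz _ => hz) h.norm_v
      (Eventually.of_forall fun _ => subset_univ _)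
    rw [h.contactSet_eq_empty hT hs] at this
    exact not_nonempty_empty this

end IsBadPoint

end Floor

/-! ### Touching balls and second-order conditions -/

section Calculus

variable {n : ℕ} {q : Amb n}

/-- The interior ball condition. In the ball, `‖x - q‖² < 2 r ⟪ν, x - q⟫`, so for small `r` the
quadratic Taylor error is smaller than the linear term. -/
theorem eventually_ball_subset_pos {ψ : Amb n → ℝ} (hψ : ContDiffAt ℝ 2 ψ q) (h0 : ψ q = 0)
    {ν : Amb n} (hν : ‖ν‖ = 1) {a : ℝ} (ha : 0 < a) (hd : fderiv ℝ ψ q = a • innerSL ℝ ν) :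
    ∀ᶠ r in 𝓝[>] (0 : ℝ), ball (q + r • ν) r ⊆ {x | 0 < ψ x} := by
  obtain ⟨K, t, ht, hLip⟩ :=
    (hψ.fderiv_right (m := 1) (by norm_num)).exists_lipschitzOnWith
  obtain ⟨ρ, hρ, hball⟩ := Metric.mem_nhds_iff.1 (inter_mem ht (hψ.eventually (by norm_num)))
  have hTaylor : ∀ x ∈ ball q ρ, |ψ x - a * ⟪ν, x - q⟫| ≤ K * ‖x - q‖ ^ 2 := by
    intro x hx
    have hsub : closedBall q ‖x - q‖ ⊆ ball q ρ :=
      closedBall_subset_ball (by rwa [mem_ball, dist_eq_norm] at hx)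
    have h1 := (convex_closedBall q ‖x - q‖).norm_image_sub_le_of_norm_hasFDerivWithin_le'
      (f := ψ) (f' := fderiv ℝ ψ) (φ := fderiv ℝ ψ q) (C := K * ‖x - q‖) (x := q) (y := x)
      (fun z hz => ((show ContDiffAt ℝ 2 ψ z from (hball (hsub hz)).2).differentiableAt (by norm_num)).hasFDerivAt.hasFDerivWithinAt)
      (fun z hz => by
        have h2 := hLip.dist_le_mul z (hball (hsub hz)).1 q (mem_of_mem_nhds ht)
        rw [dist_eq_norm] at h2
        exact h2.trans (mul_le_mul_of_nonneg_left hz K.2))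
      (mem_closedBall_self (norm_nonneg _)) (by rw [mem_closedBall, dist_eq_norm])
    rw [h0, sub_zero, hd, smul_apply, innerSL_apply_apply, smul_eq_mul, Real.norm_eq_abs] at h1
    linarith [sq ‖x - q‖]
  have hK : (0 : ℝ) ≤ K := K.2
  have hr₀ : 0 < min (ρ / 2) (a / (2 * (K + 1))) := lt_min (half_pos hρ) (by positivity)
  filter_upwards [Ioo_mem_nhdsGT hr₀] with r hr x hx
  have hr1 := hr.2.trans_le (min_le_left _ _)
  have hr2 := hr.2.trans_le (min_le_right _ _)
  have hr0 : 0 < r := hr.1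
  rw [lt_div_iff₀ (by positivity)] at hr2
  rw [mem_ball, dist_eq_norm] at hx
  have h1 : ‖x - (q + r • ν)‖ ^ 2 = ‖x - q‖ ^ 2 - 2 * r * ⟪ν, x - q⟫ + r ^ 2 := by
    rw [show x - (q + r • ν) = (x - q) - r • ν by abel, norm_sub_sq_real, inner_smul_right,
      norm_smul, hν, real_inner_comm, mul_one, Real.norm_eq_abs, sq_abs]
    ring
  have h2 : ‖x - (q + r • ν)‖ ^ 2 < r ^ 2 := by gcongr
  have h3 : ‖x - q‖ ^ 2 < 2 * r * ⟪ν, x - q⟫ := by linarith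
  have hD : 0 < ⟪ν, x - q⟫ := by
    by_contra! hneg
    nlinarith [sq_nonneg ‖x - q‖, mul_nonneg hr0.le (neg_nonneg.2 hneg)]
  have h4 : x ∈ ball q ρ := by
    rw [mem_ball, dist_eq_norm]
    have : x - q = (x - (q + r • ν)) + r • ν := by abel
    rw [this]
    refine (norm_add_le _ _).trans_lt ?_
    rw [norm_smul, hν, mul_one, Real.norm_eq_abs, abs_of_pos hr0]
    linarith
  have h5 := (abs_le.1 (hTaylor x h4)).1
  have h6 : K * ‖x - q‖ ^ 2 ≤ K * (2 * r * ⟪ν, x - q⟫) := mul_le_mul_of_nonneg_left h3.le hK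
  have h7 : 0 < (a - 2 * r * K) * ⟪ν, x - q⟫ := mul_pos (by nlinarith) hD
  change 0 < ψ x
  nlinarith

/-- A one-sided test suffices because the first derivative vanishes: a negative second derivative
would make `w` decrease just after `t = 0`. -/
theorem hess_nonneg_of_eventually_le {w : Amb n → ℝ} {ξ : Amb n} (hw : ContDiffAt ℝ 2 w q)
    (hd : fderiv ℝ w q ξ = 0) (h : ∀ᶠ t in 𝓝[>] (0 : ℝ), w q ≤ w (q + t • ξ)) :
    0 ≤ hess w q ξ ξ := by
  by_contra! hneg
  have hq0 : q + (0 : ℝ) • ξ = q := by simp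
  have h1 : HasDerivAt (fun t : ℝ => fderiv ℝ w (q + t • ξ) ξ) (hess w q ξ ξ) 0 := by
    have := hasDerivAt_fderiv_comp_line (w := w) (x := q) (ξ := ξ) (η := ξ) (t := 0)
      (by rwa [hq0])
    rwa [hq0] at this
  have h2 : ∀ᶠ t in 𝓝[>] (0 : ℝ), fderiv ℝ w (q + t • ξ) ξ < 0 := by
    have h3 := (hasDerivAt_iff_tendsto_slope.1 h1).mono_left
      (nhdsWithin_mono 0 (fun t (ht : t ∈ Ioi (0 : ℝ)) => ne_of_gt ht))
    filter_upwards [h3.eventually (gt_mem_nhds hneg), self_mem_nhdsWithin] with t ht ht0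
    rw [slope_def_field, hq0, hd, sub_zero, sub_zero] at ht
    exact neg_of_div_neg_left ht (le_of_lt ht0)
  have ht := (tendsto_add_smul q ξ).mono_left (nhdsWithin_le_nhds (s := Ioi (0 : ℝ)))
  obtain ⟨ε, hε, hball⟩ := mem_nhdsGT_iff_exists_Ioo_subset.1
    ((h2.and (ht.eventually (hw.eventually (by norm_num)))).and h)
  have hε0 : 0 < ε / 2 := half_pos hε
  have hd' : ∀ t ∈ Icc 0 (ε / 2), HasDerivAt (fun t : ℝ => w (q + t • ξ))
      (fderiv ℝ w (q + t • ξ) ξ) t := by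
    intro t ht
    refine hasDerivAt_comp_line ?_
    rcases ht.1.eq_or_lt with rfl | h0
    · rw [hq0]; exact hw.differentiableAt (by norm_num)
    · exact (hball ⟨h0, by linarith [ht.2, show (0 : ℝ) < ε from hε]⟩).1.2.differentiableAt
        (by norm_num)
  obtain ⟨c, hc, hc'⟩ := exists_hasDerivAt_eq_slope (fun t : ℝ => w (q + t • ξ))
    (fun t : ℝ => fderiv ℝ w (q + t • ξ) ξ) hε0
    (fun t ht => (hd' t ht).continuousAt.continuousWithinAt)
    (fun t ht => hd' t (Ioo_subset_Icc_self ht))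
  have h3 := (hball ⟨hc.1, by linarith [hc.2, show (0 : ℝ) < ε from hε]⟩).1.1
  have h4 := (hball ⟨hε0, by linarith [show (0 : ℝ) < ε from hε]⟩).2
  rw [hc', hq0, sub_zero] at h3
  exact absurd (neg_of_div_neg_left h3 hε0.le) (by simpa using h4)

theorem hess_graphFn {N : Amb n} {G : Amb n → ℝ} (hG : ContDiffAt ℝ 2 G q) :
    hess (graphFn N G) q = -hess G q := by
  have h1 : fderiv ℝ (graphFn N G) =ᶠ[𝓝 q] fun x => innerSL ℝ N - fderiv ℝ G x := by
    filter_upwards [hG.eventually (by norm_num)] with x hx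
    exact fderiv_graphFn (hx.differentiableAt (by norm_num))
  rw [hess, h1.fderiv_eq, fderiv_const_sub, hess]

theorem levelSetMeanCurvature_graphFn_eq_zero {N : Amb n} (hN : ‖N‖ = 1) {G : Amb n → ℝ}
    (hi : InvariantAlong N G) (hG : ContDiffAt ℝ 2 G q) (h0 : hess G q = 0) :
    levelSetMeanCurvature (graphFn N G) q = 0 := by
  rw [levelSetMeanCurvature_eq hG.graphFn
    (gradient_graphFn_ne_zero hN hi (hG.differentiableAt (by norm_num))), hess_graphFn hG, h0]
  simp [mcForm, trForm]

theorem fderiv_eq_smul_innerSL {ψ : Amb n → ℝ} (h : fderiv ℝ ψ q ≠ 0) :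
    ∃ (ν : Amb n) (a : ℝ), ‖ν‖ = 1 ∧ 0 < a ∧ fderiv ℝ ψ q = a • innerSL ℝ ν := by
  obtain ⟨ν, a, hν, ha, hd⟩ := exists_unit_normal (gradient_ne_zero_iff.2 h)
  rcases ha.lt_or_gt with ha | ha
  · exact ⟨-ν, -a, by rwa [norm_neg], neg_pos.2 ha, by rw [map_neg, smul_neg, neg_smul, neg_neg, hd]⟩
  · exact ⟨ν, a, hν, ha, hd⟩

/-- Let `g` be constant on `{ψ = 0}`, not smaller on `{ψ > 0}`, and critical at `q`. If its Hessian
does not vanish, then it is positive in the directions transversal to `{ψ = 0}`. -/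
theorem hess_pos_of_constant_on_zeroSet {g ψ : Amb n → ℝ} {v : Amb n} (hg : ContDiffAt ℝ 2 g q)
    (hψ : ContDiffAt ℝ 2 ψ q) (hψ0 : ψ q = 0) (hdg : fderiv ℝ g q = 0) (hv : fderiv ℝ ψ q v ≠ 0)
    (h0 : ∀ᶠ x in 𝓝 q, ψ x = 0 → g x = g q) (hpos : ∀ᶠ x in 𝓝 q, 0 < ψ x → g q ≤ g x)
    (hB : hess g q ≠ 0) : 0 < hess g q v v := by
  set B := hess g q with hBdef
  have hsymm : ∀ ξ η, B ξ η = B η ξ := fun ξ η =>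
    (hg.isSymmSndFDerivAt (by simp)) ξ η
  have hpsd' : ∀ ξ, 0 < fderiv ℝ ψ q ξ → 0 ≤ B ξ ξ := by
    intro ξ hξ
    refine hess_nonneg_of_eventually_le hg (by rw [hdg]; rfl) ?_
    have h1 : HasDerivAt (fun t : ℝ => ψ (q + t • ξ)) (fderiv ℝ ψ q ξ) 0 := by
      have := hasDerivAt_comp_line (w := ψ) (x := q) (ξ := ξ) (t := 0)
        (by simpa using hψ.differentiableAt (by norm_num))
      simpa using this
    have h2 := (hasDerivAt_iff_tendsto_slope.1 h1).mono_left
      (nhdsWithin_mono 0 (fun t (ht : t ∈ Ioi (0 : ℝ)) => ne_of_gt ht))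
    filter_upwards [h2.eventually (lt_mem_nhds hξ), self_mem_nhdsWithin,
      ((tendsto_add_smul q ξ).mono_left nhdsWithin_le_nhds).eventually hpos] with t h3 h4 h5
    apply h5
    rw [slope_def_field, zero_smul, add_zero, hψ0, sub_zero, sub_zero] at h3
    have h6 : (0 : ℝ) < t := h4
    have := mul_pos h3 h6
    rwa [div_mul_cancel₀ _ h6.ne'] at this
  have hpsd : ∀ ξ, fderiv ℝ ψ q ξ ≠ 0 → 0 ≤ B ξ ξ := by
    intro ξ hξ
    rcases hξ.lt_or_gt with h1 | h1
    · have := hpsd' (-ξ) (by rw [map_neg]; linarith)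
      simpa using this
    · exact hpsd' ξ h1
  refine (hpsd v hv).lt_of_ne fun hvv => hB ?_
  -- the differential of `g` is proportional to that of `ψ` along `{ψ = 0}`
  have hψs := hψ.hasStrictFDerivAt (by norm_num)
  have hψne : fderiv ℝ ψ q ≠ 0 := fun h => hv (by rw [h]; rfl)
  have hlag : ∀ ξ, fderiv ℝ ψ q ξ = 0 → ∃ c : ℝ, ∀ η, B η ξ * fderiv ℝ ψ q v = c * fderiv ℝ ψ q η := by
    intro ξ hξ
    have hgs : HasStrictFDerivAt (fderiv ℝ g) B q :=
      (hg.fderiv_right (m := 1) (by norm_num)).hasStrictFDerivAt (by norm_num)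
    have hps : HasStrictFDerivAt (fderiv ℝ ψ) (hess ψ q) q :=
      (hψ.fderiv_right (m := 1) (by norm_num)).hasStrictFDerivAt (by norm_num)
    have happ : ∀ (F : Amb n → Amb n →L[ℝ] ℝ) (F' : Amb n →L[ℝ] Amb n →L[ℝ] ℝ) (ζ : Amb n),
        HasStrictFDerivAt F F' q → HasStrictFDerivAt (fun p => F p ζ) (F'.flip ζ) q := by
      intro F F' ζ hF
      exact (ContinuousLinearMap.apply ℝ ℝ ζ).hasStrictFDerivAt.comp q hF
    -- This minor of `Dg` and `Dψ` vanishes on `{ψ = 0}`, where the two differentials are parallel,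
    -- so its differential at `q` is a multiple of `Dψ`. Since `Dg` and `Dψ ξ` vanish at `q`, only
    -- the term with `B η ξ` survives.
    have hf := ((happ _ _ ξ hgs).mul (happ _ _ v hps)).sub ((happ _ _ v hgs).mul (happ _ _ ξ hps))
    obtain ⟨c, hc⟩ := exists_smul_eq_of_nonneg_on_zeroSet hf hψs hψ0 (by simp [hdg]) (by
      have hcont : ContinuousAt (fderiv ℝ ψ) q := hps.continuousAt
      filter_upwards [h0.eventually_nhds, hg.eventually (by norm_num), hψ.eventually (by norm_num),
        hcont.eventually_ne hψne] with x h1 h2 h3 h4 hx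
      obtain ⟨l, hl⟩ := exists_smul_eq_of_nonneg_on_zeroSet
        ((h2.hasStrictFDerivAt (by norm_num)).sub_const (g q)) (h3.hasStrictFDerivAt (by norm_num))
        hx (by rw [h1.self_of_nhds hx, sub_self])
        (h1.mono fun y hy hy0 => by rw [hy hy0, sub_self]) h4
      simp only [Pi.sub_apply, Pi.mul_apply, hl, smul_apply, smul_eq_mul]
      apply le_of_eq; ring) hψne
    refine ⟨c, fun η => ?_⟩
    have h5 := congrArg (fun l : Amb n →L[ℝ] ℝ => l η) hc
    simp only [hdg, hξ, smul_apply, zero_apply, zero_smul, zero_add, smul_eq_mul,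
      ContinuousLinearMap.flip_apply, sub_zero] at h5
    rw [← h5]; ring
  have hker : ∀ ξ, fderiv ℝ ψ q ξ = 0 → ∀ η, B η ξ = 0 := by
    intro ξ hξ
    obtain ⟨c, hc⟩ := hlag ξ hξ
    have h1 : B ξ ξ = 0 := by
      have := hc ξ
      rw [hξ, mul_zero] at this
      exact (mul_eq_zero.1 this).resolve_right hv
    have h2 : B v ξ = c := mul_right_cancel₀ hv (hc v)
    -- With `B v v = B ξ ξ = 0`, the form on `ξ + α • v` is linear in `α`, and it is nonnegative for
    -- both signs of `α`.
    have h3 : ∀ α : ℝ, α ≠ 0 → 0 ≤ 2 * α * B v ξ := by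
      intro α hα
      have := hpsd (ξ + α • v) (by
        rw [map_add, map_smul, hξ, zero_add, smul_eq_mul]; exact mul_ne_zero hα hv)
      simp only [map_add, map_smul, add_apply, smul_apply, smul_eq_mul, h1, ← hvv,
        hsymm ξ v] at this
      linarith
    have h4 : B v ξ = 0 := by linarith [h3 1 one_ne_zero, h3 (-1) (by norm_num)]
    intro η
    have h5 := hc η
    rw [← h2, h4, zero_mul] at h5
    exact (mul_eq_zero.1 h5).resolve_right hv
  ext ζ η
  have h1 : fderiv ℝ ψ q (η - (fderiv ℝ ψ q η / fderiv ℝ ψ q v) • v) = 0 := by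
    rw [map_sub, map_smul, smul_eq_mul, div_mul_cancel₀ _ hv, sub_self]
  have h2 : fderiv ℝ ψ q (ζ - (fderiv ℝ ψ q ζ / fderiv ℝ ψ q v) • v) = 0 := by
    rw [map_sub, map_smul, smul_eq_mul, div_mul_cancel₀ _ hv, sub_self]
  have h3 : B ζ v = 0 := by
    have := hker _ h2 v
    rw [map_sub, map_smul, ← hvv, smul_zero, sub_zero, hsymm] at this
    exact this
  have h4 := hker _ h1 ζ
  rw [map_sub, map_smul, h3, smul_zero, sub_zero] at h4
  simpa using h4

/-- A function which is convex in the direction `w` and equal to its lower bound on `{ψ = 0}` takes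
no larger value twice on a line in the direction `w`. -/
theorem exists_nhds_line_of_hess_pos {g ψ : Amb n → ℝ} {w : Amb n} (hw1 : ‖w‖ = 1)
    (hg : ContDiffAt ℝ 2 g q) (hψ : ContDiffAt ℝ 2 ψ q) (hψ0 : ψ q = 0)
    (hw : 0 < fderiv ℝ ψ q w) (h0 : ∀ᶠ x in 𝓝 q, ψ x = 0 → g x = g q) (hB : 0 < hess g q w w) :
    ∃ U ∈ 𝓝 q, ∀ m ∈ U, 0 ≤ ψ m → g q < g m → ∀ τ : ℝ, 0 < τ → m + τ • w ∈ U →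
      g (m + τ • w) ≠ g m := by
  have hBev : ∀ᶠ x in 𝓝 q, 0 < hess g x w w := by
    have : ContinuousAt (fun x => hess g x w w) q :=
      (hg.continuousAt_hess.clm_apply continuousAt_const).clm_apply continuousAt_const
    exact this.eventually (lt_mem_nhds hB)
  obtain ⟨r, hr, hball⟩ := Metric.eventually_nhds_iff_ball.1
    (h0.and (hBev.and ((hg.eventually (by norm_num)).and hψ.eventually_continuousAt)))
  obtain ⟨r₁, hr₁, hr₁', hneg⟩ : ∃ r₁ : ℝ, 0 < r₁ ∧ r₁ < r / 2 ∧ ψ (q + r₁ • -w) < 0 := by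
    by_contra! hcon
    have h1 : HasDerivAt (fun t : ℝ => ψ (q + t • -w)) (fderiv ℝ ψ q (-w)) 0 := by
      have := hasDerivAt_comp_line (w := ψ) (x := q) (ξ := -w) (t := 0)
        (by simpa using hψ.differentiableAt (by norm_num))
      simpa using this
    have := nonneg_of_hasDerivAt_of_eventually_nonneg h1 (by simp [hψ0]) (by
      filter_upwards [Ioo_mem_nhdsGT (half_pos hr)] with t ht using hcon t ht.1 ht.2)
    rw [map_neg] at this
    linarith
  have hdist : ∀ (x : Amb n) (t : ℝ), dist (x + t • w) x = |t| := fun x t => by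
    rw [dist_eq_norm, add_sub_cancel_left, norm_smul, hw1, mul_one, Real.norm_eq_abs]
  have hcψ : ContinuousAt ψ (q + r₁ • -w) := by
    refine (hball _ ?_).2.2.2
    rw [smul_neg, ← neg_smul, mem_ball, hdist, abs_neg, abs_of_pos hr₁]; linarith
  have hU : ∀ᶠ m in 𝓝 q, ψ (m + r₁ • -w) < 0 := by
    have h1 : Tendsto (fun m => m + r₁ • -w) (𝓝 q) (𝓝 (q + r₁ • -w)) :=
      (continuous_add_const _).tendsto q
    exact h1.eventually (hcψ.eventually (gt_mem_nhds hneg))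
  refine ⟨_, inter_mem hU (ball_mem_nhds q (half_pos hr)), ?_⟩
  rintro m ⟨hm1, hm2⟩ hψm hgm τ hτ ⟨-, hmτ⟩ heq
  rw [mem_ball] at hm2 hmτ
  have hIcc : ∀ t ∈ Icc 0 r₁, m + (-t) • w ∈ ball q r := by
    intro t ht
    rw [mem_ball]
    have h1 := hdist m (-t)
    rw [abs_neg, abs_of_nonneg ht.1] at h1
    linarith [dist_triangle (m + (-t) • w) m q, ht.2]
  -- Going backwards from `m`, the line crosses `{ψ = 0}`, where `g` takes the value `g q < g m`.
  obtain ⟨t₀, ht₀, hzero⟩ : ∃ t₀ ∈ Icc 0 r₁, ψ (m + (-t₀) • w) = 0 := by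
    have hc : ContinuousOn (fun t : ℝ => ψ (m + (-t) • w)) (Icc 0 r₁) := by
      intro t ht
      have h1 : ContinuousAt (fun t : ℝ => m + (-t) • w) t := by fun_prop
      exact (ContinuousAt.comp (g := ψ) (f := fun t : ℝ => m + (-t) • w) (hball _ (hIcc t ht)).2.2.2 h1).continuousWithinAt
    have := intermediate_value_Icc' hr₁.le hc
    have h0 : (0 : ℝ) ∈ Icc (ψ (m + (-r₁) • w)) (ψ (m + (-0 : ℝ) • w)) := by
      refine ⟨?_, by simpa using hψm⟩
      rw [neg_smul, ← smul_neg]; exact le_of_lt hm1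
    obtain ⟨t, ht, ht'⟩ := this h0
    exact ⟨t, ht, ht'⟩
  have hg₀ := (hball _ (hIcc t₀ ht₀)).1 hzero
  have ht₀pos : 0 < t₀ := by
    refine lt_of_le_of_ne ht₀.1 fun h => ?_
    rw [← h, neg_zero, zero_smul, add_zero] at hg₀
    linarith
  set k : ℝ → ℝ := fun t => g (m + t • w) with hk
  have hin : ∀ t ∈ Icc (-t₀) τ, m + t • w ∈ ball q r := by
    intro t ht
    rcases le_total t 0 with h1 | h1
    · have := hIcc (-t) ⟨by linarith, by linarith [ht.1, ht₀.2]⟩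
      rwa [neg_neg] at this
    · have h2 := hdist (m + t • w) (τ - t)
      rw [add_assoc, ← add_smul, add_sub_cancel] at h2
      have h3 := hdist m t
      rw [abs_of_nonneg h1] at h3
      rw [abs_of_nonneg (by linarith [ht.2])] at h2
      have h4 := hdist m τ
      rw [abs_of_pos hτ] at h4
      rw [mem_ball]
      have h5 := dist_triangle (m + t • w) m q
      have h6 := dist_triangle_right (m + t • w) q (m + τ • w)
      rw [dist_comm (m + t • w) (m + τ • w), dist_comm q] at h6
      have h7 := dist_triangle (m + τ • w) q m
      rw [dist_comm q m] at h7
      linarith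
  have hk1 : ∀ t ∈ Icc (-t₀) τ, HasDerivAt k (fderiv ℝ g (m + t • w) w) t := fun t ht =>
    hasDerivAt_comp_line ((hball _ (hin t ht)).2.2.1.differentiableAt (by norm_num))
  have hk2 : ∀ t ∈ Icc (-t₀) τ, HasDerivAt (fun t : ℝ => fderiv ℝ g (m + t • w) w)
      (hess g (m + t • w) w w) t := fun t ht =>
    hasDerivAt_fderiv_comp_line (hball _ (hin t ht)).2.2.1
  -- The mean slope is positive before `m` and would be zero from `m` to `m + τ • w`, against
  -- convexity.
  obtain ⟨a, ha, ha'⟩ := exists_hasDerivAt_eq_slope k _ (neg_neg_of_pos ht₀pos)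
    (fun t ht => (hk1 t ⟨ht.1, ht.2.trans hτ.le⟩).continuousAt.continuousWithinAt)
    (fun t ht => hk1 t ⟨ht.1.le, ht.2.le.trans hτ.le⟩)
  obtain ⟨b, hb, hb'⟩ := exists_hasDerivAt_eq_slope k _ hτ
    (fun t ht => (hk1 t ⟨by linarith [ht.1], ht.2⟩).continuousAt.continuousWithinAt)
    (fun t ht => hk1 t ⟨by linarith [ht.1], ht.2.le⟩)
  have hab : a < b := ha.2.trans hb.1
  obtain ⟨c, hc, hc'⟩ := exists_hasDerivAt_eq_slope _ _ hab
    (fun t ht => (hk2 t ⟨ha.1.le.trans ht.1, ht.2.trans hb.2.le⟩).continuousAt.continuousWithinAt)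
    (fun t ht => hk2 t ⟨ha.1.le.trans ht.1.le, ht.2.le.trans hb.2.le⟩)
  have hcpos := (hball _ (hin c ⟨ha.1.le.trans hc.1.le, hc.2.le.trans hb.2.le⟩)).2.1
  have hk0 : k 0 = g m := by simp [hk]
  have hkτ : k τ = g m := heq
  have hkt : k (-t₀) = g q := hg₀
  rw [hc', ha', hb', hk0, hkτ, hkt] at hcpos
  have h1 := (div_pos_iff_of_pos_right (sub_pos.2 hab)).1 hcpos
  rw [sub_self, zero_div, zero_sub, Left.neg_pos_iff] at h1
  exact absurd h1 (not_lt.2 (div_nonneg (by linarith) (by linarith)))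

end Calculus

/-! ### Hypersurfaces with boundary in local charts -/

section BoundaryCharts

variable {n : ℕ} {M V : Set (Amb n)} {φ ψ : Amb n → ℝ} {p : Amb n}

/-- On the open set `V`, the set `M` is a hypersurface with boundary, given by `φ = 0` and
`ψ ≥ 0`. -/
structure IsBoundaryChart (M V : Set (Amb n)) (φ ψ : Amb n → ℝ) : Prop where
  isOpen : IsOpen V
  contDiffOn_fst : ContDiffOn ℝ 2 φ V
  contDiffOn_snd : ContDiffOn ℝ 2 ψ V
  linearIndependent : ∀ x ∈ V, LinearIndependent ℝ ![gradient φ x, gradient ψ x]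
  inter_eq : M ∩ V = {x ∈ V | φ x = 0 ∧ 0 ≤ ψ x}

namespace IsBoundaryChart

theorem contDiffAt_fst (h : IsBoundaryChart M V φ ψ) (hp : p ∈ V) : ContDiffAt ℝ 2 φ p :=
  h.contDiffOn_fst.contDiffAt (h.isOpen.mem_nhds hp)

theorem contDiffAt_snd (h : IsBoundaryChart M V φ ψ) (hp : p ∈ V) : ContDiffAt ℝ 2 ψ p :=
  h.contDiffOn_snd.contDiffAt (h.isOpen.mem_nhds hp)

theorem mem_iff (h : IsBoundaryChart M V φ ψ) (hp : p ∈ V) : p ∈ M ↔ φ p = 0 ∧ 0 ≤ ψ p := by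
  have := congrArg (p ∈ ·) h.inter_eq
  simpa [hp] using this

theorem linearIndependent_fderiv (h : IsBoundaryChart M V φ ψ) (hp : p ∈ V) :
    LinearIndependent ℝ ![fderiv ℝ φ p, fderiv ℝ ψ p] := by
  rw [LinearIndependent.pair_iff]
  intro a b hab
  refine LinearIndependent.pair_iff.1 (h.linearIndependent p hp) a b ?_
  refine ext_inner_right ℝ fun ξ => ?_
  rw [inner_add_left, real_inner_smul_left, real_inner_smul_left, inner_gradient, inner_gradient,
    inner_zero_left]
  simpa using congrArg (fun l : Amb n →L[ℝ] ℝ => l ξ) hab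

theorem fderiv_fst_ne_zero (h : IsBoundaryChart M V φ ψ) (hp : p ∈ V) : fderiv ℝ φ p ≠ 0 :=
  (h.linearIndependent_fderiv hp).ne_zero 0

/-- On a hypersurface without boundary through `p` both `φ` and `ψ` would be nonnegative, so both
differentials would be multiples of the same one, against their independence. -/
theorem not_isC2InteriorPoint (h : IsBoundaryChart M V φ ψ) (hp : p ∈ V) (hφ : φ p = 0)
    (hψ : ψ p = 0) : ¬ IsC2InteriorPoint M p := by
  rintro ⟨hpM, W, χ, hpW, hχ⟩
  have hev := hχ.eventually_mem_iff hpW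
  have hχs := (hχ.contDiffAt hpW).hasStrictFDerivAt (by norm_num)
  have hχ0 := hev.self_of_nhds.1 hpM
  have hne : fderiv ℝ χ p ≠ 0 := gradient_ne_zero_iff.1 (hχ.gradient_ne_zero p hpW)
  have hV := h.isOpen.mem_nhds hp
  obtain ⟨a, ha⟩ := exists_smul_eq_of_nonneg_on_zeroSet
    ((h.contDiffAt_fst hp).hasStrictFDerivAt (by norm_num)) hχs hχ0 hφ (by
      filter_upwards [hev, hV] with x h1 h2 h3
      exact ((h.mem_iff h2).1 (h1.2 h3)).1.ge) hne
  obtain ⟨b, hb⟩ := exists_smul_eq_of_nonneg_on_zeroSet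
    ((h.contDiffAt_snd hp).hasStrictFDerivAt (by norm_num)) hχs hχ0 hψ (by
      filter_upwards [hev, hV] with x h1 h2 h3
      exact ((h.mem_iff h2).1 (h1.2 h3)).2) hne
  have h1 := LinearIndependent.pair_iff.1 (h.linearIndependent_fderiv hp) b (-a) (by
    rw [ha, hb]; module)
  exact h.fderiv_fst_ne_zero hp (by rw [ha, neg_eq_zero.1 h1.2, zero_smul])

theorem isC2InteriorPoint (h : IsBoundaryChart M V φ ψ) (hp : p ∈ V) (hφ : φ p = 0)
    (hψ : 0 < ψ p) : IsC2InteriorPoint M p := by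
  refine ⟨(h.mem_iff hp).2 ⟨hφ, hψ.le⟩, V ∩ ψ ⁻¹' Ioi 0, φ, ⟨hp, hψ⟩,
    h.contDiffOn_snd.continuousOn.isOpen_inter_preimage h.isOpen isOpen_Ioi,
    h.contDiffOn_fst.mono inter_subset_left, fun x hx => ?_, ?_⟩
  · exact gradient_ne_zero_iff.2 (h.fderiv_fst_ne_zero hx.1)
  · ext x
    constructor
    · rintro ⟨h1, h2⟩
      exact ⟨h2, ((h.mem_iff h2.1).1 h1).1⟩
    · rintro ⟨h1, h2⟩
      exact ⟨(h.mem_iff h1.1).2 ⟨h2, le_of_lt h1.2⟩, h1⟩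

end IsBoundaryChart

/-- Near `q`, the set `M` is the part over `{ψ ≥ 0}` of a graph in the direction `e`, which is
horizontal at `q`; its boundary lies over `{ψ = 0}`. -/
structure IsBoundaryGraph (M Γ : Set (Amb n)) (q e : Amb n) (g ψ : Amb n → ℝ) : Prop where
  inv_fst : InvariantAlong e g
  inv_snd : InvariantAlong e ψ
  contDiffAt_fst : ContDiffAt ℝ 2 g q
  contDiffAt_snd : ContDiffAt ℝ 2 ψ q
  apply_fst : g q = ⟪e, q⟫
  apply_snd : ψ q = 0
  fderiv_fst : fderiv ℝ g q = 0
  fderiv_snd_ne_zero : fderiv ℝ ψ q ≠ 0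
  mem_iff : ∀ᶠ x in 𝓝 q, x ∈ M ↔ ⟪e, x⟫ = g x ∧ 0 ≤ ψ x
  mem_boundary_iff : ∀ᶠ x in 𝓝 q, x ∈ Γ ↔ ⟪e, x⟫ = g x ∧ ψ x = 0

/-- As `e` is normal to `{φ = 0}` at `q`, this level set is a horizontal graph. The function `ψ` is
replaced by its composition with the projection to the graph: this agrees with `ψ` on the graph and
no longer depends on the height. -/
theorem IsBoundaryChart.exists_isBoundaryGraph (h : IsBoundaryChart M V φ ψ) {q e : Amb n}
    {Γ : Set (Amb n)} (hq : q ∈ V) (he : ‖e‖ = 1) (hφ : φ q = 0) (hψ : ψ q = 0)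
    (hΓ : ∀ᶠ x in 𝓝 q, x ∈ Γ ↔ φ x = 0 ∧ ψ x = 0) {a : ℝ}
    (hd : innerSL ℝ e = a • fderiv ℝ φ q) :
    ∃ g χ : Amb n → ℝ, IsBoundaryGraph M Γ q e g χ ∧
      ∀ ξ, ⟪e, ξ⟫ = 0 → fderiv ℝ χ q ξ = fderiv ℝ ψ q ξ := by
  have ha : a ≠ 0 := by
    rintro rfl
    have := congrArg (fun l : Amb n →L[ℝ] ℝ => l e) hd
    simp [he] at this
  have hd' : fderiv ℝ φ q = a⁻¹ • innerSL ℝ e := by rw [hd, smul_smul, inv_mul_cancel₀ ha, one_smul]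
  obtain ⟨g, hg⟩ := exists_tangent_graph (h.contDiffAt_fst hq) hφ he (inv_ne_zero ha) hd'
  have hgp : graphPt e g q = q := by simp [graphPt, hg.apply_eq]
  have hfix : ∀ x, ⟪e, x⟫ = g x → graphPt e g x = x := fun x hx => by simp [graphPt, hx]
  have hcg : ContDiffAt ℝ 2 (graphPt e g) q := by
    unfold graphPt
    exact contDiffAt_id.add ((hg.contDiffAt.sub (contDiffAt_const.inner ℝ contDiffAt_id)).smul
      contDiffAt_const)
  have hdg : HasFDerivAt (graphPt e g) (ContinuousLinearMap.id ℝ _ +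
      (fderiv ℝ g q - innerSL ℝ e).smulRight e) q := by
    unfold graphPt
    exact (hasFDerivAt_id q).add (((hg.contDiffAt.differentiableAt (by norm_num)).hasFDerivAt.sub
      (innerSL ℝ e).hasFDerivAt).smul_const e)
  have hψ2 := h.contDiffAt_snd hq
  have hψ2' : ContDiffAt ℝ 2 ψ (graphPt e g q) := by rwa [hgp]
  have hdχ : ∀ ξ, ⟪e, ξ⟫ = 0 → fderiv ℝ (fun x => ψ (graphPt e g x)) q ξ = fderiv ℝ ψ q ξ := by
    intro ξ hξ
    have h1 := ((hψ2'.differentiableAt (by norm_num)).hasFDerivAt.comp q hdg).fderiv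
    have h2 : fderiv ℝ (fun x => ψ (graphPt e g x)) q = _ := h1
    rw [h2, hgp, hg.fderiv_eq]
    simp [hξ]
  have hev : ∀ᶠ x in 𝓝 q, (x ∈ M ↔ φ x = 0 ∧ 0 ≤ ψ x) :=
    mem_of_superset (h.isOpen.mem_nhds hq) fun x hx => h.mem_iff hx
  refine ⟨g, fun x => ψ (graphPt e g x), ⟨hg.inv, fun x t => ?_, hg.contDiffAt, hψ2'.comp q hcg,
    hg.apply_eq, by rw [hgp, hψ], hg.fderiv_eq, fun h0 => ?_, ?_, ?_⟩, hdχ⟩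
  · have : graphPt e g (x + t • e) = graphPt e g x := by
      rw [graphPt, hg.inv, inner_add_right, inner_smul_right, real_inner_self_eq_norm_sq, he,
        graphPt]
      module
    rw [this]
  · have h1 : fderiv ℝ ψ q = fderiv ℝ ψ q e • innerSL ℝ e := by
      ext ξ
      have h2 := hdχ (ξ - ⟪e, ξ⟫ • e) (by
        rw [inner_sub_right, inner_smul_right, real_inner_self_eq_norm_sq, he]; ring)
      rw [h0, zero_apply, map_sub, map_smul, smul_eq_mul] at h2
      rw [smul_apply, innerSL_apply_apply, smul_eq_mul]
      linarith
    have h2 := LinearIndependent.pair_iff.1 (h.linearIndependent_fderiv hq)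
      (-(fderiv ℝ ψ q e * a)) 1 (by
        rw [one_smul, mul_comm, neg_smul, mul_comm, mul_smul, ← hd, ← h1, neg_add_cancel])
    exact one_ne_zero h2.2
  · filter_upwards [hev, hg.mem_iff] with x h1 h2
    have h2' : φ x = 0 ↔ ⟪e, x⟫ = g x := h2
    rw [h1, h2']
    exact and_congr_right fun h3 => by rw [hfix x h3]
  · filter_upwards [hΓ, hg.mem_iff] with x h1 h2
    have h2' : φ x = 0 ↔ ⟪e, x⟫ = g x := h2
    rw [h1, h2']
    exact and_congr_right fun h3 => by rw [hfix x h3]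

end BoundaryCharts

/-! ### The boundary of `M` on the lower face -/

section FloorBoundary

variable {n : ℕ} {e v : Amb n} {c₁ c₂ s L T : ℝ} {Ω M : Set (Amb n)} {Hf : Amb n → ℝ}
  {q x : Amb n} {G g ψ : Amb n → ℝ}

namespace SlabConfig

/-- The chart's own boundary is the border of the faces: its points are not interior points of `M`,
and the points with `ψ > 0` are, while every border point nearby has a boundary chart of its own. -/
theorem exists_isBoundaryChart (h : SlabConfig e v c₁ c₂ s Ω M Hf L)
    (hq : q ∈ faceBoundaries e c₁ c₂ Ω) (hqs : s < ⟪v, q⟫) :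
    ∃ (V : Set (Amb n)) (φ ψ : Amb n → ℝ), q ∈ V ∧ IsBoundaryChart M V φ ψ ∧ φ q = 0 ∧ ψ q = 0 ∧
      ∀ᶠ x in 𝓝 q, x ∈ faceBoundaries e c₁ c₂ Ω ↔ φ x = 0 ∧ ψ x = 0 := by
  obtain ⟨V, φ, ψ, hV, hqV, hφ, hψ, hli, hφ0, hψ0, hMV⟩ := h.boundary_point q hq hqs
  have hc : IsBoundaryChart M V φ ψ := ⟨hV, hφ, hψ, hli, hMV⟩
  refine ⟨V, φ, ψ, hqV, hc, hφ0, hψ0, ?_⟩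
  have hvc : Continuous fun y : Amb n => ⟪v, y⟫ := by fun_prop
  filter_upwards [hV.mem_nhds hqV, (isOpen_lt continuous_const hvc).mem_nhds hqs] with x hx hxs
  constructor
  · intro hxΓ
    obtain ⟨h1, h2⟩ := (hc.mem_iff hx).1 (h.boundary_subset hxΓ)
    refine ⟨h1, h2.eq_or_lt.elim Eq.symm fun h3 => ?_⟩
    obtain ⟨V', φ', ψ', hV', hxV', hφ', hψ', hli', hφ0', hψ0', hMV'⟩ := h.boundary_point x hxΓ hxs
    exact absurd (hc.isC2InteriorPoint hx h1 h3)
      (IsBoundaryChart.not_isC2InteriorPoint ⟨hV', hφ', hψ', hli', hMV'⟩ hxV' hφ0' hψ0')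
  · rintro ⟨h1, h2⟩
    by_contra hxΓ
    exact hc.not_isC2InteriorPoint hx h1 h2
      (h.interior_point x ⟨(hc.mem_iff hx).2 ⟨h1, h2.ge⟩, hxΓ⟩)

theorem eventually_inner_eq_of_mem_faceBoundaries (h : SlabConfig e v c₁ c₂ s Ω M Hf L)
    (hq : ⟪e, q⟫ = c₁) : ∀ᶠ x in 𝓝 q, x ∈ faceBoundaries e c₁ c₂ Ω → ⟪e, x⟫ = c₁ := by
  filter_upwards [h.eventually_lt_top hq] with x hx hxΓ
  rcases hxΓ with h1 | h1
  · exact (relBoundary_face_subset _ _ _ h1).2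
  · exact absurd (relBoundary_face_subset _ _ _ h1).2 hx.ne

theorem eventually_le_of_mem (h : SlabConfig e v c₁ c₂ s Ω M Hf L) (x : Amb n) (hx : x ∈ M) :
    c₁ ≤ ⟪e, x⟫ := (h.dom.closure_subset (h.dom.mem_closure_of_mem hx)).1

end SlabConfig

namespace IsBoundaryGraph

variable (hg : IsBoundaryGraph M (faceBoundaries e c₁ c₂ Ω) q e g ψ)

include hg

theorem tendsto_graphPt : Tendsto (graphPt e g) (𝓝 q) (𝓝 q) :=
  _root_.tendsto_graphPt hg.contDiffAt_fst.continuousAt hg.apply_fst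

theorem snd_graphPt (x : Amb n) : ψ (graphPt e g x) = ψ x := hg.inv_snd _ _

theorem eventually_graphPt_mem (he : ‖e‖ = 1) : ∀ᶠ x in 𝓝 q, 0 ≤ ψ x → graphPt e g x ∈ M := by
  filter_upwards [hg.tendsto_graphPt.eventually hg.mem_iff] with x hx h0
  rw [hx, inner_graphPt he, hg.inv_fst.graphPt, hg.snd_graphPt]
  exact ⟨rfl, h0⟩

theorem eventually_le (h : SlabConfig e v c₁ c₂ s Ω M Hf L) :
    ∀ᶠ x in 𝓝 q, 0 ≤ ψ x → c₁ ≤ g x := by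
  filter_upwards [hg.eventually_graphPt_mem h.norm_e] with x hx h0
  have := h.eventually_le_of_mem _ (hx h0)
  rwa [inner_graphPt h.norm_e] at this

theorem eventually_eq (h : SlabConfig e v c₁ c₂ s Ω M Hf L) (hq : ⟪e, q⟫ = c₁) :
    ∀ᶠ x in 𝓝 q, ψ x = 0 → g x = c₁ := by
  filter_upwards [hg.tendsto_graphPt.eventually (hg.mem_boundary_iff.and
    (h.eventually_inner_eq_of_mem_faceBoundaries hq))] with x hx h0
  have := hx.2 (hx.1.2 (by
    rw [inner_graphPt h.norm_e, hg.inv_fst.graphPt, hg.snd_graphPt]; exact ⟨rfl, h0⟩))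
  rwa [inner_graphPt h.norm_e] at this

/-- The mean curvature of the graph, up to sign; the upper sign requires `Ω` above the graph. -/
theorem eventually_levelSetMeanCurvature (h : SlabConfig e v c₁ c₂ s Ω M Hf L)
    (hq : ⟪e, q⟫ = c₁) :
    ∀ᶠ x in 𝓝 q, 0 < ψ x →
      levelSetMeanCurvature (graphFn e g) x = -Hf (graphPt e g x) ∨
      levelSetMeanCurvature (graphFn e g) x = Hf (graphPt e g x) ∧
        ∀ᶠ z in 𝓝 (graphPt e g x), g z < ⟪e, z⟫ → z ∈ Ω := by
  have he := h.norm_e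
  have hev := hg.tendsto_graphPt.eventually
    (((hg.mem_iff.and (hg.eventually_le h)).and ((hg.eventually_graphPt_mem he).and
      (hg.contDiffAt_snd.eventually_continuousAt.and
        (hg.contDiffAt_fst.eventually (by norm_num))))).eventually_nhds.and
      (hg.mem_boundary_iff.and (h.eventually_lt_top hq)))
  filter_upwards [hev] with x ⟨h1, h2, h3⟩ hx
  set m := graphPt e g x with hm
  have hgm : ⟪e, m⟫ = g m := by rw [hm, inner_graphPt he, hg.inv_fst.graphPt]
  have hψm : 0 < ψ m := by rw [hm, hg.snd_graphPt]; exact hx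
  have hfix : graphPt e g m = m := by simp [graphPt, hgm]
  have hC2 : ContDiffAt ℝ 2 g m := h1.self_of_nhds.2.2.2
  have hcont : ∀ᶠ z in 𝓝 m, ContinuousAt g z := h1.mono fun z hz => hz.2.2.2.continuousAt
  have hψpos : ∀ᶠ z in 𝓝 m, 0 < ψ z := h1.self_of_nhds.2.2.1.eventually (lt_mem_nhds hψm)
  have hMG : ∀ᶠ z in 𝓝 m, z ∈ M ↔ ⟪e, z⟫ = g z := by
    filter_upwards [h1, hψpos] with z h4 h5
    rw [h4.1.1]; exact and_iff_left h5.le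
  have hmM : m ∈ M := hMG.self_of_nhds.2 hgm
  have hmΓ : m ∉ faceBoundaries e c₁ c₂ Ω := fun h4 => hψm.ne' (h2.1 h4).2
  rw [← levelSetMeanCurvature_graphPt he hg.inv_fst x, ← hm]
  have habove : (∀ᶠ z in 𝓝 m, g z < ⟪e, z⟫ → z ∈ Ω) →
      levelSetMeanCurvature (graphFn e g) m = -Hf m ∨
      levelSetMeanCurvature (graphFn e g) m = Hf m ∧ ∀ᶠ z in 𝓝 m, g z < ⟪e, z⟫ → z ∈ Ω :=
    fun h4 => Or.inr ⟨h.mc.eq_of_above he hg.inv_fst hC2 hgm.symm hMG hmΓ h4, h4⟩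
  -- A point of `M` off its boundary may still lie in the face; there the dichotomy between half
  -- ball and lower graph replaces the two sides of `M` in the open slab.
  rcases (h.eventually_le_of_mem m hmM).eq_or_lt with hc | hc
  · rcases h.half_ball_or_isLowerGraph ⟨h.dom.mem_closure_of_mem hmM, hc.symm⟩ hmΓ with h4 | ⟨G, hG⟩
    · refine habove ?_
      filter_upwards [h4, h1, hψpos] with z h5 h6 h7 h8
      exact h5 ((h6.1.2 h7.le).trans_lt h8)
    · left
      have ht : Tendsto (graphPt e g) (𝓝 m) (𝓝 m) :=
        _root_.tendsto_graphPt hC2.continuousAt hgm.symm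
      have heq : ∀ᶠ z in 𝓝 m, g z = G z := by
        filter_upwards [ht.eventually hG.mem_iff, h1, hψpos] with z h5 h6 h7
        have h8 := h5.1 (h6.2.1 h7.le)
        rw [inner_graphPt he] at h8
        rw [h8, graphPt, hG.inv]
      have h5 : graphFn e g =ᶠ[𝓝 m] graphFn e G := by
        filter_upwards [heq] with z hz
        simp only [graphFn, hz]
      rw [levelSetMeanCurvature_congr h5, hG.pde.self_of_nhds]
      simp [graphPt, hG.apply_eq]
  · have hmS : m ∈ openSlab e c₁ c₂ := ⟨hc, h3⟩
    have hfr := (h.eventually_interior hmS).1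
    rcases eventually_mem_or_notMem_of_above he hg.inv_fst hcont hgm.symm (Ω := Ω) (by
      filter_upwards [hfr, hMG] with z h4 h5 h6
      rw [h4, h5]; exact h6.ne') with h4 | h4
    · exact habove h4
    rcases eventually_mem_or_notMem_of_below he hg.inv_fst hcont hgm.symm (Ω := Ω) (by
      filter_upwards [hfr, hMG] with z h4 h5 h6
      rw [h4, h5]; exact h6.ne) with h5 | h5
    · exact Or.inl (h.mc.eq_of_below he hg.inv_fst hC2 hgm.symm hMG hmΓ h5)
    obtain ⟨z, hz, h6, h7, h8⟩ := ((mem_closure_iff_frequently.1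
      (h.dom.mem_closure_of_mem hmM)).and_eventually (h4.and (h5.and hMG))).exists
    rcases lt_trichotomy (g z) ⟪e, z⟫ with h9 | h9 | h9
    · exact absurd hz (h6 h9)
    · exact absurd hz (h.dom.notMem_of_mem (h8.2 h9.symm))
    · exact absurd hz (h7 h9)

theorem eventually_ball_subset :
    ∃ ν : Amb n, ‖ν‖ = 1 ∧ ∀ᶠ r in 𝓝[>] (0 : ℝ), ball (q + r • ν) r ⊆ {x | 0 < ψ x} := by
  obtain ⟨ν, a, hν, ha, hd⟩ := fderiv_eq_smul_innerSL hg.fderiv_snd_ne_zero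
  exact ⟨ν, hν, eventually_ball_subset_pos hg.contDiffAt_snd hg.apply_snd hν ha hd⟩

theorem frequently_pos : ∃ᶠ x in 𝓝 q, 0 < ψ x := by
  obtain ⟨ν, hν, hball⟩ := hg.eventually_ball_subset
  have ht := (tendsto_add_smul q ν).mono_left (nhdsWithin_le_nhds (s := Ioi (0 : ℝ)))
  refine ht.frequently ?_
  have hpos : ∀ᶠ r in 𝓝[>] (0 : ℝ), 0 < r := self_mem_nhdsWithin
  exact (hball.and hpos).frequently.mono fun r hr => hr.1 (mem_ball_self hr.2)

end IsBoundaryGraph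

end FloorBoundary

/-! ### Bad points on the boundary of `M` and their exclusion -/

section BoundaryPoints

variable {n : ℕ} {e v : Amb n} {c₁ c₂ s L T : ℝ} {Ω M V : Set (Amb n)} {Hf : Amb n → ℝ}
  {p q x : Amb n} {φ ψ f : Amb n → ℝ} {G g χ : Amb n → ℝ}

namespace IsBoundaryChart

/-- The component of the gradient of `ψ` tangent to `{φ = 0}` points into `M`; it is nonzero by
independence. -/
theorem exists_inward (h : IsBoundaryChart M V φ ψ) (hp : p ∈ V) :
    ∃ ξ, fderiv ℝ φ p ξ = 0 ∧ 0 < fderiv ℝ ψ p ξ := by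
  obtain ⟨N, a, hN, ha, hd⟩ := exists_unit_normal (gradient_ne_zero_iff.2 (h.fderiv_fst_ne_zero hp))
  set ξ := gradient ψ p - ⟪N, gradient ψ p⟫ • N with hξ
  have hNξ : ⟪N, ξ⟫ = 0 := by
    rw [hξ, inner_sub_right, inner_smul_right, real_inner_self_eq_norm_sq, hN]; ring
  refine ⟨ξ, by rw [hd]; simp [hNξ], ?_⟩
  have h1 : fderiv ℝ ψ p ξ = ‖ξ‖ ^ 2 := by
    rw [← inner_gradient, show gradient ψ p = ξ + ⟪N, gradient ψ p⟫ • N by rw [hξ]; module,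
      inner_add_left, real_inner_smul_left, hNξ, real_inner_self_eq_norm_sq]; ring
  rw [h1]
  refine pow_pos (norm_pos_iff.2 fun h0 => ?_) 2
  have h2 := LinearIndependent.pair_iff.1 (h.linearIndependent_fderiv hp)
    (-(⟪N, gradient ψ p⟫ * a⁻¹)) 1 (by
      ext η
      have h3 : ⟪gradient ψ p - ⟪N, gradient ψ p⟫ • N, η⟫ = 0 := by
        rw [← hξ, h0, inner_zero_left]
      rw [inner_sub_left, real_inner_smul_left, inner_gradient] at h3
      simp only [hd, add_apply, smul_apply, innerSL_apply_apply, smul_eq_mul, zero_apply]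
      field_simp
      linarith)
  exact one_ne_zero h2.2

/-- A function that is nonnegative on `M` grows in the directions that point into `M`. -/
theorem nonneg_of_inward (h : IsBoundaryChart M V φ ψ) (hp : p ∈ V) (hφ : φ p = 0) (hψ : ψ p = 0)
    {f' : Amb n →L[ℝ] ℝ} (hf : HasFDerivAt f f' p) (hf0 : f p = 0)
    (hfM : ∀ᶠ x in 𝓝 p, x ∈ M → 0 ≤ f x) {ξ : Amb n} (h1 : fderiv ℝ φ p ξ = 0)
    (h2 : 0 < fderiv ℝ ψ p ξ) : 0 ≤ f' ξ := by
  obtain ⟨N, a, hN, ha, hd⟩ := exists_unit_normal (gradient_ne_zero_iff.2 (h.fderiv_fst_ne_zero hp))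
  obtain ⟨G, hG⟩ := exists_tangent_graph (h.contDiffAt_fst hp) hφ hN ha hd
  have hNξ : ⟪N, ξ⟫ = 0 := by
    rw [hd, smul_apply, innerSL_apply_apply, smul_eq_mul] at h1
    exact (mul_eq_zero.1 h1).resolve_left ha
  have hline : HasDerivAt (fun t : ℝ => p + t • ξ) ξ 0 := by
    simpa using ((hasDerivAt_id (0 : ℝ)).smul_const ξ).const_add p
  have hp0 : p + (0 : ℝ) • ξ = p := by simp
  have hGd : HasFDerivAt G (0 : Amb n →L[ℝ] ℝ) (p + (0 : ℝ) • ξ) := by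
    rw [hp0, ← hG.fderiv_eq]
    exact (hG.contDiffAt.differentiableAt (by norm_num)).hasFDerivAt
  have hγ : HasDerivAt (fun t : ℝ => graphPt N G (p + t • ξ)) ξ 0 := by
    unfold graphPt
    have h3 := hline.add (((hGd.comp_hasDerivAt 0 hline).sub
      ((innerSL ℝ N).hasFDerivAt.comp_hasDerivAt 0 hline)).smul_const N)
    exact h3.congr_deriv (by simp [hNξ])
  have hγ0 : graphPt N G (p + (0 : ℝ) • ξ) = p := by rw [hp0]; simp [graphPt, hG.apply_eq]
  have hγt : Tendsto (fun t : ℝ => graphPt N G (p + t • ξ)) (𝓝[>] 0) (𝓝 p) := by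
    have := hγ.continuousAt.tendsto
    rw [hγ0] at this
    exact this.mono_left nhdsWithin_le_nhds
  have hψd := ((h.contDiffAt_snd hp).differentiableAt (by norm_num)).hasFDerivAt
  have hk : HasDerivAt (fun t : ℝ => ψ (graphPt N G (p + t • ξ))) (fderiv ℝ ψ p ξ) 0 := by
    rw [← hγ0] at hψd
    have := hψd.comp_hasDerivAt 0 hγ
    rwa [hγ0] at this
  have hk0 : ∀ᶠ t in 𝓝[>] (0 : ℝ), 0 < ψ (graphPt N G (p + t • ξ)) := by
    have h3 := hk.tendsto_slope.mono_left (nhdsWithin_mono 0 fun t (ht : t ∈ Ioi (0 : ℝ)) => ht.ne')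
    have hpos : ∀ᶠ t in 𝓝[>] (0 : ℝ), 0 < t := self_mem_nhdsWithin
    filter_upwards [h3.eventually (lt_mem_nhds h2), hpos] with t h4 ht
    rw [slope_def_field, hγ0, hψ, sub_zero, sub_zero] at h4
    exact (div_pos_iff_of_pos_right ht).1 h4
  have hφ0 : ∀ᶠ t in 𝓝[>] (0 : ℝ), φ (graphPt N G (p + t • ξ)) = 0 :=
    ((tendsto_add_smul p ξ).mono_left nhdsWithin_le_nhds).eventually hG.eventually_graphPt_mem
  refine nonneg_of_hasDerivAt_of_eventually_nonneg
    (k := fun t : ℝ => f (graphPt N G (p + t • ξ))) ?_ (by simp only [hγ0, hf0]) ?_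
  · rw [← hγ0] at hf
    exact hf.comp_hasDerivAt 0 hγ
  · filter_upwards [hγt.eventually hfM, hγt.eventually (h.isOpen.mem_nhds hp), hφ0, hk0]
      with t h3 h4 h5 h6
    exact h3 ((h.mem_iff h4).2 ⟨h5, h6.le⟩)

end IsBoundaryChart

namespace SlabConfig

/-- The height is constant on `{φ = 0, ψ = 0}`, so by Lagrange multipliers its differential is a
combination of those of `φ` and `ψ`. The coefficient `b` measures the failure of `M` to be
horizontal at `q`. -/
theorem exists_isBoundaryChart_floor (h : SlabConfig e v c₁ c₂ s Ω M Hf L)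
    (hq : q ∈ faceBoundaries e c₁ c₂ Ω) (hqs : s < ⟪v, q⟫) (hqe : ⟪e, q⟫ = c₁) :
    ∃ (V : Set (Amb n)) (φ ψ : Amb n → ℝ) (a b : ℝ), q ∈ V ∧ IsBoundaryChart M V φ ψ ∧
      φ q = 0 ∧ ψ q = 0 ∧ (∀ᶠ x in 𝓝 q, x ∈ faceBoundaries e c₁ c₂ Ω ↔ φ x = 0 ∧ ψ x = 0) ∧
      innerSL ℝ e = a • fderiv ℝ φ q + b • fderiv ℝ ψ q := by
  obtain ⟨V, φ, ψ, hqV, hc, hφ, hψ, hΓ⟩ := h.exists_isBoundaryChart hq hqs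
  obtain ⟨a, b, hab⟩ := exists_add_smul_eq_of_nonneg_on_zeroSet
    (φ := fun x => ⟪e, x⟫ - c₁) ((innerSL ℝ e).hasStrictFDerivAt.sub_const c₁)
    ((hc.contDiffAt_fst hqV).hasStrictFDerivAt (by norm_num))
    ((hc.contDiffAt_snd hqV).hasStrictFDerivAt (by norm_num)) hφ hψ (sub_eq_zero.2 hqe) (by
      filter_upwards [hΓ, h.eventually_inner_eq_of_mem_faceBoundaries hqe] with x h1 h2 h3 h4
      exact (sub_eq_zero.2 (h2 (h1.2 ⟨h3, h4⟩))).ge) (hc.linearIndependent_fderiv hqV)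
  exact ⟨V, φ, ψ, a, b, hqV, hc, hφ, hψ, hΓ, hab⟩

end SlabConfig

namespace IsBadPoint

/-- Where `Ω` lies below a graph tangent to the lower face, the boundary of `M` is horizontal. -/
theorem exists_isBoundaryGraph_of_lt (h : SlabConfig e v c₁ c₂ s Ω M Hf L)
    (hs : s < T) (hx : x ∈ faceBoundaries e c₁ c₂ Ω) (hxe : ⟪e, x⟫ = c₁) (hxT : T < ⟪v, x⟫) (hG : IsLowerGraph e c₁ Ω M Hf (reflectIn v T x) G)
    (hup : ∀ᶠ w in 𝓝 x, w ∈ M → ⟪e, w⟫ ≤ G (reflectIn v T w)) :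
    ∃ g χ, IsBoundaryGraph M (faceBoundaries e c₁ c₂ Ω) x e g χ := by
  obtain ⟨V, φ, ψ, a, b, hxV, hc, hφ, hψ, hΓ, hab⟩ :=
    h.exists_isBoundaryChart_floor hx (hs.trans hxT) hxe
  obtain ⟨ξ, hξ1, hξ2⟩ := hc.exists_inward hxV
  have hab' : ⟪e, ξ⟫ = b * fderiv ℝ ψ x ξ := by
    have := congrArg (fun l : Amb n →L[ℝ] ℝ => l ξ) hab
    simpa [hξ1] using this
  have h1 : 0 ≤ innerSL ℝ e ξ := hc.nonneg_of_inward hxV hφ hψ (f := fun x => ⟪e, x⟫ - c₁)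
    ((innerSL ℝ e).hasFDerivAt.sub_const c₁) (sub_eq_zero.2 hxe)
    (Eventually.of_forall fun w hw => sub_nonneg.2 (h.eventually_le_of_mem w hw)) hξ1 hξ2
  have hd : HasFDerivAt (fun w => G (reflectIn v T w)) (0 : Amb n →L[ℝ] ℝ) x := by
    have h2 : HasFDerivAt G (0 : Amb n →L[ℝ] ℝ) (reflectIn v T x) := by
      rw [← hG.fderiv_eq]
      exact (hG.contDiffAt.differentiableAt (by norm_num)).hasFDerivAt
    have h3 := h2.comp x (hasFDerivAt_reflectIn v T x)
    rwa [ContinuousLinearMap.zero_comp] at h3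
  have h2 : 0 ≤ (0 - innerSL ℝ e) ξ := hc.nonneg_of_inward hxV hφ hψ
    (f := fun w => G (reflectIn v T w) - ⟪e, w⟫) (hd.sub (innerSL ℝ e).hasFDerivAt)
    (by rw [hG.apply_eq, hG.inner_eq, hxe, sub_self])
    (hup.mono fun w hw hwM => sub_nonneg.2 (hw hwM)) hξ1 hξ2
  rw [innerSL_apply_apply] at h1
  rw [sub_apply, zero_apply, innerSL_apply_apply] at h2
  -- Near `x`, `M` is squeezed between the plane and the reflected graph, which are tangent at `x`;
  -- so the inward direction `ξ` is horizontal.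
  have hb : b = 0 := (mul_eq_zero.1 (hab'.symm.trans (by linarith))).resolve_right hξ2.ne'
  rw [hb, zero_smul, add_zero] at hab
  obtain ⟨g, χ, hg, -⟩ := hc.exists_isBoundaryGraph hxV h.norm_e hφ hψ hΓ hab
  exact ⟨g, χ, hg⟩

/-- The mirror image lies in the relative interior of the face, on a lower graph. Its reflection
squeezes `M` against the plane, so `M` is horizontal at `x`, and the Hopf lemma on a ball over `M`
touching `x` yields contact points. -/
theorem not_lt_inner (h : SlabConfig e v c₁ c₂ s Ω M Hf L) (hT : ReflectsInto v T Ω)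
    (hs : s < T) (hb : IsBadPoint v T Ω x) (hx : x ∈ faceBoundaries e c₁ c₂ Ω)
    (hxe : ⟪e, x⟫ = c₁) : ¬ T < ⟪v, x⟫ := by
  intro hxT
  have he := h.norm_e
  have hv := h.norm_v
  obtain ⟨G, hG⟩ := hb.exists_isLowerGraph_reflectIn h hs ⟨hb.mem_closure, hxe⟩ hxT
  have hRt : Tendsto (reflectIn v T) (𝓝 x) (𝓝 (reflectIn v T x)) :=
    (continuous_reflectIn v T).continuousAt
  have hvc : Continuous fun y : Amb n => ⟪v, y⟫ := by fun_prop
  have hvT : ∀ᶠ w in 𝓝 x, T < ⟪v, w⟫ := (isOpen_lt continuous_const hvc).mem_nhds hxT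
  have hΩ : ∀ᶠ w in 𝓝 x, w ∈ Ω → ⟪e, w⟫ < G (reflectIn v T w) := by
    filter_upwards [hRt.eventually hG.mem_domain_iff, hvT] with w h1 h2 h3
    have h4 := (h1.1 (hT T le_rfl w h3 h2)).2
    rwa [inner_reflectIn_of_orthogonal h.inner_eq] at h4
  have hGc : ∀ᶠ w in 𝓝 x, ContinuousAt (fun w => G (reflectIn v T w)) w :=
    (hRt.eventually hG.contDiffAt.eventually_continuousAt).mono fun w hw =>
      ContinuousAt.comp hw (continuous_reflectIn v T).continuousAt
  have hup : ∀ᶠ w in 𝓝 x, w ∈ M → ⟪e, w⟫ ≤ G (reflectIn v T w) := by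
    filter_upwards [hΩ.eventually_nhds, hGc] with w h1 h2 h3
    by_contra! h4
    have hec : ContinuousAt (fun x : Amb n => ⟪e, x⟫) w := by fun_prop
    obtain ⟨z, hz, h5, h6⟩ := ((mem_closure_iff_frequently.1
      (h.dom.mem_closure_of_mem h3)).and_eventually (h1.and (h2.eventually_lt hec h4))).exists
    exact h6.not_gt (h5 hz)
  obtain ⟨g, χ, hg⟩ := exists_isBoundaryGraph_of_lt h hs hx hxe hxT hG hup
  -- `Ω` does not lie above the graph
  obtain ⟨δ, hδ, hcol⟩ := ((h.eventually_mem_or_eq hxe).and (hg.mem_iff.and hΩ)).exists_column he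
  have hec : Continuous fun y : Amb n => ⟪e, y⟫ := by fun_prop
  have hsmall : ∀ᶠ w in 𝓝 x, G (reflectIn v T w) < c₁ + δ / 2 :=
    hGc.self_of_nhds.eventually (gt_mem_nhds (by
      simp only [hG.apply_eq, hG.inner_eq]; linarith))
  -- The other sign of the curvature would need `Ω` directly above `M`. A vertical segment of `Ω`
  -- would then rise, meeting no frontier, past the reflected lower graph that bounds `Ω` from
  -- above.
  have hpde : ∀ᶠ z in 𝓝 x, z ∈ {z | 0 < χ z} →
      levelSetMeanCurvature (graphFn e g) z = -Hf (graphPt e g z) := by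
    filter_upwards [hg.eventually_levelSetMeanCurvature h hxe, hg.tendsto_graphPt.eventually hcol,
      hg.tendsto_graphPt.eventually hsmall, hg.eventually_graphPt_mem he] with z h1 h2 h3 h4 hz
    refine (h1 hz).resolve_right ?_
    rintro ⟨-, h5⟩
    have hmc := h.eventually_le_of_mem _ (h4 (le_of_lt hz))
    have hmg : ⟪e, graphPt e g z⟫ = g (graphPt e g z) := by
      rw [inner_graphPt he, hg.inv_fst.graphPt]
    set m := graphPt e g z
    have hA : IsPreconnected ((fun t : ℝ => m + t • e) '' Ioc 0 (δ / 2)) :=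
      isPreconnected_Ioc.image _ (by fun_prop)
    rcases subset_or_disjoint_of_frontier hA (Ω := Ω) (by
      rw [eq_empty_iff_forall_notMem]
      rintro y ⟨⟨t, ht, rfl⟩, hy⟩
      have h6 := h2 t (by rw [abs_of_pos ht.1]; linarith [ht.2])
      rcases h6.1 hy with h7 | h7
      · have h8 := (h6.2.1.1 h7).1
        rw [h.inner_e_add, hg.inv_fst, hmg] at h8
        linarith [ht.1]
      · simp only [h.inner_e_add] at h7
        linarith [ht.1]) with h6 | h6
    · have h7 := (h2 (δ / 2) (by rw [abs_of_pos (by linarith)]; linarith)).2.2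
        (h6 ⟨δ / 2, ⟨by linarith, le_rfl⟩, rfl⟩)
      rw [h.inner_e_add, reflectIn_add_smul h.inner_eq, hG.inv] at h7
      linarith
    · have ht := (tendsto_add_smul m e).mono_left (nhdsWithin_le_nhds (s := Ioi (0 : ℝ)))
      obtain ⟨t, h7, ht0⟩ := ((ht.eventually h5).and
        (Ioc_mem_nhdsGT (show (0 : ℝ) < δ / 2 by linarith))).exists
      refine h6 ⟨t, ht0, rfl⟩ (h7 ?_)
      rw [hg.inv_fst, h.inner_e_add, ← hmg]
      linarith [ht0.1]
  obtain ⟨ν, hν, hball⟩ := hg.eventually_ball_subset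
  have := hG.contactSet_nonempty h hT hxT hg.inv_fst hg.contDiffAt_fst
    (by rw [hg.apply_fst, hxe]) hg.fderiv_fst
    ((hg.eventually_graphPt_mem he).mono fun z hz (hz0 : 0 < χ z) => hz hz0.le) hpde hν hball
  rw [h.contactSet_eq_empty hT hs] at this
  exact not_nonempty_empty this

end IsBadPoint

namespace IsBoundaryGraph

theorem abs_levelSetMeanCurvature (hg : IsBoundaryGraph M (faceBoundaries e c₁ c₂ Ω) q e g χ)
    (h : SlabConfig e v c₁ c₂ s Ω M Hf L) (hq : ⟪e, q⟫ = c₁) :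
    ∀ᶠ x in 𝓝 q, 0 < χ x → |levelSetMeanCurvature (graphFn e g) x| = |Hf (graphPt e g x)| := by
  filter_upwards [hg.eventually_levelSetMeanCurvature h hq] with x hx h0
  rcases hx h0 with h1 | h1
  · rw [h1, abs_neg]
  · rw [h1.1]

theorem abs_sub_le (hg : IsBoundaryGraph M (faceBoundaries e c₁ c₂ Ω) q e g χ)
    (h : SlabConfig e v c₁ c₂ s Ω M Hf L) (hq : ⟪e, q⟫ = c₁) (hqM : q ∈ M) :
    ∀ᶠ x in 𝓝 q, 0 < χ x → |Hf (graphPt e g x) - Hf q| ≤ L * |g x - c₁| := by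
  filter_upwards [hg.eventually_graphPt_mem h.norm_e] with x hx h0
  have := h.lip _ (h.dom.mem_closure_of_mem (hx h0.le)) _ (h.dom.mem_closure_of_mem hqM)
  rwa [inner_graphPt h.norm_e, hq] at this

/-- Points with `χ > 0` accumulate at `q`, and over them the curvature has absolute value `|Hf|`,
which tends to `|Hf q|`; a zero Hessian would make the curvature at `q` zero. -/
theorem hess_ne_zero (hg : IsBoundaryGraph M (faceBoundaries e c₁ c₂ Ω) q e g χ)
    (h : SlabConfig e v c₁ c₂ s Ω M Hf L) (hq : ⟪e, q⟫ = c₁) (hqM : q ∈ M) (hH : Hf q ≠ 0) :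
    hess g q ≠ 0 := by
  intro h0
  have h1 := levelSetMeanCurvature_graphFn_eq_zero h.norm_e hg.inv_fst hg.contDiffAt_fst h0
  have h2 := (continuousAt_levelSetMeanCurvature_graphFn h.norm_e hg.inv_fst
    hg.contDiffAt_fst).abs
  have h3 : ContinuousAt (fun x => L * |g x - c₁|) q :=
    continuousAt_const.mul (hg.contDiffAt_fst.continuousAt.sub continuousAt_const).abs
  have h0' : |levelSetMeanCurvature (graphFn e g) q| + L * |g q - c₁| < |Hf q| := by
    simpa [h1, hg.apply_fst, hq] using hH
  have h4 : ∀ᶠ x in 𝓝 q, |levelSetMeanCurvature (graphFn e g) x| + L * |g x - c₁| < |Hf q| :=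
    (h2.add h3).eventually (gt_mem_nhds h0')
  obtain ⟨x, hx, h5, h6, h7⟩ := (hg.frequently_pos.and_eventually (h4.and
    ((hg.abs_levelSetMeanCurvature h hq).and (hg.abs_sub_le h hq hqM)))).exists
  have h8 := h7 hx
  have h9 := h6 hx
  have h10 := abs_sub_abs_le_abs_sub (Hf q) (Hf (graphPt e g x))
  rw [abs_sub_comm] at h10
  linarith

/-- If `M` is not curved at `q`, it is flat there. -/
theorem eventually_eq_of_eq_zero (hg : IsBoundaryGraph M (faceBoundaries e c₁ c₂ Ω) q e g χ)
    (h : SlabConfig e v c₁ c₂ s Ω M Hf L) (hq : ⟪e, q⟫ = c₁) (hqM : q ∈ M) (hH : Hf q = 0) :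
    ∀ᶠ x in 𝓝 q, 0 ≤ χ x → g x = c₁ := by
  have he := h.norm_e
  obtain ⟨ν, a, hν, ha, hd⟩ := fderiv_eq_smul_innerSL hg.fderiv_snd_ne_zero
  have hball := eventually_ball_subset_pos hg.contDiffAt_snd hg.apply_snd hν ha hd
  have hgq : g q = c₁ := by rw [hg.apply_fst, hq]
  have hineq : ∀ᶠ x in 𝓝 q, 0 < χ x → c₁ ≤ g x ∧ |levelSetMeanCurvature (graphFn e g) x -
      levelSetMeanCurvature (graphFn e fun _ => c₁) x| ≤ L * |g x - c₁| := by
    filter_upwards [hg.eventually_le h, hg.abs_levelSetMeanCurvature h hq, hg.abs_sub_le h hq hqM]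
      with x h1 h2 h3 h4
    refine ⟨h1 h4.le, ?_⟩
    rw [levelSetMeanCurvature_graphFn_const he, sub_zero, h2 h4]
    simpa [hH] using h3 h4
  have hbeq := exists_ball_eq_of_touching (S := {x | 0 < χ x}) h.hn he hg.inv_fst
    (invariantAlong_const e c₁) hg.contDiffAt_fst contDiffAt_const hg.fderiv_fst (by simp) hgq
    h.nonneg hineq hν hball
  -- The Hopf lemma gives flatness only on a ball touching `q`. The strong maximum principle spreads
  -- it over the connected set `{χ > 0}` near `q`.
  obtain ⟨ρ, hρ, hell⟩ := exists_ellIneq_sub h.hn he hg.inv_fst (invariantAlong_const e c₁)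
    hg.contDiffAt_fst contDiffAt_const hg.fderiv_fst (by simp) L h.nonneg
  obtain ⟨K, hKi, hK2, hKq, hK⟩ := exists_graph hν hg.contDiffAt_snd hg.apply_snd (by
    rw [hd]; simpa [hν] using ha)
  obtain ⟨W, hWq, hWo, hWU, hWc⟩ := exists_nhds_isPreconnected_above hν hKi
    hK2.eventually_continuousAt hKq (inter_mem (ball_mem_nhds q hρ) (hK.and (hineq.and
      ((hg.contDiffAt_fst.eventually (by norm_num)).and
        hg.contDiffAt_snd.eventually_continuousAt))))
  have hWeq : {x ∈ W | K x < ⟪ν, x⟫} = {x ∈ W | 0 < χ x} := by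
    ext x
    exact and_congr_right fun hx => ((hWU hx).2.1.2.1).symm
  rw [hWeq] at hWc
  have hOo : IsOpen {x ∈ W | 0 < χ x} := by
    refine isOpen_iff_mem_nhds.2 fun x hx => ?_
    exact inter_mem (hWo.mem_nhds hx.1) ((hWU hx.1).2.2.2.2.eventually (lt_mem_nhds hx.2))
  have ht := (tendsto_add_smul q ν).mono_left (nhdsWithin_le_nhds (s := Ioi (0 : ℝ)))
  have hpos : ∀ᶠ r in 𝓝[>] (0 : ℝ), 0 < r := self_mem_nhdsWithin
  obtain ⟨r, hr1, hr2, hr3, hr0⟩ := (hbeq.and (hball.and ((ht.eventually hWq).and hpos))).exists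
  have hrb := mem_ball_self (x := q + r • ν) hr0
  have hzero := eq_zero_of_nonneg_of_ellIneq (w := fun x => g x - c₁) hOo hWc
    (fun x hx => (hWU hx.1).2.2.2.1.sub contDiffAt_const)
    (hell _ (fun x hx => (hWU hx.1).1) fun x hx => ((hWU hx.1).2.2.1 hx.2).2)
    (fun x hx => sub_nonneg.2 ((hWU hx.1).2.2.1 hx.2).1) (p := q + r • ν)
    ⟨hr3, hr2 hrb⟩ (sub_eq_zero.2 (hr1 _ hrb))
  filter_upwards [hWq, hg.eventually_eq h hq] with x h1 h2 h3
  rcases h3.eq_or_lt with h4 | h4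
  · exact h2 h4.symm
  · exact sub_eq_zero.1 (hzero x ⟨h1, h4⟩)

end IsBoundaryGraph

namespace IsBadPoint

/-- On the plane of reflection it suffices that lines in the direction `v` meet `M` inside the slab
at most once near `q`. This holds if `v` is transversal to `M`. Otherwise `M` is horizontal at `q`.
If `Hf q = 0`, it is flat there and has no nearby points inside the slab; if `Hf q ≠ 0`, it is the
graph of a function strictly convex in the direction `v` that takes its least value on the border.
-/
theorem inner_ne (h : SlabConfig e v c₁ c₂ s Ω M Hf L) (hT : ReflectsInto v T Ω)
    (hs : s < T) (hb : IsBadPoint v T Ω q) (hqΓ : q ∈ faceBoundaries e c₁ c₂ Ω)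
    (hqe : ⟪e, q⟫ = c₁) : ⟪v, q⟫ ≠ T := by
  intro hqT
  have hqs : s < ⟪v, q⟫ := hqT ▸ hs
  have hqM := h.boundary_subset hqΓ
  obtain ⟨V, φ, ψ, a, b, hqV, hc, hφ, hψ, hΓ, hab⟩ := h.exists_isBoundaryChart_floor hqΓ hqs hqe
  by_cases hφv : fderiv ℝ φ q v = 0
  swap
  · obtain ⟨U, hU, hline⟩ := exists_nhds_line
      ((hc.contDiffAt_fst hqV).hasStrictFDerivAt (by norm_num)) hφv h.norm_v
    refine hb.false_of_line h hT hqT (inter_mem hU (hc.isOpen.mem_nhds hqV))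
      fun m hm hmM _ τ hτ hmτ hM => ?_
    exact hline m hm.1 ((hc.mem_iff hm.2).1 hmM).1 τ hτ hmτ.1 ((hc.mem_iff hmτ.2).1 hM).1
  -- Transversality of the border to `v` together with `Dφ v = 0` gives `Dψ v ≠ 0`; as `e` is
  -- orthogonal to `v`, the coefficient `b` must vanish.
  obtain ⟨F, F', hF, hF0, hFv, hFΓ⟩ := h.border q hqΓ hqs
  obtain ⟨a', b', hab'⟩ := exists_add_smul_eq_of_nonneg_on_zeroSet hF
    ((hc.contDiffAt_fst hqV).hasStrictFDerivAt (by norm_num))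
    ((hc.contDiffAt_snd hqV).hasStrictFDerivAt (by norm_num)) hφ hψ hF0 (by
      filter_upwards [hΓ, hFΓ] with x h1 h2 h3 h4
      exact (h2 (h1.2 ⟨h3, h4⟩)).ge) (hc.linearIndependent_fderiv hqV)
  have hψv : fderiv ℝ ψ q v ≠ 0 := fun h0 => hFv (by rw [hab']; simp [hφv, h0])
  have hb0 : b = 0 := by
    have h1 := congrArg (fun l : Amb n →L[ℝ] ℝ => l v) hab
    simpa [hφv, hψv, h.inner_eq] using h1
  rw [hb0, zero_smul, add_zero] at hab
  obtain ⟨g, χ, hg, hχ⟩ := hc.exists_isBoundaryGraph hqV h.norm_e hφ hψ hΓ hab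
  have hχv : fderiv ℝ χ q v ≠ 0 := by rwa [hχ v h.inner_eq]
  have hgq : g q = c₁ := by rw [hg.apply_fst, hqe]
  by_cases hH : Hf q = 0
  · refine hb.false_of_line h hT hqT (inter_mem hg.mem_iff
      (hg.eventually_eq_of_eq_zero h hqe hqM hH)) fun m hm hmM hmS _ _ _ _ => ?_
    have h1 := hm.1.1 hmM
    exact hmS.1.ne' (h1.1.trans (hm.2 h1.2))
  have h0 : ∀ᶠ x in 𝓝 q, χ x = 0 → g x = g q := by rw [hgq]; exact hg.eventually_eq h hqe
  have hB := hess_pos_of_constant_on_zeroSet hg.contDiffAt_fst hg.contDiffAt_snd hg.apply_snd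
    hg.fderiv_fst hχv h0 (by
      rw [hgq]; exact (hg.eventually_le h).mono fun x hx hx0 => hx hx0.le)
    (hg.hess_ne_zero h hqe hqM hH)
  have hkey : ∀ m, (m ∈ M ↔ ⟪e, m⟫ = g m ∧ 0 ≤ χ m) → m ∈ M → m ∈ openSlab e c₁ c₂ →
      0 ≤ χ m ∧ g q < g m ∧ g m = ⟪e, m⟫ := fun m hm hmM hmS =>
    ⟨(hm.1 hmM).2, by rw [hgq, ← (hm.1 hmM).1]; exact hmS.1, (hm.1 hmM).1.symm⟩
  have hev : ∀ (m : Amb n) (τ : ℝ), ⟪e, m + τ • v⟫ = ⟪e, m⟫ := fun m τ => by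
    rw [inner_add_right, inner_smul_right, h.inner_eq, mul_zero, add_zero]
  rcases lt_or_gt_of_ne hχv with hneg | hpos
  · obtain ⟨U, hU, hline⟩ := exists_nhds_line_of_hess_pos (w := -v) (by rw [norm_neg, h.norm_v])
      hg.contDiffAt_fst hg.contDiffAt_snd hg.apply_snd (by rw [map_neg]; linarith) h0
      (by simpa using hB)
    refine hb.false_of_line h hT hqT (inter_mem hU hg.mem_iff) fun m hm hmM hmS τ hτ hmτ hM => ?_
    have h1 := hkey m hm.2 hmM hmS
    have h2 := hkey _ hmτ.2 hM ((h.add_smul_mem_openSlab τ).2 hmS)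
    have h3 : m + τ • v + τ • -v = m := by module
    have h4 := hline _ hmτ.1 h2.1 h2.2.1 τ hτ (by rw [h3]; exact hm.1)
    rw [h3, h1.2.2, h2.2.2, hev] at h4
    exact h4 rfl
  · obtain ⟨U, hU, hline⟩ := exists_nhds_line_of_hess_pos (w := v) h.norm_v
      hg.contDiffAt_fst hg.contDiffAt_snd hg.apply_snd hpos h0 hB
    refine hb.false_of_line h hT hqT (inter_mem hU hg.mem_iff) fun m hm hmM hmS τ hτ hmτ hM => ?_
    have h1 := hkey m hm.2 hmM hmS
    have h2 := hkey _ hmτ.2 hM ((h.add_smul_mem_openSlab τ).2 hmS)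
    have h4 := hline _ hm.1 h1.1 h1.2.1 τ hτ hmτ.1
    rw [h1.2.2, h2.2.2, hev] at h4
    exact h4 rfl

theorem notMem_face (h : SlabConfig e v c₁ c₂ s Ω M Hf L) (hT : ReflectsInto v T Ω)
    (hs : s < T) (hb : IsBadPoint v T Ω x) : ⟪e, x⟫ ≠ c₁ := by
  intro hxe
  have hx := hb.mem_faceBoundaries h hT hs ⟨hb.mem_closure, hxe⟩
  rcases hb.le_inner.lt_or_eq with h1 | h1
  · exact hb.not_lt_inner h hT hs hx hxe h1
  · exact hb.inner_ne h hT hs hx hxe h1.symm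

end IsBadPoint

theorem SlabConfig.not_isBadPoint (h : SlabConfig e v c₁ c₂ s Ω M Hf L) (hT : ReflectsInto v T Ω)
    (hs : s < T) (x : Amb n) : ¬ IsBadPoint v T Ω x := by
  intro hb
  have h1 := hb.notMem_face h hT hs
  have h2 := hb.notMem_face h.neg hT hs
  have h3 := h.dom.closure_subset hb.mem_closure
  refine hb.notMem_openSlab h hT hs ⟨h3.1.lt_of_ne' h1, h3.2.lt_of_ne fun h4 => h2 ?_⟩
  rw [inner_neg_left, h4]

end BoundaryPoints

/-! ### The continuity argument -/

section Symmetry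

variable {n : ℕ} {e v : Amb n} {c₁ c₂ s L T : ℝ} {Ω M : Set (Amb n)} {Hf : Amb n → ℝ}

/-- The mirror image of `x` at level `T` is that of `x + (2 * (t - T)) • v` at level `t`, and for
`t` slightly above `T` this shifted point is still in `Ω`. -/
theorem reflectsInto_of_forall_gt (hv : ‖v‖ = 1) (hΩ : IsOpen Ω)
    (h : ∀ t, T < t → ∀ x ∈ Ω, t < ⟪v, x⟫ → reflectIn v t x ∈ Ω) : ReflectsInto v T Ω := by
  intro t ht x hx htx
  rcases ht.eq_or_lt with rfl | ht
  swap
  · exact h t ht x hx htx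
  have hc : ContinuousAt (fun t : ℝ => x + (2 * (t - T)) • v) T := by fun_prop
  have h1 : ∀ᶠ t in 𝓝[>] T, x + (2 * (t - T)) • v ∈ Ω :=
    nhdsWithin_le_nhds (hc.preimage_mem_nhds (hΩ.mem_nhds (by simpa using hx)))
  obtain ⟨t, h2, h3⟩ := (h1.and (Ioo_mem_nhdsGT htx)).exists
  have hvv : ⟪v, v⟫ = 1 := by rw [real_inner_self_eq_norm_sq, hv]; norm_num
  have h4 : ⟪v, x + (2 * (t - T)) • v⟫ = ⟪v, x⟫ + 2 * (t - T) := by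
    rw [inner_add_right, inner_smul_right, hvv, mul_one]
  have h5 := h t h3.1 _ h2 (by rw [h4]; linarith [h3.1, h3.2])
  convert h5 using 1
  rw [reflectIn, reflectIn, h4]
  module

namespace SlabConfig

/-- The failing levels are bounded above because `Ω` is bounded. Their supremum is not itself
failing, so they accumulate at it from the left; with no bad point in the compact closure, this is
impossible. -/
theorem reflectsInto (h : SlabConfig e v c₁ c₂ s Ω M Hf L) : ReflectsInto v s Ω := by
  refine reflectsInto_of_forall_gt h.norm_v h.dom.isOpen fun t₀ ht₀ x₀ hx₀ hxt₀ => ?_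
  by_contra hout
  set A : Set ℝ := {t | ∃ x ∈ Ω, t < ⟪v, x⟫ ∧ reflectIn v t x ∉ Ω} with hA
  have hne : A.Nonempty := ⟨t₀, x₀, hx₀, hxt₀, hout⟩
  have hbdd : BddAbove A := by
    obtain ⟨R, hR⟩ := h.dom.isBounded.exists_norm_le
    refine ⟨R, fun t ⟨x, hx, htx, _⟩ => htx.le.trans ?_⟩
    have := real_inner_le_norm v x
    rw [h.norm_v, one_mul] at this
    exact this.trans (hR x hx)
  have hlub := isLUB_csSup hne hbdd
  set T := sSup A
  have hsT : s < T := ht₀.trans_le (hlub.1 ⟨x₀, hx₀, hxt₀, hout⟩)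
  have hT : ReflectsInto v T Ω := reflectsInto_of_forall_gt h.norm_v h.dom.isOpen
    fun t ht x hx htx => by
      by_contra hcon
      exact ht.not_ge (hlub.1 ⟨x, hx, htx, hcon⟩)
  have hTA : T ∉ A := fun ⟨x, hx, htx, hcon⟩ => hcon (hT T le_rfl x hx htx)
  have hfreq : ∃ᶠ t in 𝓝[<] T, t ∈ A := by
    have h1 := hlub.frequently_mem hne
    rw [frequently_nhdsWithin_iff] at h1 ⊢
    exact h1.mono fun t ht => ⟨ht.1, lt_of_le_of_ne ht.2 fun h2 : t = T => by
      rw [h2] at ht; exact hTA ht.1⟩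
  have hK : IsCompact (closure Ω) := h.dom.isBounded.isCompact_closure
  -- Compactness turns the absence of bad points into one left neighbourhood of `T` that serves all
  -- points of the closure.
  have hall := hK.mem_prod_nhdsSet_of_forall (l := 𝓝[<] T)
    (s := {z : ℝ × Amb n | ¬ (z.2 ∈ Ω ∧ z.1 < ⟪v, z.2⟫ ∧ reflectIn v z.1 z.2 ∉ Ω)})
    fun x _ => not_frequently.1 (h.not_isBadPoint hT hsT x)
  have hev : ∀ᶠ t in 𝓝[<] T, ∀ x ∈ closure Ω,
      ¬ (x ∈ Ω ∧ t < ⟪v, x⟫ ∧ reflectIn v t x ∉ Ω) :=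
    eventually_prod_principal_iff.1 (Filter.prod_mono le_rfl principal_le_nhdsSet hall)
  obtain ⟨t, ⟨x, hx, htx, hcon⟩, h2⟩ := (hfreq.and_eventually hev).exists
  exact h2 x (subset_closure hx) ⟨hx, htx, hcon⟩

theorem reflectIn_image_eq (h : SlabConfig e v c₁ c₂ s Ω M Hf L)
    (h' : SlabConfig e (-v) c₁ c₂ (-s) Ω M Hf L) : reflectIn v s '' Ω = Ω := by
  have hmem : ∀ x ∈ Ω, reflectIn v s x ∈ Ω := by
    intro x hx
    rcases lt_trichotomy ⟪v, x⟫ s with h1 | h1 | h1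
    · have h2 := h'.reflectsInto (-s) le_rfl x hx (by rw [inner_neg_left]; linarith)
      convert h2 using 1
      rw [reflectIn, reflectIn, inner_neg_left]
      module
    · rwa [reflectIn_of_inner_eq h1]
    · exact h.reflectsInto s le_rfl x hx h1
  refine subset_antisymm (image_subset_iff.2 hmem) fun x hx => ?_
  exact ⟨_, hmem x hx, reflectIn_reflectIn h.norm_v s x⟩

end SlabConfig

end Symmetry

/-! ### Chords and transversality for faces bordered by double graphs -/

section DoubleGraphs

variable {n : ℕ} {e v : Amb n} {c c₁ c₂ s : ℝ} {P D Γ M Ω V : Set (Amb n)} {φ ψ : Amb n → ℝ}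
  {x : Amb n}

/-- `D` and the closure of `P \ D` are closed, cover `P`, and meet only in the relative boundary. -/
theorem hyperplane_subset_or_disjoint {A : Set (Amb n)} (hA : IsPreconnected A) (hAP : A ⊆ P)
    (hD : IsClosed D) (hd : ∀ x ∈ A, x ∉ relBoundary P D) (hx : x ∈ A) (hxD : x ∈ D) : A ⊆ D := by
  by_contra hcon
  obtain ⟨y, hyA, hyD⟩ := not_subset.1 hcon
  obtain ⟨z, hzA, hz⟩ := isPreconnected_closed_iff.1 hA D (closure (P \ D)) hD isClosed_closure
    (fun z hz => (em (z ∈ D)).imp id fun h => subset_closure ⟨hAP hz, h⟩) ⟨x, hx, hxD⟩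
    ⟨y, hyA, subset_closure ⟨hAP hyA, hyD⟩⟩
  exact hd z hzA ⟨subset_closure hz.1, hz.2⟩

/-- The orthogonal projection on `hyperplane v s`. -/
noncomputable def projIn (v : Amb n) (s : ℝ) (x : Amb n) : Amb n := x - (⟪v, x⟫ - s) • v

theorem projIn_add_smul (hv : ‖v‖ = 1) (x : Amb n) (t : ℝ) :
    projIn v s (x + t • v) = projIn v s x := by
  rw [projIn, projIn, inner_add_right, inner_smul_right, real_inner_self_eq_norm_sq, hv]
  module

theorem contDiff_projIn : ContDiff ℝ 2 (projIn v s) :=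
  contDiff_id.sub (((innerSL ℝ v).contDiff.sub contDiff_const).smul contDiff_const)

theorem continuous_projIn : Continuous (projIn v s) := contDiff_projIn.continuous

theorem inner_projIn_of_orthogonal (hev : ⟪e, v⟫ = 0) (x : Amb n) :
    ⟪e, projIn v s x⟫ = ⟪e, x⟫ := by
  rw [projIn, inner_sub_right, inner_smul_right, hev, mul_zero, sub_zero]

theorem projIn_of_inner_eq (h : ⟪v, x⟫ = s) : projIn v s x = x := by
  rw [projIn, h, sub_self, zero_smul, sub_zero]

theorem projIn_add (x : Amb n) : projIn v s x + (⟪v, x⟫ - s) • v = x := by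
  rw [projIn, sub_add_cancel]

theorem IsDoubleC2Graph.neg (h : IsDoubleC2Graph (hyperplane e c) v s Γ) (hv : ‖v‖ = 1) :
    IsDoubleC2Graph (hyperplane e c) (-v) (-s) Γ := by
  obtain ⟨U, f, ⟨O, hO, hU⟩, h1, h2, h3, h4, h5⟩ := h
  have hcl : closure U ⊆ hyperplane v s :=
    closure_minimal (by rw [hU]; exact fun x hx => hx.2.2) (isClosed_hyperplane v s)
  have hR : ∀ x ∈ closure U, reflectIn v s (x + f x • v) = x + f x • -v := fun x hx => by
    have hxs : ⟪v, x⟫ = s := hcl hx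
    rw [reflectIn, inner_add_right, inner_smul_right, real_inner_self_eq_norm_sq, hv, hxs]
    module
  have hR' : ∀ y, reflectIn (-v) (-s) y = reflectIn v s y := fun y => by
    rw [reflectIn, reflectIn, inner_neg_left]; module
  have himg : reflectIn v s '' ((fun x => x + f x • v) '' closure U) =
      (fun x => x + f x • -v) '' closure U := by
    rw [image_image]; exact image_congr hR
  refine ⟨U, f, ⟨O, hO, by rw [hU, hyperplane_neg]⟩, h1, h2, h3, h4, ?_⟩
  rw [h5, himg, union_comm]
  congr 1
  rw [← himg, image_congr fun y _ => hR' y, image_image,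
    image_congr fun y _ => reflectIn_reflectIn hv s y, image_id']

/-- The two graphs combine into the single equation `|⟪v, x⟫ - s| = f (projIn v s x)`, which shows
where a line in the direction `v` can meet `Γ`. -/
theorem IsDoubleC2Graph.exists_mem_iff (h : IsDoubleC2Graph (hyperplane e c) v s Γ)
    (hv : ‖v‖ = 1) :
    ∃ (U O : Set (Amb n)) (f : Amb n → ℝ), IsOpen O ∧
      U = O ∩ (hyperplane e c ∩ hyperplane v s) ∧ ContDiffOn ℝ 2 f U ∧ (∀ x ∈ U, 0 < f x) ∧
      (∀ x ∈ closure U, 0 < f x → x ∈ U) ∧ closure U ⊆ hyperplane e c ∩ hyperplane v s ∧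
      ∀ x, x ∈ Γ ↔ projIn v s x ∈ closure U ∧ |⟪v, x⟫ - s| = f (projIn v s x) := by
  obtain ⟨U, f, ⟨O, hO, hU⟩, h1, h2, h3, h4, h5⟩ := h
  have hcl : closure U ⊆ hyperplane e c ∩ hyperplane v s :=
    closure_minimal (by rw [hU]; exact inter_subset_right)
      ((isClosed_hyperplane e c).inter (isClosed_hyperplane v s))
  have hf0 : ∀ x ∈ closure U, 0 ≤ f x := fun x hx => by
    by_cases hxU : x ∈ U
    · exact (h3 x hxU).le
    · exact (h4 x ⟨hx, hxU⟩).ge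
  have hvv : ⟪v, v⟫ = 1 := by rw [real_inner_self_eq_norm_sq, hv]; norm_num
  have hlev : ∀ y ∈ closure U, ∀ t : ℝ, ⟪v, y + t • v⟫ - s = t ∧ projIn v s (y + t • v) = y := by
    intro y hy t
    have hys : ⟪v, y⟫ = s := (hcl hy).2
    refine ⟨?_, by rw [projIn_add_smul hv, projIn_of_inner_eq hys]⟩
    rw [inner_add_right, inner_smul_right, hvv, hys]; ring
  refine ⟨U, O, f, hO, hU, h1, h3, fun x hx hfx => ?_, hcl, fun x => ?_⟩
  · by_contra hxU
    exact hfx.ne' (h4 x ⟨hx, hxU⟩)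
  rw [h5]
  constructor
  · rintro (⟨y, hy, rfl⟩ | ⟨_, ⟨y, hy, rfl⟩, rfl⟩)
    · obtain ⟨h6, h7⟩ := hlev y hy (f y)
      simp only [h6, h7]
      exact ⟨hy, abs_of_nonneg (hf0 y hy)⟩
    · have h8 : reflectIn v s (y + f y • v) = y + (-f y) • v := by
        rw [reflectIn, (hlev y hy (f y)).1]; module
      obtain ⟨h6, h7⟩ := hlev y hy (-f y)
      simp only [h8, h6, h7]
      exact ⟨hy, by rw [abs_neg]; exact abs_of_nonneg (hf0 y hy)⟩
  · rintro ⟨h6, h7⟩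
    rcases abs_eq (hf0 _ h6) |>.1 h7 with h8 | h8
    · left
      exact ⟨_, h6, by simp only; rw [← h8, projIn_add]⟩
    · right
      refine ⟨_, ⟨_, h6, rfl⟩, ?_⟩
      rw [reflectIn, (hlev _ h6 _).1]
      have h9 := projIn_add (v := v) (s := s) x
      rw [h8] at h9
      conv_rhs => rw [← h9]
      module

/-- Take `F y = ⟪v, y⟫ - s - f (π y)`, whose derivative in the direction `v` is `1`. The map `π`
projects to both hyperplanes because `f` is smooth only along their intersection. -/
theorem IsDoubleC2Graph.exists_hasStrictFDerivAt (h : IsDoubleC2Graph (hyperplane e c) v s Γ)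
    (he : ‖e‖ = 1) (hv : ‖v‖ = 1) (hev : ⟪e, v⟫ = 0) (hx : x ∈ Γ) (hxs : s < ⟪v, x⟫) :
    ∃ (F : Amb n → ℝ) (F' : Amb n →L[ℝ] ℝ), HasStrictFDerivAt F F' x ∧ F x = 0 ∧ F' v ≠ 0 ∧
      ∀ᶠ y in 𝓝 x, y ∈ Γ → F y = 0 := by
  obtain ⟨U, O, f, hO, hU, hf, -, hfU, hcl, hmem⟩ := h.exists_mem_iff hv
  have hvc : Continuous fun y : Amb n => ⟪v, y⟫ := by fun_prop
  have hev' : ⟪v, e⟫ = 0 := by rw [real_inner_comm]; exact hev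
  set π : Amb n → Amb n := fun y => projIn e c (projIn v s y) with hπ
  have hπd : ContDiff ℝ 2 π := by
    exact contDiff_projIn.comp contDiff_projIn
  have hπP : ∀ y, π y ∈ hyperplane e c ∩ hyperplane v s := fun y => by
    have h1 : ⟪v, projIn v s y⟫ = s := by
      rw [projIn, inner_sub_right, inner_smul_right, real_inner_self_eq_norm_sq, hv]; ring
    refine ⟨?_, ?_⟩
    · change ⟪e, projIn e c _⟫ = c
      rw [projIn, inner_sub_right, inner_smul_right, real_inner_self_eq_norm_sq, he]; ring
    · change ⟪v, projIn e c _⟫ = s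
      rw [inner_projIn_of_orthogonal hev', h1]
  have hπΓ : ∀ y ∈ Γ, π y = projIn v s y := fun y hy =>
    projIn_of_inner_eq (hcl ((hmem y).1 hy).1).1
  have hΓf : ∀ y ∈ Γ, s < ⟪v, y⟫ → ⟪v, y⟫ - s = f (π y) := fun y hy hys => by
    have h1 := ((hmem y).1 hy).2
    rwa [abs_of_pos (by linarith), ← hπΓ y hy] at h1
  have hxU : π x ∈ U := by
    refine hfU _ ?_ (by rw [← hΓf x hx hxs]; linarith)
    rw [hπΓ x hx]; exact ((hmem x).1 hx).1
  have hxO : π ⁻¹' O ∈ 𝓝 x :=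
    (hO.preimage hπd.continuous).mem_nhds (by rw [hU] at hxU; exact hxU.1)
  have hfπ : ContDiffAt ℝ 2 (fun y => f (π y)) x := by
    have h1 : ContDiffOn ℝ 2 (fun y => f (π y)) (π ⁻¹' O) :=
      hf.comp hπd.contDiffOn fun y hy => by rw [hU]; exact ⟨hy, hπP y⟩
    exact h1.contDiffAt hxO
  have h0 : fderiv ℝ (fun y => f (π y)) x v = 0 := by
    have h1 := hasDerivAt_comp_line (w := fun y => f (π y)) (x := x) (ξ := v) (t := 0)
      (by rw [zero_smul, add_zero]; exact hfπ.differentiableAt (by norm_num))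
    rw [zero_smul, add_zero] at h1
    have h2 : (fun t : ℝ => f (π (x + t • v))) = fun _ => f (π x) := by
      funext t
      simp only [hπ, projIn_add_smul hv]
    simp only [h2] at h1
    exact h1.unique (hasDerivAt_const _ _)
  refine ⟨fun y => ⟪v, y⟫ - s - f (π y), innerSL ℝ v - fderiv ℝ (fun y => f (π y)) x,
    ((innerSL ℝ v).hasStrictFDerivAt.sub_const s).sub (hfπ.hasStrictFDerivAt (by norm_num)),
    sub_eq_zero.2 (hΓf x hx hxs), ?_, ?_⟩
  · rw [sub_apply, h0, innerSL_apply_apply, real_inner_self_eq_norm_sq, hv]; norm_num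
  · filter_upwards [(isOpen_lt continuous_const hvc).mem_nhds hxs] with y hys hy
    exact sub_eq_zero.2 (hΓf y hy hys)

/-- Every point of `D` lies on a chord of `D` in the direction `v`, centred at `hyperplane v s`. -/
theorem IsDoubleC2Graph.sub_smul_mem (hv : ‖v‖ = 1) (hev : ⟪e, v⟫ = 0) (hD : IsClosed D)
    (hb : Bornology.IsBounded D) (hDP : D ⊆ hyperplane e c)
    (h : IsDoubleC2Graph (hyperplane e c) v s (relBoundary (hyperplane e c) D))
    (hthin : ∀ x ∈ relBoundary (hyperplane e c) D, s < ⟪v, x⟫ →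
      ∃ᶠ y in 𝓝 x, y ∈ D \ relBoundary (hyperplane e c) D)
    (hx : x ∈ D) {τ : ℝ} (hτ : 0 < τ) (hτs : τ < 2 * (⟪v, x⟫ - s)) :
    x - τ • v ∈ D \ relBoundary (hyperplane e c) D := by
  obtain ⟨U, O, f, hO, hU, hf, hfpos, hfU, hcl, hmem⟩ := h.exists_mem_iff hv
  have hvv : ⟪v, v⟫ = 1 := by rw [real_inner_self_eq_norm_sq, hv]; norm_num
  have hlev : ∀ (y : Amb n) (t : ℝ), ⟪v, y + t • v⟫ = ⟪v, y⟫ + t := fun y t => by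
    rw [inner_add_right, inner_smul_right, hvv, mul_one]
  have hplane : ∀ y ∈ D, ∀ I : Set ℝ, (fun t : ℝ => y + t • v) '' I ⊆ hyperplane e c := by
    rintro y hy I _ ⟨t, -, rfl⟩
    have hye : ⟪e, y⟫ = c := hDP hy
    change ⟪e, y + t • v⟫ = c
    rw [inner_add_right, inner_smul_right, hev, hye, mul_zero, add_zero]
  have hpre : ∀ (y : Amb n) {I : Set ℝ}, I.OrdConnected →
      IsPreconnected ((fun t : ℝ => y + t • v) '' I) := fun y I hI =>
    hI.isPreconnected.image _ (by fun_prop)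
  -- the rays that start in `D` meet the boundary
  have hray : ∀ y ∈ D, s < ⟪v, y⟫ → projIn v s y ∈ closure U ∧ ⟪v, y⟫ - s ≤ f (projIn v s y) := by
    intro y hy hys
    by_contra hcon
    have hsub := hyperplane_subset_or_disjoint (hpre y ordConnected_Ici)
      (hplane y hy _) hD (x := y) (by
        rintro _ ⟨t, ht, rfl⟩ hΓ
        have ht0 : 0 ≤ t := ht
        have h1 := (hmem _).1 hΓ
        simp only [projIn_add_smul hv, hlev] at h1
        rw [abs_of_pos (by linarith)] at h1
        exact hcon ⟨h1.1, by linarith [h1.2]⟩) ⟨0, self_mem_Ici, by simp⟩ hy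
    obtain ⟨R, hR⟩ := hb.exists_norm_le
    have h1 := hR _ (hsub ⟨|R| + |⟪v, y⟫| + 1, show (0 : ℝ) ≤ _ by positivity, rfl⟩)
    have h2 := real_inner_le_norm v (y + (|R| + |⟪v, y⟫| + 1) • v)
    rw [hv, one_mul, hlev] at h2
    linarith [neg_abs_le ⟪v, y⟫, le_abs_self R]
  -- The open segment between the two graphs through `y` misses the border, so it lies in `D` as `y`
  -- does.
  have hseg : ∀ y ∈ D, s < ⟪v, y⟫ → ⟪v, y⟫ - s < f (projIn v s y) → ∀ t : ℝ,
      |t| < f (projIn v s y) → projIn v s y + t • v ∈ D := by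
    intro y hy hys hlt t ht
    have h1 := hyperplane_subset_or_disjoint
      (hpre y (I := Ioo (-(⟪v, y⟫ - s) - f (projIn v s y)) (-(⟪v, y⟫ - s) + f (projIn v s y)))
        ordConnected_Ioo)
      (hplane y hy _) hD (x := y) (by
        rintro _ ⟨t, ht, rfl⟩ hΓ
        have h1 := (hmem _).1 hΓ
        simp only [projIn_add_smul hv, hlev] at h1
        exact h1.2.not_lt (abs_lt.2 ⟨by linarith [ht.1], by linarith [ht.2]⟩))
      ⟨0, ⟨by linarith, by linarith⟩, by simp⟩ hy
    have h2 := h1 ⟨t - (⟪v, y⟫ - s), ⟨by linarith [(abs_lt.1 ht).1], by linarith [(abs_lt.1 ht).2]⟩,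
      rfl⟩
    convert h2 using 1
    rw [projIn]; module
  have hxs : s < ⟪v, x⟫ := by linarith
  obtain ⟨hxc, hxf⟩ := hray x hx hxs
  have hxU : projIn v s x ∈ U := hfU _ hxc (by linarith)
  have habs : |⟪v, x⟫ - τ - s| < f (projIn v s x) :=
    abs_lt.2 ⟨by linarith, by linarith⟩
  have heq : x - τ • v = projIn v s x + (⟪v, x⟫ - τ - s) • v := by rw [projIn]; module
  refine ⟨?_, fun hΓ => ?_⟩
  · rw [heq]
    rcases hxf.lt_or_eq with hlt | hxeq
    · exact hseg x hx hxs hlt _ habs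
    -- For a border point the claim follows by approximation with points of `D` off the border,
    -- supplied by `hthin`; without them `D` might be reduced to its border near `x`.
    have hxΓ : x ∈ relBoundary (hyperplane e c) D :=
      (hmem x).2 ⟨hxc, by rw [abs_of_pos (by linarith)]; exact hxeq⟩
    have hvc : Continuous fun y : Amb n => ⟪v, y⟫ := by fun_prop
    have hfc : Tendsto f (𝓝[U] (projIn v s x)) (𝓝 (f (projIn v s x))) :=
      hf.continuousOn _ hxU
    have hfr : ∃ᶠ y in 𝓝 x, projIn v s y + (⟪v, x⟫ - τ - s) • v ∈ D := by
      have h2 : ∀ᶠ z in 𝓝 (projIn v s x), z ∈ U → |⟪v, x⟫ - τ - s| < f z :=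
        eventually_nhdsWithin_iff.1 (hfc.eventually (lt_mem_nhds habs))
      refine ((hthin x hxΓ hxs).and_eventually
        ((continuous_projIn.continuousAt.eventually h2).and
          ((isOpen_lt continuous_const hvc).mem_nhds hxs))).mono fun y ⟨⟨hy, hyΓ⟩, h3, hys⟩ => ?_
      obtain ⟨hyc, hyf⟩ := hray y hy hys
      have hys' : s < ⟪v, y⟫ := hys
      have hylt : ⟪v, y⟫ - s < f (projIn v s y) := hyf.lt_of_ne fun h4 =>
        hyΓ ((hmem y).2 ⟨hyc, by rw [abs_of_pos (by linarith)]; exact h4⟩)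
      exact hseg y hy hys hylt _ (h3 (hfU _ hyc (by linarith)))
    have hcont : ContinuousAt (fun y => projIn v s y + (⟪v, x⟫ - τ - s) • v) x :=
      continuous_projIn.continuousAt.add continuousAt_const
    have := mem_closure_of_frequently_of_tendsto hfr hcont
    rwa [hD.closure_eq] at this
  · have h1 := (hmem _).1 hΓ
    rw [show x - τ • v = x + (-τ) • v by module, projIn_add_smul hv, hlev] at h1
    exact h1.2.not_lt (by rwa [← sub_eq_add_neg])

/-- Near a boundary point of `M`, the face of `Ω` is not contained in `M`. -/
theorem IsBoundaryChart.not_eventually_face_subset (h : IsBoundaryChart M V φ ψ) (hx : x ∈ V)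
    (hφ : φ x = 0) (hψ : ψ x = 0) (hΩ : IsSlabDomain e c₁ c₂ Ω M) (he : ‖e‖ = 1) (hc : c₁ < c₂)
    (hxe : ⟪e, x⟫ = c₁) : ¬ ∀ᶠ y in 𝓝 x, y ∈ face Ω (hyperplane e c₁) → y ∈ M := by
  intro hthin
  have hec : Continuous fun y : Amb n => ⟪e, y⟫ := by fun_prop
  have hxM : x ∈ M := (h.mem_iff hx).2 ⟨hφ, hψ.ge⟩
  have hfr : ∀ᶠ y in 𝓝 x, y ∈ V ∧ (y ∈ frontier Ω → y ∈ M) := by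
    filter_upwards [hthin, h.isOpen.mem_nhds hx,
      (isOpen_lt hec continuous_const).mem_nhds (show ⟪e, x⟫ < c₂ by rw [hxe]; exact hc)]
      with y h1 h2 h3
    refine ⟨h2, fun h4 => ?_⟩
    rw [hΩ.frontier_eq] at h4
    rcases h4 with (h4 | h4) | h4
    · exact h4
    · exact h1 h4
    · exact absurd h4.2 (ne_of_lt h3)
  -- each side of a smooth hypersurface disjoint from the frontier is inside or outside
  have hside : ∀ χ : Amb n → ℝ, ContDiffAt ℝ 2 χ x → χ x = 0 → fderiv ℝ χ x ≠ 0 →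
      (∀ᶠ y in 𝓝 x, 0 < χ y → y ∉ frontier Ω) →
      (∀ᶠ y in 𝓝 x, 0 < χ y → y ∈ Ω) ∨ (∀ᶠ y in 𝓝 x, 0 < χ y → y ∉ Ω) := by
    intro χ hχ hχ0 hχd hχf
    obtain ⟨ν, a, hν, ha, hd⟩ := fderiv_eq_smul_innerSL hχd
    obtain ⟨K, hKi, hK2, hKx, hK⟩ := exists_graph hν hχ hχ0 (by rw [hd]; simpa [hν] using ha)
    refine (eventually_mem_or_notMem_of_above hν hKi hK2.eventually_continuousAt hKx (Ω := Ω) (by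
      filter_upwards [hχf, hK] with y h1 h2 h3
      exact h1 (h2.2.1.2 h3))).imp (fun h1 => ?_) fun h1 => ?_
    all_goals
      filter_upwards [h1, hK] with y h2 h3 h4
      exact h2 (h3.2.1.1 h4)
  obtain ⟨ξ, hξ1, hξ2⟩ := h.exists_inward hx
  have hφs := h.contDiffAt_fst hx
  have hψs := h.contDiffAt_snd hx
  have hψd : fderiv ℝ ψ x ≠ 0 := (h.linearIndependent_fderiv hx).ne_zero 1
  have hφd := h.fderiv_fst_ne_zero hx
  have hpos : ∀ χ : Amb n → ℝ, ContDiffAt ℝ 2 χ x → χ x = 0 → ∀ ζ, 0 < fderiv ℝ χ x ζ →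
      ∀ᶠ t in 𝓝[>] (0 : ℝ), 0 < χ (x + t • ζ) := by
    intro χ hχ hχ0 ζ hζ
    have h1 := hasDerivAt_comp_line (w := χ) (x := x) (ξ := ζ) (t := 0)
      (by rw [zero_smul, add_zero]; exact hχ.differentiableAt (by norm_num))
    rw [zero_smul, add_zero] at h1
    have h3 := h1.tendsto_slope.mono_left
      (nhdsWithin_mono 0 fun t (ht : t ∈ Ioi (0 : ℝ)) => ht.ne')
    have hpos : ∀ᶠ t in 𝓝[>] (0 : ℝ), 0 < t := self_mem_nhdsWithin
    filter_upwards [h3.eventually (lt_mem_nhds hζ), hpos] with t h4 ht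
    rw [slope_def_field, zero_smul, add_zero, hχ0, sub_zero, sub_zero] at h4
    exact (div_pos_iff_of_pos_right ht).1 h4
  -- The multiple of the inward direction `ξ` is chosen so that `ψ` decreases at unit rate, while
  -- `χ`, stationary along `ξ`, increases at the rate it has along `ν`.
  have hmeet : ∀ χ : Amb n → ℝ, ContDiffAt ℝ 2 χ x → χ x = 0 → fderiv ℝ χ x ≠ 0 →
      fderiv ℝ χ x ξ = 0 → ∃ᶠ y in 𝓝 x, 0 < χ y ∧ 0 < -ψ y := by
    intro χ hχ hχ0 hχd hχξ
    obtain ⟨ν, a, hν, ha, hd⟩ := fderiv_eq_smul_innerSL hχd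
    have h1 := hpos χ hχ hχ0 (ν - ((fderiv ℝ ψ x ν + 1) / fderiv ℝ ψ x ξ) • ξ) (by
      rw [map_sub, map_smul, hχξ, hd]; simpa [hν] using ha)
    have h2 := hpos (fun y => -ψ y) hψs.neg (by rw [hψ, neg_zero])
      (ν - ((fderiv ℝ ψ x ν + 1) / fderiv ℝ ψ x ξ) • ξ) (by
        rw [fderiv_fun_neg, neg_apply, map_sub, map_smul, smul_eq_mul,
          div_mul_cancel₀ _ hξ2.ne']
        norm_num)
    exact ((tendsto_add_smul x _).mono_left (nhdsWithin_le_nhds (s := Ioi (0 : ℝ)))).frequently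
      (h1.and h2).frequently
  have hM : ∀ᶠ y in 𝓝 x, y ∈ M → φ y = 0 ∧ 0 ≤ ψ y :=
    mem_of_superset (h.isOpen.mem_nhds hx) fun y hy => (h.mem_iff hy).1
  have hnφd : fderiv ℝ (fun y => -φ y) x ≠ 0 := by rwa [fderiv_fun_neg, neg_ne_zero]
  have hs1 := hside φ hφs hφ hφd (by
    filter_upwards [hM, hfr] with y h1 h2 h3 h4
    exact h3.ne' (h1 (h2.2 h4)).1)
  have hs2 := hside (fun y => -φ y) hφs.neg (by rw [hφ, neg_zero]) hnφd (by
    filter_upwards [hM, hfr] with y h1 h2 h3 h4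
    rw [(h1 (h2.2 h4)).1, neg_zero] at h3
    exact h3.false)
  have hs3 := hside (fun y => -ψ y) hψs.neg (by rw [hψ, neg_zero])
    (by rwa [fderiv_fun_neg, neg_ne_zero]) (by
    filter_upwards [hM, hfr] with y h1 h2 h3 h4
    linarith [(h1 (h2.2 h4)).2])
  have hm1 := hmeet φ hφs hφ hφd hξ1
  have hm2 := hmeet (fun y => -φ y) hφs.neg (by rw [hφ, neg_zero]) hnφd
    (by rw [fderiv_fun_neg, neg_apply, hξ1, neg_zero])
  -- The sets `{φ > 0}`, `{φ < 0}` and `{ψ < 0}` cover the complement of `M` near `x`, and the third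
  -- meets the other two. So the complement lies all in `Ω`, which fails below the plane, or all
  -- outside, which fails as `x` is in the closure of `Ω`.
  rcases hs3 with h3 | h3
  · have h1 := hs1.resolve_right fun h1 => by
      obtain ⟨y, hy, h4, h5⟩ := (hm1.and_eventually (h1.and h3)).exists
      exact h4 hy.1 (h5 hy.2)
    have h2 := hs2.resolve_right fun h2 => by
      obtain ⟨y, hy, h4, h5⟩ := (hm2.and_eventually (h2.and h3)).exists
      exact h4 hy.1 (h5 hy.2)
    have ht := (tendsto_add_smul x (-e)).mono_left (nhdsWithin_le_nhds (s := Ioi (0 : ℝ)))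
    have hpos : ∀ᶠ r in 𝓝[>] (0 : ℝ), 0 < r := self_mem_nhdsWithin
    obtain ⟨t, ⟨h4, h5, h6, h7⟩, ht0⟩ := ((ht.eventually (h1.and (h2.and (h3.and hfr)))).and
      hpos).exists
    have hte : ⟪e, x + t • -e⟫ < c₁ := by
      rw [inner_add_right, inner_smul_right, inner_neg_right, real_inner_self_eq_norm_sq, he, hxe]
      linarith
    have hout : x + t • -e ∉ closure Ω := fun h8 => (hΩ.closure_subset h8).1.not_gt hte
    have h8 : x + t • -e ∉ M := fun h9 => hout (hΩ.mem_closure_of_mem h9)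
    refine hout (subset_closure ?_)
    rcases lt_trichotomy (φ (x + t • -e)) 0 with h9 | h9 | h9
    · exact h5 (neg_pos.2 h9)
    · refine h6 (neg_pos.2 (not_le.1 fun h10 => h8 ((h.mem_iff h7.1).2 ⟨h9, h10⟩)))
    · exact h4 h9
  · have h1 := hs1.resolve_left fun h1 => by
      obtain ⟨y, hy, h4, h5⟩ := (hm1.and_eventually (h1.and h3)).exists
      exact h5 hy.2 (h4 hy.1)
    have h2 := hs2.resolve_left fun h2 => by
      obtain ⟨y, hy, h4, h5⟩ := (hm2.and_eventually (h2.and h3)).exists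
      exact h5 hy.2 (h4 hy.1)
    obtain ⟨y, hy, h4, h5, h6, h7⟩ := ((mem_closure_iff_frequently.1
      (hΩ.mem_closure_of_mem hxM)).and_eventually (h1.and (h2.and (h3.and hfr)))).exists
    rcases lt_trichotomy (φ y) 0 with h9 | h9 | h9
    · exact h5 (neg_pos.2 h9) hy
    · rcases lt_or_ge (ψ y) 0 with h10 | h10
      · exact h6 (neg_pos.2 h10) hy
      · exact hΩ.notMem_of_mem ((h.mem_iff h7.1).2 ⟨h9, h10⟩) hy
    · exact h4 h9 hy

end DoubleGraphs

/-! ### From the geometric hypotheses to the moving plane configuration -/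

section Conclusion

variable {n : ℕ} {e v q x : Amb n} {c c₁ c₂ s r : ℝ} {Ω M : Set (Amb n)} {H : ℝ → ℝ}

theorem frequently_mem_face_diff (hΩ : IsSlabDomain e c₁ c₂ Ω M) (he : ‖e‖ = 1) (hc : c₁ < c₂)
    (hΓM : relBoundary (hyperplane e c₁) (face Ω (hyperplane e c₁)) ⊆ M)
    (hx : x ∈ relBoundary (hyperplane e c₁) (face Ω (hyperplane e c₁)))
    (hxC : IsC2BoundaryPoint M x) :
    ∃ᶠ y in 𝓝 x, y ∈ face Ω (hyperplane e c₁) \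
      relBoundary (hyperplane e c₁) (face Ω (hyperplane e c₁)) := by
  obtain ⟨V, φ, ψ, hV, hxV, hφ, hψ, hli, hφ0, hψ0, hMV⟩ := hxC
  intro hcon
  refine IsBoundaryChart.not_eventually_face_subset ⟨hV, hφ, hψ, hli, hMV⟩ hxV hφ0 hψ0 hΩ he hc
    (relBoundary_face_subset _ _ _ hx).2 (hcon.mono fun y hy hyD => hΓM ?_)
  by_contra hyΓ
  exact hy ⟨hyD, hyΓ⟩

theorem isBounded_face (hΩ : Bornology.IsBounded Ω) (P : Set (Amb n)) :
    Bornology.IsBounded (face Ω P) :=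
  hΩ.closure.subset inter_subset_left

theorem slabConfig_of_isDoubleC2Graph (hn : n ≠ 0) (he : ‖e‖ = 1) (hv : ‖v‖ = 1) (hev : ⟪e, v⟫ = 0)
    (hc : c₁ < c₂) (hΩ : IsSlabDomain e c₁ c₂ Ω M) {L : NNReal}
    (hH : LipschitzOnWith L H (Icc 0 (c₂ - c₁)))
    (hM : HasInwardMeanCurvature Ω M (faceBoundaries e c₁ c₂ Ω) (fun p => H (⟪e, p⟫ - c₁)))
    (hMc : IsCompact M) (hΓ : faceBoundaries e c₁ c₂ Ω ⊆ M)
    (hint : ∀ p ∈ M \ faceBoundaries e c₁ c₂ Ω, IsC2InteriorPoint M p)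
    (hbd : ∀ p ∈ faceBoundaries e c₁ c₂ Ω, ⟪v, p⟫ ≠ s → IsC2BoundaryPoint M p)
    (hgraph : ∀ c ∈ ({c₁, c₂} : Set ℝ), IsDoubleC2Graph (hyperplane e c) v s
      (relBoundary (hyperplane e c) (face Ω (hyperplane e c)))) :
    SlabConfig e v c₁ c₂ s Ω M (fun p => H (⟪e, p⟫ - c₁)) L where
  hn := hn
  norm_e := he
  norm_v := hv
  inner_eq := hev
  lt := hc
  dom := hΩ
  nonneg := L.2
  lip x hx y hy := by
    have h1 := hΩ.closure_subset hx
    have h2 := hΩ.closure_subset hy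
    have h3 := hH.dist_le_mul (⟪e, x⟫ - c₁) ⟨sub_nonneg.2 h1.1, sub_le_sub_right h1.2 c₁⟩
      (⟪e, y⟫ - c₁) ⟨sub_nonneg.2 h2.1, sub_le_sub_right h2.2 c₁⟩
    rwa [Real.dist_eq, Real.dist_eq, sub_sub_sub_cancel_right] at h3
  eq_of_inner_eq x y hxy := by simp only [hxy]
  isCompact := hMc
  boundary_subset := hΓ
  interior_point := hint
  boundary_point p hp hps := hbd p hp hps.ne'
  mc := hM
  face_cap := by
    rintro c hcc x hx τ hτ hτs
    refine IsDoubleC2Graph.sub_smul_mem hv hev (isClosed_face Ω e c)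
      (isBounded_face hΩ.isBounded _) inter_subset_right (hgraph c hcc) (fun y hy hys => ?_) hx hτ hτs
    rcases hcc with rfl | rfl
    · exact frequently_mem_face_diff hΩ he hc (subset_union_left.trans hΓ) hy
        (hbd y (Or.inl hy) hys.ne')
    · have h1 := frequently_mem_face_diff (x := y) hΩ.neg (by rwa [norm_neg]) (neg_lt_neg hc)
        (by rw [hyperplane_neg]; exact subset_union_right.trans hΓ)
        (by rw [hyperplane_neg]; exact hy) (hbd y (Or.inr hy) hys.ne')
      rwa [hyperplane_neg] at h1
  border := by
    have hec : Continuous fun y : Amb n => ⟪e, y⟫ := by fun_prop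
    rintro p (hp | hp) hps
    · obtain ⟨F, F', h1, h2, h3, h4⟩ :=
        (hgraph c₁ (Or.inl rfl)).exists_hasStrictFDerivAt he hv hev hp hps
      have hpe : ⟪e, p⟫ = c₁ := (relBoundary_face_subset _ _ _ hp).2
      refine ⟨F, F', h1, h2, h3, ?_⟩
      filter_upwards [h4, (isOpen_lt hec continuous_const).mem_nhds (hpe.trans_lt hc)] with y h5 h6 h7
      exact h5 (h7.resolve_right fun h8 => (ne_of_lt h6) (relBoundary_face_subset _ _ _ h8).2)
    · obtain ⟨F, F', h1, h2, h3, h4⟩ :=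
        (hgraph c₂ (Or.inr rfl)).exists_hasStrictFDerivAt he hv hev hp hps
      have hpe : ⟪e, p⟫ = c₂ := (relBoundary_face_subset _ _ _ hp).2
      refine ⟨F, F', h1, h2, h3, ?_⟩
      filter_upwards [h4, (isOpen_lt continuous_const hec).mem_nhds (hc.trans_eq hpe.symm)]
        with y h5 h6 h7
      exact h5 (h7.resolve_left fun h8 => (ne_of_gt h6) (relBoundary_face_subset _ _ _ h8).2)

theorem reflectIn_image_eq_of_isDoubleC2Graph (hn : n ≠ 0) (he : ‖e‖ = 1) (hv : ‖v‖ = 1)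
    (hev : ⟪e, v⟫ = 0) (hc : c₁ < c₂) (hΩ : IsSlabDomain e c₁ c₂ Ω M) {L : NNReal}
    (hH : LipschitzOnWith L H (Icc 0 (c₂ - c₁)))
    (hM : HasInwardMeanCurvature Ω M (faceBoundaries e c₁ c₂ Ω) (fun p => H (⟪e, p⟫ - c₁)))
    (hMc : IsCompact M) (hΓ : faceBoundaries e c₁ c₂ Ω ⊆ M)
    (hint : ∀ p ∈ M \ faceBoundaries e c₁ c₂ Ω, IsC2InteriorPoint M p)
    (hbd : ∀ p ∈ faceBoundaries e c₁ c₂ Ω, ⟪v, p⟫ ≠ s → IsC2BoundaryPoint M p)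
    (hgraph : ∀ c ∈ ({c₁, c₂} : Set ℝ), IsDoubleC2Graph (hyperplane e c) v s
      (relBoundary (hyperplane e c) (face Ω (hyperplane e c)))) :
    reflectIn v s '' Ω = Ω :=
  (slabConfig_of_isDoubleC2Graph hn he hv hev hc hΩ hH hM hMc hΓ hint hbd hgraph).reflectIn_image_eq
    (slabConfig_of_isDoubleC2Graph hn he (by rwa [norm_neg]) (by rw [inner_neg_right, hev, neg_zero])
      hc hΩ hH hM hMc hΓ hint
      (fun p hp hps => hbd p hp fun h => hps (by rw [inner_neg_left, h]))
      fun c hcc => (hgraph c hcc).neg hv)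

/-- By Pythagoras, the sphere consists of two hemispheres with height `√(r² - ‖x - q‖²)` over the
section through its centre. -/
theorem isDoubleC2Graph_sphere (hv : ‖v‖ = 1) (hev : ⟪e, v⟫ = 0) (hr : 0 < r)
    (hq : q ∈ hyperplane e c) :
    IsDoubleC2Graph (hyperplane e c) v ⟪v, q⟫ (sphere q r ∩ hyperplane e c) := by
  have hvv : ⟪v, v⟫ = 1 := by rw [real_inner_self_eq_norm_sq, hv]; norm_num
  set B := hyperplane e c ∩ hyperplane v ⟪v, q⟫ with hB
  have hqB : q ∈ B := ⟨hq, rfl⟩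
  have hcl : closure (ball q r ∩ B) = closedBall q r ∩ B := by
    refine subset_antisymm (closure_minimal (inter_subset_inter_left _ ball_subset_closedBall)
      (isClosed_closedBall.inter ((isClosed_hyperplane e c).inter (isClosed_hyperplane v _)))) ?_
    rintro x ⟨hx, hxe, hxv⟩
    have hxe' : ⟪e, x⟫ = c := hxe
    have hxv' : ⟪v, x⟫ = ⟪v, q⟫ := hxv
    have hqe' : ⟪e, q⟫ = c := hq
    have ht : Tendsto (fun t : ℝ => q + t • (x - q)) (𝓝[<] 1) (𝓝 x) := by
      have h1 : ContinuousAt (fun t : ℝ => q + t • (x - q)) 1 := by fun_prop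
      have h2 := h1.tendsto
      simp only [one_smul, add_sub_cancel] at h2
      exact h2.mono_left nhdsWithin_le_nhds
    refine mem_closure_of_tendsto ht ?_
    filter_upwards [Ioo_mem_nhdsLT (show (0 : ℝ) < 1 by norm_num)] with t h1
    refine ⟨?_, ?_, ?_⟩
    · rw [mem_closedBall, dist_eq_norm] at hx
      rw [mem_ball, dist_eq_norm, add_sub_cancel_left, norm_smul, Real.norm_eq_abs, abs_of_pos h1.1]
      calc t * ‖x - q‖ ≤ t * r := by gcongr; exact h1.1.le
        _ < r := by nlinarith [h1.2]
    · change ⟪e, q + t • (x - q)⟫ = c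
      rw [inner_add_right, inner_smul_right, inner_sub_right, hxe', hqe']; ring
    · change ⟪v, q + t • (x - q)⟫ = ⟪v, q⟫
      rw [inner_add_right, inner_smul_right, inner_sub_right, hxv']; ring
  have hpy : ∀ x ∈ B, ∀ t : ℝ, ‖x + t • v - q‖ ^ 2 = ‖x - q‖ ^ 2 + t ^ 2 := by
    intro x hx t
    have hxv : ⟪v, x⟫ = ⟪v, q⟫ := hx.2
    have h1 : ⟪x - q, v⟫ = 0 := by
      rw [real_inner_comm, inner_sub_right, hxv, sub_self]
    rw [show x + t • v - q = (x - q) + t • v by module, norm_add_sq_real, inner_smul_right, h1,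
      norm_smul, hv, mul_one, Real.norm_eq_abs, sq_abs]
    ring
  have hsq : ∀ x ∈ closedBall q r, 0 ≤ r ^ 2 - ‖x - q‖ ^ 2 := fun x hx => by
    rw [mem_closedBall, dist_eq_norm] at hx
    nlinarith [norm_nonneg (x - q)]
  have hmem : ∀ x ∈ closedBall q r ∩ B, ∀ t : ℝ, t ^ 2 = r ^ 2 - ‖x - q‖ ^ 2 →
      x + t • v ∈ sphere q r ∩ hyperplane e c := by
    intro x hx t ht
    refine ⟨?_, ?_⟩
    · rw [mem_sphere, dist_eq_norm, ← sq_eq_sq₀ (norm_nonneg _) hr.le, hpy x hx.2, ht]; ring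
    · have hxe : ⟪e, x⟫ = c := hx.2.1
      change ⟪e, x + t • v⟫ = c
      rw [inner_add_right, inner_smul_right, hev, hxe, mul_zero, add_zero]
  have hrefl : ∀ x ∈ closedBall q r ∩ B, ∀ t : ℝ,
      reflectIn v ⟪v, q⟫ (x + t • v) = x + (-t) • v := by
    intro x hx t
    have hxv : ⟪v, x⟫ = ⟪v, q⟫ := hx.2.2
    rw [reflectIn, inner_add_right, inner_smul_right, hvv, hxv]; module
  refine ⟨ball q r ∩ B, fun x => √(r ^ 2 - ‖x - q‖ ^ 2), ⟨ball q r, isOpen_ball, rfl⟩, ?_, ?_, ?_, ?_,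
    ?_⟩
  · intro x hx
    refine ContDiffAt.contDiffWithinAt (ContDiffAt.sqrt ?_ ?_)
    · exact contDiffAt_const.sub ((contDiffAt_id.sub contDiffAt_const).norm_sq ℝ)
    · have := hx.1
      rw [mem_ball, dist_eq_norm] at this
      nlinarith [norm_nonneg (x - q)]
  · fun_prop
  · intro x hx
    have := hx.1
    rw [mem_ball, dist_eq_norm] at this
    exact Real.sqrt_pos.2 (by nlinarith [norm_nonneg (x - q)])
  · rintro x ⟨hx, hx'⟩
    rw [hcl] at hx
    have h1 : x ∉ ball q r := fun h => hx' ⟨h, hx.2⟩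
    rw [mem_ball, dist_eq_norm, not_lt] at h1
    exact Real.sqrt_eq_zero_of_nonpos (by nlinarith [norm_nonneg (x - q)])
  · rw [hcl]
    refine subset_antisymm (fun y hy => ?_) (union_subset ?_ ?_)
    · have hye : ⟪e, y⟫ = c := hy.2
      set x := projIn v ⟪v, q⟫ y with hx
      set t := ⟪v, y⟫ - ⟪v, q⟫ with ht
      have hyx : x + t • v = y := projIn_add y
      have hxB : x ∈ B := by
        refine ⟨?_, ?_⟩
        · change ⟪e, projIn v _ y⟫ = c
          rw [inner_projIn_of_orthogonal hev, hye]
        · change ⟪v, projIn v _ y⟫ = _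
          rw [projIn, inner_sub_right, inner_smul_right, hvv]; ring
      have h1 := hpy x hxB t
      have h2 := hy.1
      rw [mem_sphere, dist_eq_norm] at h2
      rw [hyx, h2] at h1
      have hxb : x ∈ closedBall q r := by
        rw [mem_closedBall, dist_eq_norm]
        nlinarith [norm_nonneg (x - q), sq_nonneg t]
      have h3 : √(r ^ 2 - ‖x - q‖ ^ 2) = |t| := by
        rw [show r ^ 2 - ‖x - q‖ ^ 2 = t ^ 2 by linarith, Real.sqrt_sq_eq_abs]
      rcases le_total 0 t with h4 | h4
      · exact Or.inl ⟨x, ⟨hxb, hxB⟩, by simp only [h3, abs_of_nonneg h4, hyx]⟩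
      · refine Or.inr ⟨_, ⟨x, ⟨hxb, hxB⟩, rfl⟩, ?_⟩
        simp only
        rw [hrefl x ⟨hxb, hxB⟩, h3, abs_of_nonpos h4, neg_neg, hyx]
    · rintro _ ⟨x, hx, rfl⟩
      exact hmem x hx _ (Real.sq_sqrt (hsq x hx.1))
    · rintro _ ⟨_, ⟨x, hx, rfl⟩, rfl⟩
      simp only
      rw [hrefl x hx]
      exact hmem x hx _ (by rw [neg_sq]; exact Real.sq_sqrt (hsq x hx.1))

/-- A closed bounded subset of a hyperplane that is bordered by a sphere lies in the ball. -/
theorem subset_closedBall_of_relBoundary {D : Set (Amb n)} (hD : IsClosed D)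
    (hb : Bornology.IsBounded D) (hDP : D ⊆ hyperplane e c) (hr : 0 < r) (hq : q ∈ hyperplane e c)
    (h : relBoundary (hyperplane e c) D = sphere q r ∩ hyperplane e c) : D ⊆ closedBall q r := by
  intro x hx
  by_contra hxr
  rw [mem_closedBall, dist_eq_norm, not_le] at hxr
  have hqe : ⟪e, q⟫ = c := hq
  have hxe : ⟪e, x⟫ = c := hDP hx
  have hA : IsPreconnected ((fun t : ℝ => x + t • (x - q)) '' Ici 0) :=
    isPreconnected_Ici.image _ (by fun_prop)
  have hnorm : ∀ t : ℝ, 0 ≤ t → ‖x + t • (x - q) - q‖ = (1 + t) * ‖x - q‖ := fun t ht => by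
    rw [show x + t • (x - q) - q = (1 + t) • (x - q) by module, norm_smul, Real.norm_eq_abs,
      abs_of_nonneg (by linarith)]
  have hsub := hyperplane_subset_or_disjoint (P := hyperplane e c) hA (by
    rintro _ ⟨t, -, rfl⟩
    change ⟪e, x + t • (x - q)⟫ = c
    rw [inner_add_right, inner_smul_right, inner_sub_right, hxe, hqe]; ring) hD (x := x) (by
    rintro _ ⟨t, ht, rfl⟩ hΓ
    have ht0 : 0 ≤ t := ht
    rw [h] at hΓ
    have h1 := hΓ.1
    rw [mem_sphere, dist_eq_norm, hnorm t ht0] at h1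
    nlinarith) ⟨0, self_mem_Ici, by simp⟩ hx
  obtain ⟨R, hR⟩ := hb.exists_norm_le
  have ht0 : 0 ≤ (|R| + ‖q‖) / r := by positivity
  have h1 := hR _ (hsub ⟨_, ht0, rfl⟩)
  have h2 := norm_sub_le (x + ((|R| + ‖q‖) / r) • (x - q)) q
  rw [hnorm _ ht0] at h2
  have h3 : (|R| + ‖q‖) / r * r = |R| + ‖q‖ := div_mul_cancel₀ _ hr.ne'
  have h4 : (|R| + ‖q‖) / r * r ≤ (|R| + ‖q‖) / r * ‖x - q‖ := by gcongr
  linarith [le_abs_self R, norm_nonneg q]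

end Conclusion

/-! ### Points of `M` in the interior of a round face -/

namespace SlabConfig

variable {n : ℕ} {e v q x y p : Amb n} {c₁ c₂ s r L : ℝ} {Ω M V : Set (Amb n)} {Hf : Amb n → ℝ}
  {φ ψ : Amb n → ℝ}

/-- The side of the graph on which `Ω` lies decides the sign of the curvature; the absolute value is
enough for comparisons with the plane. -/
theorem exists_isTangentGraph_abs (h : SlabConfig e v c₁ c₂ s Ω M Hf L) (hy : ⟪e, y⟫ = c₁)
    (hyM : y ∈ M) (hyΓ : y ∉ faceBoundaries e c₁ c₂ Ω) :
    ∃ G, IsTangentGraph M y e G ∧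
      ∀ᶠ x in 𝓝 y, |levelSetMeanCurvature (graphFn e G) x| = |Hf (graphPt e G x)| := by
  rcases h.half_ball_or_isLowerGraph ⟨h.dom.mem_closure_of_mem hyM, hy⟩ hyΓ with h1 | ⟨G, hG⟩
  · obtain ⟨G, hG⟩ := h.exists_isTangentGraph_floor hy hyM hyΓ
    refine ⟨G, hG, ?_⟩
    have hΓc : IsClosed (faceBoundaries e c₁ c₂ Ω) :=
      (isClosed_closure.inter isClosed_closure).union (isClosed_closure.inter isClosed_closure)
    have h2 := h.mc.eventually_eq_of_above h.norm_e hG.inv hG.contDiffAt hG.apply_eq hG.mem_iff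
      (by filter_upwards [hΓc.isOpen_compl.mem_nhds hyΓ] with x hx _ using hx) (by
        filter_upwards [h1, hG.eventually_graphPt_mem] with x h3 h4 h5
        have h6 := h.eventually_le_of_mem _ h4
        rw [inner_graphPt h.norm_e] at h6
        exact h3 (h6.trans_lt h5))
    exact h2.mono fun x hx => by rw [hx]
  · exact ⟨G, hG.toIsTangentGraph, hG.pde.mono fun x hx => by rw [hx, abs_neg]⟩

/-- Since `H` is Lipschitz and vanishes at the height of the plane, the curvature of `M` is at most
`L` times the height over the plane, and the touching principle with the plane applies. -/
theorem eventually_mem_iff_of_eq_zero (h : SlabConfig e v c₁ c₂ s Ω M Hf L) (hy : ⟪e, y⟫ = c₁)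
    (hyM : y ∈ M) (hyΓ : y ∉ faceBoundaries e c₁ c₂ Ω) (hH : Hf y = 0) :
    ∀ᶠ z in 𝓝 y, z ∈ M ↔ ⟪e, z⟫ = c₁ := by
  obtain ⟨G, hG, habs⟩ := h.exists_isTangentGraph_abs hy hyM hyΓ
  have h1 := eventually_eq_of_touching h.hn h.norm_e hG.inv (invariantAlong_const e c₁) hG.contDiffAt
    contDiffAt_const hG.fderiv_eq (by simp) (by rw [hG.apply_eq, hy]) h.nonneg (by
      filter_upwards [habs, hG.eventually_graphPt_mem] with z h2 h3
      have h4 := h.eventually_le_of_mem _ h3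
      rw [inner_graphPt h.norm_e] at h4
      refine ⟨h4, ?_⟩
      rw [levelSetMeanCurvature_graphFn_const h.norm_e, sub_zero, h2]
      have h5 := h.lip _ (h.dom.mem_closure_of_mem h3) _ (h.dom.mem_closure_of_mem hyM)
      rwa [inner_graphPt h.norm_e, hy, hH, sub_zero] at h5)
  filter_upwards [h1, hG.mem_iff] with z h2 h3
  rw [h3, h2]

theorem eq_zero_of_eventually_mem_iff (h : SlabConfig e v c₁ c₂ s Ω M Hf L) (hy : ⟪e, y⟫ = c₁)
    (hyM : y ∈ M) (hyΓ : y ∉ faceBoundaries e c₁ c₂ Ω)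
    (hflat : ∀ᶠ z in 𝓝 y, z ∈ M → ⟪e, z⟫ = c₁) : Hf y = 0 := by
  obtain ⟨G, hG, habs⟩ := h.exists_isTangentGraph_abs hy hyM hyΓ
  have h1 : graphFn e G =ᶠ[𝓝 y] graphFn e fun _ => c₁ := by
    filter_upwards [hG.tendsto_graphPt.eventually hflat, hG.eventually_graphPt_mem] with z h2 h3
    have h4 := h2 h3
    rw [inner_graphPt h.norm_e] at h4
    simp only [graphFn, h4]
  have h2 := habs.self_of_nhds
  rw [levelSetMeanCurvature_congr h1, levelSetMeanCurvature_graphFn_const h.norm_e, abs_zero] at h2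
  have h3 := abs_eq_zero.1 h2.symm
  rwa [graphPt, hG.apply_eq, sub_self, zero_smul, add_zero] at h3

/-- If `M` is not curved on the lower face, its boundary there is not tangent to the face. -/
theorem not_fderiv_eq_smul (h : SlabConfig e v c₁ c₂ s Ω M Hf L) (hc : IsBoundaryChart M V φ ψ)
    (hp : p ∈ V) (hφ : φ p = 0) (hψ : ψ p = 0)
    (hΓ : ∀ᶠ x in 𝓝 p, x ∈ faceBoundaries e c₁ c₂ Ω ↔ φ x = 0 ∧ ψ x = 0)
    (hpΓ : p ∈ relBoundary (hyperplane e c₁) (face Ω (hyperplane e c₁))) (hH : Hf p = 0) (a : ℝ) :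
    innerSL ℝ e ≠ a • fderiv ℝ φ p := by
  intro hd
  have hpe : ⟪e, p⟫ = c₁ := (relBoundary_face_subset _ _ _ hpΓ).2
  have hpM : p ∈ M := h.boundary_subset (Or.inl hpΓ)
  obtain ⟨g, χ, hg, -⟩ := hc.exists_isBoundaryGraph hp h.norm_e hφ hψ hΓ hd
  have h1 : ∀ᶠ z in 𝓝 p, z ∈ M → ⟪e, z⟫ = c₁ := by
    filter_upwards [hg.eventually_eq_of_eq_zero h hpe hpM hH, hg.mem_iff] with z h2 h3 h4
    rw [(h3.1 h4).1, h2 (h3.1 h4).2]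
  -- If `M` were horizontal at `p`, it would be flat nearby and `Ω` would fill the space above the
  -- plane. All plane points near `p` would then belong to the face, and `p` would not be on its
  -- border.
  have h2 := h.eventually_mem_of_above_plane hpe (h.dom.mem_closure_of_mem hpM) (by
    filter_upwards [h1, h.eventually_mem_or_eq hpe] with z h2 h3 h4 h5
    exact h4.ne' ((h3 h5).elim h2 id))
  obtain ⟨z, hz, h3⟩ := ((mem_closure_iff_frequently.1 hpΓ.2).and_eventually
    h2.eventually_nhds).exists
  have hze : ⟪e, z⟫ = c₁ := hz.1
  refine hz.2 ⟨?_, hz.1⟩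
  have ht := (tendsto_add_smul z e).mono_left (nhdsWithin_le_nhds (s := Ioi (0 : ℝ)))
  have hpos : ∀ᶠ r in 𝓝[>] (0 : ℝ), 0 < r := self_mem_nhdsWithin
  refine mem_closure_of_tendsto ht ?_
  filter_upwards [ht.eventually h3, hpos] with t h4 ht0
  exact h4 (by rw [h.inner_e_add, hze]; linarith)

/-- If the lower face is bordered by a sphere, then the part of `M` in it is approached from the
interior of the slab. -/
theorem mem_closure_of_sphere (h : SlabConfig e v c₁ c₂ s Ω M Hf L) (hq : q ∈ hyperplane e c₁)
    (hqs : ⟪v, q⟫ = s) (hr : 0 < r)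
    (hsph : relBoundary (hyperplane e c₁) (face Ω (hyperplane e c₁)) =
      sphere q r ∩ hyperplane e c₁)
    (hxM : x ∈ M) (hxe : ⟪e, x⟫ = c₁) (hxΓ : x ∉ faceBoundaries e c₁ c₂ Ω) :
    x ∈ closure (M ∩ openSlab e c₁ c₂) := by
  by_contra hcon
  have hqe : ⟪e, q⟫ = c₁ := hq
  have hflat : ∀ᶠ z in 𝓝 x, z ∈ M → ⟪e, z⟫ = c₁ := by
    filter_upwards [isClosed_closure.isOpen_compl.mem_nhds hcon, h.eventually_lt_top hxe]
      with z h1 h2 h3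
    by_contra h4
    exact h1 (subset_closure ⟨h3, (h.eventually_le_of_mem z h3).lt_of_ne' h4, h2⟩)
  have hHx := h.eq_zero_of_eventually_mem_iff hxe hxM hxΓ hflat
  have hH : ∀ z, ⟪e, z⟫ = c₁ → Hf z = 0 := fun z hz => by
    rw [← hHx]; exact h.eq_of_inner_eq z x (hz.trans hxe.symm)
  have hballΓ : ∀ z ∈ ball q r, ⟪e, z⟫ = c₁ → z ∉ faceBoundaries e c₁ c₂ Ω := by
    rintro z hz hze (h1 | h1)
    · rw [hsph] at h1
      exact (ne_of_lt hz) h1.1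
    · exact h.lt.ne (hze.symm.trans (relBoundary_face_subset _ _ _ h1).2)
  have hxq : x ∈ ball q r := by
    have h1 := subset_closedBall_of_relBoundary (isClosed_face Ω e c₁)
      (isBounded_face h.dom.isBounded _) inter_subset_right hr hq hsph
      ⟨h.dom.mem_closure_of_mem hxM, hxe⟩
    exact lt_of_le_of_ne h1 fun h2 => hxΓ (Or.inl (by rw [hsph]; exact ⟨h2, hxe⟩))
  set B := ball q r ∩ hyperplane e c₁ with hB
  have hBc : IsPreconnected B := by
    refine ((convex_ball q r).inter ?_).isPreconnected
    exact convex_hyperplane (innerSL ℝ e).isBoundedLinearMap.toIsLinearMap c₁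
  -- the ball is contained in `M`
  set W : Set (Amb n) := projIn e c₁ ⁻¹' {y | ∀ᶠ z in 𝓝 y, z ∈ M ↔ ⟪e, z⟫ = c₁} with hW
  have hproj : ∀ z : Amb n, ⟪e, projIn e c₁ z⟫ = c₁ := fun z => by
    rw [projIn, inner_sub_right, inner_smul_right, h.inner_self_e]; ring
  have hWM : ∀ z ∈ W, projIn e c₁ z ∈ M := fun z hz => hz.self_of_nhds.2 (hproj z)
  have hWo : IsOpen W :=
    (isOpen_setOfPred_eventually_nhds (p := fun z => z ∈ M ↔ ⟪e, z⟫ = c₁)).preimage continuous_projIn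
  have hBW : B ⊆ W := by
    refine hBc.subset_of_closure_inter_subset hWo ⟨x, ⟨hxq, hxe⟩, ?_⟩ ?_
    · change ∀ᶠ z in 𝓝 (projIn e c₁ x), _
      rw [projIn_of_inner_eq hxe]
      exact h.eventually_mem_iff_of_eq_zero hxe hxM hxΓ hHx
    · rintro y ⟨hy, hyB⟩
      have hye : ⟪e, y⟫ = c₁ := hyB.2
      have hyM : y ∈ M := by
        have h1 : MapsTo (projIn e c₁) W M := hWM
        have h2 := h1.closure continuous_projIn hy
        rwa [projIn_of_inner_eq hye, h.isCompact.isClosed.closure_eq] at h2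
      change ∀ᶠ z in 𝓝 (projIn e c₁ y), _
      rw [projIn_of_inner_eq hye]
      exact h.eventually_mem_iff_of_eq_zero hye hyM (hballΓ y hyB.1 hye) (hH y hye)
  have hBM : ∀ z ∈ B, z ∈ M := fun z hz => by
    have h1 := hWM z (hBW hz)
    rwa [projIn_of_inner_eq hz.2] at h1
  -- so `M` is tangent to the face at its boundary
  have hvv : ⟪v, v⟫ = 1 := by rw [real_inner_self_eq_norm_sq, h.norm_v]; norm_num
  have hpe : ⟪e, q + r • v⟫ = c₁ := by
    rw [inner_add_right, inner_smul_right, h.inner_eq, hqe, mul_zero, add_zero]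
  have hpΓ : q + r • v ∈ relBoundary (hyperplane e c₁) (face Ω (hyperplane e c₁)) := by
    rw [hsph]
    refine ⟨?_, hpe⟩
    rw [mem_sphere, dist_eq_norm, add_sub_cancel_left, norm_smul, h.norm_v, mul_one,
      Real.norm_eq_abs, abs_of_pos hr]
  set p := q + r • v with hp
  obtain ⟨V, φ, ψ, hpV, hc, hφ, hψ, hΓ⟩ := h.exists_isBoundaryChart (Or.inl hpΓ) (by
    rw [hp, inner_add_right, inner_smul_right, hvv, hqs]; linarith)
  -- At the border point `p = q + r • v`, horizontal directions with negative `v`-component enter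
  -- the open disc, which lies in `M`; so `φ` vanishes along them. Such directions span the
  -- horizontal space, and `M` is tangent to the face at `p`.
  have hinw : ∀ ζ : Amb n, ⟪e, ζ⟫ = 0 → ⟪v, ζ⟫ < 0 → fderiv ℝ φ p ζ = 0 := by
    intro ζ hζe hζv
    have h1 := hasDerivAt_comp_line (w := φ) (x := p) (ξ := ζ) (t := 0)
      (by rw [zero_smul, add_zero]; exact (hc.contDiffAt_fst hpV).differentiableAt (by norm_num))
    rw [zero_smul, add_zero] at h1
    have h2 : ∀ᶠ t in 𝓝[>] (0 : ℝ), φ (p + t • ζ) = 0 := by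
      have ht := (tendsto_add_smul p ζ).mono_left (nhdsWithin_le_nhds (s := Ioi (0 : ℝ)))
      have hsm : ∀ᶠ t in 𝓝[>] (0 : ℝ), 2 * r * ⟪v, ζ⟫ + t * ‖ζ‖ ^ 2 < 0 := by
        have h3 : ContinuousAt (fun t : ℝ => 2 * r * ⟪v, ζ⟫ + t * ‖ζ‖ ^ 2) 0 := by fun_prop
        exact (h3.eventually (gt_mem_nhds (by
          simp only [zero_mul, add_zero]
          exact mul_neg_of_pos_of_neg (by linarith) hζv))).filter_mono nhdsWithin_le_nhds
      have hpos : ∀ᶠ t in 𝓝[>] (0 : ℝ), 0 < t := self_mem_nhdsWithin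
      filter_upwards [ht.eventually (hc.isOpen.mem_nhds hpV), hsm, hpos] with t h3 h4 ht0
      refine ((hc.mem_iff h3).1 (hBM _ ⟨?_, ?_⟩)).1
      · rw [mem_ball, dist_eq_norm, ← sq_lt_sq₀ (norm_nonneg _) hr.le,
          show p + t • ζ - q = r • v + t • ζ by rw [hp]; module, norm_add_sq_real,
          real_inner_smul_left, inner_smul_right, norm_smul, norm_smul, h.norm_v,
          Real.norm_eq_abs, Real.norm_eq_abs, abs_of_pos hr, abs_of_pos ht0]
        nlinarith
      · change ⟪e, p + t • ζ⟫ = c₁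
        rw [inner_add_right, inner_smul_right, hζe, hpe, mul_zero, add_zero]
    refine le_antisymm ?_ (nonneg_of_hasDerivAt_of_eventually_nonneg h1
      (by rw [zero_smul, add_zero, hφ]) (h2.mono fun t ht => ht.ge))
    have h3 := nonneg_of_hasDerivAt_of_eventually_nonneg h1.neg
      (by simp [hφ]) (h2.mono fun t ht => by simp [ht])
    linarith
  have hhor : ∀ ζ : Amb n, ⟪e, ζ⟫ = 0 → fderiv ℝ φ p ζ = 0 := by
    intro ζ hζ
    have h1 := hinw (-v) (by rw [inner_neg_right, h.inner_eq, neg_zero])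
      (by rw [inner_neg_right, hvv]; norm_num)
    have h2 := hinw (ζ + (⟪v, ζ⟫ + 1) • -v)
      (by rw [inner_add_right, inner_smul_right, inner_neg_right, h.inner_eq, hζ]; ring)
      (by rw [inner_add_right, inner_smul_right, inner_neg_right, hvv]; linarith)
    rwa [map_add, map_smul, h1, smul_zero, add_zero] at h2
  obtain ⟨b, hφe⟩ : ∃ b : ℝ, fderiv ℝ φ p = b • innerSL ℝ e := by
    refine ⟨fderiv ℝ φ p e, ?_⟩
    ext ζ
    have h1 := hhor (ζ - ⟪e, ζ⟫ • e) (by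
      rw [inner_sub_right, inner_smul_right, h.inner_self_e]; ring)
    rw [map_sub, map_smul, smul_eq_mul] at h1
    rw [smul_apply, innerSL_apply_apply, smul_eq_mul]
    linarith
  have hne : b ≠ 0 := fun h0 => hc.fderiv_fst_ne_zero hpV (by rw [hφe, h0, zero_smul])
  refine h.not_fderiv_eq_smul hc hpV hφ hψ hΓ hpΓ (hH p hpe) b⁻¹ ?_
  rw [hφe, smul_smul, inv_mul_cancel₀ hne, one_smul]

end SlabConfig

/-! ### From reflections to all isometries that fix the axis -/

section Rotations

variable {n : ℕ} {e q x y : Amb n} {c₁ c₂ : ℝ} {Ω : Set (Amb n)}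

/-- The perpendicular bisector of `x` and `y` passes through `q`, and its normal `x - y` is
orthogonal to `e`. -/
theorem exists_reflectIn_eq (hxy : dist x q = dist y q) (he : ⟪e, x⟫ = ⟪e, y⟫) (hne : x ≠ y) :
    ∃ v : Amb n, ‖v‖ = 1 ∧ ⟪e, v⟫ = 0 ∧ reflectIn v ⟪v, q⟫ x = y := by
  set w := x - y with hw
  have hw0 : ‖w‖ ≠ 0 := norm_ne_zero_iff.2 (sub_ne_zero.2 hne)
  refine ⟨‖w‖⁻¹ • w, ?_, ?_, ?_⟩
  · rw [norm_smul, norm_inv, norm_norm, inv_mul_cancel₀ hw0]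
  · rw [inner_smul_right, hw, inner_sub_right, he, sub_self, mul_zero]
  · have h1 : 2 * ⟪w, x - q⟫ = ‖w‖ ^ 2 := by
      have h2 : ‖y - q‖ ^ 2 = ‖x - q‖ ^ 2 := by rw [← dist_eq_norm, ← dist_eq_norm, hxy]
      rw [show y - q = (x - q) - w by rw [hw]; module, norm_sub_sq_real, real_inner_comm] at h2
      linarith
    rw [reflectIn, ← inner_sub_right, real_inner_smul_left, smul_smul,
      show 2 * (‖w‖⁻¹ * ⟪w, x - q⟫) * ‖w‖⁻¹ = 2 * ⟪w, x - q⟫ * (‖w‖⁻¹ * ‖w‖⁻¹) by ring, h1,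
      show ‖w‖ ^ 2 * (‖w‖⁻¹ * ‖w‖⁻¹) = 1 by field_simp, one_smul, hw]
    abel

/-- The distances to the two fixed points `q` and `q + e` determine the height. -/
theorem inner_eq_of_fixes_line {g : Amb n ≃ᵃⁱ[ℝ] Amb n} (hg : ∀ t : ℝ, g (q + t • e) = q + t • e)
    (x : Amb n) : ⟪e, g x⟫ = ⟪e, x⟫ := by
  have h1 : ∀ t : ℝ, ‖g x - q - t • e‖ ^ 2 = ‖x - q - t • e‖ ^ 2 := fun t => by
    have h2 := g.dist_map x (q + t • e)
    rw [hg, dist_eq_norm, dist_eq_norm] at h2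
    rw [sub_sub, sub_sub, h2]
  have h2 := h1 0
  have h3 := h1 1
  rw [one_smul, norm_sub_sq_real (g x - q), norm_sub_sq_real (x - q)] at h3
  rw [zero_smul, sub_zero, sub_zero] at h2
  have h4 : ⟪g x - q, e⟫ = ⟪x - q, e⟫ := by linarith
  rw [real_inner_comm, real_inner_comm e, inner_sub_right, inner_sub_right] at h4
  linarith

/-- A set that is symmetric about all the hyperplanes through a line is rotationally symmetric. -/
theorem image_subset_of_fixes_line
    (hΩ : ∀ v : Amb n, ‖v‖ = 1 → ⟪e, v⟫ = 0 → reflectIn v ⟪v, q⟫ '' Ω = Ω)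
    {g : Amb n ≃ᵃⁱ[ℝ] Amb n} (hg : ∀ t : ℝ, g (q + t • e) = q + t • e) : g '' Ω ⊆ Ω := by
  rintro _ ⟨x, hx, rfl⟩
  by_cases hne : x = g x
  · rwa [← hne]
  have hgq : g q = q := by simpa using hg 0
  obtain ⟨v, hv, hev, h1⟩ := exists_reflectIn_eq (e := e) (q := q) (x := x) (y := g x)
    (by conv_rhs => rw [← hgq, g.dist_map]) (inner_eq_of_fixes_line hg x).symm hne
  rw [← hΩ v hv hev, ← h1]
  exact mem_image_of_mem _ hx

theorem symm_fixes_line {g : Amb n ≃ᵃⁱ[ℝ] Amb n} (hg : ∀ t : ℝ, g (q + t • e) = q + t • e)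
    (t : ℝ) : g.symm (q + t • e) = q + t • e := by
  rw [AffineIsometryEquiv.symm_apply_eq, hg]

theorem image_eq_of_forall_image_subset {A : Set (Amb n)}
    (h : ∀ g : Amb n ≃ᵃⁱ[ℝ] Amb n, (∀ t : ℝ, g (q + t • e) = q + t • e) → g '' A ⊆ A)
    {g : Amb n ≃ᵃⁱ[ℝ] Amb n} (hg : ∀ t : ℝ, g (q + t • e) = q + t • e) : g '' A = A := by
  refine subset_antisymm (h g hg) fun x hx => ⟨g.symm x, h g.symm (symm_fixes_line hg) ⟨x, hx, rfl⟩, ?_⟩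
  exact g.apply_symm_apply x

/-- A closed set is rotationally symmetric if its boundary in the faces is, and the rest is
approached from the interior of the slab. -/
theorem IsSlabDomain.image_subset_of_fixes_line {M : Set (Amb n)} (hΩ : IsSlabDomain e c₁ c₂ Ω M)
    (hMc : IsClosed M) (hΓM : faceBoundaries e c₁ c₂ Ω ⊆ M)
    (hsymm : ∀ v : Amb n, ‖v‖ = 1 → ⟪e, v⟫ = 0 → reflectIn v ⟪v, q⟫ '' Ω = Ω)
    (hcl : ∀ c ∈ ({c₁, c₂} : Set ℝ), ∀ x ∈ M, ⟪e, x⟫ = c → x ∉ faceBoundaries e c₁ c₂ Ω →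
      x ∈ closure (M ∩ openSlab e c₁ c₂))
    (hΓ : ∀ c ∈ ({c₁, c₂} : Set ℝ), ∃ (t r : ℝ),
      relBoundary (hyperplane e c) (face Ω (hyperplane e c)) =
        sphere (q + t • e) r ∩ hyperplane e c)
    (g : Amb n ≃ᵃⁱ[ℝ] Amb n) (hg : ∀ t : ℝ, g (q + t • e) = q + t • e) : g '' M ⊆ M := by
  have hge := inner_eq_of_fixes_line hg
  -- Only pointwise agreement of `g` with reflections is used; the reflection varies with the point,
  -- so `g` need not be decomposed into reflections.
  have hgΩ : g '' Ω = Ω :=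
    image_eq_of_forall_image_subset (fun g hg => _root_.image_subset_of_fixes_line hsymm hg) hg
  have hfr : g '' frontier Ω = frontier Ω := by
    have h1 := g.toHomeomorph.image_frontier Ω
    rw [AffineIsometryEquiv.coe_toHomeomorph, hgΩ] at h1
    exact h1
  have hslab : ∀ x ∈ M ∩ openSlab e c₁ c₂, g x ∈ M ∩ openSlab e c₁ c₂ := by
    rintro x ⟨hx, hxS⟩
    have h1 : g x ∈ openSlab e c₁ c₂ := by
      change c₁ < ⟪e, g x⟫ ∧ ⟪e, g x⟫ < c₂
      rw [hge]; exact hxS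
    refine ⟨(hΩ.mem_frontier_iff h1).1 ?_, h1⟩
    rw [← hfr]
    exact mem_image_of_mem _ (hΩ.subset_frontier hx)
  have hface : ∀ c ∈ ({c₁, c₂} : Set ℝ), ∀ x ∈ M, ⟪e, x⟫ = c → g x ∈ M := by
    intro c hc x hx hxe
    by_cases hxΓ : x ∈ faceBoundaries e c₁ c₂ Ω
    · obtain ⟨c', hc', hx'⟩ : ∃ c' ∈ ({c₁, c₂} : Set ℝ),
          x ∈ relBoundary (hyperplane e c') (face Ω (hyperplane e c')) :=
        hxΓ.elim (fun h => ⟨c₁, Or.inl rfl, h⟩) fun h => ⟨c₂, Or.inr rfl, h⟩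
      obtain ⟨t, r, htr⟩ := hΓ c' hc'
      have h1 : g x ∈ relBoundary (hyperplane e c') (face Ω (hyperplane e c')) := by
        rw [htr] at hx' ⊢
        refine ⟨?_, ?_⟩
        · rw [mem_sphere, ← hg t, g.dist_map]; exact hx'.1
        · change ⟪e, g x⟫ = c'
          rw [hge]; exact hx'.2
      refine hΓM ?_
      rcases hc' with rfl | rfl
      · exact Or.inl h1
      · exact Or.inr h1
    · have h1 : MapsTo g (M ∩ openSlab e c₁ c₂) (M ∩ openSlab e c₁ c₂) := hslab
      have h2 := h1.closure g.continuous (hcl c hc x hx hxe hxΓ)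
      exact (hMc.closure_eq ▸ closure_mono inter_subset_left) h2
  rintro _ ⟨x, hx, rfl⟩
  have h1 := hΩ.closure_subset (hΩ.mem_closure_of_mem hx)
  rcases h1.1.eq_or_lt with h2 | h2
  · exact hface c₁ (Or.inl rfl) x hx h2.symm
  rcases h1.2.eq_or_lt with h3 | h3
  · exact hface c₂ (Or.inr rfl) x hx h3
  · exact (hslab x ⟨hx, h2, h3⟩).1

theorem exists_norm_eq_one_of_inner_eq_zero (hn : 2 ≤ n) (he : ‖e‖ = 1) :
    ∃ v : Amb n, ‖v‖ = 1 ∧ ⟪e, v⟫ = 0 := by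
  have h1 : 0 < Module.finrank ℝ (ℝ ∙ e)ᗮ := by
    have h2 := (ℝ ∙ e).finrank_add_finrank_orthogonal
    have h3 := finrank_span_singleton (K := ℝ) (norm_ne_zero_iff.1 (he ▸ one_ne_zero))
    rw [finrank_euclideanSpace_fin] at h2
    omega
  have := Module.finrank_pos_iff.1 h1
  obtain ⟨w, hw⟩ := exists_ne (0 : (ℝ ∙ e)ᗮ)
  have hw0 : ‖(w : Amb n)‖ ≠ 0 := by simpa using hw
  refine ⟨‖(w : Amb n)‖⁻¹ • w, ?_, ?_⟩
  · rw [norm_smul, norm_inv, norm_norm, inv_mul_cancel₀ hw0]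
  · rw [inner_smul_right, Submodule.mem_orthogonal_singleton_iff_inner_right.1 w.2, mul_zero]

end Rotations

end Preliminaries

/-! ### The theorem -/

theorem mainTheorem2 (n : ℕ) (hn : 2 ≤ n) (e : Amb n) (he : ‖e‖ = 1) (c₁ c₂ : ℝ) (hc : c₁ < c₂)
    (Ω M : Set (Amb n)) (hΩ : IsSlabDomain e c₁ c₂ Ω M)
    (H : ℝ → ℝ) (hH : ContDiffOn ℝ 1 H (Set.Icc 0 (c₂ - c₁)))
    (hM : HasInwardMeanCurvature Ω M (faceBoundaries e c₁ c₂ Ω) (fun p => H (⟪e, p⟫ - c₁))) :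
    (∀ (v : Amb n) (s : ℝ), ‖v‖ = 1 → ⟪e, v⟫ = 0 →
      IsCompactHypersurface M (faceBoundaries e c₁ c₂ Ω) (hyperplane v s) →
      (∀ c ∈ ({c₁, c₂} : Set ℝ),
        reflectIn v s '' face Ω (hyperplane e c) = face Ω (hyperplane e c) ∧
        IsDoubleC2Graph (hyperplane e c) v s
          (relBoundary (hyperplane e c) (face Ω (hyperplane e c)))) →
      reflectIn v s '' Ω = Ω) ∧
    (∀ (q : Amb n), IsCompactHypersurface M (faceBoundaries e c₁ c₂ Ω) ∅ →
      (∀ c ∈ ({c₁, c₂} : Set ℝ), ∃ (t r : ℝ), q + t • e ∈ hyperplane e c ∧ 0 < r ∧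
        relBoundary (hyperplane e c) (face Ω (hyperplane e c)) =
          Metric.sphere (q + t • e) r ∩ hyperplane e c) →
      ∀ g : Amb n ≃ᵃⁱ[ℝ] Amb n, (∀ t : ℝ, g (q + t • e) = q + t • e) → g '' M = M) := by
  have hn0 : n ≠ 0 := by omega
  obtain ⟨L, hL⟩ := hH.exists_lipschitzOnWith one_ne_zero (convex_Icc _ _) isCompact_Icc
  refine ⟨fun v s hv hev hMc hgraph => ?_, fun q hMc hsph g hg => ?_⟩
  · exact reflectIn_image_eq_of_isDoubleC2Graph hn0 he hv hev hc hΩ hL hM hMc.isCompact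
      hMc.boundary_subset hMc.interior_point (fun p hp hps => hMc.boundary_point p ⟨hp, hps⟩)
      fun c hcc => (hgraph c hcc).2
  have hbd : ∀ p ∈ faceBoundaries e c₁ c₂ Ω, IsC2BoundaryPoint M p := fun p hp =>
    hMc.boundary_point p ⟨hp, Set.notMem_empty p⟩
  have hgraph : ∀ v : Amb n, ‖v‖ = 1 → ⟪e, v⟫ = 0 → ∀ c ∈ ({c₁, c₂} : Set ℝ),
      IsDoubleC2Graph (hyperplane e c) v ⟪v, q⟫
        (relBoundary (hyperplane e c) (face Ω (hyperplane e c))) := by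
    intro v hv hev c hcc
    obtain ⟨t, r, hq, hr, htr⟩ := hsph c hcc
    have h1 := isDoubleC2Graph_sphere hv hev hr hq
    rwa [inner_add_right, inner_smul_right, real_inner_comm e v, hev, mul_zero, add_zero, ← htr]
      at h1
  -- The description of `M` inside the faces does not depend on the direction of the moving planes;
  -- any one direction provides a configuration for it.
  obtain ⟨v, hv, hev⟩ := exists_norm_eq_one_of_inner_eq_zero hn he
  have hconf := slabConfig_of_isDoubleC2Graph hn0 he hv hev hc hΩ hL hM hMc.isCompact
    hMc.boundary_subset hMc.interior_point (fun p hp _ => hbd p hp) (hgraph v hv hev)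
  have hlev : ∀ t : ℝ, ⟪v, q + t • e⟫ = ⟪v, q⟫ := fun t => by
    rw [inner_add_right, inner_smul_right, real_inner_comm e v, hev, mul_zero, add_zero]
  refine image_eq_of_forall_image_subset (hΩ.image_subset_of_fixes_line hMc.isCompact.isClosed
    hMc.boundary_subset (fun v hv hev => ?_) (fun c hcc x hxM hxe hxΓ => ?_) fun c hcc => ?_) hg
  · exact reflectIn_image_eq_of_isDoubleC2Graph hn0 he hv hev hc hΩ hL hM hMc.isCompact
      hMc.boundary_subset hMc.interior_point (fun p hp _ => hbd p hp) (hgraph v hv hev)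
  · obtain ⟨t, r, hq, hr, htr⟩ := hsph c hcc
    rcases hcc with rfl | rfl
    · exact hconf.mem_closure_of_sphere hq (hlev t) hr htr hxM hxe hxΓ
    -- The upper face is the lower face of the configuration turned upside down.
    · have h1 := hconf.neg.mem_closure_of_sphere (q := q + t • e) (r := r) (x := x)
        (by rwa [hyperplane_neg]) (hlev t) hr (by rwa [hyperplane_neg]) hxM
        (by rw [inner_neg_left, hxe]) (by rwa [faceBoundaries_neg])
      rwa [openSlab_neg] at h1
  · obtain ⟨t, r, -, -, htr⟩ := hsph c hcc
    exact ⟨t, r, htr⟩
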